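/- Write $(a;q)_\infty=\prod_{n\ge 0}(1-aq^n)$ for $|q|<1$, $\mathsf p_n(x)=\sum_i x_i^n$, $\mathsf p_\lambda=\prod_i \mathsf p_{\lambda_i}$ for a partition $\lambda$, $x^{-1}=(x_1^{-1},\dots,x_N^{-1})$, and $\oint_{\mathbb T^N}$ for the integral over the unit torus with each circle counterclockwise. The superconformal index of $\mathcal N=4$ $U(N)$ SYM is, for complex fugacities of modulus less than $1$ with $pq=tuv$, $$I_N(t,u,v;p,q)=\frac1{N!}\oint_{\mathbb T^N}\prod_{i=1}^N\frac{dx_i}{2\pi i x_i}\prod_{1\le i\ne j\le N}\Big(1-\frac{x_i}{x_j}\Big)\exp\Big(\sum_{n\ge1}\frac{f(t^n,u^n,v^n;p^n,q^n)}{n}\,\mathsf p_n(x)\,\mathsf p_n(x^{-1})\Big),$$ $$f(t,u,v;p,q)=1-\frac{(1-t)(1-u)(1-v)}{(1-p)(1-q)} ;$$ when $t,u\neq0$ one has $v=pq/(tu)$, and one writes $I_N(t,u;p,q)$. Put $$I_\infty=\frac{(q;q)_\infty(p;p)_\infty}{(t;t)_\infty(u;u)_\infty(v;v)_\infty},\qquad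 I_\infty^{\Sigma}=\frac{(q;q)_\infty}{(t;t)_\infty(u;u)_\infty}\sum_{\mu}\prod_{i=1}^{\ell(\mu)}\frac{v^{\mu_i}-p^{\mu_i}}{1-p^{\mu_i}},$$ the sum being over all partitions $\mu$. Let further $$\langle f,g\rangle'_N=\frac1{N!}\oint_{\mathbb T^N}\prod_{i=1}^N\frac{dx_i}{2\pi i x_i}\prod_{i\ne j}\frac{(x_i/x_j;q)_\infty}{(t x_i/x_j;q)_\infty}\,f(x)\,g(x^{-1}),\qquad \langle f,g\rangle_\infty=\lim_{N\to\infty}\frac{\langle f,g\rangle'_N}{\langle 1,1\rangle'_N},$$ and $z_\lambda(q,t)=z_\lambda\prod_{i=1}^{\ell(\lambda)}\frac{1-q^{\lambda_i}}{1-t^{\lambda_i}}$, $z_\lambda=\prod_{i\ge1}i^{m_i}m_i!$, with $m_i$ the multiplicity of the part $i$ in $\lambda$. Then: 1. For all complex $q,t$ with $|q|,|t|<1$ and all partitions $\lambda,\mu$, the limit $\langle \mathsf p_\lambda,\mathsf p_\mu\rangle_\infty$ exists and equals $\delta_{\lambda\mu}\,z_\lambda(q,t)$. 2. For all complex $q,t$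 with $|q|<1$, $0<|t|<1$, as $N\to\infty$ the index $I_N(t,u;p,q)$ tends to $I_\infty^{\Sigma}$ and to $I_\infty$ (with $v=pq/(tu)$) order by order in $p$ and $u$. That is, for all $k\in\mathbb N$ and $m\in\mathbb Z$ the coefficient of $p^ku^m$ of $I_N$ (the coefficient of $u^m$ in the Laurent expansion on $0<|u|<1$ of the $k$-th Taylor coefficient at $p=0$) converges to the coefficient of $p^ku^m$ of $I_\infty^{\Sigma}$, which equals that of $I_\infty$. 3. For all complex $t,u,v,p,q$ of modulus less than $1$ with $pq=tuv$ and $\operatorname{Re} f(t^n,u^n,v^n;p^n,q^n)<1$ for all $n\ge1$ (which is automatic for real fugacities), $\lim_{N\to\infty}I_N(t,u,v;p,q)=I_\infty$. In particular, if $t,u\ne0$, $$\lim_{N\to\infty}I_N(t,u;p,q)=\frac{(q;q)_\infty(p;p)_\infty}{(t;t)_\infty(u;u)_\infty(\frac{pq}{tu};\frac{pq}{tu})_\infty}.$$ 4. For all complex $t,u,v,p,q$ of modulus less than $1$ such that $\big|\frac{v^n-p^n}{1-p^n}\big|<1$ for all $n\ge1$ (that is, all the geometric series $\sum_k\big(\frac{v^n-p^n}{1-p^n}\big)^k$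 converge), the sum over partitions in $I_\infty^{\Sigma}$ converges absolutely and $I_\infty^{\Sigma}=I_\infty$. -/

import Mathlib

open Filter Topology

noncomputable section

namespace SCI

/-- The infinite `q`-Pochhammer symbol `(a;q)_∞ = ∏_{n ≥ 0} (1 - a qⁿ)` (used for `‖q‖ < 1`). -/
def qPoch (a q : ℂ) : ℂ := ∏' n : ℕ, (1 - a * q ^ n)

/-- The normalised contour integral
`∮_{𝕋^N} ∏ᵢ dxᵢ / (2π i xᵢ) F(x)` over the unit torus, each circle counterclockwise. -/
def torusMean {N : ℕ} (F : (Fin N → ℂ) → ℂ) : ℂ :=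
  ((2 * Real.pi * Complex.I) ^ N)⁻¹ *
    torusIntegral (fun x : Fin N → ℂ => (∏ i, (x i)⁻¹) * F x) 0 1

/-- The value of the power sum `p_n(x₁, …, x_N) = x₁ⁿ + ⋯ + x_Nⁿ`. -/
def powerSum {N : ℕ} (n : ℕ) (x : Fin N → ℂ) : ℂ := MvPolynomial.eval x (MvPolynomial.psum (Fin N) ℂ n)

/-! ### The superconformal index of `U(N)` SYM -/

/-- The single letter index. -/
def singleLetter (t u v p q : ℂ) : ℂ :=
  1 - (1 - t) * (1 - u) * (1 - v) / ((1 - p) * (1 - q))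

/-- The exponent `∑_{n ≥ 1} f(tⁿ,uⁿ,vⁿ;pⁿ,qⁿ)/n · p_n(x) p_n(x⁻¹)`. -/
def letterExponent {N : ℕ} (t u v p q : ℂ) (x : Fin N → ℂ) : ℂ :=
  ∑' k : ℕ, singleLetter (t ^ (k + 1)) (u ^ (k + 1)) (v ^ (k + 1)) (p ^ (k + 1)) (q ^ (k + 1)) /
    ((k + 1 : ℕ) : ℂ) * (powerSum (k + 1) x * powerSum (k + 1) x⁻¹)

/-- The superconformal index `I_N(t,u,v;p,q)` as an integral over the eigenvalues
`x₁, …, x_N` of a unitary matrix; the fugacities are subject to `p q = t u v`. -/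
def index (N : ℕ) (t u v p q : ℂ) : ℂ :=
  (N.factorial : ℂ)⁻¹ * torusMean (fun x : Fin N → ℂ =>
    (∏ ij ∈ (Finset.univ : Finset (Fin N)).offDiag, (1 - x ij.1 / x ij.2)) *
      Complex.exp (letterExponent t u v p q x))

/-- The closed form `(q;q)_∞ (p;p)_∞ / [(t;t)_∞ (u;u)_∞ (v;v)_∞]`. -/
def indexInfty (t u v p q : ℂ) : ℂ :=
  qPoch q q * qPoch p p / (qPoch t t * qPoch u u * qPoch v v)

/-- The summand `∏_{i=1}^{ℓ(μ)} (v^{μ_i} - p^{μ_i}) / (1 - p^{μ_i})` of a partition `μ`. -/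
def partTerm (v p : ℂ) {m : ℕ} (mu : m.Partition) : ℂ :=
  (mu.parts.map fun i => (v ^ i - p ^ i) / (1 - p ^ i)).prod

/-- `(q;q)_∞ / [(t;t)_∞ (u;u)_∞] · ∑_μ ∏_i (v^{μ_i} - p^{μ_i}) / (1 - p^{μ_i})`,
the sum running over all partitions `μ` of all natural numbers. -/
def indexInftySum (t u v p q : ℂ) : ℂ :=
  qPoch q q / (qPoch t t * qPoch u u) * ∑' mu : (Σ m : ℕ, m.Partition), partTerm v p mu.2

/-! ### The Macdonald inner product -/

/-- Macdonald's weight `∏_{i ≠ j} (x_i/x_j;q)_∞ / (t x_i/x_j;q)_∞`. -/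
def macWeight {N : ℕ} (q t : ℂ) (x : Fin N → ℂ) : ℂ :=
  ∏ ij ∈ (Finset.univ : Finset (Fin N)).offDiag,
    qPoch (x ij.1 / x ij.2) q / qPoch (t * (x ij.1 / x ij.2)) q

/-- `⟨f, g⟩'_N = (1/N!) ∮ ∏ᵢ dxᵢ / (2π i xᵢ) ω(x) f(x) g(x⁻¹)`. -/
def macInner {N : ℕ} (q t : ℂ) (f g : MvPolynomial (Fin N) ℂ) : ℂ :=
  (N.factorial : ℂ)⁻¹ * torusMean (fun x : Fin N → ℂ =>
    macWeight q t x * (MvPolynomial.eval x f * MvPolynomial.eval x⁻¹ g))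

/-- `z_λ = ∏_{i ≥ 1} i^{m_i} m_i!`, where `m_i` is the multiplicity of the part `i`. -/
def zPart {m : ℕ} (lam : m.Partition) : ℕ :=
  ∏ i ∈ lam.parts.toFinset, i ^ lam.parts.count i * (lam.parts.count i).factorial

/-- `z_λ(q,t) = z_λ ∏_{i=1}^{ℓ(λ)} (1 - q^{λ_i}) / (1 - t^{λ_i})`. -/
def zPartQT (q t : ℂ) {m : ℕ} (lam : m.Partition) : ℂ :=
  (zPart lam : ℂ) * (lam.parts.map fun i => (1 - q ^ i) / (1 - t ^ i)).prod

/-! ### Expansion coefficients -/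

/-- The coefficient of `p^k` in the Taylor expansion of `F` at `p = 0`. -/
def taylorCoeff (F : ℂ → ℂ) (k : ℕ) : ℂ := iteratedDeriv k F 0 / (k.factorial : ℂ)

/-- The coefficient of `u^m` in the Laurent expansion of `G` on a punctured disc about `0` that
contains the circle `|u| = r`. -/
def laurentCoeff (r : ℝ) (G : ℂ → ℂ) (m : ℤ) : ℂ :=
  (2 * Real.pi * Complex.I)⁻¹ * circleIntegral (fun u => u ^ (-m - 1) * G u) 0 r

/-- The coefficient of `p^k u^m` of `I(t,u,pq/(tu);p,q)`, expanded first in `p` at fixed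
`u ≠ 0` and then in `u` on the circle `|u| = r`; here `I` has arguments `t u v p q`. -/
def puCoeff (I : ℂ → ℂ → ℂ → ℂ → ℂ → ℂ) (q t : ℂ) (r : ℝ) (k : ℕ) (m : ℤ) : ℂ :=
  laurentCoeff r (fun u => taylorCoeff (fun p => I t u (p * q / (t * u)) p q) k) m

end SCI

end

/-!
Over the unitary group `U(N)` the power sums are independent complex Gaussian variables in the limit
`N → ∞`: the average of `p_λ(x) p_μ(x⁻¹)` tends to `δ_{λμ} z_λ` (`tendsto_uniCorr`). Both the index and
Macdonald's inner product are averages over `U(N)` with a Boltzmann factor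
`exp (∑ b_n p_n(x) p_n(x⁻¹) / n)` (`index_eq_unitaryMean`, `weylDensity_mul_gasWeight`), so that formally
each mode `n` contributes the Gaussian integral `1 / (1 - b_n)` to the limit. With `b_n = f(tⁿ,uⁿ,vⁿ;pⁿ,qⁿ)` the
product over `n` is the closed form of the index (`tprod_letterCoupling`).

If all the couplings `b_n` have modulus less than one, this is justified by expanding the Boltzmann factor. The
norm of a power sum over `U(N)` increases with `N` (`monotone_uniNorm`): it is the sum of squares of the
coefficients of an alternating polynomial, and setting a variable to zero leaves only part of it. Hence the limits
dominate the terms, and the sum converges termwise to a product of negative binomial series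
(`tendsto_unitaryMean_psMon`). Stronger couplings are reached by Vitali's theorem, from bounds uniform in `N`.

For the index at fixed fugacities the bound comes from positivity: if `Re b_n < 1`, the modulus of
the Boltzmann factor is dominated by a convergent real gas (`exists_unitaryMean_gasWeight_le`), and the finitely many
strong couplings can be switched on holomorphically (`tendsto_unitaryMean_gasWeight`, `tendsto_index`).

For Macdonald's weight the couplings `(tⁿ - qⁿ) / (1 - qⁿ)` may have real part beyond one, and another bound is
needed. At `t = q^k` the weight is a Laurent polynomial, and invariance of the constant term under the `q`-shift of
one variable yields loop equations for the correlators of power sums (`loop_polyWeight`). They hold for all `t` by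
analytic continuation, as the points `q^k` accumulate at `0` (`loop_macCorr`). The norm of `1` follows in the same
way from the `q`-Dyson constant term (`macMean_one_pow`, `macMean_one`). By induction on the degree all correlators
are bounded uniformly in `N` as long as `q` stays away from `0` (`exists_macCorr_le`). The maximum principle
removes this restriction, and Vitali's theorem along a complex line in the space of `(q, t)` extends the convergence
from small parameters to all of them (`tendsto_macCorr`, `tendsto_macInner_div`). The loop equations at `t = q`, where
the weight is that of `U(N)`, also prove the Gaussian limit itself (`limit_recursion`).

For the limit order by order, substitute `p = u y` and `v = (q / t) y`. The index is then an average over Macdonald's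
weight with the relative couplings `1 - (1 - uⁿ) (1 - vⁿ) / (1 - pⁿ)`, which vanish at `u = y = 0` to order `n`.
A given coefficient involves only finitely many power sums (`biCoeff_couplingMono_eq_zero`), whose norms converge by
the orthogonality above (`tendsto_macNorm`, `tendsto_biCoeff_index`). The sum over partitions, sorted by
multiplicities, is a product of geometric series, and each of them has the sum `(1 - pⁿ) / (1 - vⁿ)` (`partTerm_sum`).
-/

open MeasureTheory

noncomputable section

namespace SCI

/-! ### Integration over the unit torus -/

/-- The point of the unit torus with angles `θ`. -/
def torusPt {N : ℕ} (θ : Fin N → ℝ) : Fin N → ℂ := fun i => Complex.exp (θ i * Complex.I)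

/-- The uniform probability measure on the box `[0, 2π]^N` of angles. -/
def angleMeasure (N : ℕ) : Measure (Fin N → ℝ) :=
  ENNReal.ofReal (((2 * Real.pi) ^ N)⁻¹) •
    (volume : Measure (Fin N → ℝ)).restrict (Set.Icc 0 fun _ => 2 * Real.pi)

theorem volume_angleBox (N : ℕ) :
    (volume : Measure (Fin N → ℝ)) (Set.Icc 0 fun _ => 2 * Real.pi) =
      ENNReal.ofReal ((2 * Real.pi) ^ N) := by
  rw [Real.volume_Icc_pi]
  simp [ENNReal.ofReal_pow, Real.two_pi_pos.le]

instance (N : ℕ) : IsProbabilityMeasure (angleMeasure N) := by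
  constructor
  have h : (0 : ℝ) < (2 * Real.pi) ^ N := by positivity
  simp only [angleMeasure, Measure.smul_apply, Measure.restrict_apply_univ, smul_eq_mul]
  rw [volume_angleBox, ← ENNReal.ofReal_mul (by positivity), inv_mul_cancel₀ h.ne', ENNReal.ofReal_one]

theorem torusPt_ne_zero {N : ℕ} (θ : Fin N → ℝ) (i : Fin N) : torusPt θ i ≠ 0 :=
  Complex.exp_ne_zero _

@[simp] theorem norm_torusPt {N : ℕ} (θ : Fin N → ℝ) (i : Fin N) : ‖torusPt θ i‖ = 1 := by
  simp [torusPt, Complex.norm_exp_ofReal_mul_I]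

@[fun_prop] theorem continuous_torusPt {N : ℕ} : Continuous (torusPt : (Fin N → ℝ) → Fin N → ℂ) := by
  unfold torusPt; fun_prop

@[fun_prop] theorem continuous_torusPt_inv {N : ℕ} :
    Continuous (fun θ : Fin N → ℝ => (torusPt θ)⁻¹) := by
  refine continuous_pi fun i => ?_
  exact ((continuous_apply i).comp continuous_torusPt).inv₀ fun θ => torusPt_ne_zero θ i

theorem torusPt_inv {N : ℕ} (θ : Fin N → ℝ) : (torusPt θ)⁻¹ = star (torusPt θ) := by
  funext i
  simp only [Pi.inv_apply, Pi.star_apply]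
  rw [Complex.inv_eq_conj (norm_torusPt θ i)]; rfl

/-- The normalised contour integral is the expectation over independent uniform angles. -/
theorem torusMean_eq_integral {N : ℕ} (F : (Fin N → ℂ) → ℂ) :
    torusMean F = ∫ θ, F (torusPt θ) ∂angleMeasure N := by
  have h0 : (0 : ℝ) < (2 * Real.pi) ^ N := by positivity
  unfold torusMean torusIntegral angleMeasure
  rw [integral_smul_measure, ENNReal.toReal_ofReal (by positivity)]
  have h : ∀ θ : Fin N → ℝ, torusMap (0 : Fin N → ℂ) 1 θ = torusPt θ := by
    intro θ; funext i; simp [torusMap, torusPt]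
  have h2 : ∀ θ : Fin N → ℝ, (∏ i, ((1 : Fin N → ℝ) i : ℂ) * Complex.exp (θ i * Complex.I) * Complex.I) •
      ((∏ i, (torusMap (0 : Fin N → ℂ) 1 θ i)⁻¹) * F (torusMap (0 : Fin N → ℂ) 1 θ)) =
      Complex.I ^ N * F (torusPt θ) := by
    intro θ
    rw [h, smul_eq_mul, ← mul_assoc, ← Finset.prod_mul_distrib]
    congr 1
    rw [Finset.prod_congr rfl (g := fun _ => Complex.I)]
    · simp
    · intro i _
      have := torusPt_ne_zero θ i
      simp only [Pi.one_apply, Complex.ofReal_one, one_mul]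
      change torusPt θ i * Complex.I * (torusPt θ i)⁻¹ = _
      field_simp
  simp_rw [h2]
  rw [integral_const_mul, mul_pow, ← mul_assoc, Complex.real_smul]
  congr 1
  have hI : Complex.I ^ N ≠ 0 := pow_ne_zero _ Complex.I_ne_zero
  push_cast
  have : (2 * (Real.pi : ℂ)) ^ N ≠ 0 := pow_ne_zero _ (by simp [Real.pi_ne_zero])
  field_simp

/-- The functions whose restriction to the unit torus is continuous. -/
def TorusCont {N : ℕ} (F : (Fin N → ℂ) → ℂ) : Prop := Continuous fun θ => F (torusPt θ)

namespace TorusCont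
variable {N : ℕ} {F G : (Fin N → ℂ) → ℂ}

theorem integrable (hF : TorusCont F) : Integrable (fun θ => F (torusPt θ)) (angleMeasure N) := by
  unfold angleMeasure
  refine Integrable.smul_measure ?_ ENNReal.ofReal_ne_top
  exact (hF.continuousOn.integrableOn_compact isCompact_Icc)

theorem mul (hF : TorusCont F) (hG : TorusCont G) : TorusCont fun x => F x * G x :=
  Continuous.mul hF hG

theorem const (c : ℂ) : TorusCont (N := N) fun _ => c := continuous_const

/-- The bound depends on the function only: the torus is compact. -/
theorem exists_bound (hF : TorusCont F) : ∃ C : ℝ, 0 ≤ C ∧ ∀ θ, ‖F (torusPt θ)‖ ≤ C := by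
  have hK : IsCompact (Set.Icc (0 : Fin N → ℝ) fun _ => 2 * Real.pi) := isCompact_Icc
  obtain ⟨C, hC⟩ := hK.exists_bound_of_continuousOn (Continuous.continuousOn hF)
  refine ⟨max C 0, le_max_right _ _, fun θ => ?_⟩
  have hp := Real.two_pi_pos
  -- reduce the angles modulo `2π`
  have : torusPt θ = torusPt fun i => toIcoMod hp 0 (θ i) := by
    funext i
    simp only [torusPt]
    have h1 := self_sub_toIcoDiv_zsmul hp 0 (θ i)
    rw [← h1]
    push_cast [zsmul_eq_mul]
    rw [sub_mul, Complex.exp_sub]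
    have : Complex.exp (((toIcoDiv hp 0 (θ i) : ℤ) : ℂ) * (2 * Real.pi) * Complex.I) = 1 := by
      rw [mul_assoc]; exact Complex.exp_int_mul_two_pi_mul_I _
    rw [this, div_one]
  rw [this]
  refine (hC _ ⟨fun i => ?_, fun i => ?_⟩).trans (le_max_left _ _)
  · exact (toIcoMod_mem_Ico hp 0 (θ i)).1
  · simpa using (toIcoMod_mem_Ico hp 0 (θ i)).2.le

end TorusCont

section mean
variable {N : ℕ} {F G : (Fin N → ℂ) → ℂ}

theorem torusMean_congr (h : ∀ θ, F (torusPt θ) = G (torusPt θ)) : torusMean F = torusMean G := by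
  simp only [torusMean_eq_integral, h]

theorem torusMean_add (hF : TorusCont F) (hG : TorusCont G) :
    torusMean (fun x => F x + G x) = torusMean F + torusMean G := by
  simp only [torusMean_eq_integral]
  exact integral_add hF.integrable hG.integrable

theorem torusMean_const_mul (c : ℂ) (F : (Fin N → ℂ) → ℂ) :
    torusMean (fun x => c * F x) = c * torusMean F := by
  simp only [torusMean_eq_integral]
  exact integral_const_mul _ _

theorem torusMean_sum {ι : Type*} {s : Finset ι} {F : ι → (Fin N → ℂ) → ℂ}
    (h : ∀ i ∈ s, TorusCont (F i)) :
    torusMean (fun x => ∑ i ∈ s, F i x) = ∑ i ∈ s, torusMean (F i) := by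
  simp only [torusMean_eq_integral]
  exact integral_finsetSum _ fun i hi => (h i hi).integrable

theorem norm_torusMean_le {C : ℝ} (h : ∀ θ, ‖F (torusPt θ)‖ ≤ C) : ‖torusMean F‖ ≤ C := by
  rw [torusMean_eq_integral]
  simpa using norm_integral_le_of_norm_le_const (μ := angleMeasure N) (Eventually.of_forall h)

theorem hasSum_torusMean {ι : Type*} [Countable ι] {F : ι → (Fin N → ℂ) → ℂ}
    (hF : ∀ i, TorusCont (F i)) {u : ι → ℝ} (hu : Summable u)
    (hb : ∀ i θ, ‖F i (torusPt θ)‖ ≤ u i) {G : (Fin N → ℂ) → ℂ}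
    (hG : ∀ θ, HasSum (fun i => F i (torusPt θ)) (G (torusPt θ))) :
    HasSum (fun i => torusMean (F i)) (torusMean G) := by
  simp only [torusMean_eq_integral]
  exact hasSum_integral_of_dominated_convergence (fun i _ => u i)
    (fun i => (hF i).integrable.aestronglyMeasurable) (fun i => Eventually.of_forall (hb i))
    (Eventually.of_forall fun _ => hu) (integrable_const _) (Eventually.of_forall hG)

end mean

/-! ### Laurent polynomials -/

/-- The monomial `∏ᵢ xᵢ^{aᵢ} xᵢ^{-bᵢ}`. -/
def laurentMono {N : ℕ} (a b : Fin N → ℕ) (x : Fin N → ℂ) : ℂ := ∏ i, x i ^ a i * (x i)⁻¹ ^ b i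

/-- The algebra of Laurent polynomials in `x₁, …, x_N`, as functions. -/
def laurentAlg (N : ℕ) : Subalgebra ℂ ((Fin N → ℂ) → ℂ) :=
  Algebra.adjoin ℂ (Set.range (fun i x => x i) ∪ Set.range (fun i x => (x i)⁻¹))

theorem laurentAlg_le_span (N : ℕ) : Subalgebra.toSubmodule (laurentAlg N) ≤
    Submodule.span ℂ (Set.range fun ab : (Fin N → ℕ) × (Fin N → ℕ) => laurentMono ab.1 ab.2) := by
  rw [laurentAlg, Algebra.adjoin_eq_span]
  refine Submodule.span_mono fun F hF => ?_
  refine Submonoid.closure_induction (motive := fun F _ => F ∈ Set.range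
    fun ab : (Fin N → ℕ) × (Fin N → ℕ) => laurentMono ab.1 ab.2) ?_ ?_ ?_ hF
  · rintro _ (⟨i, rfl⟩ | ⟨i, rfl⟩)
    · refine ⟨(Pi.single i 1, 0), ?_⟩
      funext x
      simp only [laurentMono, Pi.zero_apply, pow_zero, mul_one]
      rw [Finset.prod_eq_single i] <;> simp +contextual
    · refine ⟨(0, Pi.single i 1), ?_⟩
      funext x
      simp only [laurentMono, Pi.zero_apply, pow_zero, one_mul]
      rw [Finset.prod_eq_single i] <;> simp +contextual
  · exact ⟨(0, 0), by funext x; simp [laurentMono]⟩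
  · rintro _ _ _ _ ⟨⟨a, b⟩, rfl⟩ ⟨⟨a', b'⟩, rfl⟩
    refine ⟨(a + a', b + b'), ?_⟩
    funext x
    simp only [laurentMono, Pi.mul_apply, ← Finset.prod_mul_distrib, Pi.add_apply, pow_add]
    exact Finset.prod_congr rfl fun i _ => by ring

theorem laurentAlg_induction {N : ℕ} {p : ((Fin N → ℂ) → ℂ) → Prop}
    (mono : ∀ a b, p (laurentMono a b)) (zero : p 0)
    (add : ∀ F G, F ∈ laurentAlg N → G ∈ laurentAlg N → p F → p G → p (F + G))
    (smul : ∀ (c : ℂ) F, F ∈ laurentAlg N → p F → p (c • F)) {F : (Fin N → ℂ) → ℂ}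
    (hF : F ∈ laurentAlg N) : p F := by
  have hmono : ∀ a b, laurentMono a b ∈ laurentAlg N := by
    intro a b
    have : laurentMono a b = ∏ i, (fun x : Fin N → ℂ => x i) ^ a i * (fun x : Fin N → ℂ => (x i)⁻¹) ^ b i := by
      funext x; simp [laurentMono, Finset.prod_apply]
    rw [this]
    refine Subalgebra.prod_mem _ fun i _ => Subalgebra.mul_mem _ (Subalgebra.pow_mem _ ?_ _)
      (Subalgebra.pow_mem _ ?_ _)
    · exact Algebra.subset_adjoin (Or.inl ⟨i, rfl⟩)
    · exact Algebra.subset_adjoin (Or.inr ⟨i, rfl⟩)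
  have h := laurentAlg_le_span N hF
  suffices h2 : F ∈ laurentAlg N ∧ p F from h2.2
  refine Submodule.span_induction (p := fun F _ => F ∈ laurentAlg N ∧ p F) ?_ ?_ ?_ ?_ h
  · rintro _ ⟨⟨a, b⟩, rfl⟩; exact ⟨hmono a b, mono a b⟩
  · exact ⟨Subalgebra.zero_mem _, zero⟩
  · rintro F G _ _ ⟨h1, h2⟩ ⟨h3, h4⟩; exact ⟨Subalgebra.add_mem _ h1 h3, add F G h1 h3 h2 h4⟩
  · rintro c F _ ⟨h1, h2⟩; exact ⟨Subalgebra.smul_mem _ h1 c, smul c F h1 h2⟩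

theorem coord_mem_laurentAlg {N : ℕ} (i : Fin N) : (fun x : Fin N → ℂ => x i) ∈ laurentAlg N :=
  Algebra.subset_adjoin (Or.inl ⟨i, rfl⟩)

theorem inv_coord_mem_laurentAlg {N : ℕ} (i : Fin N) :
    (fun x : Fin N → ℂ => (x i)⁻¹) ∈ laurentAlg N :=
  Algebra.subset_adjoin (Or.inr ⟨i, rfl⟩)

theorem const_mem_laurentAlg {N : ℕ} (c : ℂ) : (fun _ : Fin N → ℂ => c) ∈ laurentAlg N :=
  Subalgebra.algebraMap_mem (laurentAlg N) c

theorem prod_mem_laurentAlg {N : ℕ} {ι : Type*} {s : Finset ι} {F : ι → (Fin N → ℂ) → ℂ}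
    (h : ∀ i ∈ s, F i ∈ laurentAlg N) : (fun x => ∏ i ∈ s, F i x) ∈ laurentAlg N := by
  have : (fun x => ∏ i ∈ s, F i x) = ∏ i ∈ s, F i := by funext x; simp [Finset.prod_apply]
  rw [this]; exact Subalgebra.prod_mem _ h

theorem sum_mem_laurentAlg {N : ℕ} {ι : Type*} {s : Finset ι} {F : ι → (Fin N → ℂ) → ℂ}
    (h : ∀ i ∈ s, F i ∈ laurentAlg N) : (fun x => ∑ i ∈ s, F i x) ∈ laurentAlg N := by
  have : (fun x => ∑ i ∈ s, F i x) = ∑ i ∈ s, F i := by funext x; simp [Finset.sum_apply]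
  rw [this]; exact Subalgebra.sum_mem _ h

theorem mul_mem_laurentAlg {N : ℕ} {F G : (Fin N → ℂ) → ℂ} (hF : F ∈ laurentAlg N)
    (hG : G ∈ laurentAlg N) : (fun x => F x * G x) ∈ laurentAlg N :=
  Subalgebra.mul_mem _ hF hG

theorem add_mem_laurentAlg {N : ℕ} {F G : (Fin N → ℂ) → ℂ} (hF : F ∈ laurentAlg N)
    (hG : G ∈ laurentAlg N) : (fun x => F x + G x) ∈ laurentAlg N :=
  Subalgebra.add_mem _ hF hG

theorem sub_mem_laurentAlg {N : ℕ} {F G : (Fin N → ℂ) → ℂ} (hF : F ∈ laurentAlg N)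
    (hG : G ∈ laurentAlg N) : (fun x => F x - G x) ∈ laurentAlg N :=
  Subalgebra.sub_mem _ hF hG

theorem pow_mem_laurentAlg {N : ℕ} {F : (Fin N → ℂ) → ℂ} (hF : F ∈ laurentAlg N) (n : ℕ) :
    (fun x => F x ^ n) ∈ laurentAlg N :=
  Subalgebra.pow_mem _ hF n

theorem div_mem_laurentAlg {N : ℕ} (i j : Fin N) : (fun x : Fin N → ℂ => x i / x j) ∈ laurentAlg N := by
  simp only [div_eq_mul_inv]
  exact mul_mem_laurentAlg (coord_mem_laurentAlg i) (inv_coord_mem_laurentAlg j)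

theorem torusCont_of_mem {N : ℕ} {F : (Fin N → ℂ) → ℂ} (hF : F ∈ laurentAlg N) : TorusCont F := by
  refine laurentAlg_induction ?_ ?_ ?_ ?_ hF
  · intro a b
    unfold TorusCont laurentMono
    refine continuous_finsetProd _ fun i _ => Continuous.mul ?_ ?_
    · exact ((continuous_apply i).comp continuous_torusPt).pow _
    · exact ((continuous_apply i).comp continuous_torusPt_inv).pow _
  · exact continuous_const
  · intro F G _ _ h1 h2; exact Continuous.add h1 h2
  · intro c F _ h1; exact Continuous.const_smul h1 c

theorem integral_exp_angle (a b : ℕ) :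
    ∫ θ in Set.Icc (0 : ℝ) (2 * Real.pi), Complex.exp (θ * Complex.I) ^ a * (Complex.exp (θ * Complex.I))⁻¹ ^ b
      = if a = b then (2 * Real.pi : ℂ) else 0 := by
  rw [integral_Icc_eq_integral_Ioc, ← intervalIntegral.integral_of_le Real.two_pi_pos.le]
  have h : ∀ θ : ℝ, Complex.exp (θ * Complex.I) ^ a * (Complex.exp (θ * Complex.I))⁻¹ ^ b =
      Complex.exp ((((a : ℤ) - b : ℤ) : ℂ) * Complex.I * θ) := by
    intro θ
    rw [← Complex.exp_neg, ← Complex.exp_nat_mul, ← Complex.exp_nat_mul, ← Complex.exp_add]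
    congr 1; push_cast; ring
  simp_rw [h]
  split_ifs with hab
  · subst hab; simp
  · have hc : (((a : ℤ) - b : ℤ) : ℂ) * Complex.I ≠ 0 := by
      refine mul_ne_zero ?_ Complex.I_ne_zero
      rw [Int.cast_ne_zero]; omega
    rw [integral_exp_mul_complex hc]
    have : (((a : ℤ) - b : ℤ) : ℂ) * Complex.I * ((2 * Real.pi : ℝ) : ℂ) =
        (((a : ℤ) - b : ℤ) : ℂ) * (2 * Real.pi * Complex.I) := by push_cast; ring
    rw [this, Complex.exp_int_mul_two_pi_mul_I]
    simp

/-- The integral over the torus extracts the constant term. -/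
theorem torusMean_laurentMono {N : ℕ} (a b : Fin N → ℕ) :
    torusMean (laurentMono a b) = if a = b then 1 else 0 := by
  rw [torusMean_eq_integral, angleMeasure, integral_smul_measure,
    ENNReal.toReal_ofReal (by positivity)]
  have h : (volume : Measure (Fin N → ℝ)).restrict (Set.Icc 0 fun _ => 2 * Real.pi) =
      Measure.pi fun _ => (volume : Measure ℝ).restrict (Set.Icc 0 (2 * Real.pi)) := by
    rw [volume_pi, ← Measure.restrict_pi_pi]
    congr 1
    exact (Set.pi_univ_Icc _ _).symm
  rw [h]
  have h2 := integral_fintype_prod_eq_prod (𝕜 := ℂ)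
    (μ := fun _ : Fin N => (volume : Measure ℝ).restrict (Set.Icc 0 (2 * Real.pi)))
    (fun i (θ : ℝ) => Complex.exp (θ * Complex.I) ^ a i * (Complex.exp (θ * Complex.I))⁻¹ ^ b i)
  simp only [integral_exp_angle] at h2
  have h3 : ∀ θ : Fin N → ℝ, laurentMono a b (torusPt θ) = ∏ i,
    (Complex.exp (θ i * Complex.I) ^ a i * (Complex.exp (θ i * Complex.I))⁻¹ ^ b i) := fun θ => rfl
  simp_rw [h3]
  rw [h2]
  split_ifs with hab
  · subst hab
    have : (2 * (Real.pi : ℂ)) ^ N ≠ 0 := pow_ne_zero _ (by simp [Real.pi_ne_zero])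
    simp only [if_true, Finset.prod_const, Finset.card_univ, Fintype.card_fin, Complex.real_smul]
    push_cast
    field_simp
  · obtain ⟨i, hi⟩ := Function.ne_iff.mp hab
    rw [Finset.prod_eq_zero (Finset.mem_univ i) (if_neg hi), smul_zero]

/-- The constant term of a Laurent polynomial is invariant under `xᵢ ↦ q xᵢ` for any `q ≠ 0`. No contour is
moved, hence no condition on `|q|`. -/
theorem torusMean_scale {N : ℕ} {F : (Fin N → ℂ) → ℂ} (hF : F ∈ laurentAlg N) (i : Fin N) {q : ℂ}
    (hq : q ≠ 0) :
    (fun x => F (Function.update x i (q * x i))) ∈ laurentAlg N ∧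
    torusMean (fun x => F (Function.update x i (q * x i))) = torusMean F := by
  refine laurentAlg_induction (p := fun F =>
    (fun x => F (Function.update x i (q * x i))) ∈ laurentAlg N ∧
    torusMean (fun x => F (Function.update x i (q * x i))) = torusMean F) ?_ ?_ ?_ ?_ hF
  · intro a b
    have h : ∀ x : Fin N → ℂ, laurentMono a b (Function.update x i (q * x i)) =
        (q ^ a i * q⁻¹ ^ b i) * laurentMono a b x := by
      intro x
      simp only [laurentMono]
      rw [← Finset.mul_prod_erase Finset.univ _ (Finset.mem_univ i),
        ← Finset.mul_prod_erase Finset.univ (fun j => x j ^ a j * (x j)⁻¹ ^ b j) (Finset.mem_univ i)]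
      rw [Finset.prod_congr rfl (g := fun j => x j ^ a j * (x j)⁻¹ ^ b j)]
      · simp only [Function.update_self, mul_inv, mul_pow]; ring
      · intro j hj
        rw [Function.update_of_ne (Finset.ne_of_mem_erase hj)]
    simp_rw [h]
    refine ⟨?_, ?_⟩
    · refine mul_mem_laurentAlg (const_mem_laurentAlg _) ?_
      refine prod_mem_laurentAlg fun j _ => mul_mem_laurentAlg ?_ ?_
      · exact pow_mem_laurentAlg (coord_mem_laurentAlg j) _
      · exact pow_mem_laurentAlg (inv_coord_mem_laurentAlg j) _
    · rw [torusMean_const_mul, torusMean_laurentMono]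
      split_ifs with hab
      · subst hab; rw [← mul_pow, mul_inv_cancel₀ hq]; simp
      · simp
  · exact ⟨const_mem_laurentAlg 0, rfl⟩
  · rintro F G hF hG ⟨h1, h2⟩ ⟨h3, h4⟩
    refine ⟨add_mem_laurentAlg h1 h3, ?_⟩
    have e1 := torusMean_add (torusCont_of_mem h1) (torusCont_of_mem h3)
    have e2 := torusMean_add (torusCont_of_mem hF) (torusCont_of_mem hG)
    simp only [Pi.add_apply]
    rw [e1, h2, h4, ← e2]; rfl
  · rintro c F hF ⟨h1, h2⟩
    refine ⟨Subalgebra.smul_mem _ h1 c, ?_⟩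
    simp only [Pi.smul_apply, smul_eq_mul, torusMean_const_mul, h2]
    exact (torusMean_const_mul c F).symm

theorem torusMean_perm {N : ℕ} {F : (Fin N → ℂ) → ℂ} (hF : F ∈ laurentAlg N)
    (σ : Equiv.Perm (Fin N)) :
    (fun x => F (x ∘ σ)) ∈ laurentAlg N ∧ torusMean (fun x => F (x ∘ σ)) = torusMean F := by
  refine laurentAlg_induction (p := fun F =>
    (fun x => F (x ∘ σ)) ∈ laurentAlg N ∧ torusMean (fun x => F (x ∘ σ)) = torusMean F)
    ?_ ?_ ?_ ?_ hF
  · intro a b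
    have h : (fun x : Fin N → ℂ => laurentMono a b (x ∘ σ)) = laurentMono (a ∘ σ.symm) (b ∘ σ.symm) := by
      funext x
      simp only [laurentMono, Function.comp]
      exact (Equiv.prod_comp σ.symm (fun i => x (σ i) ^ a i * (x (σ i))⁻¹ ^ b i)).symm.trans
        (by simp)
    rw [h]
    refine ⟨?_, ?_⟩
    · refine prod_mem_laurentAlg fun j _ => mul_mem_laurentAlg ?_ ?_
      · exact pow_mem_laurentAlg (coord_mem_laurentAlg j) _
      · exact pow_mem_laurentAlg (inv_coord_mem_laurentAlg j) _
    · rw [torusMean_laurentMono, torusMean_laurentMono]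
      congr 1
      rw [σ.symm.surjective.injective_comp_right.eq_iff]
  · exact ⟨const_mem_laurentAlg 0, rfl⟩
  · rintro F G hF hG ⟨h1, h2⟩ ⟨h3, h4⟩
    refine ⟨add_mem_laurentAlg h1 h3, ?_⟩
    have e1 := torusMean_add (torusCont_of_mem h1) (torusCont_of_mem h3)
    have e2 := torusMean_add (torusCont_of_mem hF) (torusCont_of_mem hG)
    simp only [Pi.add_apply]
    rw [e1, h2, h4, ← e2]; rfl
  · rintro c F hF ⟨h1, h2⟩
    refine ⟨Subalgebra.smul_mem _ h1 c, ?_⟩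
    simp only [Pi.smul_apply, smul_eq_mul, torusMean_const_mul, h2]
    exact (torusMean_const_mul c F).symm

theorem eval_mem_laurentAlg {N : ℕ} (P : MvPolynomial (Fin N) ℂ) :
    (fun x : Fin N → ℂ => MvPolynomial.eval x P) ∈ laurentAlg N := by
  induction P using MvPolynomial.induction_on with
  | C a => simpa using const_mem_laurentAlg a
  | add p q hp hq => simpa using add_mem_laurentAlg hp hq
  | mul_X p i hp => simpa using mul_mem_laurentAlg hp (coord_mem_laurentAlg i)

theorem eval_inv_mem_laurentAlg {N : ℕ} (P : MvPolynomial (Fin N) ℂ) :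
    (fun x : Fin N → ℂ => MvPolynomial.eval x⁻¹ P) ∈ laurentAlg N := by
  induction P using MvPolynomial.induction_on with
  | C a => simpa using const_mem_laurentAlg a
  | add p q hp hq => simpa using add_mem_laurentAlg hp hq
  | mul_X p i hp => simpa using mul_mem_laurentAlg hp (inv_coord_mem_laurentAlg i)

/-- Orthonormality of the monomials on the unit torus. -/
theorem torusMean_eval_mul_eval_inv {N : ℕ} (P Q : MvPolynomial (Fin N) ℂ) :
    torusMean (fun x => MvPolynomial.eval x P * MvPolynomial.eval x⁻¹ Q) =
      ∑ a ∈ P.support, P.coeff a * Q.coeff a := by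
  have hm : ∀ a b : Fin N →₀ ℕ, torusMean (fun x => MvPolynomial.eval x (MvPolynomial.monomial a 1) *
      MvPolynomial.eval x⁻¹ (MvPolynomial.monomial b 1)) = if a = b then 1 else 0 := by
    intro a b
    have := torusMean_laurentMono (N := N) a b
    simp only [DFunLike.coe_fn_eq] at this
    rw [← this]
    congr 1
    funext x
    simp [laurentMono, MvPolynomial.eval_monomial, Finsupp.prod_fintype, Finset.prod_mul_distrib]
  have e : ∀ (R : MvPolynomial (Fin N) ℂ) x, MvPolynomial.eval x R =
      ∑ a ∈ R.support, R.coeff a * MvPolynomial.eval x (MvPolynomial.monomial a 1) := by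
    intro R x
    conv_lhs => rw [R.as_sum]
    rw [map_sum]
    exact Finset.sum_congr rfl fun a _ => by simp [MvPolynomial.eval_monomial]
  have hc : ∀ a b : Fin N →₀ ℕ, ∀ c d : ℂ, (fun x : Fin N → ℂ =>
      c * MvPolynomial.eval x (MvPolynomial.monomial a 1) *
      (d * MvPolynomial.eval x⁻¹ (MvPolynomial.monomial b 1))) ∈ laurentAlg N := fun a b c d =>
    mul_mem_laurentAlg (mul_mem_laurentAlg (const_mem_laurentAlg c) (eval_mem_laurentAlg _))
      (mul_mem_laurentAlg (const_mem_laurentAlg d) (eval_inv_mem_laurentAlg _))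
  have : (fun x : Fin N → ℂ => MvPolynomial.eval x P * MvPolynomial.eval x⁻¹ Q) = fun x =>
      ∑ a ∈ P.support, ∑ b ∈ Q.support, (P.coeff a * MvPolynomial.eval x (MvPolynomial.monomial a 1) *
        (Q.coeff b * MvPolynomial.eval x⁻¹ (MvPolynomial.monomial b 1))) := by
    funext x
    rw [e P x, e Q x⁻¹, Finset.sum_mul_sum]
  rw [this, torusMean_sum fun a _ => torusCont_of_mem (sum_mem_laurentAlg fun b _ => hc a b _ _)]
  refine Finset.sum_congr rfl fun a _ => ?_
  rw [torusMean_sum fun b _ => torusCont_of_mem (hc a b _ _)]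
  have h4 : ∀ b, torusMean (fun x : Fin N → ℂ =>
      P.coeff a * MvPolynomial.eval x (MvPolynomial.monomial a 1) *
      (Q.coeff b * MvPolynomial.eval x⁻¹ (MvPolynomial.monomial b 1))) =
      P.coeff a * Q.coeff b * if a = b then 1 else 0 := by
    intro b
    rw [← hm a b, ← torusMean_const_mul]
    congr 1; funext x; ring
  simp only [h4, mul_ite, mul_one, mul_zero]
  rw [Finset.sum_ite_eq]
  split_ifs with h
  · rfl
  · rw [MvPolynomial.notMem_support_iff.mp h, mul_zero]

/-! ### Sums over multiplicity functions and infinite products -/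

/-- The multiplicity functions supported on `{0, …, M - 1}`. -/
abbrev MultBelow (M : ℕ) : Type := {κ : ℕ →₀ ℕ // ∀ n, M ≤ n → κ n = 0}

/-- Splitting off the multiplicity of `M`. -/
def multBelowSucc (M : ℕ) : MultBelow M × ℕ ≃ MultBelow (M + 1) where
  toFun x := ⟨x.1.1 + Finsupp.single M x.2, fun n hn => by
    simp [x.1.2 n (by omega), show M ≠ n by omega]⟩
  invFun κ := (⟨κ.1.erase M, fun n hn => by
    rcases eq_or_ne n M with rfl | h
    · simp
    · rw [Finsupp.erase_ne h, κ.2 n (by omega)]⟩, κ.1 M)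
  left_inv x := by
    refine Prod.ext (Subtype.ext ?_) ?_
    · ext n
      rcases eq_or_ne n M with rfl | h
      · simp [x.1.2 n le_rfl]
      · simp [Finsupp.erase_ne h]
    · simp [x.1.2 M le_rfl]
  right_inv κ := by
    refine Subtype.ext ?_
    ext n
    rcases eq_or_ne n M with rfl | h
    · simp
    · simp [Finsupp.erase_ne h, h.symm]

theorem prod_multBelowSucc {𝕜 : Type*} [NormedField 𝕜] {c : ℕ → ℕ → 𝕜} (h0 : ∀ n, c n 0 = 1) (M : ℕ) (x : MultBelow M × ℕ) :
    (multBelowSucc M x).1.prod c = x.1.1.prod c * c M x.2 := by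
  simp only [multBelowSucc, Equiv.coe_fn_mk]
  rw [Finsupp.prod_add_index_of_disjoint, Finsupp.prod_single_index (h0 M)]
  rw [Finset.disjoint_left]
  intro n hn hn'
  have := Finsupp.support_single_subset hn'
  rw [Finset.mem_singleton] at this
  subst this
  exact (Finsupp.mem_support_iff.mp hn) (x.1.2 n le_rfl)

theorem hasSum_multBelow_prod {𝕜 : Type*} [NormedField 𝕜] [CompleteSpace 𝕜] {c : ℕ → ℕ → 𝕜} (h0 : ∀ n, c n 0 = 1)
    (h1 : ∀ n, Summable fun m => ‖c n m‖) (M : ℕ) :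
    (Summable fun κ : MultBelow M => ‖κ.1.prod c‖) ∧
    HasSum (fun κ : MultBelow M => κ.1.prod c) (∏ n ∈ Finset.range M, ∑' m, c n m) := by
  induction M with
  | zero =>
    have huniq : ∀ κ : MultBelow 0, κ = ⟨0, fun _ _ => rfl⟩ := fun κ =>
      Subtype.ext (Finsupp.ext fun n => κ.2 n (Nat.zero_le n))
    have : Unique (MultBelow 0) := ⟨⟨⟨0, fun _ _ => rfl⟩⟩, huniq⟩
    refine ⟨(hasSum_fintype _).summable, ?_⟩
    have h := hasSum_unique (fun κ : MultBelow 0 => κ.1.prod c)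
    rw [huniq default] at h
    simpa using h
  | succ M ih =>
    obtain ⟨i1, i2⟩ := ih
    have hs : Summable fun x : MultBelow M × ℕ => ‖x.1.1.prod c * c M x.2‖ :=
      Summable.mul_norm (f := fun κ : MultBelow M => κ.1.prod c) (g := c M) i1 (h1 M)
    have e1 : (fun κ : MultBelow (M + 1) => ‖κ.1.prod c‖) ∘ multBelowSucc M =
        fun x => ‖x.1.1.prod c * c M x.2‖ := funext fun x => by
      simp only [Function.comp, prod_multBelowSucc h0]
    have e2 : (fun κ : MultBelow (M + 1) => κ.1.prod c) ∘ multBelowSucc M =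
        fun x => x.1.1.prod c * c M x.2 := funext fun x => prod_multBelowSucc h0 M x
    have i3 := HasSum.mul i2 (h1 M).of_norm.hasSum (Summable.of_norm hs)
    rw [← e1] at hs
    rw [← e2, ← Finset.prod_range_succ (fun n => ∑' m, c n m)] at i3
    generalize multBelowSucc M = e at hs i3
    exact ⟨e.summable_iff.mp hs, e.hasSum_iff.mp i3⟩

/-- An infinite product of series with constant term `1`, multiplied out: the terms are indexed by the
multiplicity functions. Finitely many factors are multiplied out at a time, and the double sum of norms
dominates. -/
theorem hasSum_finsupp_prod {c : ℕ → ℕ → ℂ} (h0 : ∀ n, c n 0 = 1)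
    (h1 : ∀ n, Summable fun m => ‖c n (m + 1)‖) (h2 : Summable fun n => ∑' m, ‖c n (m + 1)‖) :
    (Summable fun κ : ℕ →₀ ℕ => ‖κ.prod c‖) ∧
    HasSum (fun κ : ℕ →₀ ℕ => κ.prod c) (∏' n, ∑' m, c n m) := by
  have h1' : ∀ n, Summable fun m => ‖c n m‖ := fun n => (summable_nat_add_iff 1).mp (h1 n)
  have hnorm : ∀ κ : ℕ →₀ ℕ, ‖κ.prod c‖ = κ.prod fun n m => ‖c n m‖ := fun κ => by
    simp [Finsupp.prod, norm_prod]
  have hA := fun M => hasSum_multBelow_prod (c := fun n m => ‖c n m‖) (fun n => by simp [h0])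
    (fun n => by simpa using h1' n) M
  have hsplit : ∀ n, ∑' m, c n m = 1 + ∑' m, c n (m + 1) := fun n => by
    rw [(h1' n).of_norm.tsum_eq_zero_add, h0]
  have hnsplit : ∀ n, ∑' m, ‖c n m‖ = 1 + ∑' m, ‖c n (m + 1)‖ := fun n => by
    rw [(h1' n).tsum_eq_zero_add, h0, norm_one]
  have hpos : ∀ n, 0 ≤ ∑' m, ‖c n (m + 1)‖ := fun n => tsum_nonneg fun _ => norm_nonneg _
  have hS : Summable fun κ : ℕ →₀ ℕ => ‖κ.prod c‖ := by
    refine summable_of_sum_le (c := Real.exp (∑' n, ∑' m, ‖c n (m + 1)‖)) (fun _ => norm_nonneg _) ?_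
    intro T
    -- a finite set of multiplicity functions is supported below some `M`
    obtain ⟨M, hM⟩ : ∃ M, ∀ κ ∈ T, ∀ n, M ≤ n → κ n = 0 := by
      refine ⟨(T.biUnion Finsupp.support).sup id + 1, fun κ hκ n hn => ?_⟩
      by_contra hne
      have : n ∈ T.biUnion Finsupp.support :=
        Finset.mem_biUnion.mpr ⟨κ, hκ, Finsupp.mem_support_iff.mpr hne⟩
      have := Finset.le_sup (f := id) this
      simp only [id] at this
      omega
    classical
    have e : ∑ κ ∈ T, ‖κ.prod c‖ = ∑ κ ∈ T.subtype (fun κ => ∀ n, M ≤ n → κ n = 0), ‖κ.1.prod c‖ := by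
      rw [Finset.sum_subtype_of_mem (fun κ : ℕ →₀ ℕ => ‖κ.prod c‖) hM]
    rw [e]
    simp_rw [hnorm]
    refine ((hA M).2.summable.sum_le_tsum _ fun κ _ => ?_).trans ?_
    · rw [← hnorm]; exact norm_nonneg _
    · rw [(hA M).2.tsum_eq]
      simp_rw [hnsplit]
      refine (Real.prod_one_add_le_exp_sum _ hpos).trans (Real.exp_le_exp.mpr ?_)
      exact h2.sum_le_tsum _ fun n _ => hpos n
  refine ⟨hS, ?_⟩
  have hB := fun M => hasSum_multBelow_prod h0 h1' M
  have hlim1 : Tendsto (fun M : ℕ => ∑' κ : ℕ →₀ ℕ,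
      Set.indicator {κ : ℕ →₀ ℕ | ∀ n, M ≤ n → κ n = 0} (fun κ => κ.prod c) κ) atTop
      (𝓝 (∑' κ : ℕ →₀ ℕ, κ.prod c)) := by
    refine tendsto_tsum_of_dominated_convergence hS (fun κ => ?_) (Eventually.of_forall fun M κ => ?_)
    · refine tendsto_const_nhds.congr' ?_
      filter_upwards [eventually_ge_atTop (κ.support.sup id + 1)] with M hM
      rw [Set.indicator_of_mem]
      intro n hn
      by_contra hne
      have := Finset.le_sup (f := id) (Finsupp.mem_support_iff.mpr hne)
      simp only [id] at this
      omega
    · classical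
      rw [Set.indicator_apply]
      split_ifs <;> simp
  have hlim2 : Tendsto (fun M : ℕ => ∏ n ∈ Finset.range M, ∑' m, c n m) atTop
      (𝓝 (∏' n, ∑' m, c n m)) := by
    refine Multipliable.tendsto_prod_tprod_nat ?_
    simp_rw [hsplit]
    refine Complex.multipliable_one_add_of_summable (h2.of_norm_bounded fun n => ?_)
    exact norm_tsum_le_tsum_norm (h1 n)
  have : ∀ M : ℕ, ∑' κ : ℕ →₀ ℕ,
      Set.indicator {κ : ℕ →₀ ℕ | ∀ n, M ≤ n → κ n = 0} (fun κ => κ.prod c) κ =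
      ∏ n ∈ Finset.range M, ∑' m, c n m := fun M => by
    rw [← tsum_subtype]; exact (hB M).2.tsum_eq
  simp_rw [this] at hlim1
  rw [tendsto_nhds_unique hlim2 hlim1]
  exact hS.of_norm.hasSum

theorem summable_inv_one_sub_pow {g : ℕ → ℂ} (hg : Summable fun n => ‖g n‖) :
    Summable fun n => ‖g n‖ / (1 - ‖g n‖) := by
  refine (hg.mul_left 2).of_norm_bounded_eventually ?_
  rw [Nat.cofinite_eq_atTop]
  filter_upwards [hg.tendsto_atTop_zero.eventually_lt_const (show (0 : ℝ) < 1 / 2 by norm_num)] with n hn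
  have h0 := norm_nonneg (g n)
  rw [Real.norm_of_nonneg (div_nonneg h0 (by linarith)), div_le_iff₀ (by linarith)]
  nlinarith

/-- An infinite product of negative binomial series, multiplied out. At `l = 0` these are geometric series. -/
theorem hasSum_finsupp_choose {g : ℕ → ℂ} (hg1 : ∀ n, ‖g n‖ < 1) (hg : Summable fun n => ‖g n‖)
    (l : ℕ →₀ ℕ) :
    (Summable fun κ : ℕ →₀ ℕ => ‖κ.prod fun n m => (((m + l n).choose (l n) : ℕ) : ℂ) * g n ^ m‖) ∧
    HasSum (fun κ : ℕ →₀ ℕ => κ.prod fun n m => (((m + l n).choose (l n) : ℕ) : ℂ) * g n ^ m)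
      (∏' n, 1 / (1 - g n) ^ (l n + 1)) := by
  have hs : ∀ n, Summable fun m => ‖(((m + l n).choose (l n) : ℕ) : ℂ) * g n ^ m‖ := fun n =>
    (summable_choose_mul_geometric_of_norm_lt_one (l n) (hg1 n)).norm
  have key := hasSum_finsupp_prod (c := fun n m => (((m + l n).choose (l n) : ℕ) : ℂ) * g n ^ m)
    (fun n => by simp) (fun n => (summable_nat_add_iff 1).mpr (hs n)) ?_
  · refine ⟨key.1, ?_⟩
    have h := key.2
    simp_rw [tsum_choose_mul_geometric_of_norm_lt_one _ (hg1 _)] at h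
    exact h
  · refine (summable_congr_cofinite ?_).mpr (summable_inv_one_sub_pow hg)
    filter_upwards [l.hasFiniteSupport.compl_mem_cofinite] with n hn
    have : l n = 0 := by simpa using hn
    simp only [this, add_zero, Nat.choose_zero_right, Nat.cast_one, one_mul, pow_succ, norm_mul, norm_pow]
    rw [tsum_mul_right, tsum_geometric_of_lt_one (norm_nonneg _) (hg1 n)]
    ring

/-! ### The `q`-Pochhammer symbol -/

theorem one_sub_ne_zero_of_norm {z : ℂ} (h : ‖z‖ < 1) : 1 - z ≠ 0 := by
  intro h0
  rw [sub_eq_zero] at h0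
  rw [← h0] at h
  simp at h

theorem one_sub_pow_ne_zero {z : ℂ} (h : ‖z‖ < 1) (n : ℕ) : 1 - z ^ (n + 1) ≠ 0 :=
  one_sub_ne_zero_of_norm (by rw [norm_pow]; exact pow_lt_one₀ (norm_nonneg _) h (by omega))

theorem multipliable_qPoch (a : ℂ) {q : ℂ} (hq : ‖q‖ < 1) : Multipliable fun n : ℕ => 1 - a * q ^ n := by
  simp_rw [sub_eq_add_neg]
  exact Complex.multipliable_one_add_of_summable
    ((summable_geometric_of_norm_lt_one hq).mul_left a).neg

theorem qPoch_eq_mul (a : ℂ) {q : ℂ} (hq : ‖q‖ < 1) : qPoch a q = (1 - a) * qPoch (q * a) q := by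
  unfold qPoch
  have h : (fun n : ℕ => 1 - a * q ^ (n + 1)) = fun n => 1 - q * a * q ^ n := by
    funext n; ring
  rw [tprod_eq_zero_mul' (f := fun n : ℕ => 1 - a * q ^ n), h]
  · simp
  · rw [h]; exact multipliable_qPoch _ hq

theorem qPoch_eq_prod_mul (a : ℂ) {q : ℂ} (hq : ‖q‖ < 1) (k : ℕ) :
    qPoch a q = (∏ s ∈ Finset.range k, (1 - a * q ^ s)) * qPoch (a * q ^ k) q := by
  induction k with
  | zero => simp
  | succ k ih =>
    rw [ih, qPoch_eq_mul (a * q ^ k) hq, Finset.prod_range_succ, mul_assoc]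
    congr 3; ring

theorem norm_one_sub_pow_ge {ρ : ℝ} {q : ℂ} (hρ : ρ < 1) (hq : ‖q‖ ≤ ρ) (n : ℕ) :
    1 - ρ ≤ ‖1 - q ^ (n + 1)‖ := by
  have h1 : ‖q ^ (n + 1)‖ ≤ ρ := by
    rw [norm_pow]
    exact (pow_le_of_le_one (norm_nonneg _) (hq.trans hρ.le) (by omega)).trans hq
  have := norm_sub_norm_le (1 : ℂ) (q ^ (n + 1))
  rw [norm_one] at this
  linarith

theorem norm_qPoch_exponent_le {ρ : ℝ} {a q : ℂ} (hρ : ρ < 1) (ha : ‖a‖ ≤ ρ) (hq : ‖q‖ ≤ ρ) (n : ℕ) :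
    ‖a ^ (n + 1) / (((n + 1 : ℕ) : ℂ) * (1 - q ^ (n + 1)))‖ ≤ ρ ^ (n + 1) / (1 - ρ) := by
  have hρ0 : 0 ≤ ρ := (norm_nonneg a).trans ha
  rw [norm_div, norm_mul, norm_pow]
  refine div_le_div₀ (by positivity) (pow_le_pow_left₀ (norm_nonneg _) ha _) (by linarith) ?_
  have h1 := norm_one_sub_pow_ge hρ hq n
  have h2 : (1 : ℝ) ≤ ‖((n + 1 : ℕ) : ℂ)‖ := by
    rw [Complex.norm_natCast]; exact_mod_cast Nat.le_add_left 1 n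
  nlinarith [norm_nonneg (1 - q ^ (n + 1))]

theorem summable_pow_succ_div {ρ : ℝ} (h0 : 0 ≤ ρ) (hρ : ρ < 1) :
    Summable fun n : ℕ => ρ ^ (n + 1) / (1 - ρ) :=
  ((summable_nat_add_iff 1).mpr (summable_geometric_of_lt_one h0 hρ)).div_const _

/-- The logarithm of the `q`-Pochhammer symbol as a Lambert series. -/
theorem qPoch_eq_exp {a q : ℂ} (ha : ‖a‖ < 1) (hq : ‖q‖ < 1) :
    qPoch a q = Complex.exp (-∑' n : ℕ, a ^ (n + 1) / (((n + 1 : ℕ) : ℂ) * (1 - q ^ (n + 1)))) := by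
  have hak : ∀ k : ℕ, ‖a * q ^ k‖ < 1 := fun k => by
    rw [norm_mul, norm_pow]
    exact (mul_le_of_le_one_right (norm_nonneg _) (pow_le_one₀ (norm_nonneg _) hq.le)).trans_lt ha
  have hlog : ∀ k : ℕ, HasSum (fun n : ℕ => (a * q ^ k) ^ (n + 1) / ((n + 1 : ℕ) : ℂ))
      (-Complex.log (1 - a * q ^ k)) := fun k => by
    have := (hasSum_nat_add_iff' 1).mpr (Complex.hasSum_taylorSeries_neg_log (hak k))
    simpa using this
  have hS : Summable fun x : ℕ × ℕ => (a * q ^ x.1) ^ (x.2 + 1) / ((x.2 + 1 : ℕ) : ℂ) := by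
    have h1 : Summable fun x : ℕ × ℕ => ‖q‖ ^ x.1 * ‖a‖ ^ x.2 :=
      (summable_geometric_of_lt_one (norm_nonneg _) hq).mul_of_nonneg
        (summable_geometric_of_lt_one (norm_nonneg _) ha)
        (fun _ => by positivity) (fun _ => by positivity)
    refine h1.of_norm_bounded fun x => ?_
    rw [norm_div, norm_pow, norm_mul, norm_pow, Complex.norm_natCast]
    have h2 : (1 : ℝ) ≤ ((x.2 + 1 : ℕ) : ℝ) := by exact_mod_cast Nat.le_add_left 1 x.2
    refine (div_le_self (by positivity) h2).trans ?_
    rw [mul_pow, mul_comm]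
    refine mul_le_mul ?_ (pow_le_pow_of_le_one (norm_nonneg _) ha.le (by omega)) (by positivity)
      (by positivity)
    rw [← pow_mul]
    exact pow_le_pow_of_le_one (norm_nonneg _) hq.le (by nlinarith [Nat.zero_le (x.1 * x.2)])
  have h1 : HasSum (fun k : ℕ => -Complex.log (1 - a * q ^ k))
      (∑' n : ℕ, a ^ (n + 1) / (((n + 1 : ℕ) : ℂ) * (1 - q ^ (n + 1)))) := by
    have e1 := hS.hasSum.prod_fiberwise hlog
    have hS' : Summable fun x : ℕ × ℕ => (a * q ^ x.2) ^ (x.1 + 1) / ((x.1 + 1 : ℕ) : ℂ) :=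
      (Equiv.prodComm ℕ ℕ).summable_iff.mpr hS
    have e2 : ∑' x : ℕ × ℕ, (a * q ^ x.1) ^ (x.2 + 1) / ((x.2 + 1 : ℕ) : ℂ) =
        ∑' n : ℕ, a ^ (n + 1) / (((n + 1 : ℕ) : ℂ) * (1 - q ^ (n + 1))) := by
      rw [← (Equiv.prodComm ℕ ℕ).tsum_eq]
      simp only [Equiv.prodComm_apply, Prod.fst_swap, Prod.snd_swap]
      rw [hS'.tsum_prod]
      congr 1; funext n
      have hqn : ‖q ^ (n + 1)‖ < 1 := by
        rw [norm_pow]; exact pow_lt_one₀ (norm_nonneg _) hq (by omega)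
      have : ∀ k : ℕ, (a * q ^ k) ^ (n + 1) / ((n + 1 : ℕ) : ℂ) =
          a ^ (n + 1) / ((n + 1 : ℕ) : ℂ) * (q ^ (n + 1)) ^ k := fun k => by
        rw [mul_pow, ← pow_mul, ← pow_mul, mul_comm k]; ring
      simp_rw [this]
      rw [tsum_mul_left, tsum_geometric_of_norm_lt_one hqn, ← div_eq_mul_inv, div_div]
    rwa [e2] at e1
  unfold qPoch
  refine (Complex.hasProd_of_hasSum_log (fun k => one_sub_ne_zero_of_norm (hak k)) ?_).tprod_eq
  simpa using h1.neg

theorem qPoch_ne_zero {a q : ℂ} (ha : ‖a‖ < 1) (hq : ‖q‖ < 1) : qPoch a q ≠ 0 := by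
  rw [qPoch_eq_exp ha hq]; exact Complex.exp_ne_zero _

/-- Two-sided bounds for the `q`-Pochhammer symbol, uniform on compact subsets of the bidisc. -/
theorem norm_qPoch_bounds {ρ : ℝ} (hρ : ρ < 1) : ∃ C : ℝ, 0 < C ∧ ∀ a q : ℂ, ‖a‖ ≤ ρ → ‖q‖ ≤ ρ →
    ‖qPoch a q‖ ≤ C ∧ ‖(qPoch a q)⁻¹‖ ≤ C := by
  refine ⟨Real.exp (∑' n : ℕ, ρ ^ (n + 1) / (1 - ρ)), Real.exp_pos _, fun a q ha hq => ?_⟩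
  have hρ0 : 0 ≤ ρ := (norm_nonneg a).trans ha
  have h : ‖∑' n : ℕ, a ^ (n + 1) / (((n + 1 : ℕ) : ℂ) * (1 - q ^ (n + 1)))‖ ≤
      ∑' n : ℕ, ρ ^ (n + 1) / (1 - ρ) :=
    tsum_of_norm_bounded (summable_pow_succ_div hρ0 hρ).hasSum (norm_qPoch_exponent_le hρ ha hq)
  have h' := Complex.abs_re_le_norm (∑' n : ℕ, a ^ (n + 1) / (((n + 1 : ℕ) : ℂ) * (1 - q ^ (n + 1))))
  rw [abs_le] at h'
  rw [qPoch_eq_exp (ha.trans_lt hρ) (hq.trans_lt hρ), ← Complex.exp_neg, neg_neg,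
    Complex.norm_exp, Complex.norm_exp, Real.exp_le_exp, Real.exp_le_exp, Complex.neg_re]
  constructor <;> linarith

theorem multipliable_one_sub_pow {q : ℂ} (hq : ‖q‖ < 1) : Multipliable fun n : ℕ => 1 - q ^ (n + 1) := by
  have := multipliable_qPoch q hq
  simpa only [← pow_succ'] using this

theorem qPoch_self (q : ℂ) : qPoch q q = ∏' n : ℕ, (1 - q ^ (n + 1)) := by
  simp only [qPoch, ← pow_succ']

theorem hasProd_qPoch_self {q : ℂ} (hq : ‖q‖ < 1) : HasProd (fun n : ℕ => 1 - q ^ (n + 1)) (qPoch q q) := by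
  rw [qPoch_self]; exact (multipliable_one_sub_pow hq).hasProd

theorem hasProd_inv_qPoch_self {q : ℂ} (hq : ‖q‖ < 1) :
    HasProd (fun n : ℕ => (1 - q ^ (n + 1))⁻¹) (qPoch q q)⁻¹ := by
  have h := hasProd_qPoch_self hq
  have := Filter.Tendsto.inv₀ h (qPoch_ne_zero hq hq)
  simpa only [HasProd, Finset.prod_inv_distrib] using this

/-! ### The sum over partitions -/

/-- A partition is determined by the multiplicities `κ n` of its parts `n + 1`. -/
def partitionEquiv : (Σ m : ℕ, m.Partition) ≃ (ℕ →₀ ℕ) where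
  toFun mu := Multiset.toFinsupp (mu.2.parts.map Nat.pred)
  invFun κ := ⟨((Finsupp.toMultiset κ).map Nat.succ).sum,
    ⟨(Finsupp.toMultiset κ).map Nat.succ, fun {i} hi => by
      obtain ⟨n, _, rfl⟩ := Multiset.mem_map.mp hi
      exact Nat.succ_pos n, rfl⟩⟩
  left_inv := by
    rintro ⟨m, mu⟩
    have h : (Finsupp.toMultiset (Multiset.toFinsupp (mu.parts.map Nat.pred))).map Nat.succ = mu.parts := by
      rw [Multiset.toFinsupp_toMultiset, Multiset.map_map]
      conv_rhs => rw [← Multiset.map_id mu.parts]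
      exact Multiset.map_congr rfl fun i hi => Nat.succ_pred_eq_of_pos (mu.parts_pos hi)
    have hm : ((Finsupp.toMultiset (Multiset.toFinsupp (mu.parts.map Nat.pred))).map Nat.succ).sum = m := by
      rw [h, mu.parts_sum]
    refine Sigma.ext hm ?_
    dsimp only
    have key : ∀ (k : ℕ) (nu : k.Partition), k = m → nu.parts = mu.parts → HEq nu mu := by
      rintro k nu rfl hp
      exact heq_of_eq (Nat.Partition.ext hp)
    exact key _ _ hm h
  right_inv κ := by
    simp only [Multiset.map_map, Function.comp_def, Nat.pred_eq_sub_one, Nat.succ_eq_add_one, Nat.add_sub_cancel]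
    simp

theorem prod_map_parts {R : Type*} [CommMonoid R] (f : ℕ → R) (κ : ℕ →₀ ℕ) :
    ((((Finsupp.toMultiset κ).map Nat.succ)).map f).prod = κ.prod fun n m => f (n + 1) ^ m := by
  rw [Multiset.map_map, Finsupp.toMultiset_map, Finsupp.prod_toMultiset]
  exact Finsupp.prod_mapDomain_index (fun _ => pow_zero _) (fun _ _ _ => pow_add _ _ _)

theorem norm_pow_succ_le {z : ℂ} (h : ‖z‖ < 1) (n : ℕ) : ‖z ^ (n + 1)‖ ≤ ‖z‖ := by
  rw [norm_pow]; exact pow_le_of_le_one (norm_nonneg _) h.le (by omega)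

theorem summable_norm_pow_succ {z : ℂ} (h : ‖z‖ < 1) : Summable fun n : ℕ => ‖z ^ (n + 1)‖ := by
  simp only [norm_pow]
  exact (summable_nat_add_iff 1).mpr (summable_geometric_of_lt_one (norm_nonneg _) h)

theorem summable_partRatio {v p : ℂ} (hv : ‖v‖ < 1) (hp : ‖p‖ < 1) :
    Summable fun n : ℕ => ‖(v ^ (n + 1) - p ^ (n + 1)) / (1 - p ^ (n + 1))‖ := by
  refine Summable.of_nonneg_of_le (fun _ => norm_nonneg _) (fun n => ?_)
    (((summable_norm_pow_succ hv).add (summable_norm_pow_succ hp)).div_const (1 - ‖p‖))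
  rw [norm_div]
  exact div_le_div₀ (by positivity) (norm_sub_le _ _) (by linarith) (norm_one_sub_pow_ge hp le_rfl n)

/-- Sorted by multiplicities, the sum over partitions is the product over `n ≥ 1` of the geometric series
with ratio `(vⁿ - pⁿ) / (1 - pⁿ)` and sum `(1 - pⁿ) / (1 - vⁿ)`. -/
theorem partTerm_sum {v p : ℂ} (hv : ‖v‖ < 1) (hp : ‖p‖ < 1)
    (h : ∀ n : ℕ, 1 ≤ n → ‖(v ^ n - p ^ n) / (1 - p ^ n)‖ < 1) :
    Summable (fun mu : (Σ m : ℕ, m.Partition) => partTerm v p mu.2) ∧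
      ∑' mu : (Σ m : ℕ, m.Partition), partTerm v p mu.2 = qPoch p p / qPoch v v := by
  have key := hasSum_finsupp_choose (fun n => h (n + 1) (by omega)) (summable_partRatio hv hp) 0
  simp only [Finsupp.coe_zero, Pi.zero_apply, add_zero, Nat.choose_zero_right, Nat.cast_one, one_mul,
    zero_add, pow_one] at key
  have e : (fun κ : ℕ →₀ ℕ => κ.prod fun n m => ((v ^ (n + 1) - p ^ (n + 1)) / (1 - p ^ (n + 1))) ^ m) =
      (fun mu : (Σ m : ℕ, m.Partition) => partTerm v p mu.2) ∘ partitionEquiv.symm := by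
    funext κ
    exact (prod_map_parts (fun i => (v ^ i - p ^ i) / (1 - p ^ i)) κ).symm
  have hs := key.2
  rw [e, Equiv.hasSum_iff] at hs
  refine ⟨hs.summable, ?_⟩
  rw [hs.tsum_eq]
  have h2 := (hasProd_qPoch_self hp).mul (hasProd_inv_qPoch_self hv)
  rw [div_eq_mul_inv, ← h2.tprod_eq]
  congr 1; funext n
  have h3 := one_sub_pow_ne_zero hp n
  have h4 := one_sub_pow_ne_zero hv n
  have : 1 - (v ^ (n + 1) - p ^ (n + 1)) / (1 - p ^ (n + 1)) = (1 - v ^ (n + 1)) / (1 - p ^ (n + 1)) := by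
    field_simp; ring
  rw [this, one_div_div, div_eq_mul_inv]

theorem indexInftySum_eq {t u v p q : ℂ} (hv : ‖v‖ < 1) (hp : ‖p‖ < 1)
    (h : ∀ n : ℕ, 1 ≤ n → ‖(v ^ n - p ^ n) / (1 - p ^ n)‖ < 1) :
    indexInftySum t u v p q = indexInfty t u v p q := by
  rw [indexInftySum, indexInfty, (partTerm_sum hv hp h).2]
  ring

/-! ### The unitary average and the power sum expansion -/

theorem powerSum_eq {N : ℕ} (n : ℕ) (x : Fin N → ℂ) : powerSum n x = ∑ i, x i ^ n := by
  simp [powerSum, MvPolynomial.psum]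

/-- The Weyl density `∏_{i ≠ j} (1 - x_i / x_j)` of the unitary group. -/
def weylDensity {N : ℕ} (x : Fin N → ℂ) : ℂ :=
  ∏ ij ∈ (Finset.univ : Finset (Fin N)).offDiag, (1 - x ij.1 / x ij.2)

/-- The average over the unitary group `U(N)` of a function of the eigenvalues. -/
def unitaryMean {N : ℕ} (F : (Fin N → ℂ) → ℂ) : ℂ :=
  (N.factorial : ℂ)⁻¹ * torusMean fun x => weylDensity x * F x

/-- The Boltzmann factor `exp (∑_{n ≥ 1} b_n / n · p_n(x) p_n(x⁻¹))`; the coupling `b_n` is stored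
at the index `n - 1`. -/
def gasWeight {N : ℕ} (b : ℕ → ℂ) (x : Fin N → ℂ) : ℂ :=
  Complex.exp (∑' k : ℕ, b k / ((k + 1 : ℕ) : ℂ) * (powerSum (k + 1) x * powerSum (k + 1) x⁻¹))

/-- The couplings `1 - (1 - tⁿ) / (1 - qⁿ)`, which turn `weylDensity` into Macdonald's weight. -/
def macCoupling (q t : ℂ) (k : ℕ) : ℂ := (t ^ (k + 1) - q ^ (k + 1)) / (1 - q ^ (k + 1))

/-- The average with respect to Macdonald's weight, normalised by the factor
`((q;q)_∞ / (t;q)_∞)^N`. -/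
def macMean {N : ℕ} (q t : ℂ) (F : (Fin N → ℂ) → ℂ) : ℂ :=
  unitaryMean fun x => gasWeight (macCoupling q t) x * F x

theorem weylDensity_mem {N : ℕ} : (weylDensity : (Fin N → ℂ) → ℂ) ∈ laurentAlg N :=
  prod_mem_laurentAlg fun _ _ => sub_mem_laurentAlg (const_mem_laurentAlg 1) (div_mem_laurentAlg _ _)

theorem powerSum_mem {N : ℕ} (n : ℕ) : (powerSum n : (Fin N → ℂ) → ℂ) ∈ laurentAlg N :=
  eval_mem_laurentAlg _

theorem powerSum_inv_mem {N : ℕ} (n : ℕ) : (fun x : Fin N → ℂ => powerSum n x⁻¹) ∈ laurentAlg N :=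
  eval_inv_mem_laurentAlg _

theorem norm_powerSum_le {N : ℕ} (n : ℕ) (θ : Fin N → ℝ) : ‖powerSum n (torusPt θ)‖ ≤ N := by
  rw [powerSum_eq]
  refine (norm_sum_le _ _).trans ?_
  simp

theorem powerSum_inv_torusPt {N : ℕ} (n : ℕ) (θ : Fin N → ℝ) :
    powerSum n (torusPt θ)⁻¹ = starRingEnd ℂ (powerSum n (torusPt θ)) := by
  rw [torusPt_inv, powerSum_eq, powerSum_eq, map_sum]
  simp

theorem norm_powerSum_inv_le {N : ℕ} (n : ℕ) (θ : Fin N → ℝ) : ‖powerSum n (torusPt θ)⁻¹‖ ≤ N := by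
  rw [powerSum_inv_torusPt, RCLike.norm_conj]; exact norm_powerSum_le n θ

section linear
variable {N : ℕ} {F G : (Fin N → ℂ) → ℂ}

theorem unitaryMean_congr (h : ∀ θ, F (torusPt θ) = G (torusPt θ)) : unitaryMean F = unitaryMean G := by
  unfold unitaryMean; congr 1; exact torusMean_congr fun θ => by rw [h]

theorem unitaryMean_const_mul (c : ℂ) (F : (Fin N → ℂ) → ℂ) :
    unitaryMean (fun x => c * F x) = c * unitaryMean F := by
  unfold unitaryMean
  simp only [mul_left_comm _ c]
  rw [torusMean_const_mul]; ring

/-- The operator norm of `unitaryMean` on the continuous functions, estimated crudely. -/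
theorem exists_norm_unitaryMean_le (N : ℕ) : ∃ K : ℝ, 0 ≤ K ∧ ∀ (F : (Fin N → ℂ) → ℂ) (C : ℝ),
    (∀ θ, ‖F (torusPt θ)‖ ≤ C) → ‖unitaryMean F‖ ≤ K * C := by
  obtain ⟨K, hK, hb⟩ := (torusCont_of_mem (weylDensity_mem (N := N))).exists_bound
  refine ⟨‖(N.factorial : ℂ)⁻¹‖ * K, by positivity, fun F C hC => ?_⟩
  unfold unitaryMean
  rw [norm_mul, mul_assoc]
  refine mul_le_mul_of_nonneg_left (norm_torusMean_le fun θ => ?_) (norm_nonneg _)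
  rw [norm_mul]
  exact mul_le_mul (hb θ) (hC θ) (norm_nonneg _) hK

theorem hasSum_unitaryMean {ι : Type*} [Countable ι] {F : ι → (Fin N → ℂ) → ℂ}
    (hF : ∀ i, TorusCont (F i)) {u : ι → ℝ} (hu : Summable u)
    (hb : ∀ i θ, ‖F i (torusPt θ)‖ ≤ u i) {G : (Fin N → ℂ) → ℂ}
    (hG : ∀ θ, HasSum (fun i => F i (torusPt θ)) (G (torusPt θ))) :
    HasSum (fun i => unitaryMean (F i)) (unitaryMean G) := by
  have hW := torusCont_of_mem (weylDensity_mem (N := N))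
  obtain ⟨K, hK, hbW⟩ := hW.exists_bound
  unfold unitaryMean
  refine HasSum.mul_left _ (hasSum_torusMean (fun i => hW.mul (hF i)) (hu.mul_left K) ?_ ?_)
  · intro i θ
    rw [norm_mul]
    exact mul_le_mul (hbW θ) (hb i θ) (norm_nonneg _) hK
  · intro θ; exact (hG θ).mul_left _

end linear

/-- The power sum `p_κ = ∏ₙ p_{n+1}^{κ n}` of the partition with multiplicities `κ`. -/
def powerSumMult {N : ℕ} (κ : ℕ →₀ ℕ) (x : Fin N → ℂ) : ℂ := κ.prod fun n m => powerSum (n + 1) x ^ m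

/-- The number `z_κ = ∏ₙ (n+1)^{κ n} (κ n)!`. -/
def zMult (κ : ℕ →₀ ℕ) : ℕ := κ.prod fun n m => (n + 1) ^ m * m.factorial

theorem zMult_pos (κ : ℕ →₀ ℕ) : 0 < zMult κ :=
  Finset.prod_pos fun n _ => by positivity

theorem zMult_ne_zero (κ : ℕ →₀ ℕ) : (zMult κ : ℂ) ≠ 0 := by exact_mod_cast (zMult_pos κ).ne'

theorem powerSumMult_add {N : ℕ} (κ l : ℕ →₀ ℕ) (x : Fin N → ℂ) :
    powerSumMult (κ + l) x = powerSumMult κ x * powerSumMult l x :=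
  Finsupp.prod_add_index' (fun _ => pow_zero _) fun _ _ _ => pow_add _ _ _

theorem powerSumMult_mem {N : ℕ} (κ : ℕ →₀ ℕ) : (powerSumMult κ : (Fin N → ℂ) → ℂ) ∈ laurentAlg N :=
  prod_mem_laurentAlg fun _ _ => pow_mem_laurentAlg (powerSum_mem _) _

theorem powerSumMult_inv_mem {N : ℕ} (κ : ℕ →₀ ℕ) :
    (fun x : Fin N → ℂ => powerSumMult κ x⁻¹) ∈ laurentAlg N :=
  prod_mem_laurentAlg fun _ _ => pow_mem_laurentAlg (powerSum_inv_mem _) _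

theorem norm_powerSumMult_mul_le {N : ℕ} (κ : ℕ →₀ ℕ) (θ : Fin N → ℝ) :
    ‖powerSumMult κ (torusPt θ) * powerSumMult κ (torusPt θ)⁻¹‖ ≤ κ.prod fun _ m => ((N : ℝ) ^ 2) ^ m := by
  rw [powerSumMult, powerSumMult, Finsupp.prod, Finsupp.prod, ← Finset.prod_mul_distrib, norm_prod]
  refine Finset.prod_le_prod (fun _ _ => norm_nonneg _) fun n _ => ?_
  rw [← mul_pow, norm_pow, norm_mul]
  refine pow_le_pow_left₀ (by positivity) ?_ _
  rw [sq]
  exact mul_le_mul (norm_powerSum_le _ θ) (norm_powerSum_inv_le _ θ) (norm_nonneg _) (by positivity)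

/-- Expansion of the exponential of a series over multiplicity functions. -/
theorem hasSum_exp_tsum {y : ℕ → ℂ} (hy : Summable fun n => ‖y n‖) :
    (Summable fun κ : ℕ →₀ ℕ => ‖κ.prod fun n m => y n ^ m / (m.factorial : ℂ)‖) ∧
    HasSum (fun κ : ℕ →₀ ℕ => κ.prod fun n m => y n ^ m / (m.factorial : ℂ))
      (Complex.exp (∑' n, y n)) := by
  have hs : ∀ n, Summable fun m => ‖y n ^ m / (m.factorial : ℂ)‖ := fun n => by
    simpa using Real.summable_pow_div_factorial ‖y n‖
  have key := hasSum_finsupp_prod (c := fun n m => y n ^ m / (m.factorial : ℂ)) (fun n => by simp)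
    (fun n => (summable_nat_add_iff 1).mpr (hs n)) ?_
  · have h : ∀ n, ∑' m : ℕ, y n ^ m / (m.factorial : ℂ) = Complex.exp (y n) := fun n => by
      rw [Complex.exp_eq_exp_ℂ, NormedSpace.exp_eq_tsum_div]
    simp_rw [h] at key
    have h2 : ∏' n, Complex.exp (y n) = Complex.exp (∑' n, y n) := hy.of_norm.hasSum.cexp.tprod_eq
    rwa [h2] at key
  · obtain ⟨B, hB⟩ := hy.tendsto_atTop_zero.bddAbove_range
    have hB' : ∀ n, ‖y n‖ ≤ B := fun n => hB ⟨n, rfl⟩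
    refine Summable.of_nonneg_of_le (fun n => tsum_nonneg fun _ => norm_nonneg _) (fun n => ?_)
      (hy.mul_right (Real.exp B))
    have h1 : HasSum (fun m : ℕ => ‖y n ^ m / (m.factorial : ℂ)‖) (Real.exp ‖y n‖) := by
      have := NormedSpace.expSeries_div_hasSum_exp (𝔸 := ℝ) ‖y n‖
      rw [← Real.exp_eq_exp_ℝ] at this
      simpa using this
    have h2 := (hasSum_nat_add_iff' 1).mpr h1
    rw [h2.tsum_eq]
    have h3 := Real.add_one_le_exp (-‖y n‖)
    have h4 : Real.exp ‖y n‖ * Real.exp (-‖y n‖) = 1 := by rw [← Real.exp_add]; simp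
    have h5 : Real.exp ‖y n‖ ≤ Real.exp B := Real.exp_le_exp.mpr (hB' n)
    have h6 := Real.exp_pos ‖y n‖
    simp only [Finset.range_one, Finset.sum_singleton, pow_zero, Nat.factorial_zero, Nat.cast_one,
      div_one, norm_one]
    nlinarith [norm_nonneg (y n)]

/-- The monomial `b_κ = ∏ₙ bₙ^{κ n}` in the couplings. -/
def couplingMono (b : ℕ → ℂ) (κ : ℕ →₀ ℕ) : ℂ := κ.prod fun n m => b n ^ m

theorem couplingMono_mul (b c : ℕ → ℂ) (κ : ℕ →₀ ℕ) :
    couplingMono (fun n => b n * c n) κ = couplingMono b κ * couplingMono c κ := by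
  simp only [couplingMono, Finsupp.prod, mul_pow, Finset.prod_mul_distrib]

section expansion
variable {N : ℕ}

theorem summable_coupling_bound {B : ℕ → ℝ} (hB0 : ∀ n, 0 ≤ B n) (hB : Summable B) (N : ℕ) :
    Summable fun κ : ℕ →₀ ℕ => (κ.prod fun n m => B n ^ m) / (zMult κ : ℝ) *
      κ.prod fun _ m => ((N : ℝ) ^ 2) ^ m := by
  have h1 : Summable fun n => ‖((B n * (N : ℝ) ^ 2 : ℝ) : ℂ)‖ := by
    refine (hB.mul_right ((N : ℝ) ^ 2)).congr fun n => ?_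
    rw [Complex.norm_real, Real.norm_of_nonneg (mul_nonneg (hB0 n) (by positivity))]
  refine Summable.of_nonneg_of_le (fun κ => ?_) (fun κ => ?_) (hasSum_exp_tsum h1).1
  · refine mul_nonneg (div_nonneg (Finset.prod_nonneg fun n _ => pow_nonneg (hB0 n) _) (by positivity))
      (Finset.prod_nonneg fun n _ => by positivity)
  · rw [zMult, Finsupp.prod, Finsupp.prod, Finsupp.prod, Finsupp.prod, norm_prod, Nat.cast_prod, ← Finset.prod_div_distrib,
      ← Finset.prod_mul_distrib]
    refine Finset.prod_le_prod (fun n _ => ?_) fun n _ => ?_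
    · exact mul_nonneg (div_nonneg (pow_nonneg (hB0 n) _) (by positivity)) (by positivity)
    · rw [norm_div, norm_pow, Complex.norm_real, Complex.norm_natCast,
        Real.norm_of_nonneg (mul_nonneg (hB0 n) (by positivity)), mul_pow, div_mul_eq_mul_div]
      refine div_le_div_of_nonneg_left (by have := hB0 n; positivity) (by positivity) ?_
      push_cast
      refine le_mul_of_one_le_left (by positivity) (one_le_pow₀ ?_)
      linarith [(Nat.cast_nonneg n : (0 : ℝ) ≤ n)]

/-- The modes of the exponent of `gasWeight` are dominated by the couplings. -/
theorem norm_gas_mode_le (b : ℕ → ℂ) (k : ℕ) (θ : Fin N → ℝ) :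
    ‖b k / ((k + 1 : ℕ) : ℂ) * (powerSum (k + 1) (torusPt θ) * powerSum (k + 1) (torusPt θ)⁻¹)‖ ≤
      ‖b k‖ * (N : ℝ) ^ 2 := by
  rw [norm_mul, norm_mul, norm_div, Complex.norm_natCast]
  have h1 : (1 : ℝ) ≤ ((k + 1 : ℕ) : ℝ) := by exact_mod_cast Nat.le_add_left 1 k
  refine mul_le_mul (div_le_self (norm_nonneg _) h1) ?_ (by positivity) (norm_nonneg _)
  rw [sq]
  exact mul_le_mul (norm_powerSum_le _ θ) (norm_powerSum_inv_le _ θ) (norm_nonneg _) (by positivity)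

theorem gasWeight_torusCont {b : ℕ → ℂ} (hb : Summable fun n => ‖b n‖) :
    TorusCont (gasWeight b : (Fin N → ℂ) → ℂ) := by
  unfold TorusCont gasWeight
  refine Complex.continuous_exp.comp ?_
  refine continuous_tsum (fun k => ?_) (hb.mul_right ((N : ℝ) ^ 2)) fun k θ => norm_gas_mode_le b k θ
  exact (torusCont_of_mem (mul_mem_laurentAlg (const_mem_laurentAlg _)
    (mul_mem_laurentAlg (powerSum_mem (k + 1)) (powerSum_inv_mem (k + 1)))))

theorem hasSum_gasWeight {b : ℕ → ℂ} (hb : Summable fun n => ‖b n‖) (θ : Fin N → ℝ) :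
    HasSum (fun κ : ℕ →₀ ℕ => couplingMono b κ / (zMult κ : ℂ) *
      (powerSumMult κ (torusPt θ) * powerSumMult κ (torusPt θ)⁻¹)) (gasWeight b (torusPt θ)) := by
  have h := (hasSum_exp_tsum (y := fun k => b k / ((k + 1 : ℕ) : ℂ) *
    (powerSum (k + 1) (torusPt θ) * powerSum (k + 1) (torusPt θ)⁻¹))
    (Summable.of_nonneg_of_le (fun _ => norm_nonneg _) (fun k => norm_gas_mode_le b k θ)
      (hb.mul_right _))).2
  refine Eq.mp (congrArg (fun f => HasSum f (gasWeight b (torusPt θ))) (funext fun κ => ?_)) h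
  symm
  simp only [couplingMono, zMult, powerSumMult, Finsupp.prod, Nat.cast_prod]
  rw [← Finset.prod_div_distrib, ← Finset.prod_mul_distrib, ← Finset.prod_mul_distrib]
  refine Finset.prod_congr rfl fun n _ => ?_
  push_cast
  rw [mul_pow, mul_pow, div_pow]
  ring

/-- Expansion of an average with the weight `gasWeight b` in the couplings: the coefficient of `b_κ` is
the average of `p_κ(x) p_κ(x⁻¹) / z_κ`. -/
theorem hasSum_unitaryMean_gasWeight {b : ℕ → ℂ} (hb : Summable fun n => ‖b n‖)
    {F : (Fin N → ℂ) → ℂ} (hF : TorusCont F) :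
    HasSum (fun κ : ℕ →₀ ℕ => couplingMono b κ / (zMult κ : ℂ) *
      unitaryMean fun x => powerSumMult κ x * powerSumMult κ x⁻¹ * F x)
      (unitaryMean fun x : Fin N → ℂ => gasWeight b x * F x) := by
  obtain ⟨C, hC0, hC⟩ := hF.exists_bound
  have h := hasSum_unitaryMean (N := N) (F := fun (κ : ℕ →₀ ℕ) x => couplingMono b κ / (zMult κ : ℂ) *
    (powerSumMult κ x * powerSumMult κ x⁻¹ * F x)) (G := fun x => gasWeight b x * F x) (fun κ => ?_)
    ((summable_coupling_bound (fun n => norm_nonneg (b n)) hb N).mul_right C) (fun κ θ => ?_) (fun θ => ?_)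
  · simpa only [unitaryMean_const_mul] using h
  · exact (TorusCont.const _).mul ((torusCont_of_mem (mul_mem_laurentAlg (powerSumMult_mem κ)
      (powerSumMult_inv_mem κ))).mul hF)
  · rw [norm_mul, norm_mul, norm_div, Complex.norm_natCast, ← mul_assoc]
    refine mul_le_mul (mul_le_mul ?_ (norm_powerSumMult_mul_le κ θ) (norm_nonneg _) ?_) (hC θ) (norm_nonneg _) ?_
    · simp only [couplingMono, Finsupp.prod, norm_prod, norm_pow]; exact le_rfl
    · exact div_nonneg (Finset.prod_nonneg fun n _ => by positivity) (by positivity)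
    · exact mul_nonneg (div_nonneg (Finset.prod_nonneg fun n _ => by positivity) (by positivity))
        (Finset.prod_nonneg fun n _ => by positivity)
  · have := (hasSum_gasWeight hb θ).mul_right (F (torusPt θ))
    simpa only [mul_assoc] using this

/-- The terms of the power sum expansion are dominated uniformly in the couplings. -/
theorem exists_expansion_bound {B : ℕ → ℝ} (hB0 : ∀ n, 0 ≤ B n) (hB : Summable B)
    {F : (Fin N → ℂ) → ℂ} (hF : TorusCont F) :
    ∃ u : (ℕ →₀ ℕ) → ℝ, Summable u ∧ ∀ (b : ℕ → ℂ) (κ : ℕ →₀ ℕ), (∀ n, ‖b n‖ ≤ B n) →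
      ‖couplingMono b κ / (zMult κ : ℂ) *
        unitaryMean fun x : Fin N → ℂ => powerSumMult κ x * powerSumMult κ x⁻¹ * F x‖ ≤ u κ := by
  obtain ⟨C, hC0, hC⟩ := hF.exists_bound
  obtain ⟨K, hK0, hK⟩ := exists_norm_unitaryMean_le N
  refine ⟨_, (summable_coupling_bound hB0 hB N).mul_right (K * C), fun b κ hb => ?_⟩
  have h1 : ‖unitaryMean fun x : Fin N → ℂ => powerSumMult κ x * powerSumMult κ x⁻¹ * F x‖ ≤
      K * ((κ.prod fun _ m => ((N : ℝ) ^ 2) ^ m) * C) := by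
    refine hK _ _ fun θ => ?_
    rw [norm_mul]
    exact mul_le_mul (norm_powerSumMult_mul_le κ θ) (hC θ) (norm_nonneg _)
      (Finset.prod_nonneg fun n _ => by positivity)
  have h2 : ‖couplingMono b κ / (zMult κ : ℂ)‖ ≤ (κ.prod fun n m => B n ^ m) / (zMult κ : ℝ) := by
    rw [norm_div, Complex.norm_natCast, couplingMono, Finsupp.prod, norm_prod]
    refine div_le_div_of_nonneg_right ?_ (by positivity)
    refine Finset.prod_le_prod (fun _ _ => norm_nonneg _) fun n _ => ?_
    rw [norm_pow]; exact pow_le_pow_left₀ (norm_nonneg _) (hb n) _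
  rw [norm_mul]
  refine (mul_le_mul h2 h1 (norm_nonneg _) ?_).trans (le_of_eq (by ring))
  exact div_nonneg (Finset.prod_nonneg fun n _ => pow_nonneg (hB0 n) _) (by positivity)

/-- Averages of `gasWeight` depend holomorphically on parameters, whenever the couplings do. -/
theorem differentiableOn_unitaryMean_gasWeight {U : Set ℂ} (hU : IsOpen U) {b : ℂ → ℕ → ℂ}
    (hb : ∀ n, DifferentiableOn ℂ (fun z => b z n) U)
    (hB : ∀ z ∈ U, ∃ B : ℕ → ℝ, Summable B ∧ ∀ᶠ w in 𝓝 z, ∀ n, ‖b w n‖ ≤ B n)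
    {F : (Fin N → ℂ) → ℂ} (hF : TorusCont F) :
    DifferentiableOn ℂ (fun z => unitaryMean fun x => gasWeight (b z) x * F x) U := by
  intro z hz
  obtain ⟨B, hBs, hBb⟩ := hB z hz
  obtain ⟨V, hV, hVo, hzV⟩ := mem_nhds_iff.mp (hBb.and (hU.mem_nhds hz))
  have hB0 : ∀ n, 0 ≤ B n := fun n => (norm_nonneg _).trans ((hV hzV).1 n)
  obtain ⟨u, hu, hbound⟩ := exists_expansion_bound hB0 hBs hF
  have h1 : DifferentiableOn ℂ (fun z => ∑' κ : ℕ →₀ ℕ, couplingMono (b z) κ / (zMult κ : ℂ) *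
      unitaryMean fun x : Fin N → ℂ => powerSumMult κ x * powerSumMult κ x⁻¹ * F x) V := by
    refine Complex.differentiableOn_tsum_of_summable_norm hu (fun κ => ?_) hVo fun κ w hw =>
      hbound (b w) κ (hV hw).1
    refine DifferentiableOn.mul_const (DifferentiableOn.div_const ?_ _) _
    unfold couplingMono Finsupp.prod
    refine DifferentiableOn.fun_finsetProd fun n _ => DifferentiableOn.fun_pow ((hb n).mono fun w hw => (hV hw).2) _
  have h2 : DifferentiableOn ℂ (fun z => unitaryMean fun x => gasWeight (b z) x * F x) V := by
    refine h1.congr fun w hw => ?_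
    exact (hasSum_unitaryMean_gasWeight (Summable.of_nonneg_of_le (fun _ => norm_nonneg _)
      (hV hw).1 hBs) hF).tsum_eq.symm
  exact (h2.differentiableAt (hVo.mem_nhds hzV)).differentiableWithinAt

theorem continuousOn_unitaryMean_gasWeight {X : Type*} [TopologicalSpace X] {U : Set X}
    {b : X → ℕ → ℂ} (hb : ∀ n, ContinuousOn (fun z => b z n) U) {B : ℕ → ℝ} (hBs : Summable B)
    (hB : ∀ z ∈ U, ∀ n, ‖b z n‖ ≤ B n) {F : (Fin N → ℂ) → ℂ} (hF : TorusCont F) :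
    ContinuousOn (fun z => unitaryMean fun x => gasWeight (b z) x * F x) U := by
  rcases U.eq_empty_or_nonempty with rfl | ⟨z0, hz0⟩
  · exact continuousOn_empty _
  have hB0 : ∀ n, 0 ≤ B n := fun n => (norm_nonneg _).trans (hB z0 hz0 n)
  obtain ⟨u, hu, hbound⟩ := exists_expansion_bound hB0 hBs hF
  have h1 : ContinuousOn (fun z => ∑' κ : ℕ →₀ ℕ, couplingMono (b z) κ / (zMult κ : ℂ) *
      unitaryMean fun x : Fin N → ℂ => powerSumMult κ x * powerSumMult κ x⁻¹ * F x) U := by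
    refine continuousOn_tsum (fun κ => ?_) hu fun κ w hw => hbound (b w) κ (hB w hw)
    refine ContinuousOn.mul (ContinuousOn.div_const ?_ _) continuousOn_const
    unfold couplingMono Finsupp.prod
    exact continuousOn_finsetProd _ fun n _ => (hb n).pow _
  refine h1.congr fun w hw => ?_
  exact (hasSum_unitaryMean_gasWeight (Summable.of_nonneg_of_le (fun _ => norm_nonneg _)
    (hB w hw) hBs) hF).tsum_eq.symm

end expansion

/-! ### Macdonald's weight as a Boltzmann factor -/

theorem norm_macCoupling_le {ρ : ℝ} (hρ : ρ < 1) {q t : ℂ} (hq : ‖q‖ ≤ ρ) (ht : ‖t‖ ≤ ρ) (k : ℕ) :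
    ‖macCoupling q t k‖ ≤ 2 * ρ ^ (k + 1) / (1 - ρ) := by
  have hρ0 : 0 ≤ ρ := (norm_nonneg q).trans hq
  rw [macCoupling, norm_div]
  refine div_le_div₀ (by positivity) ?_ (by linarith) (norm_one_sub_pow_ge hρ hq k)
  refine (norm_sub_le _ _).trans ?_
  rw [norm_pow, norm_pow]
  have := pow_le_pow_left₀ (norm_nonneg _) hq (k + 1)
  have := pow_le_pow_left₀ (norm_nonneg _) ht (k + 1)
  linarith

theorem summable_macCoupling_bound {ρ : ℝ} (h0 : 0 ≤ ρ) (hρ : ρ < 1) :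
    Summable fun k : ℕ => 2 * ρ ^ (k + 1) / (1 - ρ) := by
  simp only [mul_div_assoc]
  exact (summable_pow_succ_div h0 hρ).mul_left 2

theorem summable_macCoupling {q t : ℂ} (hq : ‖q‖ < 1) (ht : ‖t‖ < 1) :
    Summable fun k => ‖macCoupling q t k‖ :=
  Summable.of_nonneg_of_le (fun _ => norm_nonneg _)
    (norm_macCoupling_le (max_lt hq ht) (le_max_left _ _) (le_max_right _ _))
    (summable_macCoupling_bound ((norm_nonneg q).trans (le_max_left _ _)) (max_lt hq ht))

theorem powerSum_mul_powerSum_inv {N : ℕ} (n : ℕ) (x : Fin N → ℂ) :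
    powerSum n x * powerSum n x⁻¹ = ∑ i, ∑ j, (x i / x j) ^ n := by
  rw [powerSum_eq, powerSum_eq, Finset.sum_mul_sum]
  simp [div_eq_mul_inv, mul_pow]

/-- The contribution of an ordered pair of eigenvalues with ratio `z` to the Boltzmann factor. -/
theorem exp_macCoupling {q t z : ℂ} (hq : ‖q‖ < 1) (ht : ‖t‖ < 1) (hz : ‖z‖ = 1) :
    (Summable fun k : ℕ => macCoupling q t k / ((k + 1 : ℕ) : ℂ) * z ^ (k + 1)) ∧
    Complex.exp (∑' k : ℕ, macCoupling q t k / ((k + 1 : ℕ) : ℂ) * z ^ (k + 1)) =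
      qPoch (q * z) q / qPoch (t * z) q := by
  have hqz : ‖q * z‖ < 1 := by rwa [norm_mul, hz, mul_one]
  have htz : ‖t * z‖ < 1 := by rwa [norm_mul, hz, mul_one]
  have hs : ∀ a : ℂ, ‖a‖ < 1 → Summable fun n : ℕ => a ^ (n + 1) / (((n + 1 : ℕ) : ℂ) * (1 - q ^ (n + 1))) :=
    fun a ha => Summable.of_norm_bounded (summable_pow_succ_div
      ((norm_nonneg q).trans (le_max_right ‖a‖ ‖q‖)) (max_lt ha hq))
      (norm_qPoch_exponent_le (max_lt ha hq) (le_max_left _ _) (le_max_right _ _))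
  have e : ∀ k : ℕ, macCoupling q t k / ((k + 1 : ℕ) : ℂ) * z ^ (k + 1) =
      (t * z) ^ (k + 1) / (((k + 1 : ℕ) : ℂ) * (1 - q ^ (k + 1))) -
      (q * z) ^ (k + 1) / (((k + 1 : ℕ) : ℂ) * (1 - q ^ (k + 1))) := by
    intro k
    have h1 := one_sub_pow_ne_zero hq k
    have h2 : ((k + 1 : ℕ) : ℂ) ≠ 0 := by exact_mod_cast k.succ_ne_zero
    rw [macCoupling, mul_pow, mul_pow]
    field_simp
  simp_rw [e]
  refine ⟨(hs _ htz).sub (hs _ hqz), ?_⟩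
  rw [(hs _ htz).tsum_sub (hs _ hqz), qPoch_eq_exp hqz hq, qPoch_eq_exp htz hq, ← Complex.exp_sub]
  congr 1; ring

/-- Macdonald's weight is the Weyl density times a Boltzmann factor. -/
theorem weylDensity_mul_gasWeight {N : ℕ} {q t : ℂ} (hq : ‖q‖ < 1) (ht : ‖t‖ < 1) (θ : Fin N → ℝ) :
    weylDensity (torusPt θ) * gasWeight (macCoupling q t) (torusPt θ) =
      (qPoch q q / qPoch t q) ^ N * macWeight q t (torusPt θ) := by
  set x := torusPt θ with hx
  have hz : ∀ i j : Fin N, ‖x i / x j‖ = 1 := fun i j => by simp [hx]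
  have h1 : gasWeight (macCoupling q t) x =
      ∏ i, ∏ j, (qPoch (q * (x i / x j)) q / qPoch (t * (x i / x j)) q) := by
    unfold gasWeight
    simp_rw [powerSum_mul_powerSum_inv, Finset.mul_sum]
    rw [Summable.tsum_finsetSum fun i _ => summable_sum fun j _ => (exp_macCoupling hq ht (hz i j)).1,
      Complex.exp_sum]
    refine Finset.prod_congr rfl fun i _ => ?_
    rw [Summable.tsum_finsetSum fun j _ => (exp_macCoupling hq ht (hz i j)).1, Complex.exp_sum]
    exact Finset.prod_congr rfl fun j _ => (exp_macCoupling hq ht (hz i j)).2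
  rw [h1, ← Finset.prod_product', ← Finset.diag_union_offDiag, Finset.prod_union
    (Finset.disjoint_diag_offDiag _), Finset.prod_diag, weylDensity, macWeight, mul_left_comm,
    ← Finset.prod_mul_distrib]
  congr 1
  · rw [Finset.prod_congr rfl (g := fun _ => qPoch q q / qPoch t q)]
    · simp [div_pow]
    · intro i _
      rw [div_self (torusPt_ne_zero θ i), mul_one, mul_one]
  · refine Finset.prod_congr rfl fun ij _ => ?_
    rw [qPoch_eq_mul (x ij.1 / x ij.2) hq, mul_div_assoc]

theorem macInner_eq_macMean {N : ℕ} {q t : ℂ} (hq : ‖q‖ < 1) (ht : ‖t‖ < 1)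
    (f g : MvPolynomial (Fin N) ℂ) :
    (qPoch q q / qPoch t q) ^ N * macInner q t f g =
      macMean q t fun x => MvPolynomial.eval x f * MvPolynomial.eval x⁻¹ g := by
  unfold macInner macMean unitaryMean
  rw [mul_left_comm, ← torusMean_const_mul]
  congr 1
  refine torusMean_congr fun θ => ?_
  rw [← mul_assoc, ← weylDensity_mul_gasWeight hq ht, mul_assoc]

/-! ### Newton's recursion and partial fractions -/

/-- The sequence with generating function `exp (∑_{j ≥ 1} y_j z^j / j)`, defined by Newton's recursion
`n h_n = ∑_{j=1}^n y_j h_{n-j}`. -/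
def newton (y : ℕ → ℂ) : ℕ → ℂ
  | 0 => 1
  | n + 1 => (∑ j : Fin (n + 1), y (j + 1) * newton y (n - j)) / (n + 1)

theorem newton_zero (y : ℕ → ℂ) : newton y 0 = 1 := by rw [newton]

theorem newton_succ (y : ℕ → ℂ) (n : ℕ) :
    ((n : ℂ) + 1) * newton y (n + 1) = ∑ j ∈ Finset.range (n + 1), y (j + 1) * newton y (n - j) := by
  have h : ((n : ℂ) + 1) ≠ 0 := by exact_mod_cast n.succ_ne_zero
  rw [newton, mul_div_cancel₀ _ h, ← Fin.sum_univ_eq_sum_range (fun j => y (j + 1) * newton y (n - j))]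

theorem eq_newton {y h : ℕ → ℂ} (h0 : h 0 = 1)
    (hs : ∀ n : ℕ, ((n : ℂ) + 1) * h (n + 1) = ∑ j ∈ Finset.range (n + 1), y (j + 1) * h (n - j)) (n : ℕ) :
    h n = newton y n := by
  induction n using Nat.strong_induction_on with
  | _ n ih =>
    cases n with
    | zero => rw [h0, newton_zero]
    | succ n =>
      have hn : ((n : ℂ) + 1) ≠ 0 := by exact_mod_cast n.succ_ne_zero
      refine mul_left_cancel₀ hn ?_
      rw [hs, newton_succ]
      exact Finset.sum_congr rfl fun j _ => by rw [ih (n - j) (by omega)]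

/-- Newton's recursion is homogeneous. -/
theorem newton_scale (y : ℕ → ℂ) (c : ℂ) (n : ℕ) :
    newton (fun j => c ^ j * y j) n = c ^ n * newton y n := by
  refine (eq_newton (h := fun n => c ^ n * newton y n) (by simp [newton_zero]) (fun n => ?_) n).symm
  rw [mul_left_comm, newton_succ, Finset.mul_sum]
  refine Finset.sum_congr rfl fun j hj => ?_
  have : c ^ (n + 1) = c ^ (j + 1) * c ^ (n - j) := by
    rw [← pow_add]; congr 1; have := Finset.mem_range.mp hj; omega
  rw [this]; ring

section partialFractions
open Polynomial

/-- The partial fraction decomposition of `∏ⱼ (1 - t yⱼ z) / (1 - yⱼ z)`, cleared of denominators. -/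
theorem prod_one_sub_eq {N : ℕ} {y : Fin N → ℂ} (hy : Function.Injective y) (h0 : ∀ i, y i ≠ 0) (t : ℂ) :
    (∏ j, (1 - C (t * y j) * X) : ℂ[X]) = C (t ^ N) * ∏ j, (1 - C (y j) * X) +
      C (1 - t) * ∑ i, C (∏ j ∈ Finset.univ.erase i, (y i - t * y j) / (y i - y j)) *
        ∏ j ∈ Finset.univ.erase i, (1 - C (y j) * X) := by
  have key : (∏ j, (X - C (t * y j)) : ℂ[X]) = C (t ^ N) * ∏ j, (X - C (y j)) +
      C (1 - t) * ∑ i, C (∏ j ∈ Finset.univ.erase i, (y i - t * y j) / (y i - y j)) *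
        (X * ∏ j ∈ Finset.univ.erase i, (X - C (y j))) := by
    have hprod : ∀ (s : Finset (Fin N)) (f : Fin N → ℂ), (∏ j ∈ s, (X - C (f j)) : ℂ[X]).natDegree ≤ s.card := by
      intro s f
      refine (natDegree_prod_le _ _).trans ?_
      simp
    -- both sides have degree at most `N` and agree at the `N + 1` points `0, y₁, …, y_N`
    refine eq_of_degrees_lt_of_eval_index_eq (s := (Finset.univ : Finset (Option (Fin N))))
      (v := fun o => o.elim 0 y) ?_ ?_ ?_ ?_
    · rintro (_ | a) _ (_ | b) _ h
      · rfl
      · exact absurd h.symm (h0 b)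
      · exact absurd h (h0 a)
      · exact congrArg some (hy h)
    · refine (degree_le_natDegree.trans (Nat.cast_le.mpr (hprod _ _))).trans_lt ?_
      simp only [Finset.card_univ, Fintype.card_option, Fintype.card_fin]
      exact_mod_cast Nat.lt_succ_self N
    · refine lt_of_le_of_lt (degree_le_natDegree.trans (Nat.cast_le.mpr (?_ : _ ≤ N))) ?_
      · refine natDegree_add_le_of_degree_le ?_ ?_
        · exact (natDegree_C_mul_le _ _).trans ((hprod _ _).trans (by simp))
        · refine (natDegree_C_mul_le _ _).trans (natDegree_sum_le_of_forall_le _ _ fun i _ => ?_)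
          refine (natDegree_C_mul_le _ _).trans (natDegree_mul_le.trans ?_)
          have h1 := hprod (Finset.univ.erase i) y
          rw [Finset.card_erase_of_mem (Finset.mem_univ i), Finset.card_univ, Fintype.card_fin] at h1
          have h2 := i.pos
          have h3 : (X : ℂ[X]).natDegree ≤ 1 := natDegree_X_le
          omega
      · simp only [Finset.card_univ, Fintype.card_option, Fintype.card_fin]
        exact_mod_cast Nat.lt_succ_self N
    · rintro (_ | i) _
      · simp [eval_prod, eval_finsetSum, Finset.prod_neg, Finset.prod_mul_distrib]
        ring
      · simp only [Option.elim_some, eval_prod, eval_sub, eval_X, eval_C, eval_add, eval_mul, eval_finsetSum]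
        have hz : ∏ j, (y i - y j) = 0 := Finset.prod_eq_zero (Finset.mem_univ i) (sub_self (y i))
        rw [hz, mul_zero, zero_add, Finset.sum_eq_single i, ← Finset.mul_prod_erase Finset.univ _ (Finset.mem_univ i)]
        · rw [Finset.prod_div_distrib]
          have : ∏ j ∈ Finset.univ.erase i, (y i - y j) ≠ 0 := Finset.prod_ne_zero_iff.mpr fun j hj =>
            sub_ne_zero.mpr fun h => (Finset.ne_of_mem_erase hj) (hy h).symm
          field_simp
        · intro j _ hj
          have hz : ∏ k ∈ Finset.univ.erase j, (y i - y k) = 0 :=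
            Finset.prod_eq_zero (Finset.mem_erase.mpr ⟨hj.symm, Finset.mem_univ i⟩) (sub_self (y i))
          rw [hz]; ring
        · simp
  refine eq_of_infinite_eval_eq _ _ ((Set.finite_singleton (0 : ℂ)).infinite_compl.mono fun z hz => ?_)
  have hz : z ≠ 0 := hz
  have h := congrArg (fun p => z ^ N * eval z⁻¹ p) key
  simp only [eval_prod, eval_sub, eval_X, eval_C, eval_add, eval_mul, eval_finsetSum] at h
  have e1 : ∀ f : Fin N → ℂ, z ^ N * ∏ j, (z⁻¹ - f j) = ∏ j, (1 - f j * z) := by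
    intro f
    have : z ^ N = ∏ _j : Fin N, z := by simp
    rw [this, ← Finset.prod_mul_distrib]
    exact Finset.prod_congr rfl fun j _ => by field_simp
  have e2 : ∀ i, z ^ N * (z⁻¹ * ∏ j ∈ Finset.univ.erase i, (z⁻¹ - y j)) =
      ∏ j ∈ Finset.univ.erase i, (1 - y j * z) := by
    intro i
    have : z ^ N * z⁻¹ = ∏ _j ∈ Finset.univ.erase i, z := by
      rw [Finset.prod_const, Finset.card_erase_of_mem (Finset.mem_univ i), Finset.card_univ,
        Fintype.card_fin, pow_sub₀ z hz (show 1 ≤ N from i.pos), pow_one]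
    rw [← mul_assoc, this, ← Finset.prod_mul_distrib]
    exact Finset.prod_congr rfl fun j _ => by field_simp
  simp only [Set.mem_ofPred_eq, eval_prod, eval_sub, eval_X, eval_C, eval_add, eval_mul, eval_finsetSum, eval_one]
  rw [mul_add, e1, mul_left_comm, e1, mul_left_comm, Finset.mul_sum] at h
  rw [h]
  congr 2
  exact Finset.sum_congr rfl fun i _ => by rw [mul_left_comm, e2]

end partialFractions

section powerSeries
open PowerSeries

/-- The series `(1 - t a z) / (1 - a z)`. -/
def fracSeries (t a : ℂ) : ℂ⟦X⟧ := mk fun n => if n = 0 then 1 else (1 - t) * a ^ n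

theorem one_sub_mul_geom (a : ℂ) : (1 - C a * X) * (mk fun n => a ^ n : ℂ⟦X⟧) = 1 := by
  ext n
  rw [sub_mul, one_mul, mul_assoc, map_sub, coeff_C_mul, coeff_mk]
  cases n with
  | zero => simp
  | succ n => rw [coeff_succ_X_mul, coeff_mk, pow_succ', sub_self, coeff_one, if_neg n.succ_ne_zero]

theorem one_sub_mul_fracSeries (t a : ℂ) : (1 - C a * X) * fracSeries t a = 1 - C (t * a) * X := by
  ext n
  rw [sub_mul, one_mul, mul_assoc, map_sub, coeff_C_mul, fracSeries, coeff_mk, map_sub, coeff_C_mul]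
  rcases n with _ | _ | n
  · simp
  · rw [coeff_succ_X_mul, coeff_mk]; simp [coeff_one]; ring
  · rw [coeff_succ_X_mul, coeff_mk]; simp [coeff_one, coeff_X, pow_succ]; ring

theorem X_mul_deriv_fracSeries (t a : ℂ) : X * derivative ℂ (fracSeries t a) =
    fracSeries t a * (mk fun n => (1 - t ^ n) * a ^ n) := by
  have h1 := one_sub_mul_geom a
  have h2 := one_sub_mul_geom (t * a)
  have h3 := one_sub_mul_fracSeries t a
  have hψ : (mk fun n => (1 - t ^ n) * a ^ n : ℂ⟦X⟧) = (mk fun n => a ^ n) - mk fun n => (t * a) ^ n := by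
    ext n; simp [mul_pow]; ring
  have h4 := congrArg (derivative ℂ) h3
  simp only [Derivation.leibniz, map_sub, Derivation.map_one_eq_zero, derivative_C, derivative_X, smul_eq_mul,
    mul_zero, add_zero, mul_one, zero_sub] at h4
  rw [hψ]
  set g := (mk fun n => a ^ n : ℂ⟦X⟧)
  set k := (mk fun n => (t * a) ^ n : ℂ⟦X⟧)
  set φ := fracSeries t a
  set D := derivative ℂ φ
  have h5 : φ = (1 - C (t * a) * X) * g := by linear_combination g * h3 - φ * h1
  have h6 : φ * k = g := by linear_combination g * h2 + k * h5
  linear_combination X * g * h4 - X * D * h1 - φ * h1 + h6 - h5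

theorem X_mul_deriv_prod_fracSeries {ι : Type*} (s : Finset ι) (t : ℂ) (y : ι → ℂ) :
    X * derivative ℂ (∏ i ∈ s, fracSeries t (y i)) = (∏ i ∈ s, fracSeries t (y i)) *
      ∑ i ∈ s, (mk fun n => (1 - t ^ n) * y i ^ n) := by
  classical
  induction s using Finset.induction_on with
  | empty => simp
  | insert a s ha ih =>
    rw [Finset.prod_insert ha, Finset.sum_insert ha, Derivation.leibniz, smul_eq_mul, smul_eq_mul]
    linear_combination (fracSeries t (y a)) * ih +
      (∏ i ∈ s, fracSeries t (y i)) * X_mul_deriv_fracSeries t (y a)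

theorem coeff_prod_fracSeries {N : ℕ} (t : ℂ) (y : Fin N → ℂ) (n : ℕ) :
    coeff n (∏ i, fracSeries t (y i)) = newton (fun j => (1 - t ^ j) * powerSum j y) n := by
  refine eq_newton (h := fun n => coeff n (∏ i, fracSeries t (y i))) ?_ (fun n => ?_) n
  · simp only [coeff_zero_eq_constantCoeff, map_prod]
    refine Finset.prod_eq_one fun i _ => ?_
    rw [← coeff_zero_eq_constantCoeff, fracSeries, coeff_mk, if_pos rfl]
  · have h := congrArg (coeff (n + 1)) (X_mul_deriv_prod_fracSeries Finset.univ t y)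
    rw [coeff_succ_X_mul, coeff_derivative, mul_comm (∏ i, _), coeff_mul,
      Finset.Nat.sum_antidiagonal_eq_sum_range_succ_mk, Finset.sum_range_succ'] at h
    simp only [map_sum, coeff_mk, pow_zero, sub_self, zero_mul, Finset.sum_const_zero, add_zero] at h
    rw [mul_comm, h]
    refine Finset.sum_congr rfl fun j _ => ?_
    rw [powerSum_eq, Finset.mul_sum, Nat.add_sub_add_right]

/-- The symmetrised partial fraction coefficients are polynomials in the power sums. -/
theorem sum_lagrange_mul_pow {N : ℕ} {y : Fin N → ℂ} (hy : Function.Injective y) (h0 : ∀ i, y i ≠ 0)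
    (t : ℂ) (s : ℕ) :
    (1 - t) * ∑ i, (∏ j ∈ Finset.univ.erase i, (y i - t * y j) / (y i - y j)) * y i ^ s =
      newton (fun j => (1 - t ^ j) * powerSum j y) s - if s = 0 then t ^ N else 0 := by
  set A : Fin N → ℂ := fun i => ∏ j ∈ Finset.univ.erase i, (y i - t * y j) / (y i - y j)
  set D : ℂ⟦X⟧ := ∏ j, (1 - C (y j) * X)
  have hD : D * ∏ j, (mk fun n => y j ^ n : ℂ⟦X⟧) = 1 := by
    rw [← Finset.prod_mul_distrib]
    exact Finset.prod_eq_one fun j _ => one_sub_mul_geom (y j)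
  have h1 : D * ∏ i, fracSeries t (y i) = ∏ j, (1 - C (t * y j) * X) := by
    rw [← Finset.prod_mul_distrib]
    exact Finset.prod_congr rfl fun j _ => one_sub_mul_fracSeries t (y j)
  have h2 : D * (C (t ^ N) + C (1 - t) * ∑ i, C (A i) * (mk fun n => y i ^ n)) =
      ∏ j, (1 - C (t * y j) * X) := by
    have hE : ∀ i, D * (mk fun n => y i ^ n) = ∏ j ∈ Finset.univ.erase i, (1 - C (y j) * X) := fun i => by
      change (∏ j, (1 - C (y j) * X)) * _ = _
      rw [← Finset.mul_prod_erase Finset.univ _ (Finset.mem_univ i), mul_right_comm, one_sub_mul_geom, one_mul]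
    have h := congrArg Polynomial.coeToPowerSeries.ringHom (prod_one_sub_eq hy h0 t)
    have hX : Polynomial.coeToPowerSeries.ringHom (Polynomial.X : Polynomial ℂ) = X := Polynomial.coe_X
    have hC : ∀ a : ℂ, Polynomial.coeToPowerSeries.ringHom (Polynomial.C a) = C a := Polynomial.coe_C
    rw [mul_add, mul_left_comm D (C (1 - t)), Finset.mul_sum, mul_comm D]
    simp_rw [mul_left_comm D, hE]
    rw [map_prod, map_add, map_mul, map_mul, map_prod, map_sum, hC, hC] at h
    simp_rw [map_mul _ (Polynomial.C _) (Finset.prod _ _), hC, map_prod Polynomial.coeToPowerSeries.ringHom,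
      map_sub Polynomial.coeToPowerSeries.ringHom, map_one Polynomial.coeToPowerSeries.ringHom,
      map_mul Polynomial.coeToPowerSeries.ringHom, hX, hC] at h
    exact h.symm
  have h3 : ∏ i, fracSeries t (y i) = C (t ^ N) + C (1 - t) * ∑ i, C (A i) * (mk fun n => y i ^ n) := by
    have := h1.trans h2.symm
    set G := ∏ j, (mk fun n => y j ^ n : ℂ⟦X⟧)
    set P := ∏ i, fracSeries t (y i)
    set Q := C (t ^ N) + C (1 - t) * ∑ i, C (A i) * (mk fun n => y i ^ n)
    linear_combination G * this - (P - Q) * hD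
  rw [← coeff_prod_fracSeries, h3]
  simp only [map_add, coeff_C_mul, map_sum, coeff_mk, coeff_C]
  ring

end powerSeries

/-! ### The weight at `t = q^k` and its `q`-shifts -/

/-- The finite `q`-Pochhammer symbol `(z;q)_k`. -/
def qPochFin (k : ℕ) (q z : ℂ) : ℂ := ∏ s ∈ Finset.range k, (1 - z * q ^ s)

theorem qPochFin_shift (k : ℕ) (q z : ℂ) :
    qPochFin k q (q * z) * (1 - z) = qPochFin k q z * (1 - q ^ k * z) := by
  have h1 : qPochFin k q (q * z) = ∏ s ∈ Finset.range k, (1 - z * q ^ (s + 1)) :=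
    Finset.prod_congr rfl fun s _ => by ring
  have h2 := Finset.prod_range_succ (fun s => 1 - z * q ^ s) k
  rw [Finset.prod_range_succ'] at h2
  rw [h1]
  simpa [qPochFin, mul_comm z] using h2

theorem qPochFin_one {k : ℕ} (hk : 1 ≤ k) (q : ℂ) : qPochFin k q 1 = 0 :=
  Finset.prod_eq_zero (Finset.mem_range.mpr (show 0 < k from hk)) (by simp)

section weights
variable {N : ℕ}

/-- Macdonald's weight at `t = q^k`, a Laurent polynomial. -/
def polyWeight (q : ℂ) (k : ℕ) (x : Fin N → ℂ) : ℂ :=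
  ∏ ij ∈ (Finset.univ : Finset (Fin N)).offDiag, qPochFin k q (x ij.1 / x ij.2)

/-- The factors of `polyWeight` that do not involve `xᵢ`. -/
def restWeight (q : ℂ) (k : ℕ) (i : Fin N) (x : Fin N → ℂ) : ℂ :=
  ∏ ab ∈ (Finset.univ.erase i : Finset (Fin N)).offDiag, qPochFin k q (x ab.1 / x ab.2)

/-- The Laurent polynomial `polyWeight · ∏_{j ≠ i} (1 - q^k xᵢ / xⱼ) / (1 - xᵢ / xⱼ)`. -/
def shiftWeight (q : ℂ) (k : ℕ) (i : Fin N) (x : Fin N → ℂ) : ℂ :=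
  (∏ j ∈ Finset.univ.erase i, qPochFin k q (q * (x i / x j))) *
    (∏ j ∈ Finset.univ.erase i, qPochFin k q (x j / x i)) * restWeight q k i x

theorem polyWeight_split (q : ℂ) (k : ℕ) (i : Fin N) (x : Fin N → ℂ) :
    polyWeight q k x = (∏ j ∈ Finset.univ.erase i, qPochFin k q (x i / x j)) *
      (∏ j ∈ Finset.univ.erase i, qPochFin k q (x j / x i)) * restWeight q k i x := by
  have h : (Finset.univ : Finset (Fin N)) = insert i (Finset.univ.erase i) :=
    (Finset.insert_erase (Finset.mem_univ i)).symm
  rw [polyWeight]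
  conv_lhs => rw [h, Finset.offDiag_insert (Finset.notMem_erase i _)]
  rw [Finset.prod_union, Finset.prod_union, Finset.prod_product, Finset.prod_product]
  · simp [restWeight]; ring
  · rw [Finset.disjoint_left]
    rintro ⟨a, b⟩ h1 h2
    simp only [Finset.mem_offDiag, Finset.mem_product, Finset.mem_singleton] at h1 h2
    exact (Finset.ne_of_mem_erase h1.1) h2.1
  · rw [Finset.disjoint_left]
    rintro ⟨a, b⟩ h1 h2
    simp only [Finset.mem_union, Finset.mem_offDiag, Finset.mem_product, Finset.mem_singleton] at h1 h2
    rcases h1 with h1 | h1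
    · exact (Finset.ne_of_mem_erase h1.2.1) h2.2
    · exact (Finset.ne_of_mem_erase h2.1) h1.1

theorem polyWeight_inv (q : ℂ) (k : ℕ) (x : Fin N → ℂ) : polyWeight q k x⁻¹ = polyWeight q k x := by
  unfold polyWeight
  refine Finset.prod_nbij' Prod.swap Prod.swap ?_ ?_ (fun _ _ => rfl) (fun _ _ => rfl) ?_
  · rintro ⟨a, b⟩ h; simp only [Finset.mem_offDiag, Prod.swap] at h ⊢; exact ⟨h.2.1, h.1, h.2.2.symm⟩
  · rintro ⟨a, b⟩ h; simp only [Finset.mem_offDiag, Prod.swap] at h ⊢; exact ⟨h.2.1, h.1, h.2.2.symm⟩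
  · rintro ⟨a, b⟩ _; simp [div_eq_mul_inv, mul_comm]

theorem qPochFin_mem {F : (Fin N → ℂ) → ℂ} (hF : F ∈ laurentAlg N) (k : ℕ) (q : ℂ) :
    (fun x => qPochFin k q (F x)) ∈ laurentAlg N :=
  prod_mem_laurentAlg fun _ _ => sub_mem_laurentAlg (const_mem_laurentAlg 1)
    (mul_mem_laurentAlg hF (const_mem_laurentAlg _))

theorem polyWeight_mem (q : ℂ) (k : ℕ) : (polyWeight q k : (Fin N → ℂ) → ℂ) ∈ laurentAlg N :=
  prod_mem_laurentAlg fun _ _ => qPochFin_mem (div_mem_laurentAlg _ _) k q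

theorem shiftWeight_mem (q : ℂ) (k : ℕ) (i : Fin N) : (shiftWeight q k i : (Fin N → ℂ) → ℂ) ∈ laurentAlg N :=
  mul_mem_laurentAlg (mul_mem_laurentAlg
    (prod_mem_laurentAlg fun _ _ => qPochFin_mem (mul_mem_laurentAlg (const_mem_laurentAlg q) (div_mem_laurentAlg _ _)) k q)
    (prod_mem_laurentAlg fun _ _ => qPochFin_mem (div_mem_laurentAlg _ _) k q))
    (prod_mem_laurentAlg fun _ _ => qPochFin_mem (div_mem_laurentAlg _ _) k q)

theorem inv_mem_laurentAlg {F : (Fin N → ℂ) → ℂ} (hF : F ∈ laurentAlg N) :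
    (fun x => F x⁻¹) ∈ laurentAlg N := by
  refine laurentAlg_induction (p := fun F => (fun x => F x⁻¹) ∈ laurentAlg N) ?_ ?_ ?_ ?_ hF
  · intro a b
    refine prod_mem_laurentAlg fun i _ => mul_mem_laurentAlg (pow_mem_laurentAlg ?_ _) (pow_mem_laurentAlg ?_ _)
    · exact inv_coord_mem_laurentAlg i
    · simpa using coord_mem_laurentAlg i
  · exact const_mem_laurentAlg 0
  · intro F G _ _ h1 h2; exact add_mem_laurentAlg h1 h2
  · intro c F _ h1; exact Subalgebra.smul_mem _ h1 c

/-- The `q`-shift of `xᵢ` maps the mirror image of `shiftWeight` to `shiftWeight`. -/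
theorem shiftWeight_inv_update {q : ℂ} (hq : q ≠ 0) (k : ℕ) (i : Fin N) (x : Fin N → ℂ) :
    shiftWeight q k i (Function.update x i (q * x i))⁻¹ = shiftWeight q k i x := by
  have hne : ∀ j ∈ Finset.univ.erase i, (Function.update x i (q * x i))⁻¹ j = (x j)⁻¹ := fun j hj => by
    rw [Pi.inv_apply, Function.update_of_ne (Finset.ne_of_mem_erase hj)]
  have hi : (Function.update x i (q * x i))⁻¹ i = (q * x i)⁻¹ := by simp
  have hrest : restWeight q k i (Function.update x i (q * x i))⁻¹ = restWeight q k i x := by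
    unfold restWeight
    refine Finset.prod_nbij' Prod.swap Prod.swap ?_ ?_ (fun _ _ => rfl) (fun _ _ => rfl) ?_
    · rintro ⟨a, b⟩ h; simp only [Finset.mem_offDiag, Prod.swap] at h ⊢; exact ⟨h.2.1, h.1, h.2.2.symm⟩
    · rintro ⟨a, b⟩ h; simp only [Finset.mem_offDiag, Prod.swap] at h ⊢; exact ⟨h.2.1, h.1, h.2.2.symm⟩
    · rintro ⟨a, b⟩ h
      simp only [Finset.mem_offDiag] at h
      simp only [hne a h.1, hne b h.2.1, Prod.swap]
      rw [div_eq_mul_inv, inv_inv, mul_comm, ← div_eq_mul_inv]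
  unfold shiftWeight
  rw [hrest, mul_comm (∏ j ∈ Finset.univ.erase i, qPochFin k q (q * (x i / x j)))]
  congr 2
  · refine Finset.prod_congr rfl fun j hj => ?_
    rw [hne j hj, hi]
    congr 1
    rw [mul_inv, div_eq_mul_inv, inv_inv, div_eq_mul_inv]
    field_simp
  · refine Finset.prod_congr rfl fun j hj => ?_
    rw [hne j hj, hi]
    congr 1
    rw [mul_inv, div_eq_mul_inv, mul_inv, inv_inv, inv_inv, div_eq_mul_inv]
    ring

theorem shiftWeight_eq {q : ℂ} (k : ℕ) {x : Fin N → ℂ} (hx : Function.Injective x) (h0 : ∀ i, x i ≠ 0)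
    (i : Fin N) : shiftWeight q k i x = polyWeight q k x *
      ∏ j ∈ Finset.univ.erase i, (1 - q ^ k * (x i / x j)) / (1 - x i / x j) := by
  rw [polyWeight_split q k i, shiftWeight]
  have : ∏ j ∈ Finset.univ.erase i, qPochFin k q (q * (x i / x j)) =
      (∏ j ∈ Finset.univ.erase i, qPochFin k q (x i / x j)) *
      ∏ j ∈ Finset.univ.erase i, (1 - q ^ k * (x i / x j)) / (1 - x i / x j) := by
    rw [← Finset.prod_mul_distrib]
    refine Finset.prod_congr rfl fun j hj => ?_
    have h1 : 1 - x i / x j ≠ 0 := by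
      rw [sub_ne_zero, ne_comm, Ne, div_eq_one_iff_eq (h0 j)]
      exact fun h => (Finset.ne_of_mem_erase hj) (hx h).symm
    exact (eq_div_of_mul_eq h1 (qPochFin_shift k q _)).trans (mul_div_assoc _ _ _)
  rw [this]; ring

/-- On the diagonals all the weights vanish, so that no division by zero occurs below. -/
theorem weights_eq_zero {q : ℂ} {k : ℕ} (hk : 1 ≤ k) {x : Fin N → ℂ} (hx : ¬ Function.Injective x)
    (h0 : ∀ i, x i ≠ 0) : polyWeight q k x = 0 ∧ ∀ i, shiftWeight q k i x = 0 := by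
  obtain ⟨a, b, hab, hne⟩ := by simpa [Function.Injective] using hx
  have h1 : ∀ c d : Fin N, x c = x d → qPochFin k q (x c / x d) = 0 := fun c d h => by
    rw [h, div_self (h0 d), qPochFin_one hk]
  refine ⟨Finset.prod_eq_zero (i := (a, b)) (by simp [hne]) (h1 a b hab), fun i => ?_⟩
  unfold shiftWeight
  by_cases hia : i = a
  · subst hia
    have : ∏ j ∈ Finset.univ.erase i, qPochFin k q (x j / x i) = 0 :=
      Finset.prod_eq_zero (i := b) (by simp [Ne.symm hne]) (h1 b i hab.symm)
    rw [this]; ring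
  by_cases hib : i = b
  · subst hib
    have : ∏ j ∈ Finset.univ.erase i, qPochFin k q (x j / x i) = 0 :=
      Finset.prod_eq_zero (i := a) (by simp [hne]) (h1 a i hab)
    rw [this]; ring
  · have : restWeight q k i x = 0 :=
      Finset.prod_eq_zero (i := (a, b)) (by simp [hne, Ne.symm hia, Ne.symm hib]) (h1 a b hab)
    rw [this]; ring

/-- The symmetric function that results from `(1 - t) ∑ᵢ xᵢ^{a - s} ∏_{j ≠ i} (1 - t xᵢ/xⱼ)/(1 - xᵢ/xⱼ)`. -/
def loopFun (t : ℂ) (a s : ℕ) (x : Fin N → ℂ) : ℂ :=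
  if a < s then newton (fun j => (1 - t ^ j) * powerSum j x⁻¹) (s - a)
  else if a = s then 1 - t ^ N
  else -(t ^ (N - (a - s)) * newton (fun j => (t ^ j - 1) * powerSum j x) (a - s))

theorem sum_shiftWeight_neg {q : ℂ} {k : ℕ} (hk : 1 ≤ k) {x : Fin N → ℂ} (h0 : ∀ i, x i ≠ 0) (s : ℕ) :
    (1 - q ^ k) * ∑ i, shiftWeight q k i x * (x i)⁻¹ ^ s = polyWeight q k x *
      (newton (fun j => (1 - (q ^ k) ^ j) * powerSum j x⁻¹) s - if s = 0 then (q ^ k) ^ N else 0) := by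
  by_cases hx : Function.Injective x
  · have hinj : Function.Injective x⁻¹ := fun a b hab => hx (inv_injective hab)
    have h := sum_lagrange_mul_pow hinj (fun i => inv_ne_zero (h0 i)) (q ^ k) s
    rw [← h, mul_left_comm (polyWeight q k x)]
    congr 1
    rw [Finset.mul_sum]
    refine Finset.sum_congr rfl fun i _ => ?_
    rw [shiftWeight_eq k hx h0, mul_assoc]
    congr 2
    refine Finset.prod_congr rfl fun j hj => ?_
    have h1 := h0 i
    have h2 := h0 j
    have h3 : (x i)⁻¹ ≠ 0 := inv_ne_zero h1
    rw [Pi.inv_apply, Pi.inv_apply, ← mul_div_mul_left _ _ h3]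
    congr 1 <;> field_simp
  · simp [weights_eq_zero hk hx h0]

/-- For positive powers of `xᵢ` the partial fractions are taken at `t⁻¹` in place of `t = q^k`. This brings
in the factor `t^{N - e}`, which makes the term negligible for large `N`. -/
theorem sum_shiftWeight_pos {q : ℂ} (hq : q ≠ 0) {k : ℕ} (hk : 1 ≤ k) {x : Fin N → ℂ}
    (h0 : ∀ i, x i ≠ 0) {e : ℕ} (he : 1 ≤ e) (heN : e ≤ N) :
    (1 - q ^ k) * ∑ i, shiftWeight q k i x * x i ^ e = -(polyWeight q k x *
      ((q ^ k) ^ (N - e) * newton (fun j => ((q ^ k) ^ j - 1) * powerSum j x) e)) := by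
  by_cases hx : Function.Injective x
  · set t := q ^ k with ht
    have ht0 : t ≠ 0 := pow_ne_zero _ hq
    have h := sum_lagrange_mul_pow (y := x) hx h0 t⁻¹ e
    rw [if_neg (by omega), sub_zero] at h
    have hn : newton (fun j => (t ^ j - 1) * powerSum j x) e =
        t ^ e * newton (fun j => (1 - t⁻¹ ^ j) * powerSum j x) e := by
      rw [← newton_scale]
      congr 1; funext j
      rw [← mul_assoc, mul_sub, mul_one, ← mul_pow, mul_inv_cancel₀ ht0, one_pow]
    rw [hn, ← h]
    have hA : ∀ i, shiftWeight q k i x = polyWeight q k x * (t ^ (N - 1) *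
        ∏ j ∈ Finset.univ.erase i, (x i - t⁻¹ * x j) / (x i - x j)) := by
      intro i
      rw [shiftWeight_eq k hx h0]
      congr 1
      have : t ^ (N - 1) = ∏ _j ∈ Finset.univ.erase i, t := by
        rw [Finset.prod_const, Finset.card_erase_of_mem (Finset.mem_univ i), Finset.card_univ, Fintype.card_fin]
      rw [this, ← Finset.prod_mul_distrib]
      refine Finset.prod_congr rfl fun j hj => ?_
      have h1 := h0 i
      have h2 := h0 j
      have e1 : -x j * (1 - t * (x i / x j)) = t * (x i - t⁻¹ * x j) := by field_simp; ring
      have e2 : -x j * (1 - x i / x j) = x i - x j := by field_simp; ring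
      rw [← mul_div_mul_left _ _ (neg_ne_zero.mpr h2), e1, e2, mul_div_assoc]
    have hpow : t ^ (N - e) * t ^ e = t * t ^ (N - 1) := by
      rw [← pow_add, ← pow_succ']; congr 1; omega
    have h1t : (1 - t) = -(t * (1 - t⁻¹)) := by field_simp; ring
    simp_rw [hA]
    rw [h1t, Finset.mul_sum, Finset.mul_sum, Finset.mul_sum, Finset.mul_sum, Finset.mul_sum, ← Finset.sum_neg_distrib]
    refine Finset.sum_congr rfl fun i _ => ?_
    linear_combination (polyWeight q k x * (1 - t⁻¹) * (∏ j ∈ Finset.univ.erase i, (x i - t⁻¹ * x j) / (x i - x j)) * x i ^ e) * hpow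
  · simp [weights_eq_zero hk hx h0]

/-- After the `q`-shift the symmetrised function is again `polyWeight` times a polynomial in power sums. -/
theorem sum_shiftWeight {q : ℂ} (hq : q ≠ 0) {k : ℕ} (hk : 1 ≤ k) {x : Fin N → ℂ}
    (h0 : ∀ i, x i ≠ 0) {a s : ℕ} (haN : a ≤ N) :
    (1 - q ^ k) * ∑ i, shiftWeight q k i x * (x i ^ a * (x i)⁻¹ ^ s) =
      polyWeight q k x * loopFun (q ^ k) a s x := by
  unfold loopFun
  have hpow : ∀ (i : Fin N) (m : ℕ), x i ^ m * (x i)⁻¹ ^ m = 1 := fun i m => by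
    rw [← mul_pow, mul_inv_cancel₀ (h0 i), one_pow]
  split_ifs with h1 h2
  · have := sum_shiftWeight_neg (q := q) hk h0 (s - a)
    rw [if_neg (by omega), sub_zero] at this
    rw [← this]
    congr 1
    refine Finset.sum_congr rfl fun i _ => ?_
    congr 1
    conv_lhs => rw [show s = a + (s - a) by omega, pow_add, ← mul_assoc, hpow, one_mul]
  · subst h2
    have := sum_shiftWeight_neg (q := q) hk h0 0
    rw [if_pos rfl, newton_zero] at this
    simp_rw [hpow]
    simpa using this
  · rw [mul_neg, ← sum_shiftWeight_pos hq hk h0 (show 1 ≤ a - s by omega) (by omega)]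
    congr 1
    refine Finset.sum_congr rfl fun i _ => ?_
    congr 1
    conv_lhs => rw [show a = a - s + s by omega, pow_add, mul_assoc, hpow, mul_one]

end weights

/-! ### Loop equations at `t = q^k` -/

section hSum
variable {V W : Type*} [AddCommGroup V] [Module ℂ V] [AddCommGroup W] [Module ℂ W]

/-- The image of `newton (fun j => c j * p j) n`, a polynomial in indeterminates `p j`, under the
linear map that sends the monomial `∏_{j ∈ s} p j` to `X s`. -/
def hSum (c : ℕ → ℂ) : ℕ → (Multiset ℕ → V) → V
  | 0, X => X 0
  | n + 1, X => ((n : ℂ) + 1)⁻¹ • ∑ j : Fin (n + 1), c (j + 1) • hSum c (n - j) fun s => X ((j + 1 : ℕ) ::ₘ s)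

theorem hSum_zero (c : ℕ → ℂ) (X : Multiset ℕ → V) : hSum c 0 X = X 0 := by rw [hSum]

theorem hSum_succ (c : ℕ → ℂ) (n : ℕ) (X : Multiset ℕ → V) : hSum c (n + 1) X =
    ((n : ℂ) + 1)⁻¹ • ∑ j ∈ Finset.range (n + 1), c (j + 1) • hSum c (n - j) fun s => X ((j + 1) ::ₘ s) := by
  rw [hSum, ← Fin.sum_univ_eq_sum_range (fun j => c (j + 1) • hSum c (n - j) fun s => X ((j + 1) ::ₘ s))]

theorem map_hSum (L : V →ₗ[ℂ] W) (c : ℕ → ℂ) (n : ℕ) (X : Multiset ℕ → V) :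
    L (hSum c n X) = hSum c n fun s => L (X s) := by
  induction n using Nat.strong_induction_on generalizing X with
  | _ n ih =>
    cases n with
    | zero => simp only [hSum_zero]
    | succ n =>
      simp only [hSum_succ, map_smul, map_sum]
      congr 1
      refine Finset.sum_congr rfl fun j _ => ?_
      rw [ih (n - j) (by omega)]

theorem hSum_eq_newton (c y : ℕ → ℂ) (n : ℕ) :
    hSum c n (fun s => (s.map y).prod) = newton (fun j => c j * y j) n := by
  induction n using Nat.strong_induction_on with
  | _ n ih =>
    cases n with
    | zero => simp [hSum_zero, newton_zero]
    | succ n =>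
      have hn : ((n : ℂ) + 1) ≠ 0 := by exact_mod_cast n.succ_ne_zero
      rw [hSum_succ, smul_eq_mul, inv_mul_eq_iff_eq_mul₀ hn, newton_succ]
      refine Finset.sum_congr rfl fun j _ => ?_
      simp only [Multiset.map_cons, Multiset.prod_cons]
      have := map_hSum (LinearMap.mulLeft ℂ (y (j + 1))) c (n - j) (fun s => (s.map y).prod)
      simp only [LinearMap.mulLeft_apply] at this
      rw [← this, ih (n - j) (by omega), smul_eq_mul]
      ring

/-- A property of families of numbers that is stable under addition and under multiplication by the
coefficients passes to `hSum`; only monomials of the right degree occur. -/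
theorem hSum_induction {α : Type*} {P : (α → ℂ) → Prop} (h0 : P fun _ => 0)
    (hadd : ∀ f g, P f → P g → P fun a => f a + g a) (hconst : ∀ (z : ℂ) f, P f → P fun a => z * f a)
    {c : α → ℕ → ℂ} (hc : ∀ j f, P f → P fun a => c a j * f a) (n : ℕ) {X : α → Multiset ℕ → ℂ}
    (hX : ∀ s : Multiset ℕ, s.sum = n → (∀ a ∈ s, 0 < a) → P fun a => X a s) :
    P fun a => hSum (c a) n (X a) := by
  induction n using Nat.strong_induction_on generalizing X with
  | _ n ih =>
    cases n with
    | zero => simp only [hSum_zero]; exact hX 0 rfl (by simp)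
    | succ n =>
      simp only [hSum_succ, smul_eq_mul]
      refine hconst _ _ ?_
      have : ∀ J : Finset ℕ, J ⊆ Finset.range (n + 1) → P fun a =>
          ∑ j ∈ J, c a (j + 1) * hSum (c a) (n - j) fun s => X a ((j + 1) ::ₘ s) := by
        intro J
        induction J using Finset.induction_on with
        | empty => intro _; simpa using h0
        | insert j J hj ihJ =>
          intro hJ
          simp only [Finset.sum_insert hj]
          have hjn : j < n + 1 := Finset.mem_range.mp (hJ (Finset.mem_insert_self _ _))
          refine hadd _ _ (hc _ _ (ih (n - j) (by omega) fun s hs hp => hX _ ?_ ?_))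
            (ihJ fun i hi => hJ (Finset.mem_insert_of_mem hi))
          · rw [Multiset.sum_cons, hs]; omega
          · intro a ha
            rcases Multiset.mem_cons.mp ha with rfl | ha
            · omega
            · exact hp a ha
      exact this _ subset_rfl

end hSum

/-- `∏_{a ∈ s} (z^a - 1)`. -/
def shiftCoeff (z : ℂ) (s : Multiset ℕ) : ℂ := (s.map fun a => z ^ a - 1).prod

section loopTerm
variable {V W : Type*} [AddCommGroup V] [Module ℂ V] [AddCommGroup W] [Module ℂ W]

/-- The image of `loopFun t a s` times the monomial `p_σ p_{-τ}` under a linear map, of which `X`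
gives the values on the monomials. -/
def loopTerm (N : ℕ) (t : ℂ) (X : Multiset ℕ → Multiset ℕ → V) (a s : ℕ) (σ τ : Multiset ℕ) : V :=
  if a < s then hSum (fun j => 1 - t ^ j) (s - a) fun ν => X σ (ν + τ)
  else if a = s then (1 - t ^ N) • X σ τ
  else -(t ^ (N - (a - s)) • hSum (fun j => t ^ j - 1) (a - s) fun ν => X (ν + σ) τ)

/-- The right hand side of the loop equation, for a functional with values `X l r` on the monomials
`p_l(x) p_r(x⁻¹)`. Shifting `xᵢ` replaces `p_a(x)` by `p_a(x) + (q^a - 1) xᵢ^a`. The antidiagonals run over the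
ways to choose which factors of `p_λ(x) p_μ(x⁻¹)` are hit by the shift. -/
def loopRHS (N : ℕ) (q t : ℂ) (m : ℕ) (X : Multiset ℕ → Multiset ℕ → V) (lam mu : Multiset ℕ) : V :=
  q ^ m • (lam.antidiagonal.map fun p => (mu.antidiagonal.map fun r =>
    (shiftCoeff q p.2 * shiftCoeff q⁻¹ r.2) • loopTerm N t X (m + p.2.sum) r.2.sum p.1 r.1).sum).sum

theorem map_loopTerm (L : V →ₗ[ℂ] W) (N : ℕ) (t : ℂ) (X : Multiset ℕ → Multiset ℕ → V) (a s : ℕ)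
    (σ τ : Multiset ℕ) :
    L (loopTerm N t X a s σ τ) = loopTerm N t (fun l m => L (X l m)) a s σ τ := by
  unfold loopTerm
  split_ifs
  · rw [map_hSum]
  · rw [map_smul]
  · rw [map_neg, map_smul, map_hSum]

theorem map_loopRHS (L : V →ₗ[ℂ] W) (N : ℕ) (q t : ℂ) (m : ℕ) (X : Multiset ℕ → Multiset ℕ → V)
    (lam mu : Multiset ℕ) :
    L (loopRHS N q t m X lam mu) = loopRHS N q t m (fun l m => L (X l m)) lam mu := by
  unfold loopRHS
  simp only [map_smul, map_multiset_sum, Multiset.map_map, Function.comp_def, map_loopTerm]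

end loopTerm

section monomials
variable {N : ℕ}

/-- `p_s(x) = ∏_{a ∈ s} p_a(x)`. -/
def powerSumProd (s : Multiset ℕ) (x : Fin N → ℂ) : ℂ := (s.map fun a => powerSum a x).prod

theorem powerSumProd_zero (x : Fin N → ℂ) : powerSumProd 0 x = 1 := by simp [powerSumProd]

theorem powerSumProd_add (s r : Multiset ℕ) (x : Fin N → ℂ) :
    powerSumProd (s + r) x = powerSumProd s x * powerSumProd r x := by
  simp [powerSumProd]

theorem powerSumProd_cons (a : ℕ) (s : Multiset ℕ) (x : Fin N → ℂ) :
    powerSumProd (a ::ₘ s) x = powerSum a x * powerSumProd s x := by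
  simp [powerSumProd]

theorem powerSumProd_mem (s : Multiset ℕ) : (powerSumProd s : (Fin N → ℂ) → ℂ) ∈ laurentAlg N := by
  induction s using Multiset.induction_on with
  | empty =>
    rw [show (powerSumProd 0 : (Fin N → ℂ) → ℂ) = fun _ => 1 from funext powerSumProd_zero]
    exact const_mem_laurentAlg 1
  | cons a s ih =>
    have h : (powerSumProd (a ::ₘ s) : (Fin N → ℂ) → ℂ) = fun x => powerSum a x * powerSumProd s x :=
      funext fun x => powerSumProd_cons a s x
    rw [h]
    exact mul_mem_laurentAlg (powerSum_mem a) ih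

theorem powerSumProd_eq_eval (s : Multiset ℕ) (x : Fin N → ℂ) :
    powerSumProd s x = MvPolynomial.eval x (s.map (MvPolynomial.psum (Fin N) ℂ)).prod := by
  rw [map_multiset_prod, Multiset.map_map]; rfl

/-- The Laurent polynomial `p_λ(x) p_μ(x⁻¹)`. -/
def psMon (N : ℕ) (lam mu : Multiset ℕ) : laurentAlg N :=
  ⟨fun x => powerSumProd lam x * powerSumProd mu x⁻¹,
    mul_mem_laurentAlg (powerSumProd_mem lam) (inv_mem_laurentAlg (powerSumProd_mem mu))⟩

theorem psMon_apply (lam mu : Multiset ℕ) (x : Fin N → ℂ) :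
    (psMon N lam mu : (Fin N → ℂ) → ℂ) x = powerSumProd lam x * powerSumProd mu x⁻¹ := rfl

/-- Evaluation of Laurent polynomials at a point. -/
def laurentEval (x : Fin N → ℂ) : laurentAlg N →ₗ[ℂ] ℂ where
  toFun F := (F : (Fin N → ℂ) → ℂ) x
  map_add' _ _ := rfl
  map_smul' _ _ := rfl

theorem hSum_psMon_left (c : ℕ → ℂ) (n : ℕ) (σ τ : Multiset ℕ) (x : Fin N → ℂ) :
    hSum c n (fun s => laurentEval x (psMon N (s + σ) τ)) =
      newton (fun j => c j * powerSum j x) n * (powerSumProd σ x * powerSumProd τ x⁻¹) := by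
  have h := map_hSum (LinearMap.mulRight ℂ (powerSumProd σ x * powerSumProd τ x⁻¹)) c n
    (fun s => (s.map fun a => powerSum a x).prod)
  rw [hSum_eq_newton] at h
  simp only [LinearMap.mulRight_apply] at h
  rw [h]
  congr 1; funext s
  change powerSumProd (s + σ) x * powerSumProd τ x⁻¹ = powerSumProd s x * _
  rw [powerSumProd_add]; ring

theorem hSum_psMon_right (c : ℕ → ℂ) (n : ℕ) (σ τ : Multiset ℕ) (x : Fin N → ℂ) :
    hSum c n (fun s => laurentEval x (psMon N σ (s + τ))) =
      newton (fun j => c j * powerSum j x⁻¹) n * (powerSumProd σ x * powerSumProd τ x⁻¹) := by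
  have h := map_hSum (LinearMap.mulRight ℂ (powerSumProd σ x * powerSumProd τ x⁻¹)) c n
    (fun s => (s.map fun a => powerSum a x⁻¹).prod)
  rw [hSum_eq_newton] at h
  simp only [LinearMap.mulRight_apply] at h
  rw [h]
  congr 1; funext s
  change powerSumProd σ x * powerSumProd (s + τ) x⁻¹ = powerSumProd s x⁻¹ * _
  rw [powerSumProd_add]; ring

theorem laurentEval_loopTerm (t : ℂ) (a s : ℕ) (σ τ : Multiset ℕ) (x : Fin N → ℂ) :
    loopTerm N t (fun l m => laurentEval x (psMon N l m)) a s σ τ =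
      loopFun t a s x * (powerSumProd σ x * powerSumProd τ x⁻¹) := by
  unfold loopTerm loopFun
  split_ifs
  · rw [hSum_psMon_right]
  · rfl
  · rw [hSum_psMon_left, smul_eq_mul]; ring

theorem powerSum_update (q : ℂ) (i : Fin N) (a : ℕ) (x : Fin N → ℂ) :
    powerSum a (Function.update x i (q * x i)) = powerSum a x + (q ^ a - 1) * x i ^ a := by
  rw [powerSum_eq, powerSum_eq, ← Finset.add_sum_erase _ _ (Finset.mem_univ i),
    ← Finset.add_sum_erase _ (fun j => x j ^ a) (Finset.mem_univ i)]
  have : ∑ j ∈ Finset.univ.erase i, Function.update x i (q * x i) j ^ a =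
      ∑ j ∈ Finset.univ.erase i, x j ^ a :=
    Finset.sum_congr rfl fun j hj => by rw [Function.update_of_ne (Finset.ne_of_mem_erase hj)]
  rw [this, Function.update_self, mul_pow]; ring

theorem update_inv (q : ℂ) (i : Fin N) (x : Fin N → ℂ) :
    (Function.update x i (q * x i))⁻¹ = Function.update x⁻¹ i (q⁻¹ * x⁻¹ i) := by
  funext j
  by_cases h : j = i
  · subst h; simp [mul_comm]
  · simp [h]

theorem powerSumProd_update (q : ℂ) (i : Fin N) (s : Multiset ℕ) (x : Fin N → ℂ) :
    powerSumProd s (Function.update x i (q * x i)) =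
      (s.antidiagonal.map fun p => shiftCoeff q p.2 * x i ^ p.2.sum * powerSumProd p.1 x).sum := by
  unfold powerSumProd
  simp only [powerSum_update]
  rw [Multiset.prod_map_add]
  congr 1
  refine Multiset.map_congr rfl fun p _ => ?_
  rw [Multiset.prod_map_mul, shiftCoeff, mul_comm]
  congr 2
  induction p.2 using Multiset.induction_on with
  | empty => simp
  | cons a s ih => simp [ih, pow_add]

end monomials

/-- Integration over the torus against a continuous weight, as a linear map on Laurent polynomials. -/
def weightedMean {N : ℕ} (w : (Fin N → ℂ) → ℂ) (hw : TorusCont w) : laurentAlg N →ₗ[ℂ] ℂ where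
  toFun F := torusMean fun x => w x * (F : (Fin N → ℂ) → ℂ) x
  map_add' F G := by
    rw [← torusMean_add (hw.mul (torusCont_of_mem F.2)) (hw.mul (torusCont_of_mem G.2))]
    exact torusMean_congr fun θ => mul_add _ _ _
  map_smul' c F := by
    rw [RingHom.id_apply, smul_eq_mul, ← torusMean_const_mul]
    exact torusMean_congr fun θ => mul_left_comm _ _ _

theorem sum_map_finsetSum {ι β : Type*} (I : Finset ι) (s : Multiset β) (f : ι → β → ℂ) :
    (s.map fun b => ∑ i ∈ I, f i b).sum = ∑ i ∈ I, (s.map (f i)).sum := by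
  induction s using Multiset.induction_on with
  | empty => simp
  | cons a s ih => simp [ih, Finset.sum_add_distrib]

/-- The loop equation. The integral of a Laurent polynomial `Gᵢ` is invariant under the `q`-shift of `xᵢ`.
For `Gᵢ(x) = xᵢ^m p_λ(x) p_μ(x⁻¹)` times the mirror image of `shiftWeight`, the sum over `i` is expressed through
power sums both before the shift and after it. -/
theorem loop_polyWeight {N : ℕ} {q : ℂ} (hq : q ≠ 0) {k : ℕ} (hk : 1 ≤ k) {m : ℕ} (hm : 1 ≤ m)
    (lam mu : Multiset ℕ) (hN : m + lam.sum ≤ N) :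
    hSum (fun j => 1 - (q ^ k) ^ j) m (fun s => torusMean fun x : Fin N → ℂ => polyWeight q k x *
      (psMon N (s + lam) mu : (Fin N → ℂ) → ℂ) x) =
    loopRHS N q (q ^ k) m (fun l r => torusMean fun x : Fin N → ℂ => polyWeight q k x *
      (psMon N l r : (Fin N → ℂ) → ℂ) x) lam mu := by
  set t := q ^ k with ht
  set L := weightedMean (polyWeight q k) (torusCont_of_mem (polyWeight_mem (N := N) q k)) with hL
  change hSum _ m (fun s => L (psMon N (s + lam) mu)) = loopRHS N q t m (fun l r => L (psMon N l r)) lam mu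
  rw [← map_hSum, ← map_loopRHS]
  -- the sum over `i` of the functions to be shifted, `xᵢ ↦ q xᵢ` in the `i`-th one
  set G : Fin N → (Fin N → ℂ) → ℂ := fun i x =>
    (1 - t) * (shiftWeight q k i x⁻¹ * x i ^ m * (powerSumProd lam x * powerSumProd mu x⁻¹)) with hG
  have hGm : ∀ i, G i ∈ laurentAlg N := fun i =>
    mul_mem_laurentAlg (const_mem_laurentAlg _) (mul_mem_laurentAlg (mul_mem_laurentAlg
      (inv_mem_laurentAlg (shiftWeight_mem q k i)) (pow_mem_laurentAlg (coord_mem_laurentAlg i) m))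
      (psMon N lam mu).2)
  have h1 : L (hSum (fun j => 1 - t ^ j) m fun s => psMon N (s + lam) mu) = ∑ i, torusMean (G i) := by
    rw [← torusMean_sum fun i _ => torusCont_of_mem (hGm i)]
    refine torusMean_congr fun θ => ?_
    set x := torusPt θ
    have hx := torusPt_ne_zero θ
    have e1 := map_hSum (laurentEval x) (fun j => 1 - t ^ j) m fun s => psMon N (s + lam) mu
    change polyWeight q k x * laurentEval x _ = _
    rw [e1, hSum_psMon_left, ← mul_assoc]
    have e2 := sum_shiftWeight_neg (q := q) hk (x := x⁻¹) (fun i => inv_ne_zero (hx i)) m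
    rw [if_neg (by omega), sub_zero, polyWeight_inv, inv_inv] at e2
    rw [← e2, Finset.mul_sum, Finset.sum_mul]
    refine Finset.sum_congr rfl fun i _ => ?_
    simp only [hG, Pi.inv_apply, inv_inv]
    ring
  have h2 : L (loopRHS N q t m (fun l r => psMon N l r) lam mu) =
      ∑ i, torusMean (fun x => G i (Function.update x i (q * x i))) := by
    rw [← torusMean_sum fun i _ => torusCont_of_mem (torusMean_scale (hGm i) i hq).1]
    refine torusMean_congr fun θ => ?_
    set x := torusPt θ
    have hx := torusPt_ne_zero θ
    change polyWeight q k x * laurentEval x (loopRHS N q t m (fun l r => psMon N l r) lam mu) = _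
    rw [map_loopRHS]
    unfold loopRHS
    simp only [laurentEval_loopTerm, hG, shiftWeight_inv_update hq]
    simp only [update_inv, powerSumProd_update]
    simp only [smul_eq_mul, Function.update_self]
    have hS : ∀ p r : Multiset ℕ × Multiset ℕ, p ∈ lam.antidiagonal →
        polyWeight q k x * loopFun t (m + p.2.sum) r.2.sum x =
        (1 - t) * ∑ i, shiftWeight q k i x * (x i ^ (m + p.2.sum) * (x i)⁻¹ ^ r.2.sum) := by
      intro p r hp
      refine (sum_shiftWeight hq hk hx ?_).symm
      have : p.1.sum + p.2.sum = lam.sum := by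
        rw [← Multiset.sum_add, Multiset.mem_antidiagonal.mp hp]
      omega
    set T : Fin N → Multiset ℕ × Multiset ℕ → Multiset ℕ × Multiset ℕ → ℂ := fun i p r =>
      (1 - t) * (shiftWeight q k i x * (q * x i) ^ m * ((shiftCoeff q p.2 * x i ^ p.2.sum * powerSumProd p.1 x) *
        (shiftCoeff q⁻¹ r.2 * x⁻¹ i ^ r.2.sum * powerSumProd r.1 x⁻¹))) with hT
    have hR : ∀ i, (1 - t) * (shiftWeight q k i x * (q * x i) ^ m *
        ((lam.antidiagonal.map fun p => shiftCoeff q p.2 * x i ^ p.2.sum * powerSumProd p.1 x).sum *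
        (mu.antidiagonal.map fun p => shiftCoeff q⁻¹ p.2 * x⁻¹ i ^ p.2.sum * powerSumProd p.1 x⁻¹).sum)) =
        (lam.antidiagonal.map fun p => (mu.antidiagonal.map fun r => T i p r).sum).sum := by
      intro i
      simp only [hT, Multiset.sum_map_mul_left, Multiset.sum_map_mul_right]
    simp only [hR]
    rw [← sum_map_finsetSum, ← Multiset.sum_map_mul_left, ← Multiset.sum_map_mul_left]
    congr 1
    refine Multiset.map_congr rfl fun p hp => ?_
    rw [← sum_map_finsetSum, ← Multiset.sum_map_mul_left, ← Multiset.sum_map_mul_left]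
    congr 1
    refine Multiset.map_congr rfl fun r _ => ?_
    have h := hS p r hp
    have h' : polyWeight q k x * (q ^ m * (shiftCoeff q p.2 * shiftCoeff q⁻¹ r.2 *
        (loopFun t (m + p.2.sum) r.2.sum x * (powerSumProd p.1 x * powerSumProd r.1 x⁻¹)))) =
        (polyWeight q k x * loopFun t (m + p.2.sum) r.2.sum x) * (q ^ m * (shiftCoeff q p.2 * shiftCoeff q⁻¹ r.2 *
          (powerSumProd p.1 x * powerSumProd r.1 x⁻¹))) := by ring
    rw [h', h, Finset.mul_sum, Finset.sum_mul]
    refine Finset.sum_congr rfl fun i _ => ?_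
    simp only [hT, Pi.inv_apply]
    ring
  rw [h1, h2]
  exact Finset.sum_congr rfl fun i _ => ((torusMean_scale (hGm i) i hq).2).symm

/-! ### The norm of `1` at `t = q^k` -/

/-- Lagrange interpolation in several variables: the coefficient of `∏ᵢ Xᵢ^d` of a polynomial of total
degree at most `N d` in terms of its values on a grid. -/
theorem coeff_eq_sum_grid {N : ℕ} (d : ℕ) {v : ℕ → ℂ} (hv : Set.InjOn v (Finset.range (d + 1)))
    (F : MvPolynomial (Fin N) ℂ) (hF : F.totalDegree ≤ N * d) :
    F.coeff (Finsupp.equivFunOnFinite.symm fun _ => d) =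
      ∑ c ∈ Fintype.piFinset fun _ : Fin N => Finset.range (d + 1), F.eval (fun i => v (c i)) *
        ∏ i, (∏ e ∈ (Finset.range (d + 1)).erase (c i), (v (c i) - v e))⁻¹ := by
  have huni : ∀ a ≤ d, ∑ e ∈ Finset.range (d + 1), v e ^ a *
      (∏ e' ∈ (Finset.range (d + 1)).erase e, (v e - v e'))⁻¹ = if a = d then 1 else 0 := by
    intro a ha
    have h := Lagrange.coeff_eq_sum hv (P := (Polynomial.X ^ a : Polynomial ℂ)) (by
      rw [Polynomial.degree_X_pow, Finset.card_range]; exact_mod_cast Nat.lt_succ_of_le ha)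
    simp only [Finset.card_range, Nat.add_sub_cancel, Polynomial.coeff_X_pow, Polynomial.eval_pow,
      Polynomial.eval_X, div_eq_mul_inv] at h
    rw [← h]
    simp [eq_comm]
  have hsum : ∀ a : Fin N →₀ ℕ, a ∈ F.support →
      ∑ c ∈ Fintype.piFinset fun _ : Fin N => Finset.range (d + 1), (∏ i, v (c i) ^ a i) *
        ∏ i, (∏ e ∈ (Finset.range (d + 1)).erase (c i), (v (c i) - v e))⁻¹ =
      if a = Finsupp.equivFunOnFinite.symm fun _ => d then 1 else 0 := by
    intro a ha
    have hdeg : ∑ i, a i ≤ N * d := by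
      refine le_trans (le_of_eq ?_) ((MvPolynomial.le_totalDegree ha).trans hF)
      rw [Finsupp.sum_fintype]; simp
    simp_rw [← Finset.prod_mul_distrib]
    rw [← Finset.prod_univ_sum (fun _ : Fin N => Finset.range (d + 1)) (fun i e => v e ^ a i *
      (∏ e' ∈ (Finset.range (d + 1)).erase e, (v e - v e'))⁻¹)]
    split_ifs with h
    · subst h
      refine Finset.prod_eq_one fun i _ => ?_
      have := huni d le_rfl
      rw [if_pos rfl] at this
      exact this
    · have : ∃ i, a i < d := by
        by_contra hcon
        push Not at hcon
        refine h (Finsupp.ext fun i => ?_)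
        have h1 : ∑ i : Fin N, d ≤ ∑ i, a i := Finset.sum_le_sum fun i _ => hcon i
        have h2 : ∑ i : Fin N, d = N * d := by simp
        have h3 := (Finset.sum_eq_sum_iff_of_le fun i _ => hcon i).mp (le_antisymm h1 (by omega))
        exact (h3 i (Finset.mem_univ i)).symm
      obtain ⟨i, hi⟩ := this
      exact Finset.prod_eq_zero (Finset.mem_univ i) (by rw [huni _ hi.le, if_neg hi.ne])
  simp_rw [MvPolynomial.eval_eq', Finset.sum_mul, mul_assoc]
  rw [Finset.sum_comm]
  simp_rw [← Finset.mul_sum]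
  rw [Finset.sum_congr rfl fun a ha => by rw [hsum a ha]]
  simp

/-- Exponents that are pairwise far apart, in a range that is as short as possible. This singles out the
only point of the grid of powers of `q` at which the polynomial `dysonPoly` below does not vanish. -/
theorem eq_mul_of_separated {k : ℕ} (hk : 1 ≤ k) (n : ℕ) (α : Fin (n + 1) → ℕ) (hb : ∀ i, α i ≤ k * n)
    (h : ∀ i j, i < j → α i + k ≤ α j ∨ α j + k + 1 ≤ α i) (i : Fin (n + 1)) : α i = k * i := by
  induction n with
  | zero =>
    have := hb i
    have hi : (i : ℕ) = 0 := by omega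
    rw [hi]
    simpa using this
  | succ n ih =>
    obtain ⟨M, hM⟩ := Finite.exists_max α
    have hsep : ∀ j, j ≠ M → α j + k ≤ α M := by
      intro j hj
      have := hM j
      rcases lt_or_gt_of_ne hj with h1 | h1
      · rcases h _ _ h1 with h2 | h2 <;> omega
      · rcases h _ _ h1 with h2 | h2 <;> omega
    have hbM := hb M
    rw [mul_add, mul_one] at hbM
    have ih' := ih (fun j => α (M.succAbove j)) (fun j => by
      have := hsep _ (Fin.succAbove_ne M j)
      omega) (fun a b hab => h _ _ (Fin.strictMono_succAbove M hab))
    have hlast : M = Fin.last (n + 1) := by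
      by_contra hne
      have h1 := ih' (Fin.last n)
      have h2 : M.succAbove (Fin.last n) = Fin.last (n + 1) := Fin.succAbove_ne_last_last hne
      rw [h2, Fin.val_last] at h1
      have h3 := hM (Fin.last (n + 1))
      rcases h M (Fin.last (n + 1)) (Fin.lt_last_iff_ne_last.mpr hne) with h4 | h4 <;> omega
    subst hlast
    refine Fin.lastCases ?_ (fun j => ?_) i
    · have h1 := ih' (Fin.last n)
      have h2 := hsep ((Fin.last (n + 1)).succAbove (Fin.last n)) (Fin.succAbove_ne _ _)
      simp only [Fin.val_last] at h1 ⊢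
      rw [mul_add, mul_one]
      omega
    · have h1 := ih' j
      simpa using h1

section symmetrization

theorem prod_swap_succ {n : ℕ} (p : Fin (n + 1)) (f : Fin (n + 1) → ℂ) :
    ∏ j : Fin n, f (Equiv.swap 0 p j.succ) = ∏ j ∈ Finset.univ.erase p, f j := by
  refine Finset.prod_nbij (fun j => Equiv.swap 0 p j.succ) ?_ ?_ ?_ (fun _ _ => rfl)
  · intro j _
    simp only [Finset.mem_erase, Finset.mem_univ, and_true]
    intro h
    exact Fin.succ_ne_zero j ((Equiv.swap 0 p).injective (h.trans (Equiv.swap_apply_left 0 p).symm))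
  · intro a _ b _ hab
    exact Fin.succ_injective _ ((Equiv.swap 0 p).injective hab)
  · intro b hb
    have hbp : b ≠ p := by simpa using hb
    have h0 : Equiv.swap 0 p b ≠ 0 := fun h => hbp
      ((Equiv.swap 0 p).injective (h.trans (Equiv.swap_apply_right 0 p).symm))
    obtain ⟨j, hj⟩ := Fin.exists_succ_eq.mpr h0
    exact ⟨j, by simp, by simp only [hj, Equiv.swap_apply_self]⟩

/-- The symmetrization of `∏_{i < j} (xᵢ - t xⱼ)/(xᵢ - xⱼ)` is constant. -/
theorem sum_perm_prod {t : ℂ} (ht : t ≠ 1) (n : ℕ) {x : Fin n → ℂ} (hx : Function.Injective x)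
    (h0 : ∀ i, x i ≠ 0) :
    ∑ σ : Equiv.Perm (Fin n), ∏ i, ∏ j ∈ Finset.Ioi i, (x (σ i) - t * x (σ j)) / (x (σ i) - x (σ j)) =
      ∏ m ∈ Finset.range n, (1 - t ^ (m + 1)) / (1 - t) := by
  induction n with
  | zero => simp
  | succ n ih =>
    rw [← Equiv.Perm.decomposeFin.symm.sum_comp, Fintype.sum_prod_type, Finset.prod_range_succ, mul_comm]
    have h1t : 1 - t ≠ 0 := sub_ne_zero.mpr ht.symm
    have hl := sum_lagrange_mul_pow hx h0 t 0
    simp only [newton_zero, if_true, pow_zero, mul_one] at hl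
    rw [div_mul_eq_mul_div, eq_div_iff h1t, ← hl, mul_comm, Finset.mul_sum, mul_assoc, Finset.sum_mul, Finset.mul_sum]
    refine Finset.sum_congr rfl fun p _ => ?_
    congr 1
    set y : Fin n → ℂ := fun j => x (Equiv.swap 0 p j.succ) with hy
    have hyi : Function.Injective y := fun a b hab =>
      Fin.succ_injective _ ((Equiv.swap 0 p).injective (hx hab))
    rw [← ih hyi fun i => h0 _, Finset.mul_sum]
    refine Finset.sum_congr rfl fun e _ => ?_
    rw [Fin.prod_univ_succ, Fin.prod_Ioi_zero]
    simp only [Fin.prod_Ioi_succ, Equiv.Perm.decomposeFin_symm_apply_zero, Equiv.Perm.decomposeFin_symm_apply_succ]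
    congr 1
    rw [← prod_swap_succ p (fun j => (x p - t * x j) / (x p - x j))]
    exact Equiv.prod_comp e fun j : Fin n => (x p - t * x (Equiv.swap 0 p j.succ)) / (x p - x (Equiv.swap 0 p j.succ))

end symmetrization

section dyson
variable {N : ℕ}

theorem prod_range_prod_range (k n : ℕ) (g : ℕ → ℂ) :
    ∏ i ∈ Finset.range n, ∏ s ∈ Finset.range k, g (k * i + s) = ∏ e ∈ Finset.range (k * n), g e := by
  induction n with
  | zero => simp
  | succ n ih => rw [Finset.prod_range_succ, ih, mul_add, mul_one, Finset.prod_range_add]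

theorem prod_Iio_eq_range (j : Fin N) (f : ℕ → ℂ) :
    ∏ i ∈ Finset.Iio j, f i = ∏ i ∈ Finset.range j, f i := by
  rw [← Nat.Iio_eq_range, ← Fin.map_valEmbedding_Iio, Finset.prod_map]; rfl

theorem prod_Ioi_eq_range (i : Fin N) (f : ℕ → ℂ) :
    ∏ j ∈ Finset.Ioi i, f j = ∏ j ∈ Finset.range (N - 1 - i), f (i + 1 + j) := by
  have h : (Finset.range (N - 1 - i)).map (addLeftEmbedding (i + 1 : ℕ)) = Finset.Ioo (i : ℕ) N := by
    ext a
    simp only [Finset.mem_map, Finset.mem_range, addLeftEmbedding_apply, Finset.mem_Ioo]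
    exact ⟨fun ⟨b, hb, hab⟩ => by omega, fun h => ⟨a - (i + 1), by omega, by omega⟩⟩
  have h2 : ∏ j ∈ Finset.Ioi i, f j = ∏ j ∈ (Finset.Ioi i).map Fin.valEmbedding, f j := by
    rw [Finset.prod_map]; rfl
  rw [h2, Fin.map_valEmbedding_Ioi, ← h, Finset.prod_map]; rfl

/-- The `q`-Dyson product with all parameters equal to `k`. -/
def dysonProd (q : ℂ) (k : ℕ) (x : Fin N → ℂ) : ℂ :=
  ∏ i, ∏ j ∈ Finset.Ioi i, (qPochFin k q (x i / x j) * qPochFin k q (q * (x j / x i)))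

/-- The `q`-Dyson product without its denominator, as a polynomial. -/
def dysonPoly (N : ℕ) (q : ℂ) (k : ℕ) : MvPolynomial (Fin N) ℂ :=
  ∏ i, ∏ j ∈ Finset.Ioi i, ((∏ s ∈ Finset.range k, (MvPolynomial.X j - MvPolynomial.C (q ^ s) * MvPolynomial.X i)) *
    ∏ s ∈ Finset.range k, (MvPolynomial.X i - MvPolynomial.C (q ^ (s + 1)) * MvPolynomial.X j))

theorem sum_card_Ioi : ∑ i : Fin N, (Finset.Ioi i).card * 2 = N * (N - 1) := by
  simp only [Fin.card_Ioi]
  rw [← Finset.sum_mul, Fin.sum_univ_eq_sum_range (fun i => N - 1 - i) N, Finset.sum_range_reflect (fun i => i),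
    Finset.sum_range_id_mul_two]

theorem totalDegree_dysonPoly_le (q : ℂ) (k : ℕ) : (dysonPoly N q k).totalDegree ≤ N * (k * (N - 1)) := by
  have h1 : ∀ (i j : Fin N) (c : ℂ),
      (MvPolynomial.X i - MvPolynomial.C c * MvPolynomial.X j : MvPolynomial (Fin N) ℂ).totalDegree ≤ 1 := by
    intro i j c
    refine (MvPolynomial.totalDegree_sub _ _).trans (max_le (by simp) ?_)
    refine (MvPolynomial.totalDegree_mul _ _).trans (by simp)
  have h2 : ∀ (i j : Fin N) (c : ℕ → ℂ), (∏ s ∈ Finset.range k,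
      (MvPolynomial.X i - MvPolynomial.C (c s) * MvPolynomial.X j) : MvPolynomial (Fin N) ℂ).totalDegree ≤ k := by
    intro i j c
    refine (MvPolynomial.totalDegree_finsetProd _ _).trans ?_
    refine (Finset.sum_le_sum fun s _ => h1 i j (c s)).trans (by simp)
  refine (MvPolynomial.totalDegree_finsetProd _ _).trans ?_
  refine (Finset.sum_le_sum fun i _ => (MvPolynomial.totalDegree_finsetProd _ _).trans
    (Finset.sum_le_sum fun j _ => (MvPolynomial.totalDegree_mul _ _).trans
      (add_le_add (h2 j i fun s => q ^ s) (h2 i j fun s => q ^ (s + 1))))).trans (le_of_eq ?_)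
  simp only [Finset.sum_const, smul_eq_mul]
  have := sum_card_Ioi (N := N)
  calc ∑ i : Fin N, (Finset.Ioi i).card * (k + k) = k * ∑ i : Fin N, (Finset.Ioi i).card * 2 := by
        rw [Finset.mul_sum]; exact Finset.sum_congr rfl fun i _ => by ring
    _ = N * (k * (N - 1)) := by rw [this]; ring

theorem prod_Ioi_swap (f : Fin N → Fin N → ℂ) :
    ∏ i, ∏ j ∈ Finset.Ioi i, f i j = ∏ j, ∏ i ∈ Finset.Iio j, f i j :=
  Finset.prod_comm' fun i j => by simp

theorem eval_dysonPoly (q : ℂ) (k : ℕ) (x : Fin N → ℂ) : (dysonPoly N q k).eval x =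
    ∏ i, ((∏ j ∈ Finset.Iio i, ∏ s ∈ Finset.range k, (x i - q ^ s * x j)) *
      ∏ j ∈ Finset.Ioi i, ∏ s ∈ Finset.range k, (x i - q ^ (s + 1) * x j)) := by
  simp only [dysonPoly, map_prod, map_mul, map_sub, MvPolynomial.eval_X, MvPolynomial.eval_C,
    Finset.prod_mul_distrib]
  rw [prod_Ioi_swap]

theorem dysonProd_eq (q : ℂ) (k : ℕ) {x : Fin N → ℂ} (h0 : ∀ i, x i ≠ 0) :
    dysonProd q k x = (dysonPoly N q k).eval x *
      (MvPolynomial.monomial (Finsupp.equivFunOnFinite.symm fun _ => k * (N - 1)) (1 : ℂ)).eval x⁻¹ := by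
  have h1 : (MvPolynomial.monomial (Finsupp.equivFunOnFinite.symm fun _ : Fin N => k * (N - 1)) (1 : ℂ)).eval x⁻¹ =
      ∏ i, ∏ j ∈ Finset.Ioi i, ((x j)⁻¹ ^ k * (x i)⁻¹ ^ k) := by
    rw [MvPolynomial.eval_monomial, one_mul, Finsupp.prod_fintype _ _ fun i => pow_zero _]
    simp only [Finset.prod_mul_distrib]
    rw [prod_Ioi_swap, ← Finset.prod_mul_distrib]
    refine Finset.prod_congr rfl fun i _ => ?_
    rw [Finset.prod_const, Finset.prod_const, ← pow_mul, ← pow_mul, ← pow_add, ← mul_add, Fin.card_Iio, Fin.card_Ioi]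
    change (x i)⁻¹ ^ (k * (N - 1)) = _
    congr 2
    omega
  rw [h1]
  simp only [dysonProd, dysonPoly, map_prod, map_mul, map_sub, MvPolynomial.eval_X, MvPolynomial.eval_C,
    ← Finset.prod_mul_distrib]
  refine Finset.prod_congr rfl fun i _ => Finset.prod_congr rfl fun j _ => ?_
  have hi := h0 i
  have hj := h0 j
  have e1 : (x j)⁻¹ ^ k = ∏ s ∈ Finset.range k, (x j)⁻¹ := by simp
  have e2 : (x i)⁻¹ ^ k = ∏ s ∈ Finset.range k, (x i)⁻¹ := by simp
  rw [e1, e2, qPochFin, qPochFin, ← Finset.prod_mul_distrib, ← Finset.prod_mul_distrib, ← Finset.prod_mul_distrib]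
  refine Finset.prod_congr rfl fun s _ => ?_
  field_simp
  ring

/-- The constant term of the `q`-Dyson product. -/
theorem torusMean_dysonProd {q : ℂ} (hq0 : q ≠ 0) (hq : ‖q‖ < 1) {k : ℕ} (hk : 1 ≤ k) :
    torusMean (dysonProd q k : (Fin N → ℂ) → ℂ) = qPochFin (k * N) q q / qPochFin k q q ^ N := by
  have hinj : Function.Injective fun e : ℕ => q ^ e := by
    intro a b hab
    have := congrArg norm hab
    simp only [norm_pow] at this
    exact (pow_right_injective₀ (norm_pos_iff.mpr hq0) hq.ne) this
  have h1q : ∀ n : ℕ, 1 - q ^ (n + 1) ≠ 0 := fun n => one_sub_pow_ne_zero hq n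
  have h1 : torusMean (dysonProd q k : (Fin N → ℂ) → ℂ) =
      (dysonPoly N q k).coeff (Finsupp.equivFunOnFinite.symm fun _ => k * (N - 1)) := by
    rw [torusMean_congr (G := fun x => (dysonPoly N q k).eval x * (MvPolynomial.monomial
      (Finsupp.equivFunOnFinite.symm fun _ => k * (N - 1)) (1 : ℂ)).eval x⁻¹)
      fun θ => dysonProd_eq q k (torusPt_ne_zero θ), torusMean_eval_mul_eval_inv]
    simp only [MvPolynomial.coeff_monomial, mul_ite, mul_one, mul_zero, Finset.sum_ite_eq]
    split_ifs with h
    · rfl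
    · simpa using Eq.symm (by simpa using h)
  have hP : ∀ n, qPochFin n q q ≠ 0 := fun n => Finset.prod_ne_zero_iff.mpr fun s _ => by
    rw [← pow_succ']; exact h1q s
  rw [h1, coeff_eq_sum_grid (k * (N - 1)) hinj.injOn _ (totalDegree_dysonPoly_le q k)]
  -- a single grid point contributes
  rw [Finset.sum_eq_single fun i : Fin N => k * (i : ℕ)]
  rotate_left
  · intro c hc hne
    have hcb : ∀ i, c i ≤ k * (N - 1) := fun i => by
      have := Fintype.mem_piFinset.mp hc i
      rw [Finset.mem_range] at this
      omega
    rw [mul_eq_zero]; left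
    by_contra hF
    -- a nonzero value means that no factor `q^(c i) - q^s q^(c j)` vanishes, so that the exponents
    -- `c i` are separated
    rw [eval_dysonPoly] at hF
    have hF' := Finset.prod_ne_zero_iff.mp hF
    refine hne (funext fun i => ?_)
    obtain ⟨n, rfl⟩ : ∃ n, N = n + 1 := ⟨N - 1, by have := i.pos; omega⟩
    refine eq_mul_of_separated hk n c hcb (fun i j hij => ?_) i
    by_contra hcon
    push Not at hcon
    rcases le_or_gt (c i) (c j) with hle | hlt
    · have hA := left_ne_zero_of_mul (hF' j (Finset.mem_univ j))
      refine Finset.prod_ne_zero_iff.mp (Finset.prod_ne_zero_iff.mp hA i (Finset.mem_Iio.mpr hij))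
        (c j - c i) (Finset.mem_range.mpr (by omega)) ?_
      rw [← pow_add, Nat.sub_add_cancel hle, sub_self]
    · have hB := right_ne_zero_of_mul (hF' i (Finset.mem_univ i))
      refine Finset.prod_ne_zero_iff.mp (Finset.prod_ne_zero_iff.mp hB j (Finset.mem_Ioi.mpr hij))
        (c i - c j - 1) (Finset.mem_range.mpr (by omega)) ?_
      rw [← pow_add, show c i - c j - 1 + 1 + c j = c i by omega, sub_self]
  · intro h
    refine absurd (Fintype.mem_piFinset.mpr fun i => ?_) h
    have : k * (i : ℕ) ≤ k * (N - 1) := Nat.mul_le_mul_left k (by omega)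
    rw [Finset.mem_range]; omega
  rw [eval_dysonPoly, ← Finset.prod_mul_distrib]
  set g : ℕ → ℂ := fun n => qPochFin (k * (n + 1)) q q / (qPochFin k q q * qPochFin (k * n) q q) with hg
  have hterm : ∀ i : Fin N, (∏ j ∈ Finset.Iio i, ∏ s ∈ Finset.range k, (q ^ (k * (i : ℕ)) - q ^ s * q ^ (k * (j : ℕ)))) *
      (∏ j ∈ Finset.Ioi i, ∏ s ∈ Finset.range k, (q ^ (k * (i : ℕ)) - q ^ (s + 1) * q ^ (k * (j : ℕ)))) *
      (∏ e ∈ (Finset.range (k * (N - 1) + 1)).erase (k * (i : ℕ)), (q ^ (k * (i : ℕ)) - q ^ e))⁻¹ = g (N - 1 - i) := by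
    intro i
    have hki : k * (i : ℕ) + k * (N - 1 - i) = k * (N - 1) := by
      rw [← mul_add]; congr 1; omega
    set K := k * (N - 1 - i) with hK
    set a := k * (i : ℕ) with ha
    have hA : ∏ j ∈ Finset.Iio i, ∏ s ∈ Finset.range k, (q ^ a - q ^ s * q ^ (k * (j : ℕ))) =
        ∏ e ∈ Finset.range a, (q ^ a - q ^ e) := by
      rw [prod_Iio_eq_range i fun j => ∏ s ∈ Finset.range k, (q ^ a - q ^ s * q ^ (k * j)), ha,
        ← prod_range_prod_range]
      simp only [← pow_add, add_comm]
    have hB : ∏ j ∈ Finset.Ioi i, ∏ s ∈ Finset.range k, (q ^ a - q ^ (s + 1) * q ^ (k * (j : ℕ))) =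
        ∏ f ∈ Finset.range K, (q ^ a - q ^ (a + 1 + (k + f))) := by
      rw [prod_Ioi_eq_range i fun j => ∏ s ∈ Finset.range k, (q ^ a - q ^ (s + 1) * q ^ (k * j)), hK,
        ← prod_range_prod_range k _ fun f => (q ^ a - q ^ (a + 1 + (k + f)))]
      refine Finset.prod_congr rfl fun j _ => Finset.prod_congr rfl fun s _ => ?_
      rw [← pow_add]
      congr 2
      rw [ha]; ring
    have hφ : ∏ e ∈ (Finset.range (k * (N - 1) + 1)).erase a, (q ^ a - q ^ e) =
        (∏ e ∈ Finset.range a, (q ^ a - q ^ e)) * ∏ f ∈ Finset.range K, (q ^ a - q ^ (a + 1 + f)) := by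
      have hset : (Finset.range (k * (N - 1) + 1)).erase a =
          Finset.range a ∪ (Finset.range K).map (addLeftEmbedding (a + 1)) := by
        ext e
        simp only [Finset.mem_erase, Finset.mem_range, Finset.mem_union, Finset.mem_map, addLeftEmbedding_apply]
        constructor
        · rintro ⟨h1, h2⟩
          rcases lt_or_gt_of_ne h1 with h3 | h3
          · exact Or.inl h3
          · exact Or.inr ⟨e - (a + 1), by omega, by omega⟩
        · rintro (h | ⟨f, hf, rfl⟩) <;> omega
      rw [hset, Finset.prod_union, Finset.prod_map]
      · rfl
      · rw [Finset.disjoint_left]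
        intro e he
        simp only [Finset.mem_range] at he
        simp only [Finset.mem_map, Finset.mem_range, addLeftEmbedding_apply, not_exists, not_and]
        intro f _; omega
    have hA0 : ∏ e ∈ Finset.range a, (q ^ a - q ^ e) ≠ 0 := Finset.prod_ne_zero_iff.mpr fun e he =>
      sub_ne_zero.mpr fun h => by have := hinj h; rw [Finset.mem_range] at he; omega
    have hq' : ∀ c : ℕ, ∏ f ∈ Finset.range K, (q ^ a - q ^ (a + 1 + (c + f))) =
        (∏ f ∈ Finset.range K, q ^ a) * ∏ f ∈ Finset.range K, (1 - q * q ^ (c + f)) := by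
      intro c
      rw [← Finset.prod_mul_distrib]
      exact Finset.prod_congr rfl fun f _ => by ring
    have hq0' := hq' 0
    simp only [zero_add] at hq0'
    have hq0'' : (∏ f ∈ Finset.range K, q ^ a) ≠ 0 := Finset.prod_ne_zero_iff.mpr fun _ _ => pow_ne_zero _ hq0
    have hPk : qPochFin (k * (N - 1 - i + 1)) q q = qPochFin k q q * ∏ f ∈ Finset.range K, (1 - q * q ^ (k + f)) := by
      rw [qPochFin, mul_add, mul_one, add_comm, Finset.prod_range_add]; rfl
    rw [hA, hB, hφ, hq', hq0', hg]
    simp only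
    rw [hPk, ← hK]
    have hPK := hP K
    change _ = _ / (_ * ∏ f ∈ Finset.range K, (1 - q * q ^ f))
    change (∏ f ∈ Finset.range K, (1 - q * q ^ f)) ≠ 0 at hPK
    have := hP k
    field_simp
  rw [Finset.prod_congr rfl fun i _ => hterm i, Fin.prod_univ_eq_prod_range (fun i => g (N - 1 - i)) N,
    Finset.prod_range_reflect]
  clear h1 hterm
  induction N with
  | zero => simp [qPochFin]
  | succ n ih =>
    rw [Finset.prod_range_succ, ih, hg]
    have := hP k
    have := hP (k * n)
    field_simp
    ring

theorem prod_offDiag_eq (f : Fin N → Fin N → ℂ) :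
    ∏ ij ∈ (Finset.univ : Finset (Fin N)).offDiag, f ij.1 ij.2 = ∏ i, ∏ j ∈ Finset.Ioi i, (f i j * f j i) := by
  rw [Finset.prod_finset_product' _ Finset.univ (fun i => Finset.univ.erase i) fun p => by simp [eq_comm]]
  simp only [Finset.prod_mul_distrib]
  rw [prod_Ioi_swap fun i j => f j i, ← Finset.prod_mul_distrib]
  refine Finset.prod_congr rfl fun i _ => ?_
  have hset : Finset.univ.erase i = Finset.Ioi i ∪ Finset.Iio i := by
    ext j
    simp only [Finset.mem_erase, Finset.mem_univ, and_true, Finset.mem_union, Finset.mem_Ioi, Finset.mem_Iio]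
    exact ⟨fun h => (lt_or_gt_of_ne h).symm, fun h => h.elim ne_of_gt ne_of_lt⟩
  rw [hset, Finset.prod_union]
  rw [Finset.disjoint_left]
  intro j h1 h2
  exact lt_asymm (Finset.mem_Ioi.mp h1) (Finset.mem_Iio.mp h2)

theorem dysonProd_eq_polyWeight (q : ℂ) (k : ℕ) {x : Fin N → ℂ} (hx : Function.Injective x)
    (h0 : ∀ i, x i ≠ 0) : dysonProd q k x = polyWeight q k x *
      ∏ i, ∏ j ∈ Finset.Ioi i, (x i - q ^ k * x j) / (x i - x j) := by
  rw [polyWeight, prod_offDiag_eq fun i j => qPochFin k q (x i / x j), dysonProd, ← Finset.prod_mul_distrib]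
  refine Finset.prod_congr rfl fun i _ => ?_
  rw [← Finset.prod_mul_distrib]
  refine Finset.prod_congr rfl fun j hj => ?_
  have hne : x i - x j ≠ 0 := sub_ne_zero.mpr fun h => (ne_of_gt (Finset.mem_Ioi.mp hj)) (hx h).symm
  have hi := h0 i
  have h1 : (1 : ℂ) - x j / x i ≠ 0 := by
    rw [one_sub_div hi]; exact div_ne_zero hne hi
  have h3 := (eq_div_of_mul_eq h1 (qPochFin_shift k q (x j / x i)))
  rw [h3, mul_assoc, mul_div_assoc]
  congr 2
  rw [one_sub_div hi, show (1 : ℂ) - q ^ k * (x j / x i) = (x i - q ^ k * x j) / x i by field_simp,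
    div_div_div_cancel_right₀ hi]

theorem polyWeight_perm (q : ℂ) (k : ℕ) (σ : Equiv.Perm (Fin N)) (x : Fin N → ℂ) :
    polyWeight q k (x ∘ σ) = polyWeight q k x := by
  unfold polyWeight
  refine Finset.prod_bij' (fun p _ => (σ p.1, σ p.2)) (fun p _ => (σ.symm p.1, σ.symm p.2)) ?_ ?_ ?_ ?_ ?_
  · rintro ⟨a, b⟩ h; simpa using h
  · rintro ⟨a, b⟩ h; simpa using h
  · rintro ⟨a, b⟩ h; simp
  · rintro ⟨a, b⟩ h; simp
  · rintro ⟨a, b⟩ h; rfl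

theorem dysonProd_mem (q : ℂ) (k : ℕ) : (dysonProd q k : (Fin N → ℂ) → ℂ) ∈ laurentAlg N :=
  prod_mem_laurentAlg fun _ _ => prod_mem_laurentAlg fun _ _ => mul_mem_laurentAlg
    (qPochFin_mem (div_mem_laurentAlg _ _) k q)
    (qPochFin_mem (mul_mem_laurentAlg (const_mem_laurentAlg q) (div_mem_laurentAlg _ _)) k q)

/-- The symmetrization of the `q`-Dyson product is a constant multiple of `polyWeight`, by `sum_perm_prod`. -/
theorem torusMean_polyWeight {q : ℂ} (hq : ‖q‖ < 1) {k : ℕ} (hk : 1 ≤ k) :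
    (∏ m ∈ Finset.range N, (1 - (q ^ k) ^ (m + 1)) / (1 - q ^ k)) *
      torusMean (polyWeight q k : (Fin N → ℂ) → ℂ) =
      N.factorial * torusMean (dysonProd q k : (Fin N → ℂ) → ℂ) := by
  have ht : q ^ k ≠ 1 := fun h => by
    have := one_sub_pow_ne_zero hq (k - 1)
    rw [Nat.sub_add_cancel hk, h, sub_self] at this
    exact this rfl
  have h1 : ∑ σ : Equiv.Perm (Fin N), torusMean (fun x : Fin N → ℂ => dysonProd q k (x ∘ σ)) =
      N.factorial * torusMean (dysonProd q k : (Fin N → ℂ) → ℂ) := by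
    rw [Finset.sum_congr rfl fun σ _ => (torusMean_perm (dysonProd_mem q k) σ).2]
    simp [Fintype.card_perm]
  rw [← h1, ← torusMean_sum fun σ _ => torusCont_of_mem (torusMean_perm (dysonProd_mem q k) σ).1,
    ← torusMean_const_mul]
  refine torusMean_congr fun θ => ?_
  set x := torusPt θ
  have h0 : ∀ i, x i ≠ 0 := torusPt_ne_zero θ
  by_cases hx : Function.Injective x
  · rw [← sum_perm_prod ht N hx h0, Finset.sum_mul]
    refine Finset.sum_congr rfl fun σ _ => ?_
    rw [dysonProd_eq_polyWeight q k (hx.comp σ.injective) fun i => h0 _, polyWeight_perm, mul_comm]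
    rfl
  · rw [(weights_eq_zero hk hx h0).1, mul_zero]
    refine (Finset.sum_eq_zero fun σ _ => ?_).symm
    obtain ⟨a, b, hab, hne⟩ : ∃ a b, (x ∘ σ) a = (x ∘ σ) b ∧ a < b := by
      obtain ⟨a, b, hab, hne⟩ := by simpa [Function.Injective] using hx
      rcases lt_or_gt_of_ne (σ.symm.injective.ne hne) with h | h
      · exact ⟨_, _, by simpa using hab, h⟩
      · exact ⟨_, _, by simpa using hab.symm, h⟩
    refine Finset.prod_eq_zero (Finset.mem_univ a) (Finset.prod_eq_zero (Finset.mem_Ioi.mpr hne) ?_)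
    rw [hab, Function.comp_apply, div_self (h0 _), qPochFin_one hk, zero_mul]

end dyson

/-- Macdonald's weight and its expression through power sums differ by a constant. -/
theorem macMean_eq_torusMean {N : ℕ} {q t : ℂ} (hq : ‖q‖ < 1) (ht : ‖t‖ < 1) (F : (Fin N → ℂ) → ℂ) :
    macMean q t F = (qPoch q q / qPoch t q) ^ N * ((N.factorial : ℂ)⁻¹ *
      torusMean fun x => macWeight q t x * F x) := by
  unfold macMean unitaryMean
  rw [mul_left_comm]
  congr 1
  rw [← torusMean_const_mul]
  refine torusMean_congr fun θ => ?_
  rw [← mul_assoc, weylDensity_mul_gasWeight hq ht, mul_assoc]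

theorem macWeight_torusPt {N : ℕ} {q : ℂ} (hq : ‖q‖ < 1) {k : ℕ} (hk : 1 ≤ k) (θ : Fin N → ℝ) :
    macWeight q (q ^ k) (torusPt θ) = polyWeight q k (torusPt θ) := by
  refine Finset.prod_congr rfl fun ij _ => ?_
  set z := torusPt θ ij.1 / torusPt θ ij.2 with hz
  have hz1 : ‖q ^ k * z‖ < 1 := by
    rw [norm_mul, norm_pow, hz, norm_div, norm_torusPt, norm_torusPt, div_one, mul_one]
    exact pow_lt_one₀ (norm_nonneg _) hq (by omega)
  rw [qPoch_eq_prod_mul z hq k, mul_comm z (q ^ k), mul_div_cancel_right₀ _ (qPoch_ne_zero hz1 hq)]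
  rfl

theorem macMean_eq_polyWeight {N : ℕ} {q : ℂ} (hq : ‖q‖ < 1) {k : ℕ} (hk : 1 ≤ k) (F : (Fin N → ℂ) → ℂ) :
    macMean q (q ^ k) F = (qPoch q q / qPoch (q ^ k) q) ^ N * ((N.factorial : ℂ)⁻¹ *
      torusMean fun x => polyWeight q k x * F x) := by
  rw [macMean_eq_torusMean hq (by rw [norm_pow]; exact pow_lt_one₀ (norm_nonneg _) hq (by omega))]
  congr 2
  exact torusMean_congr fun θ => by rw [macWeight_torusPt hq hk]

/-- The norm of `1` at `t = q^k`, from the `q`-Dyson constant term. -/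
theorem macMean_one_pow {N : ℕ} {q : ℂ} (hq0 : q ≠ 0) (hq : ‖q‖ < 1) {k : ℕ} (hk : 1 ≤ k) :
    (∏ m ∈ Finset.range N, (1 - (q ^ k) ^ (m + 1))) * macMean q (q ^ k) (fun _ : Fin N → ℂ => 1) =
      qPochFin (k * N) q q := by
  have htk : ‖q ^ k‖ < 1 := by rw [norm_pow]; exact pow_lt_one₀ (norm_nonneg _) hq (by omega)
  have h1t : 1 - q ^ k ≠ 0 := one_sub_ne_zero_of_norm htk
  have hP : qPochFin k q q ≠ 0 := Finset.prod_ne_zero_iff.mpr fun s _ => by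
    rw [← pow_succ']; exact one_sub_pow_ne_zero hq s
  have hratio : qPoch q q / qPoch (q ^ k) q = qPochFin k q q / (1 - q ^ k) := by
    have e1 := qPoch_eq_prod_mul q hq k
    have e2 := qPoch_eq_mul (q ^ k) hq
    rw [← pow_succ'] at e1
    rw [← pow_succ'] at e2
    have hne : qPoch (q ^ (k + 1)) q ≠ 0 :=
      qPoch_ne_zero (by rw [norm_pow]; exact pow_lt_one₀ (norm_nonneg _) hq (by omega)) hq
    rw [e1, e2, mul_div_mul_right _ _ hne]
    rfl
  have h := torusMean_polyWeight (N := N) hq hk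
  rw [torusMean_dysonProd hq0 hq hk, Finset.prod_div_distrib, Finset.prod_const, Finset.card_range] at h
  rw [macMean_eq_polyWeight hq hk, hratio, div_pow]
  simp only [mul_one]
  have hf : (N.factorial : ℂ) ≠ 0 := by exact_mod_cast N.factorial_ne_zero
  change _ * (_ * (_ * torusMean (polyWeight q k))) = _
  field_simp at h ⊢
  linear_combination h

/-! ### Extension to all `t` and uniform bounds -/

theorem differentiableOn_macMean {N : ℕ} {U : Set ℂ} (hU : IsOpen U) {q t : ℂ → ℂ}
    (hq : DifferentiableOn ℂ q U) (ht : DifferentiableOn ℂ t U) (hq1 : ∀ z ∈ U, ‖q z‖ < 1)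
    (ht1 : ∀ z ∈ U, ‖t z‖ < 1) {F : (Fin N → ℂ) → ℂ} (hF : TorusCont F) :
    DifferentiableOn ℂ (fun z => macMean (q z) (t z) F) U := by
  refine differentiableOn_unitaryMean_gasWeight hU (fun n => ?_) (fun z hz => ?_) hF
  · exact ((ht.pow _).sub (hq.pow _)).div ((hq.pow _).const_sub 1) fun z hz => one_sub_pow_ne_zero (hq1 z hz) n
  · obtain ⟨ρ, hρ1, hρ2⟩ := exists_between (max_lt (hq1 z hz) (ht1 z hz))
    have h0 : 0 ≤ ρ := ((norm_nonneg _).trans (le_max_left _ _)).trans hρ1.le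
    have hqc := ((hq.differentiableAt (hU.mem_nhds hz)).continuousAt.norm).eventually_lt
      (continuousAt_const (y := ρ)) ((le_max_left _ _).trans_lt hρ1)
    have htc := ((ht.differentiableAt (hU.mem_nhds hz)).continuousAt.norm).eventually_lt
      (continuousAt_const (y := ρ)) ((le_max_right _ _).trans_lt hρ1)
    exact ⟨_, summable_macCoupling_bound h0 hρ2, (hqc.and htc).mono fun w hw n =>
      norm_macCoupling_le hρ2 hw.1.le hw.2.le n⟩

/-- An identity between analytic functions of `t` in the unit disc needs to be checked only at the
points `q^k`, which accumulate at the origin. -/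
theorem eqOn_unitBall_of_eq_pow {q : ℂ} (hq0 : q ≠ 0) (hq : ‖q‖ < 1) {f g : ℂ → ℂ}
    (hf : DifferentiableOn ℂ f (Metric.ball 0 1)) (hg : DifferentiableOn ℂ g (Metric.ball 0 1))
    (h : ∀ k : ℕ, 1 ≤ k → f (q ^ k) = g (q ^ k)) : Set.EqOn f g (Metric.ball 0 1) := by
  refine (hf.analyticOnNhd Metric.isOpen_ball).eqOn_of_preconnected_of_frequently_eq
    (hg.analyticOnNhd Metric.isOpen_ball) (convex_ball _ _).isPreconnected (Metric.mem_ball_self one_pos) ?_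
  have htend : Tendsto (fun k : ℕ => q ^ (k + 1)) atTop (𝓝[≠] 0) := by
    refine tendsto_nhdsWithin_iff.mpr ⟨(tendsto_pow_atTop_nhds_zero_of_norm_lt_one hq).comp
      (tendsto_add_atTop_nat 1), Eventually.of_forall fun k => pow_ne_zero _ hq0⟩
  exact htend.frequently (Frequently.of_forall fun k => h _ (by omega))

theorem differentiableOn_qPoch {q : ℂ} (hq : ‖q‖ < 1) :
    DifferentiableOn ℂ (fun a => qPoch a q) (Metric.ball 0 1) := by
  intro a ha
  rw [mem_ball_zero_iff] at ha
  obtain ⟨ρ, hρ1, hρ2⟩ := exists_between (max_lt hq ha)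
  have h0 : 0 ≤ ρ := ((norm_nonneg _).trans (le_max_left _ _)).trans hρ1.le
  have h : DifferentiableOn ℂ (fun a => Complex.exp (-∑' n : ℕ, a ^ (n + 1) / (((n + 1 : ℕ) : ℂ) * (1 - q ^ (n + 1)))))
      (Metric.ball 0 ρ) := by
    refine (DifferentiableOn.neg ?_).cexp
    refine Complex.differentiableOn_tsum_of_summable_norm (summable_pow_succ_div h0 hρ2)
      (fun n => ((differentiable_id.pow _).div_const _).differentiableOn) Metric.isOpen_ball
      fun n w hw => norm_qPoch_exponent_le hρ2 (mem_ball_zero_iff.mp hw).le ((le_max_left _ _).trans hρ1.le) n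
  have ha' : Metric.ball (0 : ℂ) ρ ∈ 𝓝 a :=
    Metric.isOpen_ball.mem_nhds (mem_ball_zero_iff.mpr ((le_max_right _ _).trans_lt hρ1))
  refine ((h.differentiableAt ha').congr_of_eventuallyEq ?_).differentiableWithinAt
  filter_upwards [ha'] with w hw
  exact qPoch_eq_exp ((mem_ball_zero_iff.mp hw).trans hρ2) hq

theorem norm_mul_pow_lt_one {q t : ℂ} (hq : ‖q‖ < 1) (ht : ‖t‖ < 1) (N : ℕ) : ‖q * t ^ N‖ < 1 := by
  rw [norm_mul, norm_pow]
  exact (mul_le_of_le_one_right (norm_nonneg _) (pow_le_one₀ (norm_nonneg _) ht.le)).trans_lt hq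

/-- The norm of `1` for all `t`: an identity between holomorphic functions of `t`, which
`macMean_one_pow` gives at the points `t = q^k`. -/
theorem macMean_one {N : ℕ} {q t : ℂ} (hq0 : q ≠ 0) (hq : ‖q‖ < 1) (ht : ‖t‖ < 1) :
    (∏ m ∈ Finset.range N, (1 - t ^ (m + 1))) * macMean q t (fun _ : Fin N → ℂ => 1) *
      qPoch (q * t ^ N) q = qPoch q q := by
  have hball : ∀ z ∈ Metric.ball (0 : ℂ) 1, ‖z‖ < 1 := fun z hz => mem_ball_zero_iff.mp hz
  refine eqOn_unitBall_of_eq_pow hq0 hq (f := fun t => (∏ m ∈ Finset.range N, (1 - t ^ (m + 1))) *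
    macMean q t (fun _ : Fin N → ℂ => 1) * qPoch (q * t ^ N) q) (g := fun _ => qPoch q q) ?_
    (differentiableOn_const _) (fun k hk => ?_) (mem_ball_zero_iff.mpr ht)
  · refine DifferentiableOn.mul (DifferentiableOn.mul ?_ ?_) ?_
    · exact Differentiable.differentiableOn (by fun_prop)
    · exact differentiableOn_macMean Metric.isOpen_ball (differentiableOn_const q) differentiableOn_id
        (fun _ _ => hq) hball (TorusCont.const 1)
    · exact (differentiableOn_qPoch hq).comp (Differentiable.differentiableOn (by fun_prop))
        fun z hz => mem_ball_zero_iff.mpr (norm_mul_pow_lt_one hq (hball z hz) N)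
  · rw [macMean_one_pow hq0 hq hk, qPoch_eq_prod_mul q hq (k * N), pow_mul]
    rfl

/-- The correlator of `p_λ(x)` and `p_μ(x⁻¹)` with respect to Macdonald's weight. -/
def macCorr (N : ℕ) (q t : ℂ) (lam mu : Multiset ℕ) : ℂ :=
  macMean q t (psMon N lam mu : (Fin N → ℂ) → ℂ)

theorem multisetSum_induction {α β : Type*} {P : (α → ℂ) → Prop} (h0 : P fun _ => 0)
    (hadd : ∀ f g, P f → P g → P fun a => f a + g a) (s : Multiset β) {f : β → α → ℂ}
    (hf : ∀ b ∈ s, P (f b)) : P fun a => (s.map fun b => f b a).sum := by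
  induction s using Multiset.induction_on with
  | empty => simpa using h0
  | cons b s ih =>
    simp only [Multiset.map_cons, Multiset.sum_cons]
    exact hadd _ _ (hf b (Multiset.mem_cons_self _ _)) (ih fun c hc => hf c (Multiset.mem_cons_of_mem hc))

theorem differentiableOn_macCorr_t {N : ℕ} {q : ℂ} (hq : ‖q‖ < 1) (lam mu : Multiset ℕ) :
    DifferentiableOn ℂ (fun t => macCorr N q t lam mu) (Metric.ball 0 1) :=
  differentiableOn_macMean Metric.isOpen_ball (differentiableOn_const q) differentiableOn_id
    (fun _ _ => hq) (fun _ hz => mem_ball_zero_iff.mp hz) (torusCont_of_mem (psMon N lam mu).2)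

theorem differentiableOn_hSum {U : Set ℂ} {c : ℂ → ℕ → ℂ} (hc : ∀ j, DifferentiableOn ℂ (fun t => c t j) U)
    (n : ℕ) {X : ℂ → Multiset ℕ → ℂ} (hX : ∀ s, DifferentiableOn ℂ (fun t => X t s) U) :
    DifferentiableOn ℂ (fun t => hSum (c t) n (X t)) U :=
  hSum_induction (P := fun f => DifferentiableOn ℂ f U) (differentiableOn_const 0) (fun _ _ hf hg => hf.add hg)
    (fun z _ hf => hf.const_mul z) (fun j _ hf => (hc j).mul hf) n fun s _ _ => hX s

/-- The loop equation for Macdonald's weight with arbitrary parameters. -/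
theorem loop_macCorr {N : ℕ} {q t : ℂ} (hq0 : q ≠ 0) (hq : ‖q‖ < 1) (ht : ‖t‖ < 1) {m : ℕ} (hm : 1 ≤ m)
    (lam mu : Multiset ℕ) (hN : m + lam.sum ≤ N) :
    hSum (fun j => 1 - t ^ j) m (fun s => macCorr N q t (s + lam) mu) =
      loopRHS N q t m (macCorr N q t) lam mu := by
  have hpow : ∀ j, DifferentiableOn ℂ (fun t : ℂ => 1 - t ^ j) (Metric.ball 0 1) := fun j =>
    Differentiable.differentiableOn (by fun_prop)
  have hpow' : ∀ j, DifferentiableOn ℂ (fun t : ℂ => t ^ j - 1) (Metric.ball 0 1) := fun j =>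
    Differentiable.differentiableOn (by fun_prop)
  have hD := differentiableOn_macCorr_t (N := N) hq
  have hterm : ∀ a s σ τ, DifferentiableOn ℂ (fun t => loopTerm N t (macCorr N q t) a s σ τ) (Metric.ball 0 1) := by
    intro a s σ τ
    unfold loopTerm
    split_ifs
    · exact differentiableOn_hSum hpow _ fun ν => hD _ _
    · exact (hpow N).mul (hD _ _)
    · exact (((differentiable_id.pow _).differentiableOn).mul
        (differentiableOn_hSum hpow' _ fun ν => hD _ _)).neg
  refine eqOn_unitBall_of_eq_pow hq0 hq
    (f := fun t => hSum (fun j => 1 - t ^ j) m (fun s => macCorr N q t (s + lam) mu))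
    (g := fun t => loopRHS N q t m (macCorr N q t) lam mu)
    (differentiableOn_hSum hpow m fun s => hD _ _) ?_ (fun k hk => ?_) (mem_ball_zero_iff.mpr ht)
  · unfold loopRHS
    simp only [smul_eq_mul]
    refine DifferentiableOn.const_mul ?_ _
    refine multisetSum_induction (P := fun f => DifferentiableOn ℂ f (Metric.ball 0 1)) (differentiableOn_const 0)
      (fun _ _ hf hg => hf.add hg) _ fun p _ => ?_
    refine multisetSum_induction (P := fun f => DifferentiableOn ℂ f (Metric.ball 0 1)) (differentiableOn_const 0)
      (fun _ _ hf hg => hf.add hg) _ fun r _ => ?_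
    exact (hterm _ _ _ _).const_mul _
  · set C := (qPoch q q / qPoch (q ^ k) q) ^ N * (N.factorial : ℂ)⁻¹ with hC
    have h1 : ∀ l r, macCorr N q (q ^ k) l r = C * torusMean fun x : Fin N → ℂ => polyWeight q k x *
        (psMon N l r : (Fin N → ℂ) → ℂ) x := fun l r => by
      rw [macCorr, macMean_eq_polyWeight hq hk, hC, mul_assoc]
    have h2 := congrArg (LinearMap.mulLeft ℂ C) (loop_polyWeight hq0 hk hm lam mu hN)
    rw [map_hSum, map_loopRHS] at h2
    simp only [LinearMap.mulLeft_apply, ← h1] at h2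
    exact h2

section bound

/-- The families of complex numbers that are bounded by `C + ε X` along a filter, for every `ε > 0`. -/
def AlmostBounded {α : Type*} (l : Filter α) (X : α → ℝ) (f : α → ℂ) : Prop :=
  ∀ ε > 0, ∃ C : ℝ, ∀ᶠ a in l, ‖f a‖ ≤ C + ε * X a

variable {α : Type*} {l : Filter α} {X : α → ℝ}

theorem AlmostBounded.of_bounded (hX : ∀ a, 0 ≤ X a) {f : α → ℂ} (h : ∃ C : ℝ, ∀ᶠ a in l, ‖f a‖ ≤ C) :
    AlmostBounded l X f := fun ε hε => by
  obtain ⟨C, hC⟩ := h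
  exact ⟨C, hC.mono fun a ha => ha.trans (le_add_of_nonneg_right (mul_nonneg hε.le (hX a)))⟩

theorem AlmostBounded.zero (hX : ∀ a, 0 ≤ X a) : AlmostBounded l X fun _ => 0 :=
  .of_bounded hX ⟨0, Eventually.of_forall fun _ => by simp⟩

theorem AlmostBounded.add {f g : α → ℂ} (hf : AlmostBounded l X f) (hg : AlmostBounded l X g) :
    AlmostBounded l X fun a => f a + g a := fun ε hε => by
  obtain ⟨C, hC⟩ := hf (ε / 2) (by positivity)
  obtain ⟨D, hD⟩ := hg (ε / 2) (by positivity)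
  refine ⟨C + D, (hC.and hD).mono fun a ha => (norm_add_le _ _).trans ?_⟩
  linarith [ha.1, ha.2]

theorem AlmostBounded.mul {c f : α → ℂ} {B : ℝ} (hc : ∀ᶠ a in l, ‖c a‖ ≤ B) (hf : AlmostBounded l X f) :
    AlmostBounded l X fun a => c a * f a := fun ε hε => by
  have hB : 0 < |B| + 1 := by positivity
  obtain ⟨C, hC⟩ := hf (ε / (|B| + 1)) (by positivity)
  refine ⟨(|B| + 1) * C, (hc.and hC).mono fun a ha => ?_⟩
  rw [norm_mul]
  calc ‖c a‖ * ‖f a‖ ≤ (|B| + 1) * (C + ε / (|B| + 1) * X a) :=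
        mul_le_mul (ha.1.trans ((le_abs_self B).trans (by linarith))) ha.2 (norm_nonneg _) hB.le
    _ = _ := by field_simp

theorem AlmostBounded.mul_tendsto_zero {c f : α → ℂ} (hX : ∀ a, 0 ≤ X a)
    (hc : Tendsto c l (𝓝 0)) (hf : ∃ B : ℝ, ∀ᶠ a in l, ‖f a‖ ≤ B * (1 + X a)) :
    AlmostBounded l X fun a => c a * f a := fun ε hε => by
  obtain ⟨B, hB⟩ := hf
  have hB0 : 0 < |B| + 1 := by positivity
  have h1 : ∀ᶠ a in l, ‖c a‖ < ε / (|B| + 1) := by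
    have := (tendsto_zero_iff_norm_tendsto_zero.mp hc).eventually_lt_const (show 0 < ε / (|B| + 1) by positivity)
    exact this
  refine ⟨ε, (h1.and hB).mono fun a ha => ?_⟩
  rw [norm_mul]
  have hXa := hX a
  calc ‖c a‖ * ‖f a‖ ≤ (ε / (|B| + 1)) * ((|B| + 1) * (1 + X a)) := by
        refine mul_le_mul ha.1.le (ha.2.trans ?_) (norm_nonneg _) (by positivity)
        exact mul_le_mul_of_nonneg_right ((le_abs_self B).trans (by linarith)) (by linarith)
    _ = _ := by field_simp

end bound

/-- The parameters `(N, q, t)` with `N → ∞` and `(q, t)` in a compact set that avoids `q = 0`. -/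
def paramFilter (ε ρ : ℝ) : Filter (ℕ × ℂ × ℂ) :=
  atTop ×ˢ 𝓟 {z : ℂ × ℂ | ε ≤ ‖z.1‖ ∧ ‖z.1‖ ≤ ρ ∧ ‖z.2‖ ≤ ρ}

theorem eventually_paramFilter (ε ρ : ℝ) (N : ℕ) : ∀ᶠ a in paramFilter ε ρ,
    N ≤ a.1 ∧ ε ≤ ‖a.2.1‖ ∧ ‖a.2.1‖ ≤ ρ ∧ ‖a.2.2‖ ≤ ρ := by
  have := prod_mem_prod (eventually_ge_atTop N) (mem_principal_self {z : ℂ × ℂ | ε ≤ ‖z.1‖ ∧ ‖z.1‖ ≤ ρ ∧ ‖z.2‖ ≤ ρ})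
  exact this

theorem tendsto_pow_paramFilter {ε ρ : ℝ} (h0 : 0 ≤ ρ) (hρ : ρ < 1) (e : ℕ) :
    Tendsto (fun a : ℕ × ℂ × ℂ => a.2.2 ^ (a.1 - e)) (paramFilter ε ρ) (𝓝 0) := by
  have h1 : Tendsto (fun a : ℕ × ℂ × ℂ => ρ ^ (a.1 - e)) (paramFilter ε ρ) (𝓝 0) :=
    ((tendsto_pow_atTop_nhds_zero_of_lt_one h0 hρ).comp (tendsto_sub_atTop_nat e)).comp tendsto_fst
  refine squeeze_zero_norm' ?_ h1
  filter_upwards [eventually_paramFilter ε ρ 0] with a ha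
  rw [norm_pow]
  exact pow_le_pow_left₀ (norm_nonneg _) ha.2.2.2 _

theorem exists_norm_shiftCoeff_le {α : Type*} {l : Filter α} {z : α → ℂ} {R : ℝ} (hz : ∀ᶠ a in l, ‖z a‖ ≤ R)
    (s : Multiset ℕ) : ∃ B : ℝ, ∀ᶠ a in l, ‖shiftCoeff (z a) s‖ ≤ B := by
  induction s using Multiset.induction_on with
  | empty => exact ⟨1, Eventually.of_forall fun a => by simp [shiftCoeff]⟩
  | cons b s ih =>
    obtain ⟨B, hB⟩ := ih
    refine ⟨(R ^ b + 1) * B, (hz.and hB).mono fun a ha => ?_⟩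
    rw [shiftCoeff, Multiset.map_cons, Multiset.prod_cons, norm_mul]
    have h1 : ‖z a ^ b - 1‖ ≤ R ^ b + 1 := by
      refine (norm_sub_le _ _).trans ?_
      rw [norm_pow, norm_one]
      have := pow_le_pow_left₀ (norm_nonneg _) ha.1 b
      linarith
    exact mul_le_mul h1 ha.2 (norm_nonneg _) ((norm_nonneg _).trans h1)

/-- By `macMean_one` the norm of `1` is a product of values of `(a;b)_∞` and `(a;b)_∞⁻¹` with
`|a|, |b| ≤ ρ`. -/
theorem exists_macMean_one_le {ε ρ : ℝ} (hε : 0 < ε) (hρ : ρ < 1) :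
    ∃ C : ℝ, ∀ᶠ a in paramFilter ε ρ, ‖macCorr a.1 a.2.1 a.2.2 0 0‖ ≤ C := by
  obtain ⟨C, hC0, hC⟩ := norm_qPoch_bounds hρ
  refine ⟨C * C * C * C, (eventually_paramFilter ε ρ 0).mono fun a ha => ?_⟩
  obtain ⟨N, q, t⟩ := a
  obtain ⟨-, hq0, hqρ, htρ⟩ := ha
  simp only at hq0 hqρ htρ ⊢
  have hq : ‖q‖ < 1 := hqρ.trans_lt hρ
  have ht : ‖t‖ < 1 := htρ.trans_lt hρ
  have hqn : q ≠ 0 := norm_pos_iff.mp (hε.trans_le hq0)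
  have hsmall : ∀ z : ℂ, ‖z‖ ≤ ρ → ‖z * t ^ N‖ ≤ ρ := fun z hz => by
    rw [norm_mul, norm_pow]
    exact (mul_le_of_le_one_right (norm_nonneg _) (pow_le_one₀ (norm_nonneg _) ht.le)).trans hz
  have h1 := macMean_one (N := N) hqn hq ht
  have h2 := qPoch_eq_prod_mul t ht N
  simp only [← pow_succ'] at h2
  have h3 : macCorr N q t 0 0 = macMean q t (fun _ : Fin N → ℂ => 1) := by
    unfold macCorr
    congr 1
    funext x
    rw [psMon_apply, powerSumProd_zero, powerSumProd_zero, mul_one]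
  have n1 : qPoch (q * t ^ N) q ≠ 0 := qPoch_ne_zero ((hsmall q hqρ).trans_lt hρ) hq
  have n2 : qPoch t t ≠ 0 := qPoch_ne_zero ht ht
  have n3 : qPoch (t ^ (N + 1)) t ≠ 0 := qPoch_ne_zero (by
    rw [pow_succ']; exact (hsmall t htρ).trans_lt hρ) ht
  have h4 : macCorr N q t 0 0 = qPoch q q * (qPoch (q * t ^ N) q)⁻¹ * (qPoch (t ^ (N + 1)) t * (qPoch t t)⁻¹) := by
    rw [h3, ← h1, h2]
    have n4 := left_ne_zero_of_mul (h2 ▸ n2)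
    field_simp
  rw [h4, norm_mul, norm_mul, norm_mul]
  have c1 := (hC q q hqρ hqρ).1
  have c2 := (hC (q * t ^ N) q (hsmall q hqρ) hqρ).2
  have c3 := (hC (t ^ (N + 1)) t (by rw [pow_succ']; exact hsmall t htρ) htρ).1
  have c4 := (hC t t htρ htρ).2
  calc _ ≤ (C * C) * (C * C) := by gcongr
    _ = _ := by ring

/-- The correlators are bounded uniformly in `N`. The loop equation expresses those of degree `d` through
correlators of lower degree and through terms of degree `d` with a factor `t^{N - e}`. Hence each of them is at
most `C + ε X`, where `X` is the sum of the moduli of all correlators of degree `d`, and so `X` is bounded. -/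
theorem exists_macCorr_le {ε ρ : ℝ} (hε : 0 < ε) (h0 : 0 ≤ ρ) (hρ : ρ < 1) (d : ℕ) :
    ∀ lam mu : Multiset ℕ, lam.sum = d → mu.sum = d → (∀ a ∈ lam, 0 < a) → (∀ a ∈ mu, 0 < a) →
    ∃ C : ℝ, ∀ᶠ a in paramFilter ε ρ, ‖macCorr a.1 a.2.1 a.2.2 lam mu‖ ≤ C := by
  induction d using Nat.strong_induction_on with
  | _ d ih =>
  have hnil : ∀ s : Multiset ℕ, s.sum = 0 → (∀ a ∈ s, 0 < a) → s = 0 := fun s hs hp =>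
    Multiset.eq_zero_of_forall_notMem fun a ha => by
      have := Multiset.single_le_sum (fun _ _ => Nat.zero_le _) a ha
      have := hp a ha
      omega
  rcases Nat.eq_zero_or_pos d with rfl | hd
  · intro lam mu h1 h2 p1 p2
    rw [hnil lam h1 p1, hnil mu h2 p2]
    exact exists_macMean_one_le hε hρ
  set l := paramFilter ε ρ with hl
  -- the total size of the correlators of degree `d`
  set X : ℕ × ℂ × ℂ → ℝ := fun a => ∑ z : d.Partition × d.Partition,
    ‖macCorr a.1 a.2.1 a.2.2 z.1.parts z.2.parts‖ with hX
  have hX0 : ∀ a, 0 ≤ X a := fun a => Finset.sum_nonneg fun _ _ => norm_nonneg _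
  have hle : ∀ lam mu : Multiset ℕ, lam.sum = d → mu.sum = d → (∀ a ∈ lam, 0 < a) → (∀ a ∈ mu, 0 < a) →
      ∀ a, ‖macCorr a.1 a.2.1 a.2.2 lam mu‖ ≤ X a := by
    intro lam mu h1 h2 p1 p2 a
    let z0 : d.Partition × d.Partition := (⟨lam, fun {i} h => p1 i h, h1⟩, ⟨mu, fun {i} h => p2 i h, h2⟩)
    have h := Finset.single_le_sum (s := Finset.univ) (a := z0) (f := fun z : d.Partition × d.Partition =>
      ‖macCorr a.1 a.2.1 a.2.2 z.1.parts z.2.parts‖) (fun z _ => norm_nonneg _) (Finset.mem_univ z0)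
    rw [hX]
    exact h
  have hparam := eventually_paramFilter ε ρ
  have htpow : ∀ j, ∀ᶠ a in l, ‖a.2.2 ^ j‖ ≤ 1 := fun j => (hparam 0).mono fun a ha => by
    rw [norm_pow]; exact pow_le_one₀ (norm_nonneg _) (ha.2.2.2.trans hρ.le)
  have hc1 : ∀ j, ∀ᶠ a in l, ‖1 - a.2.2 ^ j‖ ≤ 2 := fun j => (htpow j).mono fun a ha =>
    (norm_sub_le _ _).trans (by rw [norm_one]; linarith)
  have hc2 : ∀ j, ∀ᶠ a in l, ‖a.2.2 ^ j - 1‖ ≤ 2 := fun j => (htpow j).mono fun a ha =>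
    (norm_sub_le _ _).trans (by rw [norm_one]; linarith)
  -- the loop equation bounds the correlators with the polynomial `newton (fun j => (1 - t^j) p_j) m` in
  -- place of `p_m`
  have hQ : ∀ m, 1 ≤ m → ∀ lam mu : Multiset ℕ, m + lam.sum = d → mu.sum = d → (∀ a ∈ lam, 0 < a) →
      (∀ a ∈ mu, 0 < a) → AlmostBounded l X fun a => hSum (fun j => 1 - a.2.2 ^ j) m fun s =>
        macCorr a.1 a.2.1 a.2.2 (s + lam) mu := by
    intro m hm lam mu h1 h2 p1 p2
    have hloop : ∀ᶠ a in l, hSum (fun j => 1 - a.2.2 ^ j) m (fun s => macCorr a.1 a.2.1 a.2.2 (s + lam) mu) =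
        loopRHS a.1 a.2.1 a.2.2 m (macCorr a.1 a.2.1 a.2.2) lam mu := (hparam d).mono fun a ha =>
      loop_macCorr (norm_pos_iff.mp (hε.trans_le ha.2.1)) (ha.2.2.1.trans_lt hρ) (ha.2.2.2.trans_lt hρ) hm
        lam mu (h1.trans_le ha.1)
    suffices h : AlmostBounded l X fun a => loopRHS a.1 a.2.1 a.2.2 m (macCorr a.1 a.2.1 a.2.2) lam mu by
      intro δ hδ
      obtain ⟨C, hC⟩ := h δ hδ
      exact ⟨C, (hC.and hloop).mono fun a ha => by simpa only [ha.2] using ha.1⟩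
    unfold loopRHS
    simp only [smul_eq_mul]
    refine AlmostBounded.mul (B := 1) ((hparam 0).mono fun a ha => ?_) ?_
    · rw [norm_pow]; exact pow_le_one₀ (norm_nonneg _) (ha.2.2.1.trans hρ.le)
    refine multisetSum_induction (P := AlmostBounded l X) (.zero hX0) (fun _ _ => .add) _ fun p hp => ?_
    refine multisetSum_induction (P := AlmostBounded l X) (.zero hX0) (fun _ _ => .add) _ fun r hr => ?_
    obtain ⟨B1, hB1⟩ := exists_norm_shiftCoeff_le ((hparam 0).mono fun a ha => ha.2.2.1) p.2
    obtain ⟨B2, hB2⟩ := exists_norm_shiftCoeff_le (z := fun a : ℕ × ℂ × ℂ => a.2.1⁻¹) (R := ε⁻¹)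
      ((hparam 0).mono fun a ha => by rw [norm_inv]; exact inv_anti₀ hε ha.2.1) r.2
    refine AlmostBounded.mul (B := B1 * B2) ((hB1.and hB2).mono fun a ha => ?_) ?_
    · rw [norm_mul]
      exact mul_le_mul ha.1 ha.2 (norm_nonneg _) ((norm_nonneg _).trans ha.1)
    have hp' := Multiset.mem_antidiagonal.mp hp
    have hr' := Multiset.mem_antidiagonal.mp hr
    have hps : p.1.sum + p.2.sum = lam.sum := by rw [← Multiset.sum_add, hp']
    have hrs : r.1.sum + r.2.sum = mu.sum := by rw [← Multiset.sum_add, hr']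
    have hp1 : ∀ a ∈ p.1, 0 < a := fun a ha => p1 a (hp' ▸ Multiset.mem_add.mpr (Or.inl ha))
    have hr1 : ∀ a ∈ r.1, 0 < a := fun a ha => p2 a (hr' ▸ Multiset.mem_add.mpr (Or.inl ha))
    have hpos : ∀ s σ : Multiset ℕ, (∀ a ∈ s, 0 < a) → (∀ a ∈ σ, 0 < a) → ∀ a ∈ s + σ, 0 < a :=
      fun s σ hs hσ a ha => (Multiset.mem_add.mp ha).elim (hs a) (hσ a)
    unfold loopTerm
    split_ifs with c1 c2
    · -- here and in the next case the factor in `x` is a part of `p_λ`, of degree less than `d`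
      refine hSum_induction (P := AlmostBounded l X) (.zero hX0) (fun _ _ => .add)
        (fun z f hf => hf.mul (Eventually.of_forall fun _ => le_refl ‖z‖)) (fun j f hf => hf.mul (hc1 j)) _
        fun ν hν hνp => .of_bounded hX0 ?_
      refine ih p.1.sum (by omega) _ _ rfl ?_ hp1 (hpos _ _ hνp hr1)
      rw [Multiset.sum_add]; omega
    · simp only [smul_eq_mul]
      refine AlmostBounded.mul (B := 2) ?_ (.of_bounded hX0 (ih p.1.sum (by omega) _ _ rfl (by omega) hp1 hr1))
      exact (hparam 0).mono fun a ha => (norm_sub_le _ _).trans (by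
        rw [norm_one, norm_pow]
        have := pow_le_one₀ (norm_nonneg _) (ha.2.2.2.trans hρ.le) (n := a.1)
        linarith)
    · simp only [smul_eq_mul, ← neg_mul]
      -- this term may have degree `d`, but `t^{N - e}` tends to zero
      refine AlmostBounded.mul_tendsto_zero hX0 (by simpa using (tendsto_pow_paramFilter h0 hρ (m + p.2.sum - r.2.sum)).neg) ?_
      have hO : (fun a : ℕ × ℂ × ℂ => hSum (fun j => a.2.2 ^ j - 1) (m + p.2.sum - r.2.sum) fun ν =>
          macCorr a.1 a.2.1 a.2.2 (ν + p.1) r.1) =O[l] fun a => 1 + X a := by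
        refine hSum_induction (P := fun f => f =O[l] fun a => 1 + X a) (Asymptotics.isBigO_zero _ _)
          (fun _ _ hf hg => hf.add hg) (fun z f hf => hf.const_mul_left z) (fun j f hf => ?_) _ fun ν hν hνp => ?_
        · have h1 : (fun a : ℕ × ℂ × ℂ => a.2.2 ^ j - 1) =O[l] fun _ => (1 : ℝ) :=
            Asymptotics.IsBigO.of_bound 2 ((hc2 j).mono fun a ha => by simpa using ha)
          simpa using h1.mul hf
        · have hs : (ν + p.1).sum = r.1.sum := by rw [Multiset.sum_add]; omega
          rcases (show r.1.sum ≤ d by omega).lt_or_eq with hlt | heq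
          · obtain ⟨C, hC⟩ := ih r.1.sum hlt (ν + p.1) r.1 hs rfl (hpos _ _ hνp hp1) hr1
            refine Asymptotics.IsBigO.of_bound |C| (hC.mono fun a ha => ?_)
            have := hX0 a
            rw [Real.norm_of_nonneg (by linarith)]
            exact ha.trans ((le_abs_self C).trans (le_mul_of_one_le_right (abs_nonneg C) (by linarith)))
          · refine Asymptotics.IsBigO.of_bound 1 (Eventually.of_forall fun a => ?_)
            have := hX0 a
            rw [Real.norm_of_nonneg (by linarith), one_mul]
            exact (hle _ _ (hs.trans heq) heq (hpos _ _ hνp hp1) hr1 a).trans (by linarith)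
      obtain ⟨B, hB⟩ := hO.bound
      refine ⟨B, hB.mono fun a ha => ?_⟩
      have := hX0 a
      rwa [Real.norm_of_nonneg (by linarith)] at ha
  -- by Newton's recursion the same holds for `p_m` itself, as `1 - t^m` is bounded away from zero
  have hall : ∀ lam mu : Multiset ℕ, lam.sum = d → mu.sum = d → (∀ a ∈ lam, 0 < a) → (∀ a ∈ mu, 0 < a) →
      AlmostBounded l X fun a => macCorr a.1 a.2.1 a.2.2 lam mu := by
    intro lam mu h1 h2 p1 p2
    obtain ⟨m, lam, rfl⟩ : ∃ m s, lam = m ::ₘ s := by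
      induction lam using Multiset.induction_on with
      | empty => simp at h1; omega
      | cons a s _ => exact ⟨a, s, rfl⟩
    obtain ⟨n, rfl⟩ : ∃ n, m = n + 1 := ⟨m - 1, by have := p1 m (Multiset.mem_cons_self _ _); omega⟩
    rw [Multiset.sum_cons] at h1
    have p1' : ∀ a ∈ lam, 0 < a := fun a ha => p1 a (Multiset.mem_cons_of_mem ha)
    have hA := hQ (n + 1) (by omega) lam mu h1 h2 p1' p2
    have hB : AlmostBounded l X fun a => ∑ j ∈ Finset.range n, (1 - a.2.2 ^ (j + 1)) *
        hSum (fun j => 1 - a.2.2 ^ j) (n - j) fun s => macCorr a.1 a.2.1 a.2.2 ((j + 1) ::ₘ s + lam) mu := by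
      have : ∀ J : Finset ℕ, J ⊆ Finset.range n → AlmostBounded l X fun a => ∑ j ∈ J, (1 - a.2.2 ^ (j + 1)) *
          hSum (fun j => 1 - a.2.2 ^ j) (n - j) fun s => macCorr a.1 a.2.1 a.2.2 ((j + 1) ::ₘ s + lam) mu := by
        intro J
        induction J using Finset.induction_on with
        | empty => intro _; simpa using AlmostBounded.zero hX0
        | insert j J hj ihJ =>
          intro hJ
          simp only [Finset.sum_insert hj]
          have hjn := Finset.mem_range.mp (hJ (Finset.mem_insert_self _ _))
          refine .add (.mul (hc1 _) ?_) (ihJ fun i hi => hJ (Finset.mem_insert_of_mem hi))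
          have := hQ (n - j) (by omega) ((j + 1) ::ₘ lam) mu (by rw [Multiset.sum_cons]; omega) h2 (fun a ha => by
            rcases Multiset.mem_cons.mp ha with rfl | ha
            · omega
            · exact p1' a ha) p2
          simpa only [Multiset.add_cons, Multiset.cons_add] using this
      exact this _ subset_rfl
    have hrel : ∀ a : ℕ × ℂ × ℂ, ((n : ℂ) + 1) * hSum (fun j => 1 - a.2.2 ^ j) (n + 1) (fun s =>
        macCorr a.1 a.2.1 a.2.2 (s + lam) mu) = (∑ j ∈ Finset.range n, (1 - a.2.2 ^ (j + 1)) *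
        hSum (fun j => 1 - a.2.2 ^ j) (n - j) fun s => macCorr a.1 a.2.1 a.2.2 ((j + 1) ::ₘ s + lam) mu) +
        (1 - a.2.2 ^ (n + 1)) * macCorr a.1 a.2.1 a.2.2 ((n + 1) ::ₘ lam) mu := by
      intro a
      have hn : ((n : ℂ) + 1) ≠ 0 := by exact_mod_cast n.succ_ne_zero
      rw [hSum_succ, smul_eq_mul, mul_inv_cancel_left₀ hn, Finset.sum_range_succ, Nat.sub_self, hSum_zero]
      simp
    have hC : AlmostBounded l X fun a => (1 - a.2.2 ^ (n + 1)) * macCorr a.1 a.2.1 a.2.2 ((n + 1) ::ₘ lam) mu := by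
      have h := (hA.mul (c := fun _ => (n : ℂ) + 1) (Eventually.of_forall fun _ => le_refl ‖(n : ℂ) + 1‖)).add
        (hB.mul (c := fun _ => -1) (Eventually.of_forall fun _ => le_refl ‖(-1 : ℂ)‖))
      refine (congrArg (AlmostBounded l X) (funext fun a => ?_)).mp h
      rw [hrel a]; ring
    have hinv : ∀ᶠ a in l, ‖(1 - a.2.2 ^ (n + 1))⁻¹‖ ≤ (1 - ρ)⁻¹ := (hparam 0).mono fun a ha => by
      rw [norm_inv]
      exact inv_anti₀ (by linarith) (norm_one_sub_pow_ge hρ ha.2.2.2 n)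
    intro δ hδ
    obtain ⟨C, hC'⟩ := hC.mul hinv δ hδ
    refine ⟨C, (hC'.and (hparam 0)).mono fun a ha => ?_⟩
    simpa only [inv_mul_cancel_left₀ (one_sub_pow_ne_zero (ha.2.2.2.2.trans_lt hρ) n)] using ha.1
  -- summation over all pairs of partitions of `d`, with `ε` so small that `X` is absorbed
  obtain ⟨c, hc⟩ : ∃ c : ℝ, c = ((Fintype.card (d.Partition × d.Partition) : ℕ) : ℝ) := ⟨_, rfl⟩
  have hc0 : 0 ≤ c := hc ▸ Nat.cast_nonneg _
  have hbd : ∀ z : d.Partition × d.Partition, ∃ C : ℝ, ∀ᶠ a in l,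
      ‖macCorr a.1 a.2.1 a.2.2 z.1.parts z.2.parts‖ ≤ C + (1 / (2 * (c + 1))) * X a := fun z =>
    hall _ _ z.1.parts_sum z.2.parts_sum (fun a ha => z.1.parts_pos ha) (fun a ha => z.2.parts_pos ha) _ (by positivity)
  choose C hC using hbd
  have hXb : ∀ᶠ a in l, X a ≤ 2 * ∑ z, C z := by
    filter_upwards [eventually_all.mpr hC] with a ha
    have h1 : X a ≤ ∑ z, (C z + (1 / (2 * (c + 1))) * X a) := Finset.sum_le_sum fun z _ => ha z
    rw [Finset.sum_add_distrib, Finset.sum_const, nsmul_eq_mul, Finset.card_univ, ← hc] at h1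
    have h2 : c * (1 / (2 * (c + 1)) * X a) ≤ 1 / 2 * X a := by
      rw [← mul_assoc]
      refine mul_le_mul_of_nonneg_right ?_ (hX0 a)
      rw [mul_one_div, div_le_div_iff₀ (by positivity) (by norm_num)]
      linarith
    linarith
  exact fun lam mu h1 h2 p1 p2 => ⟨_, hXb.mono fun a ha => (hle lam mu h1 h2 p1 p2 a).trans ha⟩

/-! ### Power sum correlators of the unitary group at large `N` -/

/-- The correlator of `p_λ(x)` and `p_μ(x⁻¹)` over the unitary group. -/
def uniCorr (N : ℕ) (lam mu : Multiset ℕ) : ℂ := unitaryMean (psMon N lam mu : (Fin N → ℂ) → ℂ)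

/-- At `t = q` all the couplings vanish. -/
theorem macCorr_self (N : ℕ) {q : ℂ} (lam mu : Multiset ℕ) : macCorr N q q lam mu = uniCorr N lam mu := by
  unfold macCorr macMean uniCorr
  congr 1
  funext x
  simp [gasWeight, macCoupling]

/-- Rotation of all variables by a common factor. -/
theorem torusMean_dilate {N : ℕ} {F : (Fin N → ℂ) → ℂ} (hF : F ∈ laurentAlg N) {c : ℂ} (hc : c ≠ 0) :
    (fun x => F (c • x)) ∈ laurentAlg N ∧ torusMean (fun x => F (c • x)) = torusMean F := by
  have h : ∀ I : Finset (Fin N), (fun x => F (fun i => if i ∈ I then c * x i else x i)) ∈ laurentAlg N ∧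
      torusMean (fun x => F (fun i => if i ∈ I then c * x i else x i)) = torusMean F := by
    intro I
    induction I using Finset.induction_on with
    | empty => simpa using hF
    | insert j I hj ih =>
      have := torusMean_scale ih.1 j hc
      rw [ih.2] at this
      have e : (fun x : Fin N → ℂ => F (fun i => if i ∈ insert j I then c * x i else x i)) =
          fun x => F (fun i => if i ∈ I then c * (Function.update x j (c * x j)) i
            else (Function.update x j (c * x j)) i) := by
        funext x; congr 1; funext i
        by_cases hij : i = j
        · subst hij; simp [hj]
        · simp [Finset.mem_insert, hij]
      rw [e]
      exact this
  have h1 := h Finset.univ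
  simp only [Finset.mem_univ, if_true] at h1
  exact h1

theorem powerSumProd_smul {N : ℕ} (c : ℂ) (s : Multiset ℕ) (x : Fin N → ℂ) :
    powerSumProd s (c • x) = c ^ s.sum * powerSumProd s x := by
  induction s using Multiset.induction_on with
  | empty => simp [powerSumProd]
  | cons a s ih =>
    rw [powerSumProd_cons, powerSumProd_cons, ih, Multiset.sum_cons, pow_add]
    have : powerSum a (c • x) = c ^ a * powerSum a x := by
      rw [powerSum_eq, powerSum_eq, Finset.mul_sum]
      exact Finset.sum_congr rfl fun i _ => by rw [Pi.smul_apply, smul_eq_mul, mul_pow]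
    rw [this]; ring

/-- By homogeneity, power sums of different degrees are orthogonal. -/
theorem uniCorr_eq_zero {N : ℕ} {lam mu : Multiset ℕ} (h : lam.sum ≠ mu.sum) : uniCorr N lam mu = 0 := by
  have hm : (fun x : Fin N → ℂ => weylDensity x * (psMon N lam mu : (Fin N → ℂ) → ℂ) x) ∈ laurentAlg N :=
    mul_mem_laurentAlg weylDensity_mem (psMon N lam mu).2
  have h1 := (torusMean_dilate hm (c := 2) two_ne_zero).2
  have h2 : (torusMean fun x : Fin N → ℂ => weylDensity ((2 : ℂ) • x) * (psMon N lam mu : (Fin N → ℂ) → ℂ) ((2 : ℂ) • x)) =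
      (2 ^ lam.sum * (2 : ℂ)⁻¹ ^ mu.sum) * torusMean fun x : Fin N → ℂ => weylDensity x * (psMon N lam mu : (Fin N → ℂ) → ℂ) x := by
    rw [← torusMean_const_mul]
    refine torusMean_congr fun θ => ?_
    set x := torusPt θ
    have e1 : weylDensity ((2 : ℂ) • x) = weylDensity x := by
      refine Finset.prod_congr rfl fun ij _ => ?_
      rw [Pi.smul_apply, Pi.smul_apply, smul_eq_mul, smul_eq_mul, mul_div_mul_left _ _ two_ne_zero]
    have e2 : ((2 : ℂ) • x)⁻¹ = (2 : ℂ)⁻¹ • x⁻¹ := by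
      funext i; simp [mul_comm]
    rw [e1, psMon_apply, psMon_apply, e2, powerSumProd_smul, powerSumProd_smul]
    ring
  rw [h1] at h2
  have h3 : (2 : ℂ) ^ lam.sum * (2 : ℂ)⁻¹ ^ mu.sum ≠ 1 := by
    rw [inv_pow]
    intro h4
    have h5 : (2 : ℂ) ^ lam.sum = 2 ^ mu.sum := by
      rwa [mul_inv_eq_one₀ (pow_ne_zero _ two_ne_zero)] at h4
    have h6 : (2 : ℕ) ^ lam.sum = 2 ^ mu.sum := by exact_mod_cast h5
    exact h (Nat.pow_right_injective le_rfl h6)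
  have h4 : (torusMean fun x : Fin N → ℂ => weylDensity x * (psMon N lam mu : (Fin N → ℂ) → ℂ) x) = 0 := by
    by_contra hne
    exact h3 ((mul_eq_right₀ hne).mp h2.symm)
  rw [uniCorr, unitaryMean, h4, mul_zero]

theorem uniCorr_zero (N : ℕ) : uniCorr N 0 0 = 1 := by
  have hq : ‖(1 / 2 : ℂ)‖ < 1 := by norm_num
  have h1 := macMean_one (N := N) (q := 1 / 2) (by norm_num) hq hq
  have h2 := qPoch_eq_prod_mul (1 / 2) hq N
  have h3 : macMean (1 / 2) (1 / 2) (fun _ : Fin N → ℂ => 1) = uniCorr N 0 0 := by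
    rw [← macCorr_self (q := 1 / 2)]
    unfold macCorr
    congr 1
    funext x
    rw [psMon_apply, powerSumProd_zero, powerSumProd_zero, mul_one]
  have hne := qPoch_ne_zero hq hq
  simp only [← pow_succ'] at h1 h2
  rw [h3, mul_right_comm, ← h2] at h1
  exact (mul_eq_left₀ hne).mp h1

theorem tendsto_hSum {α : Type*} {g : Filter α} {c : α → ℕ → ℂ} {c0 : ℕ → ℂ} (hc : ∀ j, Tendsto (fun a => c a j) g (𝓝 (c0 j)))
    (n : ℕ) {X : α → Multiset ℕ → ℂ} {x : Multiset ℕ → ℂ}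
    (hX : ∀ s : Multiset ℕ, s.sum = n → (∀ a ∈ s, 0 < a) → Tendsto (fun a => X a s) g (𝓝 (x s))) :
    Tendsto (fun a => hSum (c a) n (X a)) g (𝓝 (hSum c0 n x)) :=
  hSum_induction (α := Option α) (P := fun f => Tendsto (fun a => f (some a)) g (𝓝 (f none)))
    (c := fun a => a.elim c0 c) (X := fun a => a.elim x X) tendsto_const_nhds (fun _ _ => Tendsto.add)
    (fun z _ hf => hf.const_mul z) (fun j _ hf => (hc j).mul hf) n hX

theorem hSum_zero_coeff (n : ℕ) (X : Multiset ℕ → ℂ) :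
    hSum (fun _ => 0) n X = if n = 0 then X 0 else 0 := by
  cases n with
  | zero => rw [hSum_zero, if_pos rfl]
  | succ n => rw [hSum_succ]; simp

theorem sum_antidiagonal_zero (mu : Multiset ℕ) (X : Multiset ℕ → ℂ) :
    (mu.antidiagonal.map fun r => if r.2 = 0 then X r.1 else 0).sum = X mu := by
  induction mu using Multiset.induction_on generalizing X with
  | empty => simp
  | cons b mu ih =>
    rw [Multiset.antidiagonal_cons, Multiset.map_add, Multiset.sum_add, Multiset.map_map, Multiset.map_map]
    simp [ih fun s => X (b ::ₘ s)]

theorem sum_antidiagonal_singleton (m : ℕ) (mu : Multiset ℕ) (X : Multiset ℕ → ℂ) :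
    (mu.antidiagonal.map fun r => if r.2 = {m} then X r.1 else 0).sum = mu.count m * X (mu.erase m) := by
  induction mu using Multiset.induction_on generalizing X with
  | empty => simp
  | cons b mu ih =>
    rw [Multiset.antidiagonal_cons, Multiset.map_add, Multiset.sum_add, Multiset.map_map, Multiset.map_map]
    have h2 := ih fun s => X (b ::ₘ s)
    simp only [Function.comp_def, Prod.map_fst, Prod.map_snd, id] at h2 ⊢
    rw [h2]
    by_cases hb : b = m
    · subst hb
      have h1 := sum_antidiagonal_zero mu X
      have h3 : ∀ s : Multiset ℕ, b ::ₘ s = {b} ↔ s = 0 := fun s => by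
        rw [← Multiset.cons_zero, Multiset.cons_inj_right]
      simp only [h3, Multiset.count_cons_self, Multiset.erase_cons_head] at h1 ⊢
      rw [h1]
      by_cases hc : mu.count b = 0
      · simp [hc]
      · have hmem : b ∈ mu := Multiset.count_pos.mp (Nat.pos_of_ne_zero hc)
        rw [Multiset.cons_erase hmem]
        push_cast; ring
    · have h3 : ∀ s : Multiset ℕ, ¬ b ::ₘ s = {m} := fun s h => by
        have : b ∈ ({m} : Multiset ℕ) := h ▸ Multiset.mem_cons_self b s
        exact hb (Multiset.mem_singleton.mp this)
      simp [h3, Multiset.count_cons_of_ne (Ne.symm hb), Multiset.erase_cons_tail _ hb]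

/-- `z_s = ∏ᵢ i^{mᵢ} mᵢ!` for the multiset `s` with multiplicities `mᵢ`. -/
def zMulti (s : Multiset ℕ) : ℕ := ∏ i ∈ s.toFinset, i ^ s.count i * (s.count i).factorial

theorem zMulti_cons (m : ℕ) (s : Multiset ℕ) : zMulti (m ::ₘ s) = m * (s.count m + 1) * zMulti s := by
  have hz : ∀ (r : Multiset ℕ) (I : Finset ℕ), r.toFinset ⊆ I →
      zMulti r = ∏ i ∈ I, i ^ r.count i * (r.count i).factorial := fun r I hI => by
    refine Finset.prod_subset hI fun i _ hi => ?_
    have : r.count i = 0 := Multiset.count_eq_zero.mpr fun h => hi (Multiset.mem_toFinset.mpr h)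
    simp [this]
  have hsub : s.toFinset ⊆ (m ::ₘ s).toFinset := Multiset.toFinset_subset.mpr (Multiset.subset_cons s m)
  have hm : m ∈ (m ::ₘ s).toFinset := Multiset.mem_toFinset.mpr (Multiset.mem_cons_self m s)
  rw [hz s _ hsub, zMulti, ← Finset.mul_prod_erase _ _ hm,
    ← Finset.mul_prod_erase _ (fun i => i ^ s.count i * (s.count i).factorial) hm, ← mul_assoc]
  congr 1
  · rw [Multiset.count_cons_self, pow_succ, Nat.factorial_succ]; ring
  · exact Finset.prod_congr rfl fun i hi => by rw [Multiset.count_cons_of_ne (Finset.ne_of_mem_erase hi)]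

theorem tendsto_one_sub_pow_div (j : ℕ) :
    Tendsto (fun r : ℝ => (1 - (r : ℂ) ^ j) / (1 - r)) (𝓝[<] 1) (𝓝 j) := by
  have h1 : Tendsto (fun r : ℝ => ∑ i ∈ Finset.range j, (r : ℂ) ^ i) (𝓝[<] 1) (𝓝 j) := by
    have : Continuous fun r : ℝ => ∑ i ∈ Finset.range j, (r : ℂ) ^ i := by fun_prop
    have h := (this.tendsto 1).mono_left (nhdsWithin_le_nhds (s := Set.Iio 1))
    simpa using h
  refine h1.congr' ?_
  filter_upwards [self_mem_nhdsWithin] with r hr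
  have hr1 : (1 : ℂ) - r ≠ 0 := by
    rw [sub_ne_zero]; exact_mod_cast (ne_of_lt hr).symm
  rw [eq_div_iff hr1, mul_comm, mul_neg_geom_sum]

theorem shiftCoeff_cons (z : ℂ) (b : ℕ) (s : Multiset ℕ) : shiftCoeff z (b ::ₘ s) = (z ^ b - 1) * shiftCoeff z s := by
  simp [shiftCoeff]

theorem shiftCoeff_one (s : Multiset ℕ) : shiftCoeff 1 s = if s = 0 then 1 else 0 := by
  induction s using Multiset.induction_on with
  | empty => simp [shiftCoeff]
  | cons b s _ => simp [shiftCoeff_cons]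

theorem tendsto_shiftCoeff {α : Type*} {g : Filter α} {z : α → ℂ} {w : ℂ} (hz : Tendsto z g (𝓝 w)) (s : Multiset ℕ) :
    Tendsto (fun a => shiftCoeff (z a) s) g (𝓝 (shiftCoeff w s)) := by
  have : Continuous fun z => shiftCoeff z s := by
    unfold shiftCoeff
    exact continuous_multiset_prod s fun a _ => by fun_prop
  exact (this.tendsto w).comp hz

/-- The limit `N → ∞` of `loopTerm` at `t = q`. -/
def limitTerm (u : Multiset ℕ → Multiset ℕ → ℂ) (q : ℂ) (a s : ℕ) (σ τ : Multiset ℕ) : ℂ :=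
  if a < s then hSum (fun j => 1 - q ^ j) (s - a) fun ν => u σ (ν + τ) else if a = s then u σ τ else 0

theorem forall_mem_add {s σ : Multiset ℕ} (hs : ∀ a ∈ s, 0 < a) (hσ : ∀ a ∈ σ, 0 < a) : ∀ a ∈ s + σ, 0 < a :=
  fun a ha => (Multiset.mem_add.mp ha).elim (hs a) (hσ a)

/-- The limit of the loop equations at `t = q`, along a filter along which all the correlators converge. The
correlators do not depend on `q`, which becomes a free parameter. -/
theorem limit_loop {g : Filter ℕ} [g.NeBot] (hg : g ≤ atTop) {u : Multiset ℕ → Multiset ℕ → ℂ}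
    (hu : ∀ lam mu : Multiset ℕ, (∀ a ∈ lam, 0 < a) → (∀ a ∈ mu, 0 < a) →
      Tendsto (fun N => uniCorr N lam mu) g (𝓝 (u lam mu)))
    {m : ℕ} (hm : 1 ≤ m) {lam mu : Multiset ℕ} (hl : ∀ a ∈ lam, 0 < a) (hmu : ∀ a ∈ mu, 0 < a)
    {q : ℂ} (hq0 : q ≠ 0) (hq : ‖q‖ < 1) : hSum (fun j => 1 - q ^ j) m (fun s => u (s + lam) mu) =
      q ^ m * (lam.antidiagonal.map fun p => (mu.antidiagonal.map fun r =>
        (shiftCoeff q p.2 * shiftCoeff q⁻¹ r.2) * limitTerm u q (m + p.2.sum) r.2.sum p.1 r.1).sum).sum := by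
  have h1 : Tendsto (fun N => hSum (fun j => 1 - q ^ j) m fun s => uniCorr N (s + lam) mu) g
      (𝓝 (hSum (fun j => 1 - q ^ j) m fun s => u (s + lam) mu)) :=
    tendsto_hSum (c := fun _ j => 1 - q ^ j) (c0 := fun j => 1 - q ^ j) (fun _ => tendsto_const_nhds) m
      fun s _ hs => hu _ _ (forall_mem_add hs hl) hmu
  have h2 : Tendsto (fun N => loopRHS N q q m (uniCorr N) lam mu) g (𝓝 (q ^ m * (lam.antidiagonal.map fun p =>
      (mu.antidiagonal.map fun r => (shiftCoeff q p.2 * shiftCoeff q⁻¹ r.2) *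
        limitTerm u q (m + p.2.sum) r.2.sum p.1 r.1).sum).sum)) := by
    unfold loopRHS
    simp only [smul_eq_mul]
    refine Tendsto.const_mul _ (tendsto_multiset_sum _ fun p hp => tendsto_multiset_sum _ fun r hr =>
      Tendsto.const_mul _ ?_)
    have hp1 : ∀ a ∈ p.1, 0 < a := fun a ha => hl a (Multiset.mem_antidiagonal.mp hp ▸ Multiset.mem_add.mpr (Or.inl ha))
    have hr1 : ∀ a ∈ r.1, 0 < a := fun a ha => hmu a (Multiset.mem_antidiagonal.mp hr ▸ Multiset.mem_add.mpr (Or.inl ha))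
    unfold limitTerm loopTerm
    split_ifs with c1 c2
    · exact tendsto_hSum (c := fun _ j => 1 - q ^ j) (fun _ => tendsto_const_nhds) _ fun ν _ hν => hu _ _ hp1 (forall_mem_add hν hr1)
    · have hN : Tendsto (fun N => 1 - q ^ N) g (𝓝 (1 - 0)) :=
        ((tendsto_pow_atTop_nhds_zero_of_norm_lt_one hq).mono_left hg).const_sub 1
      simpa using hN.smul (hu _ _ hp1 hr1)
    · have hN : Tendsto (fun N => q ^ (N - (m + p.2.sum - r.2.sum))) g (𝓝 0) :=
        ((tendsto_pow_atTop_nhds_zero_of_norm_lt_one hq).comp (tendsto_sub_atTop_nat _)).mono_left hg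
      have hX := tendsto_hSum (g := g) (c := fun _ j => q ^ j - 1) (fun _ => tendsto_const_nhds) (m + p.2.sum - r.2.sum)
        (X := fun N ν => uniCorr N (ν + p.1) r.1) fun ν _ hν => hu _ _ (forall_mem_add hν hp1) hr1
      simpa using (hN.smul hX).neg
  refine tendsto_nhds_unique h1 (h2.congr' ?_)
  filter_upwards [hg (eventually_ge_atTop (m + lam.sum))] with N hN
  have h3 := loop_macCorr hq0 hq hq hm lam mu hN
  have hM : macCorr N q q = uniCorr N := funext₂ fun l r => macCorr_self N l r
  rw [hM] at h3
  exact h3.symm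

theorem tendsto_ofReal_one : Tendsto (fun r : ℝ => (r : ℂ)) (𝓝[<] 1) (𝓝 1) := by
  have := (Complex.continuous_ofReal.tendsto 1).mono_left (nhdsWithin_le_nhds (s := Set.Iio (1 : ℝ)))
  simpa using this

theorem tendsto_one_sub_pow (j : ℕ) : Tendsto (fun r : ℝ => 1 - (r : ℂ) ^ j) (𝓝[<] 1) (𝓝 0) := by
  simpa using (tendsto_ofReal_one.pow j).const_sub 1

theorem tendsto_hSum_div (X : Multiset ℕ → ℂ) {m : ℕ} (hm : 1 ≤ m) :
    Tendsto (fun r : ℝ => (1 - (r : ℂ))⁻¹ * hSum (fun j => 1 - (r : ℂ) ^ j) m X) (𝓝[<] 1) (𝓝 (X {m})) := by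
  obtain ⟨n, rfl⟩ : ∃ n, m = n + 1 := ⟨m - 1, by omega⟩
  have hn : ((n : ℂ) + 1) ≠ 0 := by exact_mod_cast n.succ_ne_zero
  have h := Tendsto.const_mul ((n : ℂ) + 1)⁻¹ (tendsto_finsetSum (Finset.range (n + 1)) fun j _ =>
    (tendsto_one_sub_pow_div (j + 1)).mul (tendsto_hSum (g := 𝓝[<] (1 : ℝ)) tendsto_one_sub_pow (n - j)
      (X := fun _ s => X ((j + 1) ::ₘ s)) fun s _ _ => tendsto_const_nhds))
  simp only [hSum_zero_coeff] at h
  rw [Finset.sum_range_succ, Finset.sum_eq_zero, zero_add, Nat.sub_self, if_pos rfl, Nat.cast_add, Nat.cast_one,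
    inv_mul_cancel_left₀ hn] at h
  · refine h.congr fun r => ?_
    rw [hSum_succ, smul_eq_mul, mul_left_comm]
    congr 1
    rw [Finset.mul_sum]
    refine Finset.sum_congr rfl fun j _ => ?_
    rw [smul_eq_mul, div_eq_mul_inv]
    ring
  · intro j hj
    rw [if_neg (by have := Finset.mem_range.mp hj; omega), mul_zero]

theorem tendsto_limitTerm (u : Multiset ℕ → Multiset ℕ → ℂ) (a s : ℕ) (σ τ : Multiset ℕ) :
    Tendsto (fun r : ℝ => limitTerm u r a s σ τ) (𝓝[<] 1) (𝓝 (if a = s then u σ τ else 0)) := by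
  unfold limitTerm
  split_ifs with c1 c2 c2
  · omega
  · have := tendsto_hSum (g := 𝓝[<] (1 : ℝ)) tendsto_one_sub_pow (s - a) (X := fun _ ν => u σ (ν + τ))
      fun s _ _ => tendsto_const_nhds
    rwa [hSum_zero_coeff, if_neg (by omega)] at this
  · exact tendsto_const_nhds
  · exact tendsto_const_nhds

/-- After division by `1 - q`, the term of the loop equation in which the shift acts on the factors `p`
of `p_λ` and `s` of `p_{-μ}` survives in the limit `q → 1` only if it acts on a single factor `p_{-m}`. -/
theorem tendsto_loop_term (u : Multiset ℕ → Multiset ℕ → ℂ) {m : ℕ} (hm : 1 ≤ m) (p s : Multiset ℕ × Multiset ℕ) :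
    Tendsto (fun r : ℝ => (1 - (r : ℂ))⁻¹ * ((shiftCoeff r p.2 * shiftCoeff (r : ℂ)⁻¹ s.2) *
      limitTerm u r (m + p.2.sum) s.2.sum p.1 s.1)) (𝓝[<] 1)
      (𝓝 (if p.2 = 0 then (if s.2 = {m} then m * u p.1 s.1 else 0) else 0)) := by
  have hq1 := tendsto_ofReal_one
  have hqi : Tendsto (fun r : ℝ => (r : ℂ)⁻¹) (𝓝[<] 1) (𝓝 1) := by simpa using hq1.inv₀ one_ne_zero
  by_cases hs0 : s.2 = 0
  · rw [hs0, if_neg (Multiset.singleton_ne_zero m).symm, ite_self]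
    refine tendsto_const_nhds.congr fun r => ?_
    rw [limitTerm, if_neg (by simp), if_neg (by simp; omega), mul_zero, mul_zero]
  · obtain ⟨b, hb⟩ := Multiset.exists_mem_of_ne_zero hs0
    obtain ⟨s', hs'⟩ := Multiset.exists_cons_of_mem hb
    have h1 : Tendsto (fun r : ℝ => (1 - (r : ℂ))⁻¹ * ((r : ℂ)⁻¹ ^ b - 1)) (𝓝[<] 1) (𝓝 (1 ^ b * b)) := by
      refine ((hqi.pow b).mul (tendsto_one_sub_pow_div b)).congr' ?_
      filter_upwards [Ioo_mem_nhdsLT (show (0 : ℝ) < 1 by norm_num)] with r hr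
      have hr0 : (r : ℂ) ≠ 0 := by exact_mod_cast hr.1.ne'
      rw [mul_div_assoc', mul_sub, ← mul_pow, inv_mul_cancel₀ hr0, one_pow, mul_one, div_eq_inv_mul]
    have h2 := ((h1.mul (tendsto_shiftCoeff hqi s')).mul (tendsto_shiftCoeff hq1 p.2)).mul
      (tendsto_limitTerm u (m + p.2.sum) s.2.sum p.1 s.1)
    have hval : 1 ^ b * (b : ℂ) * shiftCoeff 1 s' * shiftCoeff 1 p.2 *
        (if m + p.2.sum = s.2.sum then u p.1 s.1 else 0) =
        if p.2 = 0 then (if s.2 = {m} then m * u p.1 s.1 else 0) else 0 := by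
      rw [shiftCoeff_one, shiftCoeff_one]
      by_cases hp : p.2 = 0
      · by_cases hs2 : s' = 0
        · subst hs2
          rw [hs', hp]
          by_cases hbm : b = m
          · simp [hbm]
          · have : ¬ ({b} : Multiset ℕ) = {m} := fun h => hbm (Multiset.singleton_inj.mp h)
            simp [this, Ne.symm hbm]
        · have : s.2 ≠ {m} := by
            rw [hs']
            intro h
            have hc := congrArg Multiset.card h
            rw [Multiset.card_cons, Multiset.card_singleton] at hc
            exact hs2 (Multiset.card_eq_zero.mp (by omega))
          simp [hs2, this]
      · simp [hp]
    rw [hval] at h2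
    refine h2.congr fun r => ?_
    rw [hs', shiftCoeff_cons]
    ring
/-- The recursion for the correlators that the limits `N → ∞`, `q → 1` of the loop equations at `t = q`
give. -/
theorem limit_recursion {g : Filter ℕ} [g.NeBot] (hg : g ≤ atTop) {u : Multiset ℕ → Multiset ℕ → ℂ}
    (hu : ∀ lam mu : Multiset ℕ, (∀ a ∈ lam, 0 < a) → (∀ a ∈ mu, 0 < a) →
      Tendsto (fun N => uniCorr N lam mu) g (𝓝 (u lam mu)))
    {m : ℕ} (hm : 1 ≤ m) {lam mu : Multiset ℕ} (hl : ∀ a ∈ lam, 0 < a) (hmu : ∀ a ∈ mu, 0 < a) :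
    u (m ::ₘ lam) mu = mu.count m * (m * u lam (mu.erase m)) := by
  have hB := (tendsto_ofReal_one.pow m).mul (tendsto_multiset_sum lam.antidiagonal fun p _ =>
    tendsto_multiset_sum mu.antidiagonal fun s _ => tendsto_loop_term u hm p s)
  have hAB := tendsto_nhds_unique (tendsto_hSum_div (fun s => u (s + lam) mu) hm) (hB.congr' (by
    filter_upwards [Ioo_mem_nhdsLT (show (0 : ℝ) < 1 by norm_num)] with r hr
    have hr0 : (r : ℂ) ≠ 0 := by exact_mod_cast hr.1.ne'
    have hr1 : ‖(r : ℂ)‖ < 1 := by rw [Complex.norm_real, Real.norm_of_nonneg hr.1.le]; exact hr.2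
    rw [limit_loop hg hu hm hl hmu hr0 hr1]
    simp only [Multiset.sum_map_mul_left]
    ring))
  rw [Multiset.singleton_add] at hAB
  rw [hAB, one_pow, one_mul]
  have h3 : ∀ p : Multiset ℕ × Multiset ℕ, (mu.antidiagonal.map fun s =>
      if p.2 = 0 then (if s.2 = {m} then (m : ℂ) * u p.1 s.1 else 0) else 0).sum =
      if p.2 = 0 then (mu.count m : ℂ) * (m * u p.1 (mu.erase m)) else 0 := by
    intro p
    split_ifs with hp
    · exact sum_antidiagonal_singleton m mu fun s => m * u p.1 s
    · simp
  simp only [h3]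
  exact sum_antidiagonal_zero lam fun s => (mu.count m : ℂ) * (m * u s (mu.erase m))

/-- Orthogonality of the power sums over the unitary group in the limit `N → ∞`. The correlators are
bounded, so that they converge along every ultrafilter, and the recursion determines the limits. -/
theorem tendsto_uniCorr (lam mu : Multiset ℕ) (hl : ∀ a ∈ lam, 0 < a) (hmu : ∀ a ∈ mu, 0 < a) :
    Tendsto (fun N => uniCorr N lam mu) atTop (𝓝 (if lam = mu then (zMulti lam : ℂ) else 0)) := by
  rw [tendsto_iff_ultrafilter]
  intro g hg
  have hex : ∀ lam mu : Multiset ℕ, ∃ u, (∀ a ∈ lam, 0 < a) → (∀ a ∈ mu, 0 < a) →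
      Tendsto (fun N => uniCorr N lam mu) g (𝓝 u) := by
    intro lam mu
    by_cases hpos : (∀ a ∈ lam, 0 < a) ∧ (∀ a ∈ mu, 0 < a)
    · have hbdd : ∃ C : ℝ, ∀ᶠ N in (atTop : Filter ℕ), ‖uniCorr N lam mu‖ ≤ C := by
        by_cases hsum : lam.sum = mu.sum
        · obtain ⟨C, hC⟩ := exists_macCorr_le (ε := 1 / 2) (ρ := 1 / 2) (by norm_num) (by norm_num) (by norm_num)
            mu.sum lam mu hsum rfl hpos.1 hpos.2
          have ht : Tendsto (fun N : ℕ => (N, (1 / 2 : ℂ), (1 / 2 : ℂ))) atTop (paramFilter (1 / 2) (1 / 2)) := by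
            refine tendsto_id.prodMk (tendsto_principal.mpr (Eventually.of_forall fun N => ?_))
            norm_num
          refine ⟨C, (ht.eventually hC).mono fun N hN => ?_⟩
          simpa only [macCorr_self] using hN
        · exact ⟨0, Eventually.of_forall fun N => by rw [uniCorr_eq_zero hsum, norm_zero]⟩
      obtain ⟨C, hC⟩ := hbdd
      have hle : (Filter.map (fun N => uniCorr N lam mu) g) ≤ 𝓟 (Metric.closedBall 0 C) := by
        rw [le_principal_iff, Filter.mem_map]
        filter_upwards [hg hC] with N hN
        simpa using hN
      obtain ⟨u, -, hu⟩ := (isCompact_closedBall (0 : ℂ) C).ultrafilter_le_nhds (g.map fun N => uniCorr N lam mu) hle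
      exact ⟨u, fun _ _ => hu⟩
    · exact ⟨0, fun h1 h2 => absurd ⟨h1, h2⟩ hpos⟩
  choose u hu using hex
  have hrec := fun {m : ℕ} (hm : 1 ≤ m) {lam mu : Multiset ℕ} (h1 : ∀ a ∈ lam, 0 < a) (h2 : ∀ a ∈ mu, 0 < a) =>
    limit_recursion (g := (g : Filter ℕ)) hg (u := u) hu hm h1 h2
  have hval : ∀ lam mu : Multiset ℕ, (∀ a ∈ lam, 0 < a) → (∀ a ∈ mu, 0 < a) →
      u lam mu = if lam = mu then (zMulti lam : ℂ) else 0 := by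
    intro lam
    induction lam using Multiset.induction_on with
    | empty =>
      intro mu h1 h2
      by_cases hmu : mu = 0
      · subst hmu
        rw [if_pos rfl]
        refine tendsto_nhds_unique (hu 0 0 h1 h2) ?_
        simp [uniCorr_zero, zMulti]
      · rw [if_neg (Ne.symm hmu)]
        refine tendsto_nhds_unique (hu 0 mu h1 h2) ?_
        have hs : (0 : Multiset ℕ).sum ≠ mu.sum := by
          obtain ⟨b, hb⟩ := Multiset.exists_mem_of_ne_zero hmu
          have := Multiset.single_le_sum (fun _ _ => Nat.zero_le _) b hb
          have := h2 b hb
          rw [Multiset.sum_zero]; omega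
        simp [uniCorr_eq_zero hs]
    | cons m lam ih =>
      intro mu h1 h2
      have h1' : ∀ a ∈ lam, 0 < a := fun a ha => h1 a (Multiset.mem_cons_of_mem ha)
      rw [hrec (h1 m (Multiset.mem_cons_self _ _)) h1' h2, ih (mu.erase m) h1' fun a ha => h2 a (Multiset.mem_of_mem_erase ha)]
      by_cases hm : m ∈ mu
      · obtain ⟨mu', rfl⟩ := Multiset.exists_cons_of_mem hm
        rw [Multiset.erase_cons_head]
        by_cases he : lam = mu'
        · subst he
          rw [if_pos rfl, if_pos rfl, zMulti_cons, Multiset.count_cons_self]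
          push_cast; ring
        · rw [if_neg he, if_neg fun h => he ((Multiset.cons_inj_right m).mp h)]; simp
      · rw [Multiset.count_eq_zero_of_notMem hm, if_neg fun h : m ::ₘ lam = mu => hm (h ▸ Multiset.mem_cons_self _ _)]
        simp
  rw [← hval lam mu hl hmu]
  exact hu lam mu hl hmu

/-! ### Monotonicity in `N` of the norms of power sums -/

section monotone
open MvPolynomial
variable {N : ℕ}

/-- The product of `p_s` and the Vandermonde determinant, an alternating polynomial. -/
def altPoly (N : ℕ) (s : Multiset ℕ) : MvPolynomial (Fin N) ℝ :=
  (s.map (psum (Fin N) ℝ)).prod * (Matrix.vandermonde (X : Fin N → MvPolynomial (Fin N) ℝ)).det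

/-- The sum of the squares of the coefficients. -/
def coeffNormSq (F : MvPolynomial (Fin N) ℝ) : ℝ := ∑ a ∈ F.support, F.coeff a ^ 2

theorem torusMean_real (F G : MvPolynomial (Fin N) ℝ) :
    torusMean (fun x => eval₂ Complex.ofRealHom x F * eval₂ Complex.ofRealHom x⁻¹ G) =
      ((∑ a ∈ F.support, F.coeff a * G.coeff a : ℝ) : ℂ) := by
  have h := torusMean_eval_mul_eval_inv (map Complex.ofRealHom F) (map Complex.ofRealHom G)
  simp only [eval_map] at h
  rw [h, support_map_of_injective _ Complex.ofRealHom.injective]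
  simp [coeff_map]

theorem weylDensity_eq {x : Fin N → ℂ} (h0 : ∀ i, x i ≠ 0) :
    weylDensity x = (Matrix.vandermonde x).det * (Matrix.vandermonde x⁻¹).det := by
  rw [weylDensity, prod_offDiag_eq fun i j => 1 - x i / x j, Matrix.det_vandermonde, Matrix.det_vandermonde,
    ← Finset.prod_mul_distrib]
  refine Finset.prod_congr rfl fun i _ => ?_
  rw [← Finset.prod_mul_distrib]
  refine Finset.prod_congr rfl fun j _ => ?_
  have hi := h0 i
  have hj := h0 j
  rw [Pi.inv_apply, Pi.inv_apply]
  field_simp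

theorem eval₂_altPoly (s : Multiset ℕ) (x : Fin N → ℂ) :
    eval₂ Complex.ofRealHom x (altPoly N s) = powerSumProd s x * (Matrix.vandermonde x).det := by
  rw [altPoly, eval₂_mul, Matrix.det_vandermonde, Matrix.det_vandermonde]
  congr 1
  · rw [← coe_eval₂Hom, map_multiset_prod, Multiset.map_map, powerSumProd]
    congr 1
    refine Multiset.map_congr rfl fun a _ => ?_
    simp [psum, powerSum]
  · rw [← coe_eval₂Hom, map_prod]
    refine Finset.prod_congr rfl fun i _ => ?_
    rw [map_prod]
    simp

theorem uniCorr_eq_sum_coeff (lam mu : Multiset ℕ) : uniCorr N lam mu =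
    (((N.factorial : ℝ)⁻¹ * ∑ a ∈ (altPoly N lam).support, (altPoly N lam).coeff a * (altPoly N mu).coeff a : ℝ) : ℂ) := by
  rw [Complex.ofReal_mul, ← torusMean_real, uniCorr, unitaryMean]
  push_cast
  congr 1
  refine torusMean_congr fun θ => ?_
  rw [eval₂_altPoly, eval₂_altPoly, weylDensity_eq (torusPt_ne_zero θ), psMon_apply]
  ring

theorem rename_swap_altPoly {i j : Fin N} (h : i ≠ j) (s : Multiset ℕ) :
    rename (Equiv.swap i j) (altPoly N s) = -altPoly N s := by
  rw [altPoly, map_mul, ← mul_neg]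
  congr 1
  · rw [map_multiset_prod, Multiset.map_map]
    congr 1
    exact Multiset.map_congr rfl fun a _ => rename_psum (Fin N) ℝ a _
  · rw [AlgHom.map_det]
    have : (rename (Equiv.swap i j)).mapMatrix (Matrix.vandermonde (X : Fin N → MvPolynomial (Fin N) ℝ)) =
        (Matrix.vandermonde X).submatrix (Equiv.swap i j) id := by
      ext1 a b
      simp [Matrix.vandermonde]
    rw [this, Matrix.det_permute, Equiv.Perm.sign_swap h]
    simp

theorem coeff_swap_altPoly {i j : Fin N} (h : i ≠ j) (s : Multiset ℕ) (a : Fin N →₀ ℕ) :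
    (altPoly N s).coeff (a.mapDomain (Equiv.swap i j)) = -(altPoly N s).coeff a := by
  have h1 := coeff_rename_mapDomain (Equiv.swap i j) (Equiv.injective _) (altPoly N s) a
  rw [rename_swap_altPoly h, coeff_neg] at h1
  linarith

theorem coeff_altPoly_eq_zero {i j : Fin N} (h : i ≠ j) (s : Multiset ℕ) {a : Fin N →₀ ℕ} (ha : a i = a j) :
    (altPoly N s).coeff a = 0 := by
  have h1 : a.mapDomain (Equiv.swap i j) = a := by
    ext k
    rw [← Finsupp.equivMapDomain_eq_mapDomain, Finsupp.equivMapDomain_apply, Equiv.symm_swap]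
    rcases eq_or_ne k i with rfl | hki
    · rw [Equiv.swap_apply_left, ha]
    rcases eq_or_ne k j with rfl | hkj
    · rw [Equiv.swap_apply_right, ha]
    · rw [Equiv.swap_apply_of_ne_of_ne hki hkj]
  have h2 := coeff_swap_altPoly h s a
  rw [h1] at h2
  linarith

theorem sum_coeff_sq_eq (s : Multiset ℕ) (i : Fin (N + 1)) :
    ∑ a ∈ (altPoly (N + 1) s).support with a i = 0, (altPoly (N + 1) s).coeff a ^ 2 =
      ∑ a ∈ (altPoly (N + 1) s).support with a 0 = 0, (altPoly (N + 1) s).coeff a ^ 2 := by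
  rcases eq_or_ne 0 i with rfl | hi
  · rfl
  have happ : ∀ (a : Fin (N + 1) →₀ ℕ) k, a.mapDomain (Equiv.swap 0 i) k = a (Equiv.swap 0 i k) := fun a k => by
    rw [← Finsupp.equivMapDomain_eq_mapDomain, Finsupp.equivMapDomain_apply, Equiv.symm_swap]
  have hinv : ∀ a : Fin (N + 1) →₀ ℕ, (a.mapDomain (Equiv.swap 0 i)).mapDomain (Equiv.swap 0 i) = a := fun a => by
    ext k; rw [happ, happ, Equiv.swap_apply_self]
  refine Finset.sum_nbij' (fun a => a.mapDomain (Equiv.swap 0 i)) (fun a => a.mapDomain (Equiv.swap 0 i)) ?_ ?_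
    (fun a _ => hinv a) (fun a _ => hinv a) ?_
  · intro a ha
    simp only [Finset.mem_filter, mem_support_iff] at ha ⊢
    rw [coeff_swap_altPoly hi, happ, Equiv.swap_apply_left]
    exact ⟨neg_ne_zero.mpr ha.1, ha.2⟩
  · intro a ha
    simp only [Finset.mem_filter, mem_support_iff] at ha ⊢
    rw [coeff_swap_altPoly hi, happ, Equiv.swap_apply_right]
    exact ⟨neg_ne_zero.mpr ha.1, ha.2⟩
  · intro a _
    rw [coeff_swap_altPoly hi, neg_sq]

theorem map_altPoly (ψ : MvPolynomial (Fin (N + 1)) ℝ →+* MvPolynomial (Fin N) ℝ) (h0 : ψ (X 0) = 0)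
    (h1 : ∀ j : Fin N, ψ (X j.succ) = X j) {s : Multiset ℕ} (hs : ∀ a ∈ s, 0 < a) :
    ψ (altPoly (N + 1) s) = (∏ j, X j) * altPoly N s := by
  have e1 : ψ (s.map (psum (Fin (N + 1)) ℝ)).prod = (s.map (psum (Fin N) ℝ)).prod := by
    rw [map_multiset_prod, Multiset.map_map]
    congr 1
    refine Multiset.map_congr rfl fun a ha => ?_
    rw [Function.comp_apply, psum, Fin.sum_univ_succ, map_add, map_pow, h0, zero_pow (hs a ha).ne', zero_add,
      map_sum, psum]
    simp only [map_pow, h1]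
  have e2 : ψ (Matrix.vandermonde (X : Fin (N + 1) → MvPolynomial (Fin (N + 1)) ℝ)).det =
      (∏ j, X j) * (Matrix.vandermonde (X : Fin N → MvPolynomial (Fin N) ℝ)).det := by
    rw [Matrix.det_vandermonde, Matrix.det_vandermonde, map_prod, Fin.prod_univ_succ, Fin.prod_Ioi_zero]
    simp only [map_prod, map_sub, Fin.prod_Ioi_succ, h0, h1, sub_zero]
  unfold altPoly
  rw [map_mul, e1, e2, mul_left_comm]

/-- Setting the first variable of the alternating polynomial to zero. -/
theorem constantCoeff_finSuccEquiv_altPoly {s : Multiset ℕ} (hs : ∀ a ∈ s, 0 < a) :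
    (finSuccEquiv ℝ N (altPoly (N + 1) s)).coeff 0 = (∏ j, X j) * altPoly N s :=
  map_altPoly (Polynomial.constantCoeff.comp (RingHomClass.toRingHom (finSuccEquiv ℝ N)))
    (by simp [finSuccEquiv_X_zero]) (fun j => by simp [finSuccEquiv_X_succ]) hs

/-- Multiplication by `∏ⱼ Xⱼ` moves the coefficients without changing them. -/
theorem sum_coeff_sq_zero {s : Multiset ℕ} (hs : ∀ a ∈ s, 0 < a) :
    ∑ a ∈ (altPoly (N + 1) s).support with a 0 = 0, (altPoly (N + 1) s).coeff a ^ 2 =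
      coeffNormSq (altPoly N s) := by
  have h1 : coeffNormSq ((∏ j, X j) * altPoly N s) = coeffNormSq (altPoly N s) := by
    have e1 := torusMean_real ((∏ j, X j) * altPoly N s) ((∏ j, X j) * altPoly N s)
    have e2 := torusMean_real (altPoly N s) (altPoly N s)
    have e3 : (torusMean fun x : Fin N → ℂ => eval₂ Complex.ofRealHom x ((∏ j, X j) * altPoly N s) *
        eval₂ Complex.ofRealHom x⁻¹ ((∏ j, X j) * altPoly N s)) = torusMean fun x : Fin N → ℂ =>
        eval₂ Complex.ofRealHom x (altPoly N s) * eval₂ Complex.ofRealHom x⁻¹ (altPoly N s) := by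
      refine torusMean_congr fun θ => ?_
      have hp : (∏ j, torusPt θ j) ≠ 0 := Finset.prod_ne_zero_iff.mpr fun j _ => torusPt_ne_zero θ j
      have hprod : ∀ x : Fin N → ℂ, eval₂ Complex.ofRealHom x (∏ j : Fin N, (X j : MvPolynomial (Fin N) ℝ)) = ∏ j, x j :=
        fun x => by rw [← coe_eval₂Hom, map_prod]; simp
      rw [eval₂_mul, eval₂_mul, hprod, hprod]
      have : ∏ j, (torusPt θ)⁻¹ j = (∏ j, torusPt θ j)⁻¹ := by simp
      rw [this]
      field_simp
    rw [e1, e2] at e3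
    unfold coeffNormSq
    simp only [pow_two]
    exact_mod_cast e3
  rw [← h1, ← constantCoeff_finSuccEquiv_altPoly hs]
  unfold coeffNormSq
  simp only [finSuccEquiv_coeff_coeff]
  refine Finset.sum_nbij' (fun a => a.tail) (fun b => b.cons 0) ?_ ?_ ?_ ?_ ?_
  · intro a ha
    simp only [Finset.mem_filter, mem_support_iff] at ha ⊢
    rw [finSuccEquiv_coeff_coeff, ← ha.2, Finsupp.cons_tail]
    exact ha.1
  · intro b hb
    rw [mem_support_iff, finSuccEquiv_coeff_coeff] at hb
    simpa [mem_support_iff] using hb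
  · intro a ha
    simp only [Finset.mem_filter, mem_support_iff] at ha
    rw [← ha.2, Finsupp.cons_tail]
  · intro b _
    exact Finsupp.tail_cons 0 b
  · intro a ha
    simp only [Finset.mem_filter, mem_support_iff] at ha
    simp only [← ha.2, Finsupp.cons_tail]

/-- Two entries of an exponent of an alternating polynomial are different, so at most one of them vanishes.
The terms in which a given entry vanishes are accounted for by the alternating polynomial in one variable less. -/
theorem coeffNormSq_succ {s : Multiset ℕ} (hs : ∀ a ∈ s, 0 < a) :
    ((N + 1 : ℕ) : ℝ) * coeffNormSq (altPoly N s) ≤ coeffNormSq (altPoly (N + 1) s) := by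
  have h1 : ((N + 1 : ℕ) : ℝ) * coeffNormSq (altPoly N s) =
      ∑ i : Fin (N + 1), ∑ a ∈ (altPoly (N + 1) s).support with a i = 0, (altPoly (N + 1) s).coeff a ^ 2 := by
    simp only [sum_coeff_sq_eq, sum_coeff_sq_zero hs]
    simp
  rw [h1]
  simp only [Finset.sum_filter]
  rw [Finset.sum_comm]
  refine Finset.sum_le_sum fun a ha => ?_
  by_cases h : ∃ i, a i = 0
  · obtain ⟨i, hi⟩ := h
    rw [Finset.sum_eq_single i, if_pos hi]
    · intro j _ hj
      rw [if_neg]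
      intro hj0
      exact (mem_support_iff.mp ha) (coeff_altPoly_eq_zero hj s (hj0.trans hi.symm))
    · simp
  · push Not at h
    simp only [h, if_false, Finset.sum_const_zero]
    positivity

/-- The norm of `p_s` over the unitary group. -/
def uniNorm (N : ℕ) (s : Multiset ℕ) : ℝ := (N.factorial : ℝ)⁻¹ * coeffNormSq (altPoly N s)

theorem uniCorr_eq_uniNorm (s : Multiset ℕ) : uniCorr N s s = uniNorm N s := by
  rw [uniCorr_eq_sum_coeff, uniNorm, coeffNormSq]
  simp only [pow_two]

theorem monotone_uniNorm {s : Multiset ℕ} (hs : ∀ a ∈ s, 0 < a) : Monotone fun N => uniNorm N s := by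
  refine monotone_nat_of_le_succ fun N => ?_
  unfold uniNorm
  have h := coeffNormSq_succ (N := N) hs
  have hN : (0 : ℝ) < N.factorial := by exact_mod_cast N.factorial_pos
  have hN1 : (0 : ℝ) < (N + 1).factorial := by exact_mod_cast (N + 1).factorial_pos
  rw [inv_mul_le_iff₀ hN, ← mul_assoc, Nat.factorial_succ]
  push_cast at h ⊢
  have hN' : ((N : ℝ) + 1) ≠ 0 := by positivity
  field_simp
  linarith

/-- At finite `N` the norm of a power sum is at most its limit. -/
theorem uniNorm_le {s : Multiset ℕ} (hs : ∀ a ∈ s, 0 < a) (N : ℕ) : uniNorm N s ≤ zMulti s := by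
  refine (monotone_uniNorm hs).ge_of_tendsto ?_ N
  have h := tendsto_uniCorr s s hs hs
  rw [if_pos rfl] at h
  simp only [uniCorr_eq_uniNorm] at h
  simpa [Function.comp_def] using (Complex.continuous_re.tendsto _).comp h

/-- Bound on the correlators that is uniform in `N`, by `2 |a b| ≤ a² + b²` for the coefficients. -/
theorem norm_uniCorr_le {lam mu : Multiset ℕ} (hl : ∀ a ∈ lam, 0 < a) (hmu : ∀ a ∈ mu, 0 < a) (N : ℕ) :
    ‖uniCorr N lam mu‖ ≤ (zMulti lam + zMulti mu : ℝ) / 2 := by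
  have h1 := uniNorm_le hl N
  have h2 := uniNorm_le hmu N
  have hN : (0 : ℝ) ≤ (N.factorial : ℝ)⁻¹ := by positivity
  have h3 : |∑ a ∈ (altPoly N lam).support, (altPoly N lam).coeff a * (altPoly N mu).coeff a| ≤
      (coeffNormSq (altPoly N lam) + coeffNormSq (altPoly N mu)) / 2 := by
    refine (Finset.abs_sum_le_sum_abs _ _).trans ?_
    have h4 : ∑ a ∈ (altPoly N lam).support, (altPoly N mu).coeff a ^ 2 ≤ coeffNormSq (altPoly N mu) := by
      unfold coeffNormSq
      refine (Finset.sum_le_sum_of_subset_of_nonneg Finset.subset_union_left fun _ _ _ => sq_nonneg _).trans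
        (le_of_eq (Finset.sum_subset (Finset.subset_union_right (s₁ := (altPoly N lam).support))
          fun a _ ha => ?_).symm)
      rw [notMem_support_iff.mp ha]; norm_num
    have h5 : ∑ a ∈ (altPoly N lam).support, |(altPoly N lam).coeff a * (altPoly N mu).coeff a| ≤
        ∑ a ∈ (altPoly N lam).support, ((altPoly N lam).coeff a ^ 2 + (altPoly N mu).coeff a ^ 2) / 2 := by
      refine Finset.sum_le_sum fun a _ => ?_
      rw [abs_mul, ← sq_abs ((altPoly N lam).coeff a), ← sq_abs ((altPoly N mu).coeff a)]
      nlinarith [sq_nonneg (|(altPoly N lam).coeff a| - |(altPoly N mu).coeff a|)]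
    rw [← Finset.sum_div, Finset.sum_add_distrib] at h5
    unfold coeffNormSq at h4 ⊢
    linarith
  rw [uniCorr_eq_sum_coeff, Complex.norm_real, Real.norm_eq_abs, abs_mul, abs_of_nonneg hN]
  refine (mul_le_mul_of_nonneg_left h3 hN).trans ?_
  unfold uniNorm at h1 h2
  linarith

end monotone

/-! ### Partitions as multiplicity functions -/

/-- The multiset of parts in which the part `n + 1` has multiplicity `κ n`. -/
def partMulti (κ : ℕ →₀ ℕ) : Multiset ℕ := (Finsupp.toMultiset κ).map Nat.succ

theorem partMulti_add (κ l : ℕ →₀ ℕ) : partMulti (κ + l) = partMulti κ + partMulti l := by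
  simp [partMulti]

theorem partMulti_injective : Function.Injective partMulti :=
  (Multiset.map_injective Nat.succ_injective).comp (Multiset.toFinsupp (α := ℕ)).symm.injective

theorem pos_of_mem_partMulti (κ : ℕ →₀ ℕ) : ∀ a ∈ partMulti κ, 0 < a := fun a ha => by
  obtain ⟨n, _, rfl⟩ := Multiset.mem_map.mp ha
  exact Nat.succ_pos n

theorem exists_partMulti {s : Multiset ℕ} (hs : ∀ a ∈ s, 0 < a) : ∃ κ, partMulti κ = s := by
  refine ⟨Multiset.toFinsupp (s.map Nat.pred), ?_⟩
  rw [partMulti, Multiset.toFinsupp_toMultiset, Multiset.map_map]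
  conv_rhs => rw [← Multiset.map_id s]
  exact Multiset.map_congr rfl fun i hi => Nat.succ_pred_eq_of_pos (hs i hi)

theorem prod_map_partMulti {R : Type*} [CommMonoid R] (f : ℕ → R) (κ : ℕ →₀ ℕ) :
    ((partMulti κ).map f).prod = κ.prod fun n m => f (n + 1) ^ m := prod_map_parts f κ

theorem powerSumProd_partMulti {N : ℕ} (κ : ℕ →₀ ℕ) (x : Fin N → ℂ) :
    powerSumProd (partMulti κ) x = powerSumMult κ x := prod_map_partMulti _ κ

theorem zMulti_partMulti (κ : ℕ →₀ ℕ) : zMulti (partMulti κ) = zMult κ := by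
  have h : (partMulti κ).toFinset = κ.support.image Nat.succ := by
    rw [partMulti, Multiset.toFinset_map, Finsupp.toFinset_toMultiset]
  rw [zMulti, h, Finset.prod_image fun _ _ _ _ h => Nat.succ_injective h, zMult, Finsupp.prod]
  refine Finset.prod_congr rfl fun n _ => ?_
  rw [partMulti, Multiset.count_map_eq_count' _ _ Nat.succ_injective, Finsupp.count_toMultiset]

theorem zMult_add (κ l : ℕ →₀ ℕ) :
    zMult (κ + l) = zMult κ * zMult l * κ.prod fun n m => (m + l n).choose (l n) := by
  have hk : κ.support ⊆ κ.support ∪ l.support := Finset.subset_union_left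
  have hl : l.support ⊆ κ.support ∪ l.support := Finset.subset_union_right
  rw [zMult, zMult, zMult, Finsupp.prod_of_support_subset _ (Finsupp.support_add) _ (by simp),
    Finsupp.prod_of_support_subset κ hk _ (by simp), Finsupp.prod_of_support_subset l hl _ (by simp),
    Finsupp.prod_of_support_subset κ hk _ (by simp), ← Finset.prod_mul_distrib, ← Finset.prod_mul_distrib]
  refine Finset.prod_congr rfl fun n _ => ?_
  rw [Finsupp.add_apply, pow_add, ← Nat.add_choose_mul_factorial_mul_factorial]
  ring

/-! ### The gas of power sums at infinite `N` -/

section gas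

theorem hasSum_unitaryMean_psMon {N : ℕ} {b : ℕ → ℂ} (hb : Summable fun n => ‖b n‖) (l r : ℕ →₀ ℕ) :
    HasSum (fun κ : ℕ →₀ ℕ => couplingMono b κ / (zMult κ : ℂ) *
      uniCorr N (partMulti (κ + l)) (partMulti (κ + r)))
      (unitaryMean fun x : Fin N → ℂ => gasWeight b x *
        (psMon N (partMulti l) (partMulti r) : (Fin N → ℂ) → ℂ) x) := by
  have h := hasSum_unitaryMean_gasWeight hb
    (torusCont_of_mem (psMon N (partMulti l) (partMulti r)).2)
  have e : ∀ κ : ℕ →₀ ℕ, uniCorr N (partMulti (κ + l)) (partMulti (κ + r)) = unitaryMean fun x : Fin N → ℂ =>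
      powerSumMult κ x * powerSumMult κ x⁻¹ * (psMon N (partMulti l) (partMulti r) : (Fin N → ℂ) → ℂ) x := fun κ => by
    refine unitaryMean_congr fun θ => ?_
    rw [psMon_apply, psMon_apply, powerSumProd_partMulti, powerSumProd_partMulti, powerSumProd_partMulti,
      powerSumProd_partMulti, powerSumMult_add, powerSumMult_add]
    ring
  simp only [e]
  exact h

theorem unitaryMean_psMon_eq_zero {N : ℕ} {b : ℕ → ℂ} (hb : Summable fun n => ‖b n‖) {l r : ℕ →₀ ℕ}
    (h : (partMulti l).sum ≠ (partMulti r).sum) :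
    (unitaryMean fun x : Fin N → ℂ => gasWeight b x *
        (psMon N (partMulti l) (partMulti r) : (Fin N → ℂ) → ℂ) x) = 0 := by
  rw [← (hasSum_unitaryMean_psMon hb l r).tsum_eq]
  refine (tsum_congr fun κ => ?_).trans tsum_zero
  rw [uniCorr_eq_zero, mul_zero]
  rw [partMulti_add, partMulti_add, Multiset.sum_add, Multiset.sum_add]
  omega

theorem couplingMono_ofReal_norm (b : ℕ → ℂ) (κ : ℕ →₀ ℕ) :
    couplingMono (fun n => (‖b n‖ : ℂ)) κ = (‖couplingMono b κ‖ : ℂ) := by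
  simp [couplingMono, Finsupp.prod, norm_prod]

theorem zMult_add_div (κ l : ℕ →₀ ℕ) : ((zMult (κ + l) : ℕ) : ℂ) / zMult κ =
    zMult l * κ.prod fun n m => (((m + l n).choose (l n) : ℕ) : ℂ) := by
  rw [zMult_add]
  have := zMult_ne_zero κ
  simp only [Finsupp.prod]
  push_cast
  field_simp

/-- The terms of the expansion at infinite `N`. -/
theorem couplingMono_mul_zMult_div (b : ℕ → ℂ) (κ l : ℕ →₀ ℕ) :
    couplingMono b κ / (zMult κ : ℂ) * (zMult (κ + l) : ℂ) =
      zMult l * κ.prod fun n m => (((m + l n).choose (l n) : ℕ) : ℂ) * b n ^ m := by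
  rw [div_mul_eq_mul_div, mul_div_assoc, zMult_add_div, Finsupp.prod_mul, couplingMono]
  ring

/-- Termwise limit of the expansion in power sums, dominated by the same expansion with the couplings
replaced by their absolute values. -/
theorem tendsto_unitaryMean_psMon {b : ℕ → ℂ} (hb : Summable fun n => ‖b n‖) (hb1 : ∀ n, ‖b n‖ < 1)
    (l r : ℕ →₀ ℕ) :
    Tendsto (fun N => unitaryMean fun x : Fin N → ℂ => gasWeight b x *
        (psMon N (partMulti l) (partMulti r) : (Fin N → ℂ) → ℂ) x) atTop
      (𝓝 (if l = r then (zMult l : ℂ) * ∏' n, 1 / (1 - b n) ^ (l n + 1) else 0)) := by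
  have e1 : (if l = r then (zMult l : ℂ) * ∏' n, 1 / (1 - b n) ^ (l n + 1) else 0) =
      ∑' κ : ℕ →₀ ℕ, couplingMono b κ / (zMult κ : ℂ) *
        (if κ + l = κ + r then (zMult (κ + l) : ℂ) else 0) := by
    split_ifs with h
    · subst h
      simp only [if_true, couplingMono_mul_zMult_div]
      rw [tsum_mul_left, (hasSum_finsupp_choose hb1 hb l).2.tsum_eq]
    · simp [add_right_inj, h]
  rw [e1]
  simp only [← (hasSum_unitaryMean_psMon hb l r).tsum_eq]
  have hbn : ∀ n, ‖((‖b n‖ : ℝ) : ℂ)‖ < 1 := fun n => by simpa using hb1 n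
  have hbs : Summable fun n => ‖((‖b n‖ : ℝ) : ℂ)‖ := by simpa using hb
  have hbound : ∀ l : ℕ →₀ ℕ, Summable fun κ : ℕ →₀ ℕ => ‖couplingMono b κ‖ / zMult κ * zMult (κ + l) := fun l => by
    refine (((hasSum_finsupp_choose hbn hbs l).1).mul_left (zMult l : ℝ)).congr fun κ => ?_
    have h1 := congrArg norm (couplingMono_mul_zMult_div (fun n => (‖b n‖ : ℂ)) κ l)
    rw [couplingMono_ofReal_norm] at h1
    simpa using h1.symm
  refine tendsto_tsum_of_dominated_convergence (((hbound l).add (hbound r)).div_const 2) (fun κ => ?_) ?_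
  · refine Tendsto.const_mul _ ?_
    have h := tendsto_uniCorr _ _ (pos_of_mem_partMulti (κ + l)) (pos_of_mem_partMulti (κ + r))
    simpa only [partMulti_injective.eq_iff, zMulti_partMulti] using h
  · refine Eventually.of_forall fun N κ => ?_
    have h := norm_uniCorr_le (pos_of_mem_partMulti (κ + l)) (pos_of_mem_partMulti (κ + r)) N
    rw [zMulti_partMulti, zMulti_partMulti] at h
    rw [norm_mul, norm_div, Complex.norm_natCast]
    refine (mul_le_mul_of_nonneg_left h (by positivity)).trans (le_of_eq ?_)
    ring

end gas

/-! ### Propagation of convergence -/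

theorem tendsto_circleIntegral_of_bounded {F : ℕ → ℂ → ℂ} {G : ℂ → ℂ} {r C : ℝ}
    (hF : ∀ᶠ N in atTop, ContinuousOn (F N) (Metric.sphere 0 |r|))
    (hC : ∀ᶠ N in atTop, ∀ z ∈ Metric.sphere (0 : ℂ) |r|, ‖F N z‖ ≤ C)
    (hlim : ∀ z ∈ Metric.sphere (0 : ℂ) |r|, Tendsto (fun N => F N z) atTop (𝓝 (G z))) :
    Tendsto (fun N => circleIntegral (F N) 0 r) atTop (𝓝 (circleIntegral G 0 r)) := by
  unfold circleIntegral
  have hmem : ∀ θ, circleMap 0 r θ ∈ Metric.sphere (0 : ℂ) |r| := fun θ => circleMap_mem_sphere' 0 r θ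
  refine intervalIntegral.tendsto_integral_filter_of_dominated_convergence (fun _ => |r| * C) ?_ ?_
    intervalIntegrable_const (Eventually.of_forall fun θ _ => ?_)
  · filter_upwards [hF] with N hN
    have h1 : Continuous fun θ => F N (circleMap 0 r θ) := hN.comp_continuous (continuous_circleMap 0 r) hmem
    have h2 : Continuous (deriv (circleMap 0 r)) := by
      have : deriv (circleMap 0 r) = fun θ => circleMap 0 r θ * Complex.I := by
        funext θ; rw [deriv_circleMap]
      rw [this]
      exact (continuous_circleMap 0 r).mul continuous_const
    exact (h2.smul h1).aestronglyMeasurable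
  · filter_upwards [hC] with N hN
    refine Eventually.of_forall fun θ _ => ?_
    rw [norm_smul]
    refine mul_le_mul (le_of_eq ?_) (hN _ (hmem θ)) (norm_nonneg _) (abs_nonneg _)
    simp
  · exact (hlim _ (hmem θ)).const_smul _

/-- Vitali's theorem on a disc: a bounded sequence of holomorphic functions that tends to zero on a
concentric disc tends to zero everywhere. The Taylor coefficients tend to zero. -/
theorem tendsto_zero_of_bounded_disc {F : ℕ → ℂ → ℂ} {R δ C : ℝ} (hδ : 0 < δ)
    (hF : ∀ᶠ N in atTop, DifferentiableOn ℂ (F N) (Metric.ball 0 R))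
    (hC : ∀ᶠ N in atTop, ∀ z ∈ Metric.ball (0 : ℂ) R, ‖F N z‖ ≤ C)
    (hlim : ∀ z ∈ Metric.ball (0 : ℂ) δ, Tendsto (fun N => F N z) atTop (𝓝 0)) {z : ℂ}
    (hz : z ∈ Metric.ball (0 : ℂ) R) : Tendsto (fun N => F N z) atTop (𝓝 0) := by
  rw [mem_ball_zero_iff] at hz
  obtain ⟨R', hR'1, hR'2⟩ := exists_between hz
  have hR'0 : 0 < R' := (norm_nonneg z).trans_lt hR'1
  obtain ⟨r, hr0, hr⟩ := exists_between (lt_min hδ (hR'0.trans hR'2))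
  have hrδ := hr.trans_le (min_le_left _ _)
  have hrR := hr.trans_le (min_le_right _ _)
  have hdc : ∀ r' < R, ∀ f : ℂ → ℂ, DifferentiableOn ℂ f (Metric.ball 0 R) → DiffContOnCl ℂ f (Metric.ball 0 r') :=
    fun r' h f hf => (hf.mono (Metric.closure_ball_subset_closedBall.trans
      (Metric.closedBall_subset_ball h))).diffContOnCl
  have hcoef : ∀ n, Tendsto (fun N => iteratedDeriv n (F N) 0) atTop (𝓝 0) := fun n => by
    have hsph : ∀ z ∈ Metric.sphere (0 : ℂ) |r|, ‖z‖ = r := fun z hz => by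
      rw [mem_sphere_zero_iff_norm, abs_of_pos hr0] at hz; exact hz
    have h1 : Tendsto (fun N => circleIntegral (fun z => (1 / (z - 0) ^ (n + 1)) • F N z) 0 r) atTop (𝓝 (circleIntegral (fun _ => 0) 0 r)) := by
      refine tendsto_circleIntegral_of_bounded (C := (1 / r ^ (n + 1)) * C) ?_ ?_ fun z hz => ?_
      · filter_upwards [hF] with N hN
        refine ContinuousOn.smul (continuousOn_const.div ((continuous_id.sub continuous_const).pow _).continuousOn fun z hz => ?_) (hN.continuousOn.mono fun z hz => ?_)
        · change (z - 0) ^ (n + 1) ≠ 0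
          rw [sub_zero]; exact pow_ne_zero _ (norm_pos_iff.mp (by rw [hsph z hz]; exact hr0))
        · rw [mem_ball_zero_iff, hsph z hz]; exact hrR
      · filter_upwards [hC] with N hN z hz
        rw [norm_smul, norm_div, norm_pow, sub_zero, hsph z hz, norm_one]
        exact mul_le_mul_of_nonneg_left (hN z (by rw [mem_ball_zero_iff, hsph z hz]; exact hrR)) (by positivity)
      · have := (hlim z (by rw [mem_ball_zero_iff, hsph z hz]; exact hrδ)).const_smul (1 / (z - 0) ^ (n + 1))
        simpa using this
    have h2 : Tendsto (fun N => ((2 * Real.pi * Complex.I / n.factorial : ℂ)) • iteratedDeriv n (F N) 0) atTop (𝓝 0) := by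
      simp only [circleIntegral, smul_zero, intervalIntegral.integral_zero] at h1
      refine h1.congr' ?_
      filter_upwards [hF] with N hN
      exact (hdc r hrR _ hN).circleIntegral_one_div_sub_center_pow_smul hr0 n
    have hne : (2 * Real.pi * Complex.I / n.factorial : ℂ) ≠ 0 :=
      div_ne_zero Complex.two_pi_I_ne_zero (by exact_mod_cast n.factorial_ne_zero)
    have h3 := h2.const_smul (2 * Real.pi * Complex.I / n.factorial : ℂ)⁻¹
    simpa only [inv_smul_smul₀ hne, smul_zero] using h3
  have hsum : ∀ᶠ N in atTop, F N z = ∑' n : ℕ, ((n.factorial : ℂ)⁻¹ • (z - 0) ^ n • iteratedDeriv n (F N) 0) := by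
    filter_upwards [hF] with N hN
    refine (HasSum.tsum_eq ?_).symm
    exact Complex.hasSum_taylorSeries_on_ball (r := R) hN (mem_ball_zero_iff.mpr hz)
  have hq : ‖z‖ / R' < 1 := (div_lt_one hR'0).mpr hR'1
  have h4 : Tendsto (fun N => ∑' n : ℕ, ((n.factorial : ℂ)⁻¹ • (z - 0) ^ n • iteratedDeriv n (F N) 0)) atTop
      (𝓝 (∑' _ : ℕ, (0 : ℂ))) := by
    refine tendsto_tsum_of_dominated_convergence (bound := fun n => (‖z‖ / R') ^ n * C)
      ((summable_geometric_of_lt_one (by positivity) hq).mul_right C) (fun n => ?_) ?_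
    · simpa using (((hcoef n).const_smul ((z - 0) ^ n)).const_smul (n.factorial : ℂ)⁻¹)
    · filter_upwards [hF, hC] with N hN hCN n
      have h5 := Complex.norm_iteratedDeriv_le_of_forall_mem_sphere_norm_le n hR'0 (hdc R' hR'2 _ hN)
        (C := C) fun w hw => hCN w (by
          rw [mem_ball_zero_iff]; rw [mem_sphere_zero_iff_norm] at hw; rw [hw]; exact hR'2)
      rw [norm_smul, norm_smul, norm_inv, Complex.norm_natCast, norm_pow, sub_zero, div_pow]
      have h6 : (0 : ℝ) < n.factorial := by exact_mod_cast n.factorial_pos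
      calc (n.factorial : ℝ)⁻¹ * (‖z‖ ^ n * ‖iteratedDeriv n (F N) 0‖)
          ≤ (n.factorial : ℝ)⁻¹ * (‖z‖ ^ n * (n.factorial * C / R' ^ n)) := by gcongr
        _ = _ := by field_simp
  rw [tsum_zero] at h4
  exact h4.congr' (hsum.mono fun N hN => hN.symm)

/-- Convergence on a small disc propagates to a concentric disc on which the sequence is bounded. -/
theorem tendsto_of_bounded_disc {F : ℕ → ℂ → ℂ} {G : ℂ → ℂ} {R δ C : ℝ} (hδ : 0 < δ)
    (hF : ∀ᶠ N in atTop, DifferentiableOn ℂ (F N) (Metric.ball 0 R))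
    (hC : ∀ᶠ N in atTop, ∀ z ∈ Metric.ball (0 : ℂ) R, ‖F N z‖ ≤ C)
    (hG : DifferentiableOn ℂ G (Metric.ball 0 R))
    (hlim : ∀ z ∈ Metric.ball (0 : ℂ) δ, Tendsto (fun N => F N z) atTop (𝓝 (G z))) {z : ℂ}
    (hz : z ∈ Metric.ball (0 : ℂ) R) : Tendsto (fun N => F N z) atTop (𝓝 (G z)) := by
  obtain ⟨R', hR'1, hR'2⟩ := exists_between (mem_ball_zero_iff.mp hz)
  have hsub : Metric.closedBall (0 : ℂ) R' ⊆ Metric.ball 0 R := Metric.closedBall_subset_ball hR'2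
  have hsub' : Metric.ball (0 : ℂ) R' ⊆ Metric.ball 0 R := Metric.ball_subset_ball hR'2.le
  obtain ⟨D, hD⟩ := (isCompact_closedBall (0 : ℂ) R').exists_bound_of_continuousOn (hG.continuousOn.mono hsub)
  have h := tendsto_zero_of_bounded_disc (F := fun N z => F N z - G z) (C := C + D) (R := R') hδ
    (hF.mono fun N hN => (hN.sub hG).mono hsub') ?_ (fun w hw => ?_) (mem_ball_zero_iff.mpr hR'1)
  · simpa using h.add_const (G z)
  · filter_upwards [hC] with N hN w hw
    exact (norm_sub_le _ _).trans (add_le_add (hN w (hsub' hw)) (hD w (Metric.ball_subset_closedBall hw)))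
  · simpa using (hlim w hw).sub_const (G w)

/-! ### The correlators at infinite `N` -/

theorem differentiableOn_qPoch_self : DifferentiableOn ℂ (fun z => qPoch z z) (Metric.ball 0 1) := by
  intro a ha
  rw [mem_ball_zero_iff] at ha
  obtain ⟨ρ, hρ1, hρ2⟩ := exists_between ha
  have h0 : 0 ≤ ρ := (norm_nonneg _).trans hρ1.le
  have h : DifferentiableOn ℂ (fun a : ℂ => Complex.exp (-∑' n : ℕ, a ^ (n + 1) / (((n + 1 : ℕ) : ℂ) * (1 - a ^ (n + 1)))))
      (Metric.ball 0 ρ) := by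
    refine (DifferentiableOn.neg ?_).cexp
    refine Complex.differentiableOn_tsum_of_summable_norm (summable_pow_succ_div h0 hρ2)
      (fun n => ?_) Metric.isOpen_ball
      fun n w hw => norm_qPoch_exponent_le hρ2 (mem_ball_zero_iff.mp hw).le (mem_ball_zero_iff.mp hw).le n
    refine DifferentiableOn.div (differentiable_id.pow _).differentiableOn
      (((differentiable_id.pow _).const_sub _).const_mul _).differentiableOn fun w hw => ?_
    exact mul_ne_zero (by exact_mod_cast Nat.succ_ne_zero n)
      (one_sub_pow_ne_zero ((mem_ball_zero_iff.mp hw).trans hρ2) n)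
  have ha' : Metric.ball (0 : ℂ) ρ ∈ 𝓝 a := Metric.isOpen_ball.mem_nhds (mem_ball_zero_iff.mpr hρ1)
  refine ((h.differentiableAt ha').congr_of_eventuallyEq ?_).differentiableWithinAt
  filter_upwards [ha'] with w hw
  have hw1 := (mem_ball_zero_iff.mp hw).trans hρ2
  exact qPoch_eq_exp hw1 hw1

/-- The limit of the norm of `p_l` in Macdonald's scalar product, up to the normalisation of the weight. -/
def macLimit (q t : ℂ) (l : ℕ →₀ ℕ) : ℂ :=
  zMult l * (l.prod fun n m => ((1 - q ^ (n + 1)) / (1 - t ^ (n + 1))) ^ m) * (qPoch q q / qPoch t t)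

theorem one_sub_macCoupling {q : ℂ} (hq : ‖q‖ < 1) (t : ℂ) (n : ℕ) :
    1 - macCoupling q t n = (1 - t ^ (n + 1)) / (1 - q ^ (n + 1)) := by
  have := one_sub_pow_ne_zero hq n
  rw [macCoupling]; field_simp; ring

/-- The product over the modes of a gas with a power sum inserted. -/
theorem hasProd_insertion {b : ℕ → ℂ} {P : ℂ} (hP : HasProd (fun n => (1 - b n)⁻¹) P) (l : ℕ →₀ ℕ) :
    ∏' n, 1 / (1 - b n) ^ (l n + 1) = (l.prod fun n m => ((1 - b n)⁻¹) ^ m) * P := by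
  have h1 : HasProd (fun n => ((1 - b n)⁻¹) ^ l n) (∏ n ∈ l.support, ((1 - b n)⁻¹) ^ l n) :=
    hasProd_prod_of_ne_finset_one fun n hn => by
      rw [Finsupp.notMem_support_iff.mp hn, pow_zero]
  rw [Finsupp.prod, ← (h1.mul hP).tprod_eq]
  refine tprod_congr fun n => ?_
  rw [one_div, pow_succ, mul_inv, inv_pow]

theorem macLimit_eq {q t : ℂ} (hq : ‖q‖ < 1) (ht : ‖t‖ < 1) (l : ℕ →₀ ℕ) :
    (zMult l : ℂ) * ∏' n, 1 / (1 - macCoupling q t n) ^ (l n + 1) = macLimit q t l := by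
  have h : HasProd (fun n => (1 - macCoupling q t n)⁻¹) (qPoch q q * (qPoch t t)⁻¹) := by
    have := (hasProd_qPoch_self hq).mul (hasProd_inv_qPoch_self ht)
    simpa only [one_sub_macCoupling hq, inv_div, ← div_eq_mul_inv] using this
  rw [hasProd_insertion h, macLimit]
  simp only [one_sub_macCoupling hq, inv_div]
  ring

theorem macCorr_eq_unitaryMean (N : ℕ) (q t : ℂ) (l r : Multiset ℕ) : macCorr N q t l r =
    unitaryMean fun x : Fin N → ℂ => gasWeight (macCoupling q t) x * (psMon N l r : (Fin N → ℂ) → ℂ) x := rfl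

/-- For `|q|, |t| ≤ 3/10` all the couplings of Macdonald's weight have modulus less than one. -/
theorem tendsto_macCorr_of_small {q t : ℂ} (hq : ‖q‖ ≤ 3 / 10) (ht : ‖t‖ ≤ 3 / 10) (l r : ℕ →₀ ℕ) :
    Tendsto (fun N => macCorr N q t (partMulti l) (partMulti r)) atTop
      (𝓝 (if l = r then macLimit q t l else 0)) := by
  have hq1 : ‖q‖ < 1 := hq.trans_lt (by norm_num)
  have ht1 : ‖t‖ < 1 := ht.trans_lt (by norm_num)
  have h := tendsto_unitaryMean_psMon (summable_macCoupling hq1 ht1) (fun n => ?_) l r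
  · rwa [macLimit_eq hq1 ht1] at h
  · -- `2 · (3/10) / (1 - 3/10) = 6/7`
    refine (norm_macCoupling_le (by norm_num) hq ht n).trans_lt ?_
    have : ((3 : ℝ) / 10) ^ (n + 1) ≤ (3 / 10) ^ 1 :=
      pow_le_pow_of_le_one (by norm_num) (by norm_num) (by omega)
    rw [div_lt_one (by norm_num)]
    linarith

theorem differentiableOn_macLimit {U : Set ℂ} {q t : ℂ → ℂ}
    (hq : DifferentiableOn ℂ q U) (ht : DifferentiableOn ℂ t U) (hq1 : ∀ z ∈ U, ‖q z‖ < 1)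
    (ht1 : ∀ z ∈ U, ‖t z‖ < 1) (l : ℕ →₀ ℕ) : DifferentiableOn ℂ (fun z => macLimit (q z) (t z) l) U := by
  have hQ := differentiableOn_qPoch_self.comp hq fun z hz => mem_ball_zero_iff.mpr (hq1 z hz)
  have hT := differentiableOn_qPoch_self.comp ht fun z hz => mem_ball_zero_iff.mpr (ht1 z hz)
  refine DifferentiableOn.mul (DifferentiableOn.const_mul ?_ _)
    (hQ.div hT fun z hz => qPoch_ne_zero (ht1 z hz) (ht1 z hz))
  unfold Finsupp.prod
  refine DifferentiableOn.fun_finsetProd fun n _ => DifferentiableOn.fun_pow ?_ _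
  exact ((hq.pow _).const_sub 1).div ((ht.pow _).const_sub 1) fun z hz => one_sub_pow_ne_zero (ht1 z hz) n

/-- Along the line from `(a, 0)` to `(q, t)` the correlators converge near the first point. On a circle about
it, which encloses the second point and on which `q` stays away from zero, they are bounded; by the maximum
principle so are they inside, and the convergence propagates to the second point. -/
theorem tendsto_macCorr_of_line {q t a : ℂ} (ha : ‖a‖ ≤ 1 / 4) (haq : ‖a‖ + ‖q - a‖ < 1) (hle : ‖a‖ ≤ ‖q - a‖)
    (hne : q ≠ a) (ht : ‖t‖ < 1) (l r : ℕ →₀ ℕ) :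
    Tendsto (fun N => macCorr N q t (partMulti l) (partMulti r)) atTop
      (𝓝 (if l = r then macLimit q t l else 0)) := by
  by_cases hsum : (partMulti l).sum = (partMulti r).sum
  swap
  · have hq1 : ‖q‖ < 1 := by
      have : ‖q‖ ≤ ‖a‖ + ‖q - a‖ := by simpa using norm_add_le a (q - a)
      linarith
    rw [if_neg fun h => hsum (by rw [h])]
    simp only [macCorr_eq_unitaryMean, unitaryMean_psMon_eq_zero (summable_macCoupling hq1 ht) hsum]
    exact tendsto_const_nhds
  have hd : 0 < ‖q - a‖ := norm_pos_iff.mpr (sub_ne_zero.mpr hne)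
  obtain ⟨R, hR1, hRq, hRt⟩ : ∃ R : ℝ, 1 < R ∧ ‖a‖ + R * ‖q - a‖ < 1 ∧ R * ‖t‖ < 1 := by
    have h1 : ∀ᶠ R : ℝ in 𝓝 1, ‖a‖ + R * ‖q - a‖ < 1 :=
      (Continuous.tendsto (by fun_prop) 1).eventually_lt_const (by simpa using haq)
    have h2 : ∀ᶠ R : ℝ in 𝓝 1, R * ‖t‖ < 1 :=
      (Continuous.tendsto (by fun_prop) 1).eventually_lt_const (by simpa using ht)
    obtain ⟨R, hR⟩ := (((h1.and h2).filter_mono nhdsWithin_le_nhds).and (self_mem_nhdsWithin (s := Set.Ioi (1 : ℝ)))).exists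
    exact ⟨R, hR.2, hR.1⟩
  have hR0 : 0 < R := by linarith
  have hqR : ∀ z ∈ Metric.closedBall (0 : ℂ) R, ‖a + z * (q - a)‖ ≤ ‖a‖ + R * ‖q - a‖ := fun z hz => by
    refine (norm_add_le _ _).trans ?_
    rw [norm_mul]
    have := mem_closedBall_zero_iff.mp hz
    gcongr
  have htR : ∀ z ∈ Metric.closedBall (0 : ℂ) R, ‖z * t‖ ≤ R * ‖t‖ := fun z hz => by
    rw [norm_mul]
    have := mem_closedBall_zero_iff.mp hz
    gcongr
  have hq1 : ∀ z ∈ Metric.closedBall (0 : ℂ) R, ‖a + z * (q - a)‖ < 1 := fun z hz => (hqR z hz).trans_lt hRq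
  have ht1 : ∀ z ∈ Metric.closedBall (0 : ℂ) R, ‖z * t‖ < 1 := fun z hz => (htR z hz).trans_lt hRt
  -- a slightly larger disc, for holomorphy up to the boundary
  obtain ⟨R2, hR2, hq2, ht2⟩ : ∃ R2 : ℝ, R < R2 ∧ ‖a‖ + R2 * ‖q - a‖ < 1 ∧ R2 * ‖t‖ < 1 := by
    have h1 : ∀ᶠ R' : ℝ in 𝓝 R, ‖a‖ + R' * ‖q - a‖ < 1 :=
      (Continuous.tendsto (by fun_prop) R).eventually_lt_const hRq
    have h2 : ∀ᶠ R' : ℝ in 𝓝 R, R' * ‖t‖ < 1 :=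
      (Continuous.tendsto (by fun_prop) R).eventually_lt_const hRt
    obtain ⟨R', hR'⟩ := (((h1.and h2).filter_mono nhdsWithin_le_nhds).and (self_mem_nhdsWithin (s := Set.Ioi R))).exists
    exact ⟨R', hR'.2, hR'.1⟩
  have hqd : ∀ U, DifferentiableOn ℂ (fun z : ℂ => a + z * (q - a)) U := fun U => by fun_prop
  have htd : ∀ U, DifferentiableOn ℂ (fun z : ℂ => z * t) U := fun U => by fun_prop
  have hF : ∀ N, DifferentiableOn ℂ (fun z => macCorr N (a + z * (q - a)) (z * t) (partMulti l) (partMulti r)) (Metric.ball 0 R2) := fun N => by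
    refine differentiableOn_macMean Metric.isOpen_ball (hqd _) (htd _) (fun z hz => ?_) (fun z hz => ?_)
      (torusCont_of_mem (psMon N _ _).2)
    · refine ((norm_add_le _ _).trans ?_).trans_lt hq2
      rw [norm_mul]
      have := (mem_ball_zero_iff.mp hz).le
      gcongr
    · rw [norm_mul]
      refine lt_of_le_of_lt ?_ ht2
      have := (mem_ball_zero_iff.mp hz).le
      gcongr
  -- a lower bound for `|a + z (q - a)|` on the circle `|z| = R`
  have hε : 0 < R * ‖q - a‖ - ‖a‖ := by nlinarith
  obtain ⟨C, hC⟩ := exists_macCorr_le (ρ := max (‖a‖ + R * ‖q - a‖) (R * ‖t‖)) hε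
    (le_max_of_le_right (by positivity)) (max_lt hRq hRt) _ (partMulti l) (partMulti r) rfl hsum.symm
    (pos_of_mem_partMulti l) (pos_of_mem_partMulti r)
  rw [paramFilter, eventually_prod_principal_iff] at hC
  have hG : DifferentiableOn ℂ (fun z => if l = r then macLimit (a + z * (q - a)) (z * t) l else 0) (Metric.ball 0 R) := by
    split_ifs
    · exact differentiableOn_macLimit (hqd _) (htd _) (fun z hz => hq1 z (Metric.ball_subset_closedBall hz))
        (fun z hz => ht1 z (Metric.ball_subset_closedBall hz)) l
    · exact differentiableOn_const _
  have key := tendsto_of_bounded_disc (F := fun N z => macCorr N (a + z * (q - a)) (z * t) (partMulti l) (partMulti r))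
    (R := R) (δ := 1 / 20) (C := C) (z := 1) (by norm_num)
    (Eventually.of_forall fun N => (hF N).mono (Metric.ball_subset_ball hR2.le)) ?_ hG (fun z hz => ?_)
    (by simpa using hR1)
  · simpa using key
  · filter_upwards [hC] with N hN z hz
    refine Complex.norm_le_of_forall_mem_frontier_norm_le Metric.isBounded_ball
      ((hF N).mono (Metric.closure_ball_subset_closedBall.trans (Metric.closedBall_subset_ball hR2))).diffContOnCl
      (fun w hw => ?_) (subset_closure hz)
    rw [frontier_ball _ hR0.ne', mem_sphere_zero_iff_norm] at hw
    have hw' : w ∈ Metric.closedBall (0 : ℂ) R := mem_closedBall_zero_iff.mpr hw.le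
    refine hN (_, _) ⟨?_, (hqR w hw').trans (le_max_left _ _), (htR w hw').trans (le_max_right _ _)⟩
    have := norm_sub_le_norm_add (w * (q - a)) a
    rw [norm_mul, hw, add_comm] at this
    exact this
  · have hz' := mem_ball_zero_iff.mp hz
    refine tendsto_macCorr_of_small ?_ ?_ l r
    · refine (norm_add_le _ _).trans ?_
      rw [norm_mul]
      nlinarith [norm_nonneg z, norm_nonneg a]
    · rw [norm_mul]
      nlinarith [norm_nonneg z, norm_nonneg t]

/-- The limit of the correlators for all parameters. For `q ≠ 0` the line starts at the origin. For `q = 0` it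
starts at `(1/4, 0)`, since on a line within `q = 0` there is no bound on the correlators to start from. -/
theorem tendsto_macCorr {q t : ℂ} (hq : ‖q‖ < 1) (ht : ‖t‖ < 1) (l r : ℕ →₀ ℕ) :
    Tendsto (fun N => macCorr N q t (partMulti l) (partMulti r)) atTop
      (𝓝 (if l = r then macLimit q t l else 0)) := by
  rcases eq_or_ne q 0 with rfl | h
  · exact tendsto_macCorr_of_line (a := 1 / 4) (by norm_num) (by norm_num) (by norm_num) (by norm_num) ht l r
  · exact tendsto_macCorr_of_line (a := 0) (by norm_num) (by simpa using hq) (by simp) h ht l r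

theorem psumPart_eval {N m : ℕ} (lam : m.Partition) (x : Fin N → ℂ) :
    MvPolynomial.eval x (MvPolynomial.psumPart (Fin N) ℂ lam) = powerSumProd lam.parts x :=
  (powerSumProd_eq_eval lam.parts x).symm

/-- Orthogonality of the power sums in the limit of infinitely many variables. -/
theorem tendsto_macInner_div {q t : ℂ} (hq : ‖q‖ < 1) (ht : ‖t‖ < 1) {a b : ℕ} (lam : a.Partition) (mu : b.Partition) :
    Tendsto (fun N : ℕ => macInner q t (MvPolynomial.psumPart (Fin N) ℂ lam) (MvPolynomial.psumPart (Fin N) ℂ mu) /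
      macInner q t (1 : MvPolynomial (Fin N) ℂ) 1)
      atTop (𝓝 (if lam.parts = mu.parts then zPartQT q t lam else 0)) := by
  obtain ⟨l, hl⟩ := exists_partMulti fun a ha => lam.parts_pos ha
  obtain ⟨r, hr⟩ := exists_partMulti fun a ha => mu.parts_pos ha
  have hne : ∀ N : ℕ, (qPoch q q / qPoch t q) ^ N ≠ 0 := fun N =>
    pow_ne_zero _ (div_ne_zero (qPoch_ne_zero hq hq) (qPoch_ne_zero ht hq))
  have h0 : partMulti 0 = 0 := by simp [partMulti]
  have hL : macLimit q t 0 = qPoch q q / qPoch t t := by simp [macLimit, zMult]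
  have hL0 : macLimit q t 0 ≠ 0 := by
    rw [hL]; exact div_ne_zero (qPoch_ne_zero hq hq) (qPoch_ne_zero ht ht)
  have e : ∀ N : ℕ, macInner q t (MvPolynomial.psumPart (Fin N) ℂ lam) (MvPolynomial.psumPart (Fin N) ℂ mu) /
      macInner q t (1 : MvPolynomial (Fin N) ℂ) 1 =
      macCorr N q t (partMulti l) (partMulti r) / macCorr N q t (partMulti 0) (partMulti 0) := fun N => by
    rw [← mul_div_mul_left _ _ (hne N), macInner_eq_macMean hq ht, macInner_eq_macMean hq ht, hl, hr, h0]
    congr 1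
    · unfold macCorr
      congr 1
      funext x
      rw [psMon_apply, psumPart_eval, psumPart_eval]
    · unfold macCorr
      congr 1
      funext x
      rw [psMon_apply, powerSumProd_zero, powerSumProd_zero, map_one, map_one]
  simp only [e]
  have h := (tendsto_macCorr hq ht l r).div (by simpa using tendsto_macCorr hq ht 0 0) hL0
  refine (congrArg (fun w => Tendsto _ atTop (𝓝 w)) ?_).mp h
  rw [← hl, ← hr]
  simp only [partMulti_injective.eq_iff]
  split_ifs with hlr
  · rw [div_eq_iff hL0, hL, macLimit, zPartQT]
    congr 2
    · have : zPart lam = zMulti lam.parts := rfl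
      rw [this, ← hl, zMulti_partMulti]
    · rw [← hl, prod_map_partMulti]
  · simp

/-! ### The index at fixed fugacities -/

theorem weylDensity_torusPt {N : ℕ} (θ : Fin N → ℝ) :
    ∃ w : ℝ, 0 ≤ w ∧ weylDensity (torusPt θ) = w := by
  refine ⟨Complex.normSq (Matrix.vandermonde (torusPt θ)).det, Complex.normSq_nonneg _, ?_⟩
  rw [weylDensity_eq (torusPt_ne_zero θ), Complex.normSq_eq_conj_mul_self, mul_comm, RingHom.map_det]
  congr 2
  ext i j
  rw [torusPt_inv]
  simp [Matrix.vandermonde]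

/-- The average over the unitary group is positive. -/
theorem norm_unitaryMean_le {N : ℕ} {F G : (Fin N → ℂ) → ℂ} (hG : TorusCont G)
    (h : ∀ θ, ‖F (torusPt θ)‖ ≤ (G (torusPt θ)).re) : ‖unitaryMean F‖ ≤ (unitaryMean G).re := by
  have hW : TorusCont (fun x => weylDensity x * G x) := (torusCont_of_mem (weylDensity_mem (N := N))).mul hG
  unfold unitaryMean
  rw [← Complex.ofReal_natCast, ← Complex.ofReal_inv, Complex.re_ofReal_mul, norm_mul, Complex.norm_real,
    Real.norm_of_nonneg (by positivity), torusMean_eq_integral, torusMean_eq_integral]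
  refine mul_le_mul_of_nonneg_left ?_ (by positivity)
  have e : (∫ θ, weylDensity (torusPt θ) * G (torusPt θ) ∂angleMeasure N).re =
      ∫ θ, (weylDensity (torusPt θ) * G (torusPt θ)).re ∂angleMeasure N := (integral_re hW.integrable).symm
  rw [e]
  refine norm_integral_le_of_norm_le hW.integrable.re (Eventually.of_forall fun θ => ?_)
  obtain ⟨w, hw0, hw⟩ := weylDensity_torusPt θ
  rw [hw, norm_mul, Complex.norm_real, Real.norm_of_nonneg hw0]
  rw [Complex.re_ofReal_mul]
  exact mul_le_mul_of_nonneg_left (h θ) hw0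

/-- On the torus `p_n(x) p_n(x⁻¹) = |p_n(x)|²`, so that the modulus of the Boltzmann factor depends only on
the real parts of the couplings, and increases with them. -/
theorem norm_gasWeight_le {N : ℕ} {b : ℕ → ℂ} {g : ℕ → ℝ} (hb : Summable fun n => ‖b n‖) (hg : Summable g)
    (hg0 : ∀ n, 0 ≤ g n) (hbg : ∀ n, (b n).re ≤ g n) (θ : Fin N → ℝ) :
    ‖gasWeight b (torusPt θ)‖ ≤ (gasWeight (fun n => (g n : ℂ)) (torusPt θ)).re := by
  have hgn : Summable fun n => ‖(g n : ℂ)‖ := by simpa [abs_of_nonneg (hg0 _)] using hg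
  have hs : ∀ {c : ℕ → ℂ}, (Summable fun n => ‖c n‖) → Summable fun k : ℕ => c k / ((k + 1 : ℕ) : ℂ) *
      (powerSum (k + 1) (torusPt θ) * powerSum (k + 1) (torusPt θ)⁻¹) := fun {c} hc =>
    Summable.of_norm_bounded (hc.mul_right _) fun k => norm_gas_mode_le c k θ
  have hr : ∀ k : ℕ, ∃ w : ℝ, 0 ≤ w ∧ powerSum (k + 1) (torusPt θ) * powerSum (k + 1) (torusPt θ)⁻¹ = w := fun k =>
    ⟨Complex.normSq (powerSum (k + 1) (torusPt θ)), Complex.normSq_nonneg _, by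
      rw [powerSum_inv_torusPt, Complex.mul_conj]⟩
  have hre : ∀ (c : ℂ) (k : ℕ), (c / ((k + 1 : ℕ) : ℂ) *
      (powerSum (k + 1) (torusPt θ) * powerSum (k + 1) (torusPt θ)⁻¹)).re = c.re / ((k + 1 : ℕ) : ℝ) *
      (powerSum (k + 1) (torusPt θ) * powerSum (k + 1) (torusPt θ)⁻¹).re := fun c k => by
    obtain ⟨w, -, hw⟩ := hr k
    rw [hw, Complex.re_mul_ofReal, Complex.div_natCast_re, Complex.ofReal_re]
  have e : gasWeight (fun n => (g n : ℂ)) (torusPt θ) = ((Real.exp (∑' k : ℕ, g k / ((k + 1 : ℕ) : ℝ) *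
      (powerSum (k + 1) (torusPt θ) * powerSum (k + 1) (torusPt θ)⁻¹).re) : ℝ) : ℂ) := by
    rw [gasWeight, Complex.ofReal_exp, Complex.ofReal_tsum]
    congr 1
    refine tsum_congr fun k => ?_
    obtain ⟨w, -, hw⟩ := hr k
    rw [hw]; push_cast; rfl
  have hsg : Summable fun k : ℕ => g k / ((k + 1 : ℕ) : ℝ) *
      (powerSum (k + 1) (torusPt θ) * powerSum (k + 1) (torusPt θ)⁻¹).re := by
    have := Complex.reCLM.summable (hs hgn)
    simpa only [Complex.reCLM_apply, hre, Complex.ofReal_re] using this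
  have hsb : Summable fun k : ℕ => (b k).re / ((k + 1 : ℕ) : ℝ) *
      (powerSum (k + 1) (torusPt θ) * powerSum (k + 1) (torusPt θ)⁻¹).re := by
    have := Complex.reCLM.summable (hs hb)
    simpa only [Complex.reCLM_apply, hre] using this
  rw [e, Complex.ofReal_re, gasWeight, Complex.norm_exp, Complex.re_tsum (hs hb)]
  refine Real.exp_le_exp.mpr ?_
  simp only [hre]
  refine hsb.tsum_le_tsum (fun k => ?_) hsg
  obtain ⟨w, hw0, hw⟩ := hr k
  rw [hw, Complex.ofReal_re]
  have := hbg k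
  gcongr

theorem psMon_zero {N : ℕ} (x : Fin N → ℂ) :
    (psMon N (partMulti 0) (partMulti 0) : (Fin N → ℂ) → ℂ) x = 1 := by
  rw [psMon_apply]; simp [partMulti, powerSumProd_zero]

theorem unitaryMean_gasWeight_eq (N : ℕ) (b : ℕ → ℂ) : (unitaryMean fun x : Fin N → ℂ => gasWeight b x *
      (psMon N (partMulti 0) (partMulti 0) : (Fin N → ℂ) → ℂ) x) = unitaryMean (gasWeight b : (Fin N → ℂ) → ℂ) := by
  simp only [psMon_zero, mul_one]

/-- Uniform bound on the partition function of a gas with repulsive and weakly attractive couplings: it is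
at most the one with couplings `g`, and the expansion of the latter has nonnegative terms, each of which is at most
its limit. -/
theorem exists_unitaryMean_gasWeight_le {g : ℕ → ℝ} (hg : Summable g) (hg0 : ∀ n, 0 ≤ g n) (hg1 : ∀ n, g n < 1) :
    ∃ C : ℝ, ∀ b : ℕ → ℂ, (Summable fun n => ‖b n‖) → (∀ n, (b n).re ≤ g n) →
      ∀ N, ‖unitaryMean (gasWeight b : (Fin N → ℂ) → ℂ)‖ ≤ C := by
  have hgn : Summable fun n => ‖(g n : ℂ)‖ := by simpa [abs_of_nonneg (hg0 _)] using hg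
  have h1 := (hasSum_finsupp_choose (g := fun n => (g n : ℂ))
    (fun n => by rw [Complex.norm_real, Real.norm_of_nonneg (hg0 n)]; exact hg1 n) hgn 0).1
  refine ⟨∑' κ : ℕ →₀ ℕ, ‖κ.prod fun n m => (((m + (0 : ℕ →₀ ℕ) n).choose ((0 : ℕ →₀ ℕ) n) : ℕ) : ℂ) * (g n : ℂ) ^ m‖,
    fun b hb hbg N => ?_⟩
  refine (norm_unitaryMean_le (gasWeight_torusCont hgn) (norm_gasWeight_le hb hg hg0 hbg)).trans ?_
  refine (Complex.re_le_norm _).trans ?_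
  rw [← unitaryMean_gasWeight_eq, ← (hasSum_unitaryMean_psMon hgn 0 0).tsum_eq]
  refine tsum_of_norm_bounded h1.hasSum fun κ => ?_
  have h2 := norm_uniCorr_le (pos_of_mem_partMulti (κ + 0)) (pos_of_mem_partMulti (κ + 0)) N
  have h3 := congrArg norm (couplingMono_mul_zMult_div (fun n => (g n : ℂ)) κ 0)
  have h4 : zMult 0 = 1 := by simp [zMult]
  rw [zMulti_partMulti, add_self_div_two] at h2
  rw [h4, Nat.cast_one, one_mul] at h3
  rw [← h3, norm_mul, norm_mul, Complex.norm_natCast]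
  exact mul_le_mul_of_nonneg_left h2 (norm_nonneg _)

/-- Vitali's theorem on a connected open set: convergence propagates along overlapping discs. -/
theorem tendsto_of_locally_bounded {U : Set ℂ} (hU : IsOpen U) (hUc : IsPreconnected U) {F : ℕ → ℂ → ℂ} {G : ℂ → ℂ}
    (hF : ∀ N, DifferentiableOn ℂ (F N) U) (hG : DifferentiableOn ℂ G U)
    (hb : ∀ z ∈ U, ∃ C : ℝ, ∀ᶠ w in 𝓝 z, ∀ N, ‖F N w‖ ≤ C) {z0 : ℂ} (hz0 : z0 ∈ U)
    (hlim : ∀ᶠ z in 𝓝 z0, Tendsto (fun N => F N z) atTop (𝓝 (G z))) {z : ℂ} (hz : z ∈ U) :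
    Tendsto (fun N => F N z) atTop (𝓝 (G z)) := by
  set S : Set ℂ := {z | Tendsto (fun N => F N z) atTop (𝓝 (G z))}
  suffices h : U ⊆ interior S from interior_subset (h hz)
  refine hUc.subset_of_closure_inter_subset isOpen_interior ⟨z0, hz0, mem_interior_iff_mem_nhds.mpr hlim⟩ ?_
  rintro a ⟨ha, haU⟩
  obtain ⟨C, hC⟩ := hb a haU
  obtain ⟨r, hr, hball⟩ := Metric.mem_nhds_iff.mp (hC.and (hU.mem_nhds haU))
  obtain ⟨c, hcS, hca⟩ := Metric.mem_closure_iff.mp ha (r / 2) (by positivity)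
  have hsub : ∀ w ∈ Metric.ball (0 : ℂ) (r / 2), c + w ∈ Metric.ball a r := fun w hw => by
    rw [mem_ball_zero_iff] at hw
    rw [Metric.mem_ball, dist_eq_norm, add_sub_right_comm]
    rw [dist_comm, dist_eq_norm] at hca
    exact (norm_add_le _ _).trans_lt (by linarith)
  obtain ⟨δ, hδ, hδS⟩ := Metric.mem_nhds_iff.mp (mem_interior_iff_mem_nhds.mp hcS)
  have hmaps : Set.MapsTo (fun w => c + w) (Metric.ball (0 : ℂ) (r / 2)) U := fun w hw => (hball (hsub w hw)).2
  have hdiff : DifferentiableOn ℂ (fun w => c + w) (Metric.ball (0 : ℂ) (r / 2)) := by fun_prop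
  rw [mem_interior_iff_mem_nhds]
  refine mem_of_superset (Metric.isOpen_ball.mem_nhds (Metric.mem_ball.mpr hca)) fun w hw => ?_
  have key := tendsto_of_bounded_disc (F := fun N w => F N (c + w)) (G := fun w => G (c + w)) (R := r / 2) (δ := δ) (C := C)
    (z := w - c) hδ (Eventually.of_forall fun N => (hF N).comp hdiff hmaps)
    (Eventually.of_forall fun N w hw => (hball (hsub w hw)).1 N) (hG.comp hdiff hmaps)
    (fun w hw => hδS (by rw [Metric.mem_ball, dist_eq_norm, add_sub_cancel_left]; exact mem_ball_zero_iff.mp hw))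
    (by rw [mem_ball_zero_iff, ← dist_eq_norm]; exact hw)
  change Tendsto (fun N => F N w) atTop (𝓝 (G w))
  simpa using key

theorem multipliable_inv_one_sub {b : ℕ → ℂ} (hb : Summable fun n => ‖b n‖) (h1 : ∀ n, b n ≠ 1) :
    Multipliable fun n => (1 - b n)⁻¹ := by
  have e : (fun n => (1 - b n)⁻¹) = fun n => 1 + b n / (1 - b n) := by
    funext n
    have : 1 - b n ≠ 0 := sub_ne_zero.mpr (h1 n).symm
    field_simp; ring
  rw [e]
  refine multipliable_one_add_of_summable ?_
  refine Summable.of_norm_bounded_eventually_nat (hb.mul_left 2) ?_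
  filter_upwards [hb.tendsto_atTop_zero.eventually_lt_const (show (0 : ℝ) < 1 / 2 by norm_num)] with n hn
  have h2 : 1 - ‖b n‖ ≤ ‖1 - b n‖ := by simpa using norm_sub_norm_le 1 (b n)
  rw [norm_norm, norm_div, div_le_iff₀ (by linarith)]
  nlinarith [norm_nonneg (b n)]

/-- The free energy of a gas whose modes are all stable. The finitely many couplings of modulus at least one
are multiplied by a complex parameter `z`, which runs through the convex set where their real parts stay below
one. It contains `0`, where all couplings have modulus less than one, and `1`. -/
theorem tendsto_unitaryMean_gasWeight {b : ℕ → ℂ} (hb : Summable fun n => ‖b n‖) (hre : ∀ n, (b n).re < 1) :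
    Tendsto (fun N => unitaryMean (gasWeight b : (Fin N → ℂ) → ℂ)) atTop (𝓝 (∏' n, (1 - b n)⁻¹)) := by
  obtain ⟨M, hM⟩ := eventually_atTop.mp (hb.tendsto_atTop_zero.eventually_lt_const one_pos)
  set B : ℂ → ℕ → ℂ := fun z n => if n < M then z * b n else b n with hB
  have hBd : ∀ n, Differentiable ℂ fun z => B z n := fun n => by
    simp only [hB]; split_ifs <;> fun_prop
  have hBle : ∀ z n, ‖B z n‖ ≤ (‖z‖ + 1) * ‖b n‖ := fun z n => by
    simp only [hB]
    have := norm_nonneg (b n)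
    have := norm_nonneg z
    split_ifs
    · rw [norm_mul]; nlinarith
    · nlinarith
  have hBs : ∀ z, Summable fun n => ‖B z n‖ := fun z =>
    Summable.of_nonneg_of_le (fun _ => norm_nonneg _) (hBle z) (hb.mul_left _)
  have hB1 : B 1 = b := by funext n; simp [hB]
  set U : Set ℂ := {z | ∀ n < M, (z * b n).re < 1} with hUdef
  have hUeq : U = ⋂ n ∈ Finset.range M, {z | (z * b n).re < 1} := by
    ext z; simp [hUdef]
  have hlin : ∀ n, IsLinearMap ℝ fun z : ℂ => (z * b n).re := fun n =>
    ⟨fun x y => by rw [add_mul, Complex.add_re], fun c x => by simp [mul_assoc, mul_sub]⟩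
  have hUo : IsOpen U := by
    rw [hUeq]
    exact isOpen_biInter_finset fun n _ => isOpen_lt (by fun_prop) continuous_const
  have hUc : Convex ℝ U := by
    rw [hUeq]
    exact convex_iInter₂ fun n _ => convex_halfSpace_lt (hlin n) 1
  have h0U : (0 : ℂ) ∈ U := fun n _ => by simp
  have h1U : (1 : ℂ) ∈ U := fun n _ => by simpa using hre n
  have hUre : ∀ z ∈ U, ∀ n, (B z n).re < 1 := fun z hz n => by
    simp only [hB]; split_ifs with h
    · exact hz n h
    · exact (Complex.re_le_norm _).trans_lt (hM n (not_lt.mp h))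
  have hne : ∀ z ∈ U, ∀ n, B z n ≠ 1 := fun z hz n h => by
    have := hUre z hz n
    rw [h] at this; simp at this
  -- the limit is holomorphic: all but finitely many factors are constant
  have hG : DifferentiableOn ℂ (fun z => ∏' n, (1 - B z n)⁻¹) U := by
    have h1 : ∀ z ∈ U, ∏' n, (1 - B z n)⁻¹ = (∏ n ∈ Finset.range M, (1 - z * b n)⁻¹) * ∏' n, (1 - B 0 n)⁻¹ := fun z hz => by
      have h2 : HasProd (fun n => if n < M then (1 - z * b n)⁻¹ else 1) (∏ n ∈ Finset.range M, (1 - z * b n)⁻¹) := by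
        have : HasProd (fun n => if n < M then (1 - z * b n)⁻¹ else 1)
            (∏ n ∈ Finset.range M, if n < M then (1 - z * b n)⁻¹ else 1) :=
          hasProd_prod_of_ne_finset_one fun n hn => by rw [if_neg (by simpa using hn)]
        rwa [Finset.prod_congr rfl fun n hn => if_pos (Finset.mem_range.mp hn)] at this
      rw [← (h2.mul (multipliable_inv_one_sub (hBs 0) (hne 0 h0U)).hasProd).tprod_eq]
      refine tprod_congr fun n => ?_
      simp only [hB]; split_ifs <;> simp
    refine DifferentiableOn.congr ?_ h1
    refine DifferentiableOn.mul_const (DifferentiableOn.fun_finsetProd fun n hn => ?_) _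
    refine DifferentiableOn.inv (by fun_prop) fun z hz h => ?_
    have h3 := hz n (Finset.mem_range.mp hn)
    rw [sub_eq_zero] at h
    rw [← h] at h3; simp at h3
  have hF : ∀ N, DifferentiableOn ℂ (fun z => unitaryMean (gasWeight (B z) : (Fin N → ℂ) → ℂ)) U := fun N => by
    have := differentiableOn_unitaryMean_gasWeight (N := N) hUo (b := B) (fun n => (hBd n).differentiableOn) (fun z _ => ?_)
      (TorusCont.const 1)
    · simpa only [mul_one] using this
    · refine ⟨fun n => (‖z‖ + 2) * ‖b n‖, hb.mul_left _, ?_⟩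
      filter_upwards [Metric.ball_mem_nhds z one_pos] with w hw n
      refine (hBle w n).trans (mul_le_mul_of_nonneg_right ?_ (norm_nonneg _))
      rw [Metric.mem_ball, dist_eq_norm] at hw
      have := norm_le_norm_add_norm_sub z w
      rw [norm_sub_rev] at this
      linarith
  have key := tendsto_of_locally_bounded hUo hUc.isPreconnected hF hG (fun z hz => ?_) h0U ?_ h1U
  · simpa only [hB1] using key
  · -- near `z` the real parts of the couplings stay below `g`, halfway between their values and `1`
    set g : ℕ → ℝ := fun n => if n < M then max 0 ((1 + (z * b n).re) / 2) else ‖b n‖ with hgdef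
    have hg : Summable g := by
      refine hb.congr_cofinite ?_
      rw [Nat.cofinite_eq_atTop]
      filter_upwards [eventually_ge_atTop M] with n hn
      simp [hgdef, not_lt.mpr hn]
    have hg0 : ∀ n, 0 ≤ g n := fun n => by
      simp only [hgdef]; split_ifs
      · exact le_max_left _ _
      · exact norm_nonneg _
    have hg1 : ∀ n, g n < 1 := fun n => by
      simp only [hgdef]; split_ifs with h
      · have := hz n h
        exact max_lt one_pos (by linarith)
      · exact hM n (not_lt.mp h)
    obtain ⟨C, hC⟩ := exists_unitaryMean_gasWeight_le hg hg0 hg1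
    · refine ⟨C, ?_⟩
      have h1 : ∀ᶠ w in 𝓝 z, ∀ n ∈ Finset.range M, (w * b n).re < (1 + (z * b n).re) / 2 := by
        rw [Finset.eventually_all]
        intro n hn
        have := hz n (Finset.mem_range.mp hn)
        exact (Continuous.tendsto (by fun_prop) z).eventually_lt_const (by linarith)
      filter_upwards [h1] with w hw N
      refine hC (B w) (hBs w) (fun n => ?_) N
      simp only [hB, hgdef]
      split_ifs with h
      · exact (hw n (Finset.mem_range.mpr h)).le.trans (le_max_right _ _)
      · exact Complex.re_le_norm _
  · have h1 : ∀ᶠ z : ℂ in 𝓝 0, ∀ n ∈ Finset.range M, ‖z * b n‖ < 1 := by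
      rw [Finset.eventually_all]
      intro n _
      exact (Continuous.tendsto (by fun_prop) 0).eventually_lt_const (by simp)
    filter_upwards [h1] with z hz
    have h2 := tendsto_unitaryMean_psMon (hBs z) (fun n => ?_) 0 0
    · simp only [unitaryMean_gasWeight_eq, if_true] at h2
      simpa [zMult] using h2
    · simp only [hB]; split_ifs with h
      · exact hz n (Finset.mem_range.mpr h)
      · exact hM n (not_lt.mp h)

/-! ### The single letter index -/

/-- The couplings of the index. -/
def letterCoupling (t u v p q : ℂ) (n : ℕ) : ℂ :=
  singleLetter (t ^ (n + 1)) (u ^ (n + 1)) (v ^ (n + 1)) (p ^ (n + 1)) (q ^ (n + 1))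

theorem index_eq_unitaryMean (N : ℕ) (t u v p q : ℂ) :
    index N t u v p q = unitaryMean (gasWeight (letterCoupling t u v p q) : (Fin N → ℂ) → ℂ) := rfl

theorem norm_letterCoupling_le {ρ : ℝ} (hρ : ρ < 1) {t u v p q : ℂ} (ht : ‖t‖ ≤ ρ) (hu : ‖u‖ ≤ ρ) (hv : ‖v‖ ≤ ρ)
    (hp : ‖p‖ ≤ ρ) (hq : ‖q‖ ≤ ρ) (n : ℕ) : ‖letterCoupling t u v p q n‖ ≤ 10 / (1 - ρ) * (ρ ^ (n + 1) / (1 - ρ)) := by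
  have h0 : 0 ≤ ρ := (norm_nonneg t).trans ht
  have hpow : ∀ {z : ℂ}, ‖z‖ ≤ ρ → ‖z ^ (n + 1)‖ ≤ ρ ^ (n + 1) := fun h => by
    rw [norm_pow]; exact pow_le_pow_left₀ (norm_nonneg _) h _
  have hσ1 : ρ ^ (n + 1) ≤ 1 := pow_le_one₀ h0 hρ.le
  have hσ0 : 0 ≤ ρ ^ (n + 1) := by positivity
  have hp1 : 1 - p ^ (n + 1) ≠ 0 := one_sub_pow_ne_zero (hp.trans_lt hρ) n
  have hq1 : 1 - q ^ (n + 1) ≠ 0 := one_sub_pow_ne_zero (hq.trans_lt hρ) n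
  have hmul : ∀ {z w : ℂ}, ‖z‖ ≤ ρ ^ (n + 1) → ‖w‖ ≤ ρ ^ (n + 1) → ‖z * w‖ ≤ ρ ^ (n + 1) := fun {z w} hz hw => by
    rw [norm_mul]; nlinarith [norm_nonneg z, norm_nonneg w]
  have e : letterCoupling t u v p q n = (-p ^ (n + 1) + -q ^ (n + 1) + p ^ (n + 1) * q ^ (n + 1) + t ^ (n + 1) + u ^ (n + 1) +
      v ^ (n + 1) + -(t ^ (n + 1) * u ^ (n + 1)) + -(t ^ (n + 1) * v ^ (n + 1)) + -(u ^ (n + 1) * v ^ (n + 1)) +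
      t ^ (n + 1) * u ^ (n + 1) * v ^ (n + 1)) / ((1 - p ^ (n + 1)) * (1 - q ^ (n + 1))) := by
    rw [letterCoupling, singleLetter]
    generalize p ^ (n + 1) = p' at *
    generalize q ^ (n + 1) = q' at *
    field_simp
    ring
  have ht' := hpow ht
  have hu' := hpow hu
  have hv' := hpow hv
  have hp' := hpow hp
  have hq' := hpow hq
  rw [e, norm_div, norm_mul, div_mul_div_comm]
  have h1ρ : 0 < 1 - ρ := by linarith
  refine div_le_div₀ (by positivity) ?_ (by positivity)
    (mul_le_mul (norm_one_sub_pow_ge hρ hp n) (norm_one_sub_pow_ge hρ hq n) h1ρ.le (norm_nonneg _))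
  refine (norm_add_le_of_le (norm_add_le_of_le (norm_add_le_of_le (norm_add_le_of_le (norm_add_le_of_le
    (norm_add_le_of_le (norm_add_le_of_le (norm_add_le_of_le (norm_add_le_of_le ((norm_neg _).trans_le hp')
    ((norm_neg _).trans_le hq')) (hmul hp' hq')) ht') hu') hv') ((norm_neg _).trans_le (hmul ht' hu')))
    ((norm_neg _).trans_le (hmul ht' hv'))) ((norm_neg _).trans_le (hmul hu' hv'))) (hmul (hmul ht' hu') hv')).trans
    (le_of_eq (by ring))

theorem summable_letterCoupling_bound {ρ : ℝ} (h0 : 0 ≤ ρ) (hρ : ρ < 1) :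
    Summable fun n : ℕ => 10 / (1 - ρ) * (ρ ^ (n + 1) / (1 - ρ)) := (summable_pow_succ_div h0 hρ).mul_left _

theorem summable_letterCoupling {t u v p q : ℂ} (ht : ‖t‖ < 1) (hu : ‖u‖ < 1) (hv : ‖v‖ < 1) (hp : ‖p‖ < 1)
    (hq : ‖q‖ < 1) : Summable fun n => ‖letterCoupling t u v p q n‖ := by
  obtain ⟨ρ, hρ1, hρ2⟩ := exists_between (max_lt (max_lt (max_lt ht hu) (max_lt hv hp)) hq)
  have h := hρ1.le
  simp only [max_le_iff] at h
  exact Summable.of_nonneg_of_le (fun _ => norm_nonneg _)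
    (norm_letterCoupling_le hρ2 h.1.1.1 h.1.1.2 h.1.2.1 h.1.2.2 h.2)
    (summable_letterCoupling_bound ((norm_nonneg t).trans h.1.1.1) hρ2)

theorem tprod_letterCoupling {t u v p q : ℂ} (ht : ‖t‖ < 1) (hu : ‖u‖ < 1) (hv : ‖v‖ < 1) (hp : ‖p‖ < 1)
    (hq : ‖q‖ < 1) : ∏' n, (1 - letterCoupling t u v p q n)⁻¹ = indexInfty t u v p q := by
  have h := ((hasProd_qPoch_self hq).mul (hasProd_qPoch_self hp)).mul (((hasProd_inv_qPoch_self ht).mul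
    (hasProd_inv_qPoch_self hu)).mul (hasProd_inv_qPoch_self hv))
  rw [indexInfty, div_eq_mul_inv, mul_inv, mul_inv, ← h.tprod_eq]
  refine tprod_congr fun n => ?_
  rw [letterCoupling, singleLetter, sub_sub_cancel, inv_div, div_eq_mul_inv, mul_inv, mul_inv]
  ring

/-- The limit of the index at fixed fugacities. -/
theorem tendsto_index {t u v p q : ℂ} (ht : ‖t‖ < 1) (hu : ‖u‖ < 1) (hv : ‖v‖ < 1) (hp : ‖p‖ < 1) (hq : ‖q‖ < 1)
    (hre : ∀ n : ℕ, 1 ≤ n → (singleLetter (t ^ n) (u ^ n) (v ^ n) (p ^ n) (q ^ n)).re < 1) :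
    Tendsto (fun N : ℕ => index N t u v p q) atTop (𝓝 (indexInfty t u v p q)) := by
  rw [← tprod_letterCoupling ht hu hv hp hq]
  simp only [index_eq_unitaryMean]
  exact tendsto_unitaryMean_gasWeight (summable_letterCoupling ht hu hv hp hq) fun n => hre (n + 1) (by omega)

/-! ### Coefficients of functions of two variables -/

open Real (circleAverage circleAverage_def circleAverage_congr_sphere circleAverage_eq_circleIntegral)

theorem hasSum_circleAverage {ι : Type*} [Countable ι] {r : ℝ} {f : ι → ℂ → ℂ} {g : ℂ → ℂ} {u : ι → ℝ}
    (hf : ∀ i, Continuous fun θ => f i (circleMap 0 r θ)) (hu : Summable u)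
    (hb : ∀ i θ, ‖f i (circleMap 0 r θ)‖ ≤ u i)
    (hg : ∀ θ, HasSum (fun i => f i (circleMap 0 r θ)) (g (circleMap 0 r θ))) :
    HasSum (fun i => circleAverage (f i) 0 r) (circleAverage g 0 r) := by
  simp only [circleAverage_def]
  refine HasSum.const_smul _ (intervalIntegral.hasSum_integral_of_dominated_convergence (fun i _ => u i)
    (fun i => (hf i).aestronglyMeasurable) (fun i => Eventually.of_forall fun θ _ => hb i θ)
    (Eventually.of_forall fun _ _ => hu) intervalIntegrable_const (Eventually.of_forall fun θ _ => hg θ))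

theorem norm_circleAverage_le {r C : ℝ} {f : ℂ → ℂ} (h : ∀ θ, ‖f (circleMap 0 r θ)‖ ≤ C) :
    ‖circleAverage f 0 r‖ ≤ C := by
  rw [circleAverage_def, norm_smul, Real.norm_of_nonneg (by positivity), inv_mul_le_iff₀ Real.two_pi_pos]
  refine (intervalIntegral.norm_integral_le_of_norm_le_const fun θ _ => h θ).trans (le_of_eq ?_)
  rw [sub_zero, abs_of_pos Real.two_pi_pos, mul_comm]

theorem circleAverage_const_mul (c : ℂ) (f : ℂ → ℂ) (r : ℝ) :
    circleAverage (fun z => c * f z) 0 r = c * circleAverage f 0 r := by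
  rw [circleAverage_def, circleAverage_def, intervalIntegral.integral_const_mul, mul_smul_comm]

theorem circleAverage_eq_of_annulus {r r' : ℝ} (h0 : 0 < r) (hle : r ≤ r') {f : ℂ → ℂ}
    (hc : ContinuousOn f (Metric.closedBall 0 r' \ Metric.ball 0 r))
    (hd : ∀ z ∈ Metric.ball (0 : ℂ) r' \ Metric.closedBall 0 r, DifferentiableAt ℂ f z) :
    circleAverage f 0 r' = circleAverage f 0 r := by
  rw [circleAverage_eq_circleIntegral (h0.trans_le hle).ne', circleAverage_eq_circleIntegral h0.ne',
    Complex.circleIntegral_sub_center_inv_smul_eq_of_differentiable_on_annulus_off_countable h0 hle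
      Set.countable_empty hc fun z hz => hd z hz.1]

/-- The average of a function of two variables over the product of two circles about the origin. -/
def biMean (r s : ℝ) (G : ℂ → ℂ → ℂ) : ℂ := circleAverage (fun u => circleAverage (G u) 0 s) 0 r

theorem hasSum_biMean {ι : Type*} [Countable ι] {r s : ℝ} {f : ι → ℂ → ℂ → ℂ} {g : ℂ → ℂ → ℂ} {b : ι → ℝ}
    (hf : ∀ i, Continuous fun z : ℝ × ℝ => f i (circleMap 0 r z.1) (circleMap 0 s z.2)) (hu : Summable b)
    (hb : ∀ i θ φ, ‖f i (circleMap 0 r θ) (circleMap 0 s φ)‖ ≤ b i)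
    (hg : ∀ θ φ, HasSum (fun i => f i (circleMap 0 r θ) (circleMap 0 s φ)) (g (circleMap 0 r θ) (circleMap 0 s φ))) :
    HasSum (fun i => biMean r s (f i)) (biMean r s g) := by
  refine hasSum_circleAverage (fun i => ?_) hu (fun i θ => norm_circleAverage_le (hb i θ)) fun θ =>
    hasSum_circleAverage (fun i => (hf i).comp (Continuous.prodMk_right θ)) hu (fun i φ => hb i θ φ) (hg θ)
  simp only [circleAverage_def]
  exact (intervalIntegral.continuous_parametric_intervalIntegral_of_continuous' (hf i) 0 (2 * Real.pi)).const_smul _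

theorem biMean_const_mul (c : ℂ) (r s : ℝ) (G : ℂ → ℂ → ℂ) : biMean r s (fun u y => c * G u y) = c * biMean r s G := by
  unfold biMean
  simp only [circleAverage_const_mul]

theorem biMean_swap {r s : ℝ} {G : ℂ → ℂ → ℂ}
    (hG : Continuous fun z : ℝ × ℝ => G (circleMap 0 r z.1) (circleMap 0 s z.2)) :
    biMean r s G = biMean s r fun y u => G u y := by
  have hint : Integrable (fun z : ℝ × ℝ => G (circleMap 0 r z.1) (circleMap 0 s z.2))
      ((volume.restrict (Set.Ioc 0 (2 * Real.pi))).prod (volume.restrict (Set.Ioc 0 (2 * Real.pi)))) := by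
    rw [Measure.prod_restrict]
    exact (hG.continuousOn.integrableOn_compact (isCompact_Icc.prod isCompact_Icc)).mono_set
      (Set.prod_mono Set.Ioc_subset_Icc_self Set.Ioc_subset_Icc_self)
  unfold biMean
  simp only [circleAverage_def, intervalIntegral.integral_of_le Real.two_pi_pos.le]
  rw [integral_smul, integral_smul]
  congr 2
  exact integral_integral_swap hint

/-- The coefficient of `u^j y^k` in the expansion of a function `F u y`. -/
def biCoeff (r s : ℝ) (j k : ℤ) (F : ℂ → ℂ → ℂ) : ℂ := biMean r s fun u y => u ^ (-j) * y ^ (-k) * F u y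

/-- Functions of two variables that are continuous on a closed bidisc and holomorphic in each variable
inside of it. -/
structure BiHol (R σ : ℝ) (F : ℂ → ℂ → ℂ) : Prop where
  cont : ContinuousOn (fun z : ℂ × ℂ => F z.1 z.2) (Metric.closedBall 0 R ×ˢ Metric.closedBall 0 σ)
  left : ∀ y ∈ Metric.closedBall (0 : ℂ) σ, DifferentiableOn ℂ (fun u => F u y) (Metric.ball 0 R)
  right : ∀ u ∈ Metric.closedBall (0 : ℂ) R, DifferentiableOn ℂ (F u) (Metric.ball 0 σ)

section bihol
variable {R σ r r' s s' : ℝ} {F : ℂ → ℂ → ℂ}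

theorem norm_circleMap_zero' (hr : 0 < r) (θ : ℝ) : ‖circleMap 0 r θ‖ = r := by
  rw [norm_circleMap_zero, abs_of_pos hr]

theorem BiHol.continuous_torus (hF : BiHol R σ F) (hr : 0 < r) (hrR : r ≤ R) (hs : 0 < s) (hsσ : s ≤ σ) :
    Continuous fun z : ℝ × ℝ => F (circleMap 0 r z.1) (circleMap 0 s z.2) := by
  have h : Continuous fun z : ℝ × ℝ => (circleMap 0 r z.1, circleMap 0 s z.2) :=
    ((continuous_circleMap 0 r).comp continuous_fst).prodMk ((continuous_circleMap 0 s).comp continuous_snd)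
  exact hF.cont.comp_continuous h fun z => ⟨mem_closedBall_zero_iff.mpr (by rw [norm_circleMap_zero' hr]; exact hrR),
    mem_closedBall_zero_iff.mpr (by rw [norm_circleMap_zero' hs]; exact hsσ)⟩

theorem continuous_zpow_circleMap (hr : 0 < r) (j : ℤ) : Continuous fun θ => circleMap 0 r θ ^ j :=
  (continuous_circleMap 0 r).zpow₀ j fun _ => Or.inl (circleMap_ne_center hr.ne')

theorem continuous_torus_monomial (hr : 0 < r) (hs : 0 < s) (j k : ℤ)
    (hF : Continuous fun z : ℝ × ℝ => F (circleMap 0 r z.1) (circleMap 0 s z.2)) :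
    Continuous fun z : ℝ × ℝ => circleMap 0 r z.1 ^ (-j) * circleMap 0 s z.2 ^ (-k) *
      F (circleMap 0 r z.1) (circleMap 0 s z.2) :=
  (((continuous_zpow_circleMap hr (-j)).comp continuous_fst).mul
    ((continuous_zpow_circleMap hs (-k)).comp continuous_snd)).mul hF

/-- Cauchy's theorem on an annulus for a function times a monomial. -/
theorem circleAverage_zpow_mul {f : ℂ → ℂ} (hf : ContinuousOn f (Metric.closedBall 0 R))
    (hf' : DifferentiableOn ℂ f (Metric.ball 0 R)) (hr : 0 < r) (hrR : r ≤ R) (j : ℤ) :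
    circleAverage (fun z => z ^ j * f z) 0 R = circleAverage (fun z => z ^ j * f z) 0 r := by
  refine circleAverage_eq_of_annulus hr hrR ?_ fun z hz => ?_
  · refine ContinuousOn.mul (ContinuousOn.zpow₀ continuousOn_id j fun z hz => Or.inl ?_) (hf.mono Set.sdiff_subset)
    rintro rfl
    exact hz.2 (Metric.mem_ball_self hr)
  · have h0 : z ≠ 0 := by
      rintro rfl
      exact hz.2 (Metric.mem_closedBall_self hr.le)
    exact (differentiableAt_zpow.mpr (Or.inl h0)).mul (hf'.differentiableAt (Metric.isOpen_ball.mem_nhds hz.1))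

theorem BiHol.continuousOn_left (hF : BiHol R σ F) {y : ℂ} (hy : y ∈ Metric.closedBall 0 σ) :
    ContinuousOn (fun u => F u y) (Metric.closedBall 0 R) :=
  hF.cont.comp (f := fun u : ℂ => (u, y)) (by fun_prop) fun u hu => ⟨hu, hy⟩

theorem BiHol.continuousOn_right (hF : BiHol R σ F) {u : ℂ} (hu : u ∈ Metric.closedBall 0 R) :
    ContinuousOn (F u) (Metric.closedBall 0 σ) :=
  hF.cont.comp (f := fun y : ℂ => (u, y)) (by fun_prop) fun y hy => ⟨hu, hy⟩

/-- The coefficients do not depend on the radii. -/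
theorem BiHol.biCoeff_eq (hF : BiHol R σ F) (hr : 0 < r) (hrR : r ≤ R) (hs : 0 < s) (hsσ : s ≤ σ) (j k : ℤ) :
    biCoeff R σ j k F = biCoeff r s j k F := by
  have hR := hr.trans_le hrR
  have hσ := hs.trans_le hsσ
  have h1 : biCoeff R σ j k F = biCoeff R s j k F := by
    unfold biCoeff biMean
    refine circleAverage_congr_sphere fun u hu => ?_
    rw [abs_of_pos hR] at hu
    have hu' := Metric.sphere_subset_closedBall hu
    simp only [mul_assoc, circleAverage_const_mul]
    congr 1
    exact circleAverage_zpow_mul (hF.continuousOn_right hu') (hF.right u hu') hs hsσ (-k)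
  have h2 : biCoeff R s j k F = biCoeff r s j k F := by
    refine (biMean_swap (continuous_torus_monomial hR hs j k (hF.continuous_torus hR le_rfl hs hsσ))).trans
      (Eq.trans ?_ (biMean_swap (continuous_torus_monomial hr hs j k (hF.continuous_torus hr hrR hs hsσ))).symm)
    unfold biMean
    refine circleAverage_congr_sphere fun y hy => ?_
    rw [abs_of_pos hs] at hy
    have hy' := Metric.closedBall_subset_closedBall hsσ (Metric.sphere_subset_closedBall hy)
    simp only [mul_comm _ (y ^ (-k)), mul_assoc, circleAverage_const_mul]
    congr 1
    exact circleAverage_zpow_mul (hF.continuousOn_left hy') (hF.left y hy') hr hrR (-j)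
  rw [h1, h2]

theorem norm_biCoeff_le (hr : 0 < r) (hs : 0 < s) (j k : ℤ) {C : ℝ}
    (h : ∀ θ φ, ‖F (circleMap 0 r θ) (circleMap 0 s φ)‖ ≤ C) :
    ‖biCoeff r s j k F‖ ≤ r ^ (-j) * s ^ (-k) * C := by
  refine norm_circleAverage_le fun θ => norm_circleAverage_le fun φ => ?_
  rw [norm_mul, norm_mul, norm_zpow, norm_zpow, norm_circleMap_zero' hr, norm_circleMap_zero' hs]
  exact mul_le_mul_of_nonneg_left (h θ φ) (by positivity)

theorem hasSum_biCoeff {ι : Type*} [Countable ι] (hr : 0 < r) (hs : 0 < s) (j k : ℤ) {f : ι → ℂ → ℂ → ℂ} {b : ι → ℝ}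
    (hf : ∀ i, Continuous fun z : ℝ × ℝ => f i (circleMap 0 r z.1) (circleMap 0 s z.2)) (hu : Summable b)
    (hb : ∀ i θ φ, ‖f i (circleMap 0 r θ) (circleMap 0 s φ)‖ ≤ b i)
    (hg : ∀ θ φ, HasSum (fun i => f i (circleMap 0 r θ) (circleMap 0 s φ)) (F (circleMap 0 r θ) (circleMap 0 s φ))) :
    HasSum (fun i => biCoeff r s j k (f i)) (biCoeff r s j k F) := by
  refine hasSum_biMean (fun i => continuous_torus_monomial hr hs j k (hf i)) (hu.mul_left (r ^ (-j) * s ^ (-k)))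
    (fun i θ φ => ?_) fun θ φ => (hg θ φ).mul_left _
  rw [norm_mul, norm_mul, norm_zpow, norm_zpow, norm_circleMap_zero' hr, norm_circleMap_zero' hs]
  exact mul_le_mul_of_nonneg_left (hb i θ φ) (by positivity)

theorem biCoeff_const_mul (c : ℂ) (j k : ℤ) : biCoeff r s j k (fun u y => c * F u y) = c * biCoeff r s j k F := by
  unfold biCoeff
  rw [← biMean_const_mul]
  simp only [mul_left_comm]

theorem taylorCoeff_eq {f : ℂ → ℂ} (hs : 0 < s) (hf : ContinuousOn f (Metric.closedBall 0 s))
    (hf' : DifferentiableOn ℂ f (Metric.ball 0 s)) (k : ℕ) :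
    taylorCoeff f k = circleAverage (fun y => y ^ (-(k : ℤ)) * f y) 0 s := by
  have hd : DiffContOnCl ℂ f (Metric.ball 0 s) := ⟨hf', by rwa [closure_ball _ hs.ne']⟩
  have h := hd.circleIntegral_one_div_sub_center_pow_smul hs k
  have hk : (k.factorial : ℂ) ≠ 0 := by exact_mod_cast k.factorial_ne_zero
  rw [circleAverage_eq_circleIntegral hs.ne', taylorCoeff]
  have e : (circleIntegral (fun z => (z - 0)⁻¹ • (z ^ (-(k : ℤ)) * f z)) 0 s) =
      circleIntegral (fun z => (1 / (z - 0) ^ (k + 1)) • f z) 0 s := by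
    congr 1; funext z
    rw [sub_zero, smul_eq_mul, smul_eq_mul, zpow_neg, zpow_natCast, pow_succ, one_div, mul_inv]
    ring
  rw [e, h, smul_smul, smul_eq_mul]
  have := Complex.two_pi_I_ne_zero
  field_simp

theorem laurentCoeff_eq (hr : 0 < r) (G : ℂ → ℂ) (m : ℤ) :
    laurentCoeff r G m = circleAverage (fun u => u ^ (-m) * G u) 0 r := by
  rw [circleAverage_eq_circleIntegral hr.ne', laurentCoeff, smul_eq_mul]
  congr 1
  refine circleIntegral.integral_congr hr.le fun u hu => ?_
  have h0 : u ≠ 0 := by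
    rintro rfl
    rw [mem_sphere_zero_iff_norm, norm_zero] at hu
    exact hr.ne hu
  change u ^ (-m - 1) * G u = (u - 0)⁻¹ * (u ^ (-m) * G u)
  rw [zpow_sub_one₀ h0, sub_zero]
  ring

theorem iteratedDeriv_comp_mul_left (k : ℕ) (f : ℂ → ℂ) (c : ℂ) :
    iteratedDeriv k (fun z => f (c * z)) = fun z => c ^ k * iteratedDeriv k f (c * z) := by
  induction k with
  | zero => simp
  | succ k ih =>
    rw [iteratedDeriv_succ, ih]
    funext z
    rw [deriv_const_mul_field, deriv_comp_mul_left c (iteratedDeriv k f) z, iteratedDeriv_succ, smul_eq_mul, pow_succ,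
      mul_assoc]

/-- The change of variables `p = u y` turns the expansion coefficients into those of a function that is
holomorphic at `u = 0`. -/
theorem BiHol.puCoeff_eq (hF : BiHol r s F) (hr : 0 < r) (hs : 0 < s) {I : ℂ → ℂ → ℂ → ℂ → ℂ → ℂ} {q t : ℂ}
    (hI : ∀ u p, u ≠ 0 → I t u (p * q / (t * u)) p q = F u (p / u)) (k : ℕ) (m : ℤ) :
    puCoeff I q t r k m = biCoeff r s (m + k) k F := by
  rw [puCoeff, laurentCoeff_eq hr, biCoeff, biMean]
  refine circleAverage_congr_sphere fun u hu => ?_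
  rw [abs_of_pos hr] at hu
  have hu' := Metric.sphere_subset_closedBall hu
  have hun : ‖u‖ = r := by simpa using hu
  have h0 : u ≠ 0 := norm_pos_iff.mp (by rw [hun]; exact hr)
  simp only [hI u _ h0]
  have hcont := hF.continuousOn_right hu'
  have hdiff := hF.right u hu'
  have e1 : taylorCoeff (fun p => F u (p / u)) k = u ^ (-(k : ℤ)) * taylorCoeff (F u) k := by
    have h := congrFun (iteratedDeriv_comp_mul_left k (F u) u⁻¹) 0
    simp only [div_eq_inv_mul]
    rw [taylorCoeff, h, mul_zero, taylorCoeff, zpow_neg, zpow_natCast, inv_pow, mul_div_assoc]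
  rw [e1, taylorCoeff_eq hs hcont hdiff]
  simp only [mul_assoc, circleAverage_const_mul]
  rw [neg_add, zpow_add₀ h0, mul_assoc]

end bihol

/-! ### The index as a function of `u` and `y = p / u` -/

section closure
variable {R σ : ℝ} {F G : ℂ → ℂ → ℂ}

theorem BiHol.const (c : ℂ) : BiHol R σ fun _ _ => c :=
  ⟨continuousOn_const, fun _ _ => differentiableOn_const _, fun _ _ => differentiableOn_const _⟩

theorem BiHol.fst : BiHol R σ fun u _ => u :=
  ⟨continuousOn_fst, fun _ _ => differentiableOn_id, fun _ _ => differentiableOn_const _⟩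

theorem BiHol.snd : BiHol R σ fun _ y => y :=
  ⟨continuousOn_snd, fun _ _ => differentiableOn_const _, fun _ _ => differentiableOn_id⟩

theorem BiHol.mul (hF : BiHol R σ F) (hG : BiHol R σ G) : BiHol R σ fun u y => F u y * G u y :=
  ⟨hF.cont.mul hG.cont, fun y hy => (hF.left y hy).mul (hG.left y hy), fun u hu => (hF.right u hu).mul (hG.right u hu)⟩

theorem BiHol.const_sub (c : ℂ) (hG : BiHol R σ G) : BiHol R σ fun u y => c - G u y :=
  ⟨continuousOn_const.sub hG.cont, fun y hy => (hG.left y hy).const_sub c, fun u hu => (hG.right u hu).const_sub c⟩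

theorem BiHol.pow (hF : BiHol R σ F) (n : ℕ) : BiHol R σ fun u y => F u y ^ n :=
  ⟨hF.cont.pow n, fun y hy => (hF.left y hy).pow n, fun u hu => (hF.right u hu).pow n⟩

theorem BiHol.div (hF : BiHol R σ F) (hG : BiHol R σ G)
    (h0 : ∀ u ∈ Metric.closedBall (0 : ℂ) R, ∀ y ∈ Metric.closedBall (0 : ℂ) σ, G u y ≠ 0) :
    BiHol R σ fun u y => F u y / G u y :=
  ⟨hF.cont.div hG.cont fun _ hz => h0 _ hz.1 _ hz.2,
    fun y hy => (hF.left y hy).div (hG.left y hy) fun u hu => h0 u (Metric.ball_subset_closedBall hu) y hy,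
    fun u hu => (hF.right u hu).div (hG.right u hu) fun y hy => h0 u hu y (Metric.ball_subset_closedBall hy)⟩

theorem BiHol.prod {ι : Type*} {I : Finset ι} {F : ι → ℂ → ℂ → ℂ} (h : ∀ i, BiHol R σ (F i)) :
    BiHol R σ fun u y => ∏ i ∈ I, F i u y :=
  ⟨continuousOn_finsetProd _ fun i _ => (h i).cont,
    fun y hy => DifferentiableOn.fun_finsetProd fun i _ => (h i).left y hy,
    fun u hu => DifferentiableOn.fun_finsetProd fun i _ => (h i).right u hu⟩

theorem BiHol.comp {f : ℂ → ℂ} {U : Set ℂ} (hf : DifferentiableOn ℂ f U) (hF : BiHol R σ F)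
    (h : ∀ u ∈ Metric.closedBall (0 : ℂ) R, ∀ y ∈ Metric.closedBall (0 : ℂ) σ, F u y ∈ U) :
    BiHol R σ fun u y => f (F u y) :=
  ⟨hf.continuousOn.comp hF.cont fun _ hz => h _ hz.1 _ hz.2,
    fun y hy => hf.comp (hF.left y hy) fun u hu => h u (Metric.ball_subset_closedBall hu) y hy,
    fun u hu => hf.comp (hF.right u hu) fun y hy => h u hu y (Metric.ball_subset_closedBall hy)⟩

end closure

/-- The conditions on the radii of the bidisc under which `u`, `v = c y` and `p = u y` have modulus
less than one. The ratio `v / y = q / t` is `c`. -/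
structure Admissible (c : ℂ) (r σ : ℝ) : Prop where
  r_pos : 0 < r
  r_lt : r < 1
  s_pos : 0 < σ
  s_le : σ ≤ 1 / 2
  cs_le : ‖c‖ * σ ≤ 1 / 2

section bidisc
variable {c q t : ℂ} {r σ : ℝ}

theorem Admissible.norms (h : Admissible c r σ) {u y : ℂ} (hu : u ∈ Metric.closedBall (0 : ℂ) r)
    (hy : y ∈ Metric.closedBall (0 : ℂ) σ) : ‖u‖ ≤ r ∧ ‖y‖ ≤ 1 / 2 ∧ ‖c * y‖ ≤ 1 / 2 ∧ ‖u * y‖ ≤ 1 / 2 := by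
  rw [mem_closedBall_zero_iff] at hu hy
  have h1 := h.s_le
  have h2 := h.r_lt
  refine ⟨hu, hy.trans h1, ?_, ?_⟩
  · rw [norm_mul]
    exact (mul_le_mul_of_nonneg_left hy (norm_nonneg _)).trans h.cs_le
  · rw [norm_mul]
    nlinarith [norm_nonneg u, norm_nonneg y]

theorem biHol_letterCoupling (h : Admissible c r σ) (hq : ‖q‖ < 1) (n : ℕ) :
    BiHol r σ fun u y => letterCoupling t u (c * y) (u * y) q n := by
  have hp : BiHol r σ fun u y => 1 - (u * y) ^ (n + 1) := BiHol.const_sub 1 ((BiHol.fst.mul BiHol.snd).pow _)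
  have hv : BiHol r σ fun _ y => 1 - (c * y) ^ (n + 1) := BiHol.const_sub 1 (((BiHol.const c).mul BiHol.snd).pow _)
  have hu : BiHol r σ fun u _ => 1 - u ^ (n + 1) := BiHol.const_sub 1 (BiHol.fst.pow _)
  refine BiHol.const_sub 1 ((((BiHol.const _).mul hu).mul hv).div (hp.mul (BiHol.const (1 - q ^ (n + 1))))
    fun u hu y hy => mul_ne_zero (one_sub_pow_ne_zero ?_ n) (one_sub_pow_ne_zero hq n))
  exact ((h.norms hu hy).2.2.2).trans_lt (by norm_num)

/-- In the variables `u` and `y = p / u` the index has no pole at `u = 0`. -/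
theorem biHol_index (h : Admissible c r σ) (hq : ‖q‖ < 1) (ht : ‖t‖ < 1) (N : ℕ) :
    BiHol r σ fun u y => index N t u (c * y) (u * y) q := by
  obtain ⟨ρ, hρ1, hρ2⟩ := exists_between (max_lt (max_lt ht hq) (max_lt h.r_lt (by norm_num : (1 / 2 : ℝ) < 1)))
  have hle := hρ1.le
  simp only [max_le_iff] at hle
  have h0 : 0 ≤ ρ := (norm_nonneg _).trans hle.1.1
  have hs := summable_letterCoupling_bound h0 hρ2
  have hB : ∀ u ∈ Metric.closedBall (0 : ℂ) r, ∀ y ∈ Metric.closedBall (0 : ℂ) σ, ∀ n,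
      ‖letterCoupling t u (c * y) (u * y) q n‖ ≤ 10 / (1 - ρ) * (ρ ^ (n + 1) / (1 - ρ)) := fun u hu y hy n => by
    have hn := h.norms hu hy
    exact norm_letterCoupling_le hρ2 hle.1.1 (hn.1.trans hle.2.1) (hn.2.2.1.trans hle.2.2) (hn.2.2.2.trans hle.2.2)
      hle.1.2 n
  have e : (fun u y => index N t u (c * y) (u * y) q) = fun u y => unitaryMean fun x : Fin N → ℂ =>
      gasWeight (letterCoupling t u (c * y) (u * y) q) x * (fun _ => 1) x := by
    funext u y
    simp only [mul_one]
    rfl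
  rw [e]
  refine ⟨?_, fun y hy => ?_, fun u hu => ?_⟩
  · exact continuousOn_unitaryMean_gasWeight (b := fun z : ℂ × ℂ => letterCoupling t z.1 (c * z.2) (z.1 * z.2) q)
      (fun n => (biHol_letterCoupling h hq n).cont) hs (fun z hz n => hB _ hz.1 _ hz.2 n) (TorusCont.const 1)
  · refine differentiableOn_unitaryMean_gasWeight (b := fun u => letterCoupling t u (c * y) (u * y) q) Metric.isOpen_ball
      (fun n => (biHol_letterCoupling h hq n).left y hy) (fun u hu => ⟨_, hs, ?_⟩) (TorusCont.const 1)
    filter_upwards [Metric.isOpen_ball.mem_nhds hu] with w hw n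
    exact hB w (Metric.ball_subset_closedBall hw) y hy n
  · refine differentiableOn_unitaryMean_gasWeight (b := fun y => letterCoupling t u (c * y) (u * y) q) Metric.isOpen_ball
      (fun n => (biHol_letterCoupling h hq n).right u hu) (fun y hy => ⟨_, hs, ?_⟩) (TorusCont.const 1)
    filter_upwards [Metric.isOpen_ball.mem_nhds hy] with w hw n
    exact hB u hu w (Metric.ball_subset_closedBall hw) n

theorem biHol_indexInfty (h : Admissible c r σ) (ht : ‖t‖ < 1) :
    BiHol r σ fun u y => indexInfty t u (c * y) (u * y) q := by
  have hhalf : ∀ {z : ℂ}, ‖z‖ ≤ 1 / 2 → ‖z‖ < 1 := fun hz => hz.trans_lt (by norm_num)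
  have hp : BiHol r σ fun u y => qPoch (u * y) (u * y) := BiHol.comp differentiableOn_qPoch_self (BiHol.fst.mul BiHol.snd)
    fun u hu y hy => mem_ball_zero_iff.mpr (hhalf (h.norms hu hy).2.2.2)
  have hv : BiHol r σ fun _ y => qPoch (c * y) (c * y) := BiHol.comp differentiableOn_qPoch_self
    ((BiHol.const c).mul BiHol.snd) fun u hu y hy => mem_ball_zero_iff.mpr (hhalf (h.norms hu hy).2.2.1)
  have hu : BiHol r σ fun u _ => qPoch u u := BiHol.comp differentiableOn_qPoch_self BiHol.fst
    fun u hu y hy => mem_ball_zero_iff.mpr ((h.norms hu hy).1.trans_lt h.r_lt)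
  refine ((BiHol.const _).mul hp).div (((BiHol.const _).mul hu).mul hv) fun u hu y hy => ?_
  have hn := h.norms hu hy
  have hu1 := hn.1.trans_lt h.r_lt
  exact mul_ne_zero (mul_ne_zero (qPoch_ne_zero ht ht) (qPoch_ne_zero hu1 hu1))
    (qPoch_ne_zero (hhalf hn.2.2.1) (hhalf hn.2.2.1))

/-- The coupling of the index relative to Macdonald's weight. -/
def relCoupling (c u y : ℂ) (n : ℕ) : ℂ := 1 - (1 - u ^ (n + 1)) * (1 - (c * y) ^ (n + 1)) / (1 - (u * y) ^ (n + 1))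

theorem biHol_relCoupling (h : Admissible c r σ) (n : ℕ) : BiHol r σ fun u y => relCoupling c u y n := by
  have hp : BiHol r σ fun u y => 1 - (u * y) ^ (n + 1) := BiHol.const_sub 1 ((BiHol.fst.mul BiHol.snd).pow _)
  have hv : BiHol r σ fun _ y => 1 - (c * y) ^ (n + 1) := BiHol.const_sub 1 (((BiHol.const c).mul BiHol.snd).pow _)
  have hu : BiHol r σ fun u _ => 1 - u ^ (n + 1) := BiHol.const_sub 1 (BiHol.fst.pow _)
  exact BiHol.const_sub 1 ((hu.mul hv).div hp fun u hu y hy => one_sub_pow_ne_zero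
    (((h.norms hu hy).2.2.2).trans_lt (by norm_num)) n)

theorem biHol_couplingMono (h : Admissible c r σ) (κ : ℕ →₀ ℕ) :
    BiHol r σ fun u y => couplingMono (relCoupling c u y) κ :=
  BiHol.prod fun n => (biHol_relCoupling h n).pow _

theorem norm_relCoupling_le {u y : ℂ} (hu : ‖u‖ ≤ 1 / 2) (hy : ‖y‖ ≤ 1 / 2) (n : ℕ) :
    ‖relCoupling c u y n‖ ≤ 4 * (‖u‖ ^ (n + 1) + ‖c * y‖ ^ (n + 1)) := by
  have hUn : ‖u ^ (n + 1)‖ ≤ 1 / 2 := (norm_pow_succ_le (hu.trans_lt (by norm_num)) n).trans hu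
  have hYn : ‖y ^ (n + 1)‖ ≤ 1 / 2 := (norm_pow_succ_le (hy.trans_lt (by norm_num)) n).trans hy
  have hUY : ‖u ^ (n + 1) * y ^ (n + 1)‖ ≤ 1 / 2 * (1 / 2) := by
    rw [norm_mul]; exact mul_le_mul hUn hYn (norm_nonneg _) (by norm_num)
  rw [← norm_pow u, ← norm_pow (c * y), relCoupling, mul_pow u y]
  generalize u ^ (n + 1) = U at *
  generalize y ^ (n + 1) = Y at *
  generalize (c * y) ^ (n + 1) = V at *
  have hd : 1 / 2 ≤ ‖1 - U * Y‖ := by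
    have := norm_sub_norm_le 1 (U * Y)
    rw [norm_one] at this
    linarith
  have hd0 : 1 - U * Y ≠ 0 := norm_pos_iff.mp (by linarith)
  have e : 1 - (1 - U) * (1 - V) / (1 - U * Y) = (U + V + -(U * Y) + -(U * V)) / (1 - U * Y) := by
    field_simp; ring
  rw [e, norm_div, div_le_iff₀ (by linarith)]
  have h1 : ‖U + V + -(U * Y) + -(U * V)‖ ≤ ‖U‖ + ‖V‖ + ‖U‖ * ‖Y‖ + ‖U‖ * ‖V‖ :=
    norm_add_le_of_le (norm_add_le_of_le (norm_add_le _ _) (by rw [norm_neg, norm_mul])) (by rw [norm_neg, norm_mul])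
  nlinarith [norm_nonneg U, norm_nonneg V, norm_nonneg Y]

theorem letterCoupling_eq (hq : ‖q‖ < 1) (t u y : ℂ) (huy : ‖u * y‖ < 1) (n : ℕ) :
    letterCoupling t u (c * y) (u * y) q n =
      (1 - t ^ (n + 1)) / (1 - q ^ (n + 1)) * relCoupling c u y n + macCoupling q t n := by
  have h1 := one_sub_pow_ne_zero hq n
  have h2 := one_sub_pow_ne_zero huy n
  rw [letterCoupling, singleLetter, relCoupling, macCoupling]
  generalize (u * y) ^ (n + 1) = P at *
  generalize q ^ (n + 1) = Q at *
  field_simp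
  ring

theorem prod_map_pow_eq (x : ℝ) (s : Multiset ℕ) : (s.map fun i => x ^ i).prod = x ^ s.sum := by
  induction s using Multiset.induction_on with
  | empty => simp
  | cons a s ih => simp [ih, pow_add]

/-- A product of relative couplings has no Taylor coefficients below its weight. -/
theorem biCoeff_couplingMono_eq_zero (h : Admissible c r σ) (κ : ℕ →₀ ℕ) {j k : ℤ}
    (hjk : j + k < (partMulti κ).sum) :
    biCoeff r σ j k (fun u y => couplingMono (relCoupling c u y) κ) = 0 := by
  set K : ℝ := ((partMulti κ).map fun i => 4 * (1 + ‖c‖ ^ i)).prod with hK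
  have hK0 : 0 ≤ K := Multiset.prod_nonneg fun x hx => by
    obtain ⟨i, -, rfl⟩ := Multiset.mem_map.mp hx
    positivity
  -- Cauchy's estimate on the torus `|u| = |y| = ρ`, on which the product is of order `ρ` to the weight
  have key : ∀ᶠ ρ : ℝ in 𝓝[>] 0, ‖biCoeff r σ j k (fun u y => couplingMono (relCoupling c u y) κ)‖ ≤ K * ρ := by
    filter_upwards [self_mem_nhdsWithin, nhdsWithin_le_nhds (eventually_le_nhds (show (0 : ℝ) < min r σ from lt_min h.r_pos h.s_pos))]
      with ρ hρ0 hρ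
    have hρ0' : 0 < ρ := hρ0
    have hρr := hρ.trans (min_le_left _ _)
    have hρs := hρ.trans (min_le_right _ _)
    have hρ2 := hρs.trans h.s_le
    rw [(biHol_couplingMono h κ).biCoeff_eq hρ0' hρr hρ0' hρs]
    have hb : ∀ θ φ, ‖couplingMono (relCoupling c (circleMap 0 ρ θ) (circleMap 0 ρ φ)) κ‖ ≤ K * ρ ^ (partMulti κ).sum := by
      intro θ φ
      rw [hK, ← prod_map_pow_eq, ← Multiset.prod_map_mul, prod_map_partMulti, couplingMono, Finsupp.prod, norm_prod]
      refine Finset.prod_le_prod (fun _ _ => norm_nonneg _) fun n _ => ?_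
      rw [norm_pow]
      refine pow_le_pow_left₀ (norm_nonneg _) ?_ _
      have hn := norm_circleMap_zero' hρ0'
      refine (norm_relCoupling_le (by rw [hn]; exact hρ2) (by rw [hn]; exact hρ2) n).trans (le_of_eq ?_)
      rw [norm_mul, hn, hn, mul_pow]
      ring
    refine (norm_biCoeff_le hρ0' hρ0' j k hb).trans ?_
    obtain ⟨e, he⟩ := Int.eq_ofNat_of_zero_le (show (0 : ℤ) ≤ (partMulti κ).sum - j - k - 1 by omega)
    have h1 : ρ ^ (-j) * ρ ^ (-k) * (K * ρ ^ (partMulti κ).sum) = K * ρ * ρ ^ e := by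
      have : ρ ^ (-j) * ρ ^ (-k) * ρ ^ (((partMulti κ).sum : ℕ) : ℤ) = ρ ^ (1 + (e : ℤ)) := by
        rw [← zpow_add₀ hρ0'.ne', ← zpow_add₀ hρ0'.ne', ← he]
        congr 1
        ring
      rw [zpow_natCast, zpow_add₀ hρ0'.ne', zpow_one, zpow_natCast] at this
      linear_combination K * this
    rw [h1]
    exact mul_le_of_le_one_right (by positivity) (pow_le_one₀ hρ0'.le (hρ2.trans (by norm_num)))
  have hlim : Tendsto (fun ρ : ℝ => K * ρ) (𝓝[>] 0) (𝓝 0) := by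
    have : Tendsto (fun ρ : ℝ => K * ρ) (𝓝 0) (𝓝 (K * 0)) := (continuous_const.mul continuous_id).tendsto 0
    rw [mul_zero] at this
    exact this.mono_left nhdsWithin_le_nhds
  exact norm_le_zero_iff.mp (ge_of_tendsto hlim key)

theorem finite_partMulti_sum_le (W : ℕ) : {κ : ℕ →₀ ℕ | (partMulti κ).sum ≤ W}.Finite := by
  have h : ((((Finset.range (W + 1)).sigma fun m => (Finset.univ : Finset m.Partition)) :
      Finset (Σ m : ℕ, m.Partition)) : Set (Σ m : ℕ, m.Partition)).Finite := Finset.finite_toSet _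
  refine (h.preimage (f := partitionEquiv.symm) partitionEquiv.symm.injective.injOn).subset fun κ hκ => ?_
  simp only [Set.mem_preimage, Finset.mem_coe, Finset.mem_sigma, Finset.mem_range, Finset.mem_univ, and_true]
  exact Nat.lt_succ_of_le hκ

end bidisc

/-! ### The limit of the index order by order -/

theorem gasWeight_add {N : ℕ} {b d : ℕ → ℂ} (hb : Summable fun n => ‖b n‖) (hd : Summable fun n => ‖d n‖)
    (θ : Fin N → ℝ) : gasWeight (fun n => b n + d n) (torusPt θ) = gasWeight b (torusPt θ) * gasWeight d (torusPt θ) := by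
  have hs : ∀ {c : ℕ → ℂ}, (Summable fun n => ‖c n‖) → Summable fun k : ℕ => c k / ((k + 1 : ℕ) : ℂ) *
      (powerSum (k + 1) (torusPt θ) * powerSum (k + 1) (torusPt θ)⁻¹) := fun {c} hc =>
    Summable.of_norm_bounded (hc.mul_right _) fun k => norm_gas_mode_le c k θ
  rw [gasWeight, gasWeight, gasWeight, ← Complex.exp_add, ← (hs hb).tsum_add (hs hd)]
  simp only [add_div, add_mul]

/-- The ratios `(1 - tⁿ) / (1 - qⁿ)`. -/
def macRatio (q t : ℂ) (n : ℕ) : ℂ := (1 - t ^ (n + 1)) / (1 - q ^ (n + 1))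

theorem norm_macRatio_le {q t : ℂ} (hq : ‖q‖ < 1) (ht : ‖t‖ < 1) (n : ℕ) : ‖macRatio q t n‖ ≤ 2 / (1 - ‖q‖) := by
  rw [macRatio, norm_div]
  refine div_le_div₀ (by norm_num) ?_ (by linarith) (norm_one_sub_pow_ge hq le_rfl n)
  refine (norm_sub_le _ _).trans ?_
  have := (norm_pow_succ_le ht n).trans ht.le
  rw [norm_one]; linarith

/-- The normalised power sum correlators, by which the index is expanded in the relative couplings. -/
def macNorm (N : ℕ) (q t : ℂ) (κ : ℕ →₀ ℕ) : ℂ :=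
  couplingMono (macRatio q t) κ / (zMult κ : ℂ) * macCorr N q t (partMulti κ) (partMulti κ)

/-- In the limit all power sums have the same normalised correlator. -/
theorem tendsto_macNorm {q t : ℂ} (hq : ‖q‖ < 1) (ht : ‖t‖ < 1) (κ : ℕ →₀ ℕ) :
    Tendsto (fun N => macNorm N q t κ) atTop (𝓝 (qPoch q q / qPoch t t)) := by
  have h := (tendsto_macCorr hq ht κ κ).const_mul (couplingMono (macRatio q t) κ / (zMult κ : ℂ))
  rw [if_pos rfl] at h
  refine (congrArg (fun w => Tendsto _ atTop (𝓝 w)) ?_).mp h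
  have e : couplingMono (macRatio q t) κ * (κ.prod fun n m => ((1 - q ^ (n + 1)) / (1 - t ^ (n + 1))) ^ m) = 1 := by
    rw [couplingMono, ← Finsupp.prod_mul]
    refine Finset.prod_eq_one fun n _ => ?_
    have h1 := one_sub_pow_ne_zero hq n
    have h2 := one_sub_pow_ne_zero ht n
    dsimp only
    rw [← mul_pow, macRatio, div_mul_div_cancel₀ h1, div_self h2, one_pow]
  have hz := zMult_ne_zero κ
  rw [macLimit]
  calc _ = (zMult κ / zMult κ : ℂ) * (couplingMono (macRatio q t) κ *
        (κ.prod fun n m => ((1 - q ^ (n + 1)) / (1 - t ^ (n + 1))) ^ m)) * (qPoch q q / qPoch t t) := by ring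
    _ = _ := by rw [e, div_self hz, one_mul, one_mul]

theorem summable_mul_of_bounded {C : ℝ} {a Γ : ℕ → ℝ} (hΓ : Summable Γ) (h0 : ∀ n, 0 ≤ a n) (hΓ0 : ∀ n, 0 ≤ Γ n)
    (hC : ∀ n, a n ≤ C) : Summable fun n => a n * Γ n :=
  Summable.of_nonneg_of_le (fun n => mul_nonneg (h0 n) (hΓ0 n))
    (fun n => mul_le_mul_of_nonneg_right (hC n) (hΓ0 n)) (hΓ.mul_left C)

theorem couplingMono_mul_unitaryMean (N : ℕ) (q t : ℂ) (b : ℕ → ℂ) (κ : ℕ →₀ ℕ) :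
    couplingMono (fun n => macRatio q t n * b n) κ / (zMult κ : ℂ) * (unitaryMean fun x : Fin N → ℂ =>
      powerSumMult κ x * powerSumMult κ x⁻¹ * gasWeight (macCoupling q t) x) = macNorm N q t κ * couplingMono b κ := by
  have e : (unitaryMean fun x : Fin N → ℂ => powerSumMult κ x * powerSumMult κ x⁻¹ * gasWeight (macCoupling q t) x) =
      macCorr N q t (partMulti κ) (partMulti κ) := by
    rw [macCorr_eq_unitaryMean]
    refine unitaryMean_congr fun θ => ?_
    rw [psMon_apply, powerSumProd_partMulti, powerSumProd_partMulti]
    ring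
  rw [couplingMono_mul, macNorm, e]
  ring

/-- Expansion of the index in the relative couplings. -/
theorem hasSum_index {N : ℕ} {c q t u y : ℂ} (hq : ‖q‖ < 1) (ht : ‖t‖ < 1) (huy : ‖u * y‖ < 1)
    (hs : Summable fun n => ‖relCoupling c u y n‖) :
    HasSum (fun κ : ℕ →₀ ℕ => macNorm N q t κ * couplingMono (relCoupling c u y) κ)
      (index N t u (c * y) (u * y) q) := by
  have hb : Summable fun n => ‖macRatio q t n * relCoupling c u y n‖ := by
    simp only [norm_mul]
    exact summable_mul_of_bounded hs (fun _ => norm_nonneg _) (fun _ => norm_nonneg _) (norm_macRatio_le hq ht)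
  have hm := summable_macCoupling hq ht
  have h := hasSum_unitaryMean_gasWeight (N := N) hb (gasWeight_torusCont hm)
  have e1 : (unitaryMean fun x : Fin N → ℂ => gasWeight (fun n => macRatio q t n * relCoupling c u y n) x *
      gasWeight (macCoupling q t) x) = index N t u (c * y) (u * y) q := by
    rw [index_eq_unitaryMean]
    refine unitaryMean_congr fun θ => ?_
    rw [← gasWeight_add hb hm]
    congr 1
    funext n
    exact (letterCoupling_eq hq t u y huy n).symm
  rw [e1] at h
  simpa only [couplingMono_mul_unitaryMean] using h

/-- The same expansion at infinite `N` is a product of geometric series. -/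
theorem hasSum_indexInfty {c q t u y : ℂ} (hu : ‖u‖ < 1) (hv : ‖c * y‖ < 1) (huy : ‖u * y‖ < 1)
    (hs : Summable fun n => ‖relCoupling c u y n‖) (h1 : ∀ n, ‖relCoupling c u y n‖ < 1) :
    (Summable fun κ : ℕ →₀ ℕ => ‖couplingMono (relCoupling c u y) κ‖) ∧
    HasSum (fun κ : ℕ →₀ ℕ => qPoch q q / qPoch t t * couplingMono (relCoupling c u y) κ)
      (indexInfty t u (c * y) (u * y) q) := by
  have h := hasSum_finsupp_choose h1 hs 0
  simp only [Finsupp.coe_zero, Pi.zero_apply, add_zero, Nat.choose_zero_right, Nat.cast_one, one_mul,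
    zero_add, pow_one] at h
  refine ⟨h.1, ?_⟩
  have e : indexInfty t u (c * y) (u * y) q = qPoch q q / qPoch t t * ∏' n, 1 / (1 - relCoupling c u y n) := by
    have hP := (hasProd_qPoch_self huy).mul ((hasProd_inv_qPoch_self hu).mul (hasProd_inv_qPoch_self hv))
    have e2 : ∏' n, 1 / (1 - relCoupling c u y n) = qPoch (u * y) (u * y) * ((qPoch u u)⁻¹ * (qPoch (c * y) (c * y))⁻¹) := by
      rw [← hP.tprod_eq]
      refine tprod_congr fun n => ?_
      rw [relCoupling, sub_sub_cancel, one_div_div, div_eq_mul_inv, mul_inv]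
    rw [e2, indexInfty]
    simp only [div_eq_mul_inv, mul_inv]
    ring
  rw [e]
  exact h.2.mul_left _

section coefficients
variable {c q t : ℂ} {r σ : ℝ}

/-- A small torus on which the relative couplings are dominated by a geometric series. -/
theorem Admissible.exists_small (h : Admissible c r σ) : ∃ ρ : ℝ, 0 < ρ ∧ ρ ≤ r ∧ ρ ≤ σ ∧
    ∀ θ φ n, ‖relCoupling c (circleMap 0 ρ θ) (circleMap 0 ρ φ) n‖ ≤ 1 / 2 * (1 / 16) ^ n := by
  have h1 : ∀ᶠ ρ : ℝ in 𝓝 0, ‖c‖ * ρ < 1 / 16 :=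
    (Continuous.tendsto (by fun_prop) 0).eventually_lt_const (by norm_num)
  have h2 : ∀ᶠ ρ : ℝ in 𝓝 0, ρ < min (1 / 16) (min r σ) :=
    eventually_lt_nhds (lt_min (by norm_num) (lt_min h.r_pos h.s_pos))
  obtain ⟨ρ, ⟨hρ1, hρ2⟩, hρ0⟩ := (((h1.and h2).filter_mono nhdsWithin_le_nhds).and
    (self_mem_nhdsWithin (s := Set.Ioi (0 : ℝ)))).exists
  have hρ0' : 0 < ρ := hρ0
  simp only [lt_min_iff] at hρ2
  refine ⟨ρ, hρ0, hρ2.2.1.le, hρ2.2.2.le, fun θ φ n => ?_⟩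
  have hn := norm_circleMap_zero' hρ0'
  refine (norm_relCoupling_le (by rw [hn]; linarith) (by rw [hn]; linarith) n).trans ?_
  rw [norm_mul, hn, hn]
  have h3 : ρ ^ (n + 1) ≤ (1 / 16) ^ (n + 1) := pow_le_pow_left₀ hρ0'.le hρ2.1.le _
  have h4 : (‖c‖ * ρ) ^ (n + 1) ≤ (1 / 16) ^ (n + 1) := pow_le_pow_left₀ (by positivity) hρ1.le _
  rw [pow_succ (1 / 16 : ℝ)] at h3 h4
  linarith

/-- Each coefficient is a sum over the finitely many partitions of weight at most `j + k`, in which only the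
normalised correlators of power sums depend on `N`. -/
theorem tendsto_biCoeff_index (h : Admissible c r σ) (hq : ‖q‖ < 1) (ht : ‖t‖ < 1) (j k : ℤ) :
    Tendsto (fun N => biCoeff r σ j k fun u y => index N t u (c * y) (u * y) q) atTop
      (𝓝 (biCoeff r σ j k fun u y => indexInfty t u (c * y) (u * y) q)) := by
  obtain ⟨ρ, hρ0, hρr, hρσ, hΓ⟩ := h.exists_small
  have hΓs : Summable fun n : ℕ => (1 / 2 : ℝ) * (1 / 16) ^ n :=
    (summable_geometric_of_lt_one (by norm_num) (by norm_num)).mul_left _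
  have hΓ0 : ∀ n : ℕ, (0 : ℝ) ≤ 1 / 2 * (1 / 16) ^ n := fun n => by positivity
  have hΓ1 : ∀ n : ℕ, (1 / 2 : ℝ) * (1 / 16) ^ n < 1 := fun n => by
    have : ((1 : ℝ) / 16) ^ n ≤ 1 := pow_le_one₀ (by norm_num) (by norm_num)
    linarith
  have hs : ∀ θ φ, Summable fun n => ‖relCoupling c (circleMap 0 ρ θ) (circleMap 0 ρ φ) n‖ := fun θ φ =>
    Summable.of_nonneg_of_le (fun _ => norm_nonneg _) (hΓ θ φ) hΓs
  have hmem : ∀ θ φ, ‖circleMap 0 ρ θ‖ < 1 ∧ ‖c * circleMap 0 ρ φ‖ < 1 ∧ ‖circleMap 0 ρ θ * circleMap 0 ρ φ‖ < 1 := by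
    intro θ φ
    have hn := norm_circleMap_zero' hρ0
    have := h.norms (u := circleMap 0 ρ θ) (y := circleMap 0 ρ φ) (mem_closedBall_zero_iff.mpr (by rw [hn]; exact hρr))
      (mem_closedBall_zero_iff.mpr (by rw [hn]; exact hρσ))
    exact ⟨this.1.trans_lt h.r_lt, this.2.2.1.trans_lt (by norm_num), this.2.2.2.trans_lt (by norm_num)⟩
  have hcont : ∀ κ : ℕ →₀ ℕ, Continuous fun z : ℝ × ℝ =>
      couplingMono (relCoupling c (circleMap 0 ρ z.1) (circleMap 0 ρ z.2)) κ := fun κ =>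
    (biHol_couplingMono h κ).continuous_torus hρ0 hρr hρ0 hρσ
  have hmono : ∀ (κ : ℕ →₀ ℕ) θ φ, ‖couplingMono (relCoupling c (circleMap 0 ρ θ) (circleMap 0 ρ φ)) κ‖ ≤
      ‖couplingMono (fun n => (((1 / 2 : ℝ) * (1 / 16) ^ n : ℝ) : ℂ)) κ‖ := fun κ θ φ => by
    rw [couplingMono, couplingMono, Finsupp.prod, Finsupp.prod, norm_prod, norm_prod]
    refine Finset.prod_le_prod (fun _ _ => norm_nonneg _) fun n _ => ?_
    rw [norm_pow, norm_pow, Complex.norm_real, Real.norm_of_nonneg (hΓ0 n)]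
    exact pow_le_pow_left₀ (norm_nonneg _) (hΓ θ φ n) _
  set W : ℕ := (j + k).toNat with hW
  set S : Finset (ℕ →₀ ℕ) := (finite_partMulti_sum_le W).toFinset with hS
  set E : (ℕ →₀ ℕ) → ℂ := fun κ => biCoeff ρ ρ j k fun u y => couplingMono (relCoupling c u y) κ with hE
  -- only finitely many terms of the expansions contribute to a given coefficient
  have hE0 : ∀ κ ∉ S, E κ = 0 := fun κ hκ => by
    have hκ' : W < (partMulti κ).sum := by simpa [hS] using hκ
    rw [hE]
    dsimp only
    rw [← (biHol_couplingMono h κ).biCoeff_eq hρ0 hρr hρ0 hρσ]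
    exact biCoeff_couplingMono_eq_zero h κ (by omega)
  have eN : ∀ N, (biCoeff r σ j k fun u y => index N t u (c * y) (u * y) q) = ∑ κ ∈ S, macNorm N q t κ * E κ := fun N => by
    rw [(biHol_index h hq ht N).biCoeff_eq hρ0 hρr hρ0 hρσ]
    have hB : Summable fun n : ℕ => ‖macRatio q t n‖ * (1 / 2 * (1 / 16) ^ n) :=
      summable_mul_of_bounded hΓs (fun _ => norm_nonneg _) hΓ0 (norm_macRatio_le hq ht)
    have hm := summable_macCoupling hq ht
    obtain ⟨b, hbs, hb⟩ := exists_expansion_bound (N := N) (fun n => mul_nonneg (norm_nonneg _) (hΓ0 n)) hB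
      (gasWeight_torusCont hm)
    have hsum := hasSum_biCoeff hρ0 hρ0 j k (f := fun (κ : ℕ →₀ ℕ) u y => macNorm N q t κ * couplingMono (relCoupling c u y) κ)
      (F := fun u y => index N t u (c * y) (u * y) q) (b := b)
      (fun κ => continuous_const.mul (hcont κ)) hbs (fun κ θ φ => ?_)
      (fun θ φ => hasSum_index hq ht (hmem θ φ).2.2 (hs θ φ))
    · simp only [biCoeff_const_mul] at hsum
      rw [← hsum.tsum_eq]
      exact tsum_eq_sum fun κ hκ => mul_eq_zero_of_right _ (hE0 κ hκ)
    · have h1 := hb (fun n => macRatio q t n * relCoupling c (circleMap 0 ρ θ) (circleMap 0 ρ φ) n) κ fun n => by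
        rw [norm_mul]
        exact mul_le_mul_of_nonneg_left (hΓ θ φ n) (norm_nonneg _)
      rwa [couplingMono_mul_unitaryMean] at h1
  have eI : (biCoeff r σ j k fun u y => indexInfty t u (c * y) (u * y) q) = ∑ κ ∈ S, qPoch q q / qPoch t t * E κ := by
    rw [(biHol_indexInfty h ht).biCoeff_eq hρ0 hρr hρ0 hρσ]
    have hΓn : ∀ n : ℕ, ‖(((1 / 2 : ℝ) * (1 / 16) ^ n : ℝ) : ℂ)‖ = 1 / 2 * (1 / 16) ^ n := fun n => by
      rw [Complex.norm_real, Real.norm_of_nonneg (hΓ0 n)]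
    have hfin := (hasSum_finsupp_choose (g := fun n : ℕ => (((1 / 2 : ℝ) * (1 / 16) ^ n : ℝ) : ℂ))
      (fun n => by rw [hΓn]; exact hΓ1 n) (by simpa only [hΓn] using hΓs) 0).1
    simp only [Finsupp.coe_zero, Pi.zero_apply, add_zero, Nat.choose_zero_right, Nat.cast_one, one_mul] at hfin
    have hsum := hasSum_biCoeff hρ0 hρ0 j k
      (f := fun (κ : ℕ →₀ ℕ) u y => qPoch q q / qPoch t t * couplingMono (relCoupling c u y) κ)
      (F := fun u y => indexInfty t u (c * y) (u * y) q)
      (b := fun κ => ‖qPoch q q / qPoch t t‖ * ‖couplingMono (fun n => (((1 / 2 : ℝ) * (1 / 16) ^ n : ℝ) : ℂ)) κ‖)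
      (fun κ => continuous_const.mul (hcont κ)) (hfin.mul_left _) (fun κ θ φ => ?_)
      (fun θ φ => (hasSum_indexInfty (hmem θ φ).1 (hmem θ φ).2.1 (hmem θ φ).2.2 (hs θ φ)
        fun n => (hΓ θ φ n).trans_lt (hΓ1 n)).2)
    · simp only [biCoeff_const_mul] at hsum
      rw [← hsum.tsum_eq]
      exact tsum_eq_sum fun κ hκ => mul_eq_zero_of_right _ (hE0 κ hκ)
    · rw [norm_mul]
      exact mul_le_mul_of_nonneg_left (hmono κ θ φ) (norm_nonneg _)
  simp only [eN, eI]
  exact tendsto_finsetSum _ fun κ _ => (tendsto_macNorm hq ht κ).mul_const _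

end coefficients

theorem exists_admissible (c : ℂ) {r : ℝ} (h0 : 0 < r) (h1 : r < 1) : ∃ σ, Admissible c r σ := by
  have hc := norm_nonneg c
  refine ⟨1 / (2 * (1 + ‖c‖)), h0, h1, by positivity, ?_, ?_⟩
  · exact one_div_le_one_div_of_le (by norm_num) (by linarith)
  · rw [mul_one_div, div_le_iff₀ (by positivity)]
    linarith

/-- Near `p = 0` the geometric series in the sum over partitions converge. -/
theorem puCoeff_indexInftySum_eq (q t : ℂ) (r : ℝ) (k : ℕ) (m : ℤ) :
    puCoeff indexInftySum q t r k m = puCoeff indexInfty q t r k m := by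
  unfold puCoeff
  congr 1
  funext u
  unfold taylorCoeff
  congr 1
  refine Filter.EventuallyEq.iteratedDeriv_eq k ?_
  have h1 : ∀ᶠ p : ℂ in 𝓝 0, ‖p * q / (t * u)‖ < 1 / 4 :=
    (Continuous.tendsto (by fun_prop) 0).eventually_lt_const (by norm_num)
  have h2 : ∀ᶠ p : ℂ in 𝓝 0, ‖p‖ < 1 / 4 :=
    (Continuous.tendsto (by fun_prop) 0).eventually_lt_const (by norm_num)
  filter_upwards [h1, h2] with p hv hp
  have hlt : (1 / 4 : ℝ) < 1 := by norm_num
  refine indexInftySum_eq (hv.trans hlt) (hp.trans hlt) fun n hn => ?_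
  obtain ⟨n, rfl⟩ : ∃ m, n = m + 1 := ⟨n - 1, by omega⟩
  have h3 := norm_one_sub_pow_ge hlt hp.le n
  have h4 := norm_pow_succ_le (hv.trans hlt) n
  have h5 := norm_pow_succ_le (hp.trans hlt) n
  rw [norm_div, div_lt_one (by linarith)]
  refine (norm_sub_le _ _).trans_lt ?_
  linarith

/-- The limit of the index, order by order in `p` and `u`. -/
theorem tendsto_puCoeff_index {q t : ℂ} (hq : ‖q‖ < 1) (ht : ‖t‖ < 1) {r : ℝ} (h0 : 0 < r) (h1 : r < 1)
    (k : ℕ) (m : ℤ) :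
    Tendsto (fun N : ℕ => puCoeff (index N) q t r k m) atTop (𝓝 (puCoeff indexInfty q t r k m)) := by
  obtain ⟨σ, h⟩ := exists_admissible (q / t) h0 h1
  have hv : ∀ u p : ℂ, p * q / (t * u) = q / t * (p / u) := fun u p => by ring
  have hp : ∀ u p : ℂ, u ≠ 0 → u * (p / u) = p := fun u p hu => mul_div_cancel₀ p hu
  rw [(biHol_indexInfty (q := q) h ht).puCoeff_eq h0 h.s_pos fun u p hu => by rw [hv, hp u p hu]]
  simp only [fun N => (biHol_index h hq ht N).puCoeff_eq (I := index N) (q := q) (t := t) h0 h.s_pos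
    (fun u p hu => by rw [hv, hp u p hu]) k m]
  exact tendsto_biCoeff_index h hq ht _ _

end SCI

end

theorem mainTheorem2 :
    -- orthogonality of the power sums at infinite `N`
    (∀ q t : ℂ, ‖q‖ < 1 → ‖t‖ < 1 → ∀ (a b : ℕ) (lam : a.Partition) (mu : b.Partition),
      Tendsto (fun N : ℕ =>
          SCI.macInner q t (MvPolynomial.psumPart (Fin N) ℂ lam)
            (MvPolynomial.psumPart (Fin N) ℂ mu) /
          SCI.macInner q t (1 : MvPolynomial (Fin N) ℂ) 1)
        atTop (𝓝 (if lam.parts = mu.parts then SCI.zPartQT q t lam else 0))) ∧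
    -- the limit of the index, order by order in `p` and `u`
    (∀ q t : ℂ, ‖q‖ < 1 → ‖t‖ < 1 → t ≠ 0 →
      ∀ (r : ℝ), 0 < r → r < 1 → ∀ (k : ℕ) (m : ℤ),
      Tendsto (fun N : ℕ => SCI.puCoeff (SCI.index N) q t r k m)
        atTop (𝓝 (SCI.puCoeff SCI.indexInftySum q t r k m)) ∧
      SCI.puCoeff SCI.indexInftySum q t r k m = SCI.puCoeff SCI.indexInfty q t r k m) ∧
    -- the limit of the index at fixed values of the fugacities
    (∀ t u v p q : ℂ, ‖t‖ < 1 → ‖u‖ < 1 → ‖v‖ < 1 → ‖p‖ < 1 → ‖q‖ < 1 → p * q = t * u * v →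
      (∀ n : ℕ, 1 ≤ n → (SCI.singleLetter (t ^ n) (u ^ n) (v ^ n) (p ^ n) (q ^ n)).re < 1) →
      Tendsto (fun N : ℕ => SCI.index N t u v p q) atTop (𝓝 (SCI.indexInfty t u v p q))) ∧
    -- the sum over partitions equals the closed form wherever the geometric series converge
    (∀ t u v p q : ℂ, ‖t‖ < 1 → ‖u‖ < 1 → ‖v‖ < 1 → ‖p‖ < 1 → ‖q‖ < 1 →
      (∀ n : ℕ, 1 ≤ n → ‖(v ^ n - p ^ n) / (1 - p ^ n)‖ < 1) →
      Summable (fun mu : (Σ m : ℕ, m.Partition) => SCI.partTerm v p mu.2) ∧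
      SCI.indexInftySum t u v p q = SCI.indexInfty t u v p q) := by
  refine ⟨fun q t hq ht a b lam mu => SCI.tendsto_macInner_div hq ht lam mu,
    fun q t hq ht _ r h0 h1 k m => ⟨?_, SCI.puCoeff_indexInftySum_eq q t r k m⟩,
    fun t u v p q ht hu hv hp hq _ hre => SCI.tendsto_index ht hu hv hp hq hre,
    fun t u v p q _ _ hv hp _ h => ⟨(SCI.partTerm_sum hv hp h).1, SCI.indexInftySum_eq hv hp h⟩⟩
  rw [SCI.puCoeff_indexInftySum_eq]
  exact SCI.tendsto_puCoeff_index hq ht h0 h1 k m
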